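/- **Setting.** Let $N\ge 2$, let $q$ be real with $0<q<1$, let $k\in\mathbb C^\times$ and $T=(\mathbb C^\times)^N$. Let $W=S_N\ltimes\mathbb Z^N$ act on $T$ by permutations of the coordinates, $(wt)_i=t_{w^{-1}(i)}$, and by $\lambda t=q^\lambda t$ for $\lambda\in\mathbb Z^N$, and on functions by $(wf)(t)=f(w^{-1}t)$. Let $\epsilon_1,\dots,\epsilon_N$ be the standard basis of $\mathbb Z^N$, $s_i\in S_N$ ($1\le i<N$) the simple transpositions, $\pi=\sigma\epsilon_N\in W$ with $\sigma=s_1\cdots s_{N-1}$ (so $\sigma(N)=1$ and $\sigma(i)=i+1$ otherwise), $s_0=\pi s_{N-1}\pi^{-1}$, $w_0\in S_N$ the longest element, and $\alpha_i=\epsilon_i-\epsilon_{i+1}$ for $1\le i<N$. Put $Q_+=\bigoplus_{i}\mathbb Z_{\ge0}\alpha_i$, $\delta=(N-1,N-3,\dots,1-N)$ and $\langle\cdot,\cdot\rangle$ for the standard scalar product. Let $X^\lambda$ be multiplication by $x^\lambda$ on $\mathbb C(T)$. The double affine Hecke algebra $\mathbb H$ is the algebra of operators on $\mathbb C(T)$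 generated by $\pi^{\pm1}$, all $X^\lambda$, and $T_i=k+c_k(X_i/X_{i+1})(s_i-1)$ for $1\le i<N$, where $c_k(z)=\frac{k^{-1}-kz}{1-z}$. The finite Hecke algebra $H_0\subset\mathbb H$ is generated by $T_1,\dots,T_{N-1}$ and has basis $T_w$ ($w\in S_N$), with $T_w$ the product of the $T_i$ along a reduced expression. With $Y_i=T_{i-1}^{-1}\cdots T_1^{-1}\pi T_{N-1}\cdots T_i$, the map $f\otimes g\otimes h\mapsto f(X)\,h\,g(Y)$ identifies $\mathbb C[T\times T]\otimes H_0$ with $\mathbb H$. Let $*$ be the anti-algebra involution of $\mathbb H$ with $T_w^*=T_{w^{-1}}$, $(X^\lambda)^*=Y^{-\lambda}$, $(Y^\lambda)^*=X^{-\lambda}$. For a reduced expression $w=s_{j_1}\cdots s_{j_r}\pi^m$ of $w\in W$ let $\widetilde S_w=\widetilde S_{j_1}\cdots\widetilde S_{j_r}\pi^m=d_w(X)w$ with $d_w\in\mathbb C[T]$, where $\widetilde S_i=(k-k^{-1}X_{i+1}/X_i)s_i$ for $1\le i<N$ and $\widetilde S_0=(k-k^{-1}q^{-1}X_1/X_N)s_0$.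 Let $\mathbb K=\mathcal M(T\times T)$ be the field of meromorphic functions of $(t,\gamma)\in T\times T$ (the quotient field of the ring of analytic functions) and $H_0^{\mathbb K}=\mathbb K\otimes H_0$ the space of meromorphic $H_0$-valued functions. For $w,w'\in W$ let $C_{(w,w')}$ be the $\mathbb K$-linear endomorphism of $H_0^{\mathbb K}$ with $$C_{(w,w')}h=d_w(t)^{-1}d_{w'}(\gamma^{-1})^{-1}\,\widetilde S_w\,h\,\widetilde S_{w'}^*\qquad(h\in H_0),$$ where $\widetilde S_w h\widetilde S_{w'}^*\in\mathbb H\simeq\mathbb C[T\times T]\otimes H_0$ is regarded as an element of $H_0^{\mathbb K}$. The BqKZ equations for $f\in H_0^{\mathbb K}$ are $$C_{(\lambda,\mu)}(t,\gamma)f(q^{-\lambda}t,q^{\mu}\gamma)=f(t,\gamma),\qquad\lambda,\mu\in\mathbb Z^N,$$ and $\mathrm{SOL}$ is the set of their solutions in $H_0^{\mathbb K}$. With $\theta(z)=\prod_{m\ge0}(1-q^mz)(1-q^{m+1}/z)$ and $\kappa\in\mathbb C^\times$ put $$W_\kappa(t,\gamma)=\prod_{i=1}^N\frac{\theta(\kappa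 t_i\gamma_{N-i+1}^{-1})}{\theta(\kappa k^{\langle\delta,\epsilon_i\rangle}t_i)\,\theta(\kappa k^{-\langle\delta,\epsilon_i\rangle}\gamma_{N-i+1}^{-1})}.$$ The gauged equations for $g\in H_0^{\mathbb K}$ are $$D_{(\lambda,\mu)}(t,\gamma)g(q^{-\lambda}t,q^\mu\gamma)=g(t,\gamma),\qquad \lambda,\mu\in\mathbb Z^N,$$ with $D_{(\lambda,\mu)}(t,\gamma)=W_\kappa(t,\gamma)^{-1}C_{(\lambda,\mu)}(t,\gamma)W_\kappa(q^{-\lambda}t,q^\mu\gamma)$, which does not depend on $\kappa$. For $\varepsilon>0$ let $B_\varepsilon=\{t\in T: |t^{\alpha_i}|<\varepsilon\ \forall i\}$ and $B_\varepsilon^{-1}=\{t\in T: t^{-1}\in B_\varepsilon\}$. **Theorem.** There exists a unique $\Psi\in H_0^{\mathbb K}$ that solves the gauged equations and satisfies, for some $\varepsilon>0$: (i) $\Psi$ admits an $H_0$-valued power series expansion $$\Psi(t,\gamma)=\sum_{\alpha,\beta\in Q_+}K_{\alpha,\beta}\,t^{-\alpha}\gamma^{\beta}\qquad(K_{\alpha,\beta}\in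 H_0)$$ for $(t,\gamma)\in B_\varepsilon^{-1}\times B_\varepsilon$, which is normally convergent on compacta of $B_\varepsilon^{-1}\times B_\varepsilon$; (ii) $K_{0,0}=T_{w_0}$. The function $\Psi$ is the same for all $\kappa$, and for every $\kappa\in\mathbb C^\times$ the function $\Phi_\kappa=W_\kappa\Psi$, called the basic asymptotically free solution, lies in $\mathrm{SOL}$. -/

import Mathlib

noncomputable section

namespace BqKZ

/-! ### The extended affine Weyl group of `GL_N`, `N = n + 2` -/

/-- The lattice `ℤ^N`, where `N = n + 2 ≥ 2`. The indices `1, …, N` are `0, …, n + 1` here. -/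
abbrev Lat (n : ℕ) : Type := Fin (n + 2) → ℤ

/-- The symmetric group `S_N`. -/
abbrev Perm (n : ℕ) : Type := Equiv.Perm (Fin (n + 2))

/-- The complex torus `T = (ℂˣ)^N`. -/
abbrev Torus (n : ℕ) : Type := Fin (n + 2) → ℂˣ

/-- The extended affine Weyl group `W = S_N ⋉ ℤ^N` (the lattice is written multiplicatively;
`w ∈ S_N` sends `l ∈ ℤ^N` to `(l_{w⁻¹(1)}, …, l_{w⁻¹(N)})`). -/
abbrev Weyl (n : ℕ) : Type :=
  SemidirectProduct (Fin (n + 2) → Multiplicative ℤ) (Perm n) mulAutArrow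

/-- The real parameter `q` with `0 < q < 1`. -/
abbrev QParam : Type := Set.Ioo (0 : ℝ) 1

/-- The parameter `q` as a nonzero complex number. -/
def QParam.unit (q : QParam) : ℂˣ :=
  Units.mk0 ((q : ℝ) : ℂ) (Complex.ofReal_ne_zero.mpr q.2.1.ne')

/-- The translation in `W` attached to `l ∈ ℤ^N`. -/
def transl {n : ℕ} (l : Lat n) : Weyl n :=
  SemidirectProduct.inl fun i => Multiplicative.ofAdd (l i)

/-- The inclusion of `S_N` in `W`. -/
def ofPerm {n : ℕ} (w : Perm n) : Weyl n := SemidirectProduct.inr w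

/-- The standard basis vector of `ℤ^N`. -/
def eps {n : ℕ} (i : Fin (n + 2)) : Lat n := Pi.single i 1

/-- The simple transpositions of `S_N`. -/
def simplePerm {n : ℕ} (i : Fin (n + 1)) : Perm n := Equiv.swap i.castSucc i.succ

/-- The element `π = σ ε_N` of `W`, with `σ` the rotation `i ↦ i + 1`, `N ↦ 1`. -/
def piW (n : ℕ) : Weyl n :=
  ofPerm (finRotate (n + 2)) * transl (eps (Fin.last (n + 1)))

/-- The generators `s_0 = π s_{N-1} π⁻¹, s_1, …, s_{N-1}` of the affine Weyl group. -/
def simpleW {n : ℕ} : Fin (n + 2) → Weyl n :=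
  Fin.cases (piW n * ofPerm (simplePerm (Fin.last n)) * (piW n)⁻¹)
    fun j => ofPerm (simplePerm j)

/-- The element `s_{j_1} ⋯ s_{j_r} π^m` of `W`. -/
def wordValue {n : ℕ} (p : List (Fin (n + 2)) × ℤ) : Weyl n :=
  (p.1.map simpleW).prod * piW n ^ p.2

/-- `s_{j_1} ⋯ s_{j_r} π^m` is a reduced expression of `w`. -/
def IsReducedExpr {n : ℕ} (w : Weyl n) (p : List (Fin (n + 2)) × ℤ) : Prop :=
  wordValue p = w ∧ ∀ p', wordValue p' = w → p.1.length ≤ p'.1.length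

/-- A chosen reduced expression of `w ∈ W`. -/
def reducedExpr {n : ℕ} (w : Weyl n) : List (Fin (n + 2)) × ℤ :=
  Classical.epsilon (IsReducedExpr w)

/-- `s_{j_1} ⋯ s_{j_r}` is a reduced expression of `w ∈ S_N`. -/
def IsReducedPermExpr {n : ℕ} (w : Perm n) (l : List (Fin (n + 1))) : Prop :=
  (l.map simplePerm).prod = w ∧
    ∀ l' : List (Fin (n + 1)), (l'.map simplePerm).prod = w → l.length ≤ l'.length

/-- A chosen reduced expression of `w ∈ S_N`. -/
def reducedPermExpr {n : ℕ} (w : Perm n) : List (Fin (n + 1)) :=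
  Classical.epsilon (IsReducedPermExpr w)

/-! ### `q`-difference reflection operators -/

/-- The algebra `ℂ[T]` of regular functions on `T`. -/
abbrev Reg (n : ℕ) : Type := AddMonoidAlgebra ℂ (Lat n)

/-- The field `ℂ(T)` of rational functions on `T`. -/
abbrev RatFn (n : ℕ) : Type := FractionRing (Reg n)

/-- The monomial `x^v`. -/
def mono {n : ℕ} (v : Lat n) : Reg n := AddMonoidAlgebra.single v 1

/-- The action `(w f)(t) = f(w⁻¹ t)` of `W` on `ℂ[T]`, where `S_N` acts on `T` by permutations and
`l ∈ ℤ^N` by `t ↦ q^l t`. On monomials, `w = l σ` sends `x^v` to `q^{-⟨l, σ v⟩} x^{σ v}`. -/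
def weylAct {n : ℕ} (q : QParam) (w : Weyl n) : Reg n →ₐ[ℂ] Reg n :=
  AddMonoidAlgebra.lift ℂ (Reg n) (Lat n)
    { toFun := fun v =>
        ((q.unit ^ (-∑ i, (w.left i).toAdd * v.toAdd (w.right⁻¹ i)) : ℂˣ) : ℂ) •
          mono (fun i => v.toAdd (w.right⁻¹ i))
      map_one' := by
        simp [mono, AddMonoidAlgebra.one_def]; rfl
      map_mul' := by
        intro a b
        simp only [mono, toAdd_mul, Pi.add_apply, mul_add, Finset.sum_add_distrib, neg_add, zpow_add,
          Units.val_mul, smul_mul_smul_comm, AddMonoidAlgebra.single_mul_single, mul_one]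
        rfl }

theorem weylAct_mono {n : ℕ} (q : QParam) (w : Weyl n) (v : Lat n) :
    weylAct q w (mono v) =
      ((q.unit ^ (-∑ i, (w.left i).toAdd * v (w.right⁻¹ i)) : ℂˣ) : ℂ) •
          mono (fun i => v (w.right⁻¹ i)) := by
  simp [weylAct, mono]

theorem weylAct_one {n : ℕ} (q : QParam) : weylAct q (1 : Weyl n) = AlgHom.id ℂ _ := by
  refine AddMonoidAlgebra.algHom_ext (fun v => ?_) (by ext)
  have := weylAct_mono q 1 v
  simpa [mono] using this

theorem weylAct_mul {n : ℕ} (q : QParam) (w w' : Weyl n) :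
    weylAct q (w * w') = (weylAct q w).comp (weylAct q w') := by
  refine AddMonoidAlgebra.algHom_ext (fun v => ?_) (by ext)
  change weylAct q (w * w') (mono v) = weylAct q w (weylAct q w' (mono v))
  rw [weylAct_mono, weylAct_mono, map_smul, weylAct_mono, smul_smul, ← Units.val_mul, ← zpow_add]
  have h : ∀ i, (((w * w').left i).toAdd : ℤ) =
      (w.left i).toAdd + (w'.left (w.right⁻¹ i)).toAdd := fun i => rfl
  have h' : ∀ i, (w * w').right⁻¹ i = w'.right⁻¹ (w.right⁻¹ i) := fun i => rfl
  simp only [h, h', add_mul, Finset.sum_add_distrib]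
  congr 4
  rw [neg_add, add_comm]
  congr 2
  exact Equiv.sum_comp (w.right⁻¹) fun i => (w'.left i).toAdd * v (w'.right⁻¹ i)

/-- The automorphism of `ℂ[T]` given by `w ∈ W`. -/
def weylEquiv {n : ℕ} (q : QParam) (w : Weyl n) : Reg n ≃ₐ[ℂ] Reg n :=
  AlgEquiv.ofAlgHom (weylAct q w) (weylAct q w⁻¹)
    (by rw [← weylAct_mul, mul_inv_cancel, weylAct_one])
    (by rw [← weylAct_mul, inv_mul_cancel, weylAct_one])

/-- The algebra of `ℂ`-linear operators on `ℂ(T)`. It contains the smashed product `ℂ(T) # W`,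
realized faithfully as the algebra of `q`-difference reflection operators. -/
abbrev Op (n : ℕ) : Type := Module.End ℂ (RatFn n)

/-- The automorphism of `ℂ(T)` given by `w ∈ W`. -/
def weylFieldEquiv {n : ℕ} (q : QParam) (w : Weyl n) : RatFn n ≃ₐ[ℂ] RatFn n :=
  IsFractionRing.algEquivOfAlgEquiv (weylEquiv q w)

theorem weylFieldEquiv_algebraMap {n : ℕ} (q : QParam) (w : Weyl n) (f : Reg n) :
    weylFieldEquiv q w (algebraMap (Reg n) (RatFn n) f) =
      algebraMap (Reg n) (RatFn n) (weylAct q w f) :=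
  IsFractionRing.ringEquivOfRingEquiv_algebraMap (weylEquiv q w).toRingEquiv f

/-- The operator of `w ∈ W` on `ℂ(T)`. -/
def weylOp {n : ℕ} (q : QParam) (w : Weyl n) : Op n :=
  (weylFieldEquiv q w).toLinearMap

theorem weylOp_one {n : ℕ} (q : QParam) : weylOp q (1 : Weyl n) = 1 := by
  refine LinearMap.ext fun f => ?_
  obtain ⟨x, y, -, rfl⟩ := IsFractionRing.div_surjective (Reg n) f
  change weylFieldEquiv q 1 _ = _
  simp only [map_div₀, weylFieldEquiv_algebraMap, weylAct_one]
  rfl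

theorem weylOp_mul {n : ℕ} (q : QParam) (w w' : Weyl n) :
    weylOp q (w * w') = weylOp q w * weylOp q w' := by
  refine LinearMap.ext fun f => ?_
  obtain ⟨x, y, -, rfl⟩ := IsFractionRing.div_surjective (Reg n) f
  change weylFieldEquiv q (w * w') _ = weylFieldEquiv q w (weylFieldEquiv q w' _)
  simp only [map_div₀, weylFieldEquiv_algebraMap, weylAct_mul]
  rfl

/-- The operator of multiplication by `f ∈ ℂ(T)`. -/
def mulOp {n : ℕ} (f : RatFn n) : Op n := LinearMap.mulLeft ℂ f

/-- The operator `X^l`. -/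
def opX {n : ℕ} (l : Lat n) : Op n := mulOp (algebraMap (Reg n) (RatFn n) (mono l))

/-- The rational function `x_i / x_{i+1}`. -/
def ratioX {n : ℕ} (i : Fin (n + 1)) : RatFn n :=
  algebraMap (Reg n) (RatFn n) (mono (eps i.castSucc - eps i.succ))

/-- `c_k(z) = (k⁻¹ - k z) / (1 - z)` at `z = x_i / x_{i+1}`. -/
def ckX {n : ℕ} (k : ℂˣ) (i : Fin (n + 1)) : RatFn n :=
  (algebraMap ℂ (RatFn n) ((k : ℂ)⁻¹) - algebraMap ℂ (RatFn n) (k : ℂ) * ratioX i) / (1 - ratioX i)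

/-- The Demazure-Lusztig operator `T_i = k + c_k(X_i / X_{i+1}) (s_i - 1)`. -/
def opT {n : ℕ} (q : QParam) (k : ℂˣ) (i : Fin (n + 1)) : Op n :=
  algebraMap ℂ (Op n) k + mulOp (ckX k i) * (weylOp q (ofPerm (simplePerm i)) - 1)

theorem ratioX_ne_one {n : ℕ} (i : Fin (n + 1)) : ratioX i ≠ (1 : RatFn n) := by
  intro h
  have h1 : mono (eps i.castSucc - eps i.succ) = (1 : Reg n) :=
    IsFractionRing.injective (Reg n) (RatFn n) (by simpa [ratioX] using h)
  rw [AddMonoidAlgebra.one_def, mono] at h1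
  have h2 := AddMonoidAlgebra.single_left_injective (one_ne_zero) h1
  have h3 := congrFun h2 i.castSucc
  simp [eps, Fin.ext_iff] at h3

theorem opT_apply {n : ℕ} (q : QParam) (k : ℂˣ) (i : Fin (n + 1)) (f : RatFn n) :
    opT q k i f = algebraMap ℂ (RatFn n) (k : ℂ) * f +
      ckX k i * (weylFieldEquiv q (ofPerm (simplePerm i)) f - f) := by
  simp [opT, mulOp, weylOp, Algebra.smul_def]

theorem weyl_ratioX {n : ℕ} (q : QParam) (i : Fin (n + 1)) :
    weylFieldEquiv q (ofPerm (simplePerm i)) (ratioX i) * ratioX i = 1 := by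
  rw [ratioX, weylFieldEquiv_algebraMap, weylAct_mono, ← map_mul]
  have h : (fun j => (eps i.castSucc - eps i.succ : Lat n)
      ((ofPerm (simplePerm i) : Weyl n).right⁻¹ j)) = -(eps i.castSucc - eps i.succ) := by
    funext j
    simp only [ofPerm, SemidirectProduct.right_inr, simplePerm, Equiv.swap_inv, Pi.sub_apply,
      Pi.neg_apply, eps, Pi.single_apply, Equiv.swap_apply_eq_iff, Equiv.swap_apply_left,
      Equiv.swap_apply_right]
    ring
  rw [h]
  simp [ofPerm, mono, AddMonoidAlgebra.one_def, AddMonoidAlgebra.single_mul_single]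

theorem opT_quadratic {n : ℕ} (q : QParam) (k : ℂˣ) (i : Fin (n + 1)) :
    opT q k i * opT q k i = algebraMap ℂ (Op n) ((k : ℂ) - (k : ℂ)⁻¹) * opT q k i + 1 := by
  refine LinearMap.ext fun f => ?_
  have hR : ∀ (c : ℂ) (x : RatFn n), (algebraMap ℂ (Op n) c) x = algebraMap ℂ (RatFn n) c * x := fun c x => by
    rw [Module.algebraMap_end_apply, Algebra.smul_def]
  have hz := weyl_ratioX q i
  have hk : algebraMap ℂ (RatFn n) (k : ℂ) * algebraMap ℂ (RatFn n) ((k : ℂ)⁻¹) = (1 : RatFn n) := by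
    rw [← map_mul]; simp
  have hss : weylFieldEquiv q (ofPerm (simplePerm i))
      (weylFieldEquiv q (ofPerm (simplePerm i)) f) = f := by
    have h := LinearMap.congr_fun (weylOp_mul q (ofPerm (simplePerm i)) (ofPerm (simplePerm i))) f
    rw [← show (1 : Weyl n) = ofPerm (simplePerm i) * ofPerm (simplePerm i) by
      simp [ofPerm, ← map_mul, simplePerm], weylOp_one] at h
    exact h.symm
  have h1 : (1 : RatFn n) - ratioX i ≠ 0 := sub_ne_zero.mpr (ratioX_ne_one i).symm
  have hc : weylFieldEquiv q (ofPerm (simplePerm i)) (ckX k i) =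
      -(algebraMap ℂ (RatFn n) ((k : ℂ)⁻¹) * ratioX i - algebraMap ℂ (RatFn n) (k : ℂ)) / (1 - ratioX i) := by
    have h0 : ratioX i ≠ (0 : RatFn n) := right_ne_zero_of_mul_eq_one hz
    have hz' := eq_inv_of_mul_eq_one_left hz
    simp only [ckX, map_div₀, map_sub, map_mul, AlgEquiv.commutes, map_one, hz']
    have h2 : 1 - (ratioX i)⁻¹ ≠ (0 : RatFn n) := by
      intro h
      apply h1
      have h4 : ratioX i * (1 - (ratioX i)⁻¹) = (0 : RatFn n) := by rw [h, mul_zero]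
      rw [mul_sub, mul_inv_cancel₀ h0] at h4
      linear_combination -h4
    rw [div_eq_div_iff h2 h1]
    field_simp
    ring
  simp only [Module.End.mul_apply, LinearMap.add_apply, LinearMap.sub_apply, hR, Module.End.one_apply, opT_apply,
    map_add, map_mul, map_sub, AlgEquiv.commutes, hss, hc]
  simp only [ckX]
  generalize weylFieldEquiv q (ofPerm (simplePerm i)) f = g
  generalize ratioX i = z at *
  generalize algebraMap ℂ (RatFn n) (k : ℂ) = a at *
  generalize algebraMap ℂ (RatFn n) ((k : ℂ)⁻¹) = b at *
  field_simp
  linear_combination ((1 - z) ^ 2 * f) * hk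

/-- `T_i` as an invertible operator. -/
def unitT {n : ℕ} (q : QParam) (k : ℂˣ) (i : Fin (n + 1)) : (Op n)ˣ where
  val := opT q k i
  inv := opT q k i - algebraMap ℂ (Op n) ((k : ℂ) - (k : ℂ)⁻¹)
  val_inv := by
    rw [mul_sub, opT_quadratic, Algebra.commutes]; abel
  inv_val := by
    rw [sub_mul, opT_quadratic]; abel

/-- `π` as an invertible operator. -/
def unitPi {n : ℕ} (q : QParam) : (Op n)ˣ where
  val := weylOp q (piW n)
  inv := weylOp q (piW n)⁻¹
  val_inv := by rw [← weylOp_mul, mul_inv_cancel, weylOp_one]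
  inv_val := by rw [← weylOp_mul, inv_mul_cancel, weylOp_one]

/-! ### The double affine Hecke algebra -/

/-- The basis element `T_w = T_{i_1} ⋯ T_{i_r}` of the finite Hecke algebra `H_0`, for a reduced
expression `w = s_{i_1} ⋯ s_{i_r}` of `w ∈ S_N`. -/
def opTw {n : ℕ} (q : QParam) (k : ℂˣ) (w : Perm n) : Op n :=
  ((reducedPermExpr w).map (opT q k)).prod

/-- `Y_i = T_{i-1}⁻¹ ⋯ T_1⁻¹ π T_{N-1} ⋯ T_i`. -/
def unitY {n : ℕ} (q : QParam) (k : ℂˣ) (i : Fin (n + 2)) : (Op n)ˣ :=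
  (((List.finRange (n + 1)).filter (fun j => j.castSucc < i)).reverse.map
      fun j => (unitT q k j)⁻¹).prod *
    unitPi q *
    (((List.finRange (n + 1)).filter (fun j => i ≤ j.castSucc)).reverse.map (unitT q k)).prod

/-- `Y^l = Y_1^{l_1} ⋯ Y_N^{l_N}`. -/
def opY {n : ℕ} (q : QParam) (k : ℂˣ) (l : Lat n) : Op n :=
  (((List.finRange (n + 2)).map fun i => unitY q k i ^ l i).prod : (Op n)ˣ)

/-- The double affine Hecke algebra `ℍ(k, q)`, generated by the `T_i`, `π^{±1}` and the
multiplication operators `f(X)`, `f ∈ ℂ[T]`. -/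
def daha {n : ℕ} (q : QParam) (k : ℂˣ) : Subalgebra ℂ (Op n) :=
  Algebra.adjoin ℂ (Set.range (opT q k) ∪ {weylOp q (piW n), weylOp q (piW n)⁻¹} ∪ Set.range opX)

/-- The index set of the Poincaré-Birkhoff-Witt basis: `((l, m), w)` stands for
`X^l T_w Y^m`. -/
abbrev PBWIndex (n : ℕ) : Type := (Lat n × Lat n) × Perm n

/-- The linear isomorphism `ℂ[T × T] ⊗ H_0 ≃ ℍ`, `(f ⊗ g) ⊗ h ↦ f(X) h g(Y)`, where the elements
of `ℂ[T × T] ⊗ H_0` are expanded along the basis `x^l y^m T_w`. -/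
def pbwMap {n : ℕ} (q : QParam) (k : ℂˣ) : (PBWIndex n →₀ ℂ) →ₗ[ℂ] Op n :=
  Finsupp.linearCombination ℂ fun b => opX b.1.1 * opTw q k b.2 * opY q k b.1.2

/-- The coordinates of an element of `ℍ` in the basis `X^l T_w Y^m`. -/
def pbwCoord {n : ℕ} (q : QParam) (k : ℂˣ) : Op n → (PBWIndex n →₀ ℂ) :=
  Function.invFun (pbwMap q k)

/-- The duality anti-involution of `ℍ`: the linear map with
`(X^l T_w Y^m)^* = (Y^m)^* T_w^* (X^l)^* = X^{-m} T_{w⁻¹} Y^{-l}`. -/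
def dual {n : ℕ} (q : QParam) (k : ℂˣ) (h : Op n) : Op n :=
  pbwMap q k ((pbwCoord q k h).mapDomain fun b => ((-b.1.2, -b.1.1), b.2⁻¹))

/-! ### Intertwiners -/

/-- `d_0 = k - k⁻¹ q⁻¹ x_1 / x_N` and `d_i = k - k⁻¹ x_{i+1} / x_i` for `1 ≤ i < N`. -/
def dGen {n : ℕ} (q : QParam) (k : ℂˣ) : Fin (n + 2) → Reg n :=
  Fin.cases
    ((k : ℂ) • 1 - ((k : ℂ)⁻¹ * (q.unit : ℂ)⁻¹) • mono (eps 0 - eps (Fin.last (n + 1))))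
    fun j => (k : ℂ) • 1 - (k : ℂ)⁻¹ • mono (eps j.succ - eps j.castSucc)

/-- `d_{j_1} (s_{j_1} d_{j_2}) ⋯ (s_{j_1} ⋯ s_{j_{r-1}} d_{j_r})`. -/
def dWord {n : ℕ} (q : QParam) (k : ℂˣ) : List (Fin (n + 2)) → Reg n
  | [] => 1
  | j :: l => dGen q k j * weylAct q (simpleW j) (dWord q k l)

/-- The regular function `d_w`, `w ∈ W`. -/
def dFun {n : ℕ} (q : QParam) (k : ℂˣ) (w : Weyl n) : Reg n := dWord q k (reducedExpr w).1

/-- The intertwiner `S_i = d_i(X) s_i`, `i = 0, …, N - 1`. -/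
def interGen {n : ℕ} (q : QParam) (k : ℂˣ) (j : Fin (n + 2)) : Op n :=
  mulOp (algebraMap (Reg n) (RatFn n) (dGen q k j)) * weylOp q (simpleW j)

/-- The affine intertwiner `S_w = S_{j_1} ⋯ S_{j_r} π^m`, for a reduced expression
`w = s_{j_1} ⋯ s_{j_r} π^m`. -/
def inter {n : ℕ} (q : QParam) (k : ℂˣ) (w : Weyl n) : Op n :=
  ((reducedExpr w).1.map (interGen q k)).prod * weylOp q (piW n ^ (reducedExpr w).2)

/-! ### Meromorphic functions on `T × T` -/

/-- The vector space `ℂ^N × ℂ^N`, in which `T × T` is an open subset. -/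
abbrev Ambient (n : ℕ) : Type := (Fin (n + 2) → ℂ) × (Fin (n + 2) → ℂ)

/-- `T × T` as an open subset of `ℂ^N × ℂ^N`. -/
def torusSet (n : ℕ) : Set (Ambient n) := {z | (∀ i, z.1 i ≠ 0) ∧ ∀ i, z.2 i ≠ 0}

/-- The inclusion of `T × T` in `ℂ^N × ℂ^N`. -/
def coords {n : ℕ} (p : Torus n × Torus n) : Ambient n :=
  (fun i => (p.1 i : ℂ), fun i => (p.2 i : ℂ))

/-- The function `f` on `T × T` is complex analytic. -/
def IsHolo {n : ℕ} (f : Torus n × Torus n → ℂ) : Prop :=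
  ∃ F : Ambient n → ℂ, AnalyticOnNhd ℂ F (torusSet n) ∧ ∀ p, F (coords p) = f p

/-- The ring `𝒪(T × T)` of analytic functions on `T × T`. -/
def Holo (n : ℕ) : Subalgebra ℂ (Torus n × Torus n → ℂ) where
  carrier := {f | IsHolo f}
  mul_mem' := by
    rintro f g ⟨F, hF, hf⟩ ⟨G, hG, hg⟩
    exact ⟨F * G, hF.mul hG, fun p => by simp [hf, hg]⟩
  add_mem' := by
    rintro f g ⟨F, hF, hf⟩ ⟨G, hG, hg⟩
    exact ⟨F + G, hF.add hG, fun p => by simp [hf, hg]⟩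
  algebraMap_mem' := fun c => ⟨fun _ => c, analyticOnNhd_const, fun _ => rfl⟩

theorem exists_coords {n : ℕ} {z : Ambient n} (hz : z ∈ torusSet n) : ∃ p, coords p = z :=
  ⟨(fun i => Units.mk0 (z.1 i) (hz.1 i), fun i => Units.mk0 (z.2 i) (hz.2 i)), rfl⟩

theorem coords_mem {n : ℕ} (p : Torus n × Torus n) : coords p ∈ torusSet n :=
  ⟨fun i => (p.1 i).ne_zero, fun i => (p.2 i).ne_zero⟩

theorem torusSet_eq (n : ℕ) : torusSet n =
    (Set.univ.pi fun _ => ({0}ᶜ : Set ℂ)) ×ˢ (Set.univ.pi fun _ => ({0}ᶜ : Set ℂ)) := by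
  ext z; simp [torusSet]

theorem isOpen_torusSet (n : ℕ) : IsOpen (torusSet n) := by
  rw [torusSet_eq]
  exact (isOpen_set_pi Set.finite_univ fun _ _ => isOpen_compl_singleton).prod
    (isOpen_set_pi Set.finite_univ fun _ _ => isOpen_compl_singleton)

theorem isPreconnected_torusSet (n : ℕ) : IsPreconnected (torusSet n) := by
  have h : IsPreconnected ({0}ᶜ : Set ℂ) :=
    (isConnected_compl_singleton_of_one_lt_rank (by simp) 0).isPreconnected
  rw [torusSet_eq]
  exact (isPreconnected_univ_pi fun _ => h).prod (isPreconnected_univ_pi fun _ => h)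

instance (n : ℕ) : IsDomain (Holo n) := by
  have : Nontrivial (Holo n) := inferInstance
  have : NoZeroDivisors (Holo n) := by
    refine ⟨?_⟩
    rintro ⟨f, F, hF, hf⟩ ⟨g, G, hG, hg⟩ h
    have hfg : ∀ p, f p * g p = 0 := fun p => congrFun (congrArg Subtype.val h) p
    by_cases h0 : ∀ p, f p = 0
    · exact Or.inl (Subtype.ext (funext h0))
    · right
      obtain ⟨p, hp⟩ := not_forall.mp h0
      refine Subtype.ext (funext fun p' => ?_)
      change g p' = 0
      rw [← hg]
      refine hG.eqOn_zero_of_preconnected_of_eventuallyEq_zero (isPreconnected_torusSet n)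
        (coords_mem p) ?_ (coords_mem p')
      filter_upwards [(isOpen_torusSet n).mem_nhds (coords_mem p),
        (hF _ (coords_mem p)).continuousAt.eventually_ne (by rwa [hf] : F (coords p) ≠ 0)]
        with z hz hz'
      obtain ⟨r, rfl⟩ := exists_coords hz
      rw [hf] at hz'
      rw [hg]
      exact (mul_eq_zero.mp (hfg r)).resolve_left hz'
  exact NoZeroDivisors.to_isDomain _

/-- The field `𝕂 = ℳ(T × T)` of meromorphic functions on `T × T`: the quotient field of
`𝒪(T × T)`. -/
abbrev Mero (n : ℕ) : Type := FractionRing (Holo n)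

/-- `f ↦ f(c ·)` on `𝒪(T × T)`, for `c ∈ T × T`. -/
def dilateHom {n : ℕ} (c : Torus n × Torus n) : Holo n →ₐ[ℂ] Holo n where
  toFun f := ⟨fun p => f.1 (c * p), by
    obtain ⟨F, hF, hf⟩ := f.2
    let L : Ambient n →L[ℂ] Ambient n :=
      (ContinuousLinearMap.pi fun i => (c.1 i : ℂ) • ContinuousLinearMap.proj i).prodMap
        (ContinuousLinearMap.pi fun i => (c.2 i : ℂ) • ContinuousLinearMap.proj i)
    refine ⟨F ∘ L, hF.comp (L.analyticOnNhd _) ?_, fun p => ?_⟩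
    · intro z hz
      exact ⟨fun i => mul_ne_zero (c.1 i).ne_zero (hz.1 i),
        fun i => mul_ne_zero (c.2 i).ne_zero (hz.2 i)⟩
    · exact (hf (c * p) : F (coords (c * p)) = f.1 (c * p))⟩
  map_one' := rfl
  map_mul' _ _ := rfl
  map_zero' := rfl
  map_add' _ _ := rfl
  commutes' _ := rfl

/-- `f ↦ f(c ·)` on `𝒪(T × T)`, as an automorphism. -/
def dilate {n : ℕ} (c : Torus n × Torus n) : Holo n ≃ₐ[ℂ] Holo n :=
  AlgEquiv.ofAlgHom (dilateHom c) (dilateHom c⁻¹)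
    (AlgHom.ext fun f => Subtype.ext (funext fun p =>
      congrArg f.1 (inv_mul_cancel_left c p : c⁻¹ * (c * p) = p)))
    (AlgHom.ext fun f => Subtype.ext (funext fun p =>
      congrArg f.1 (mul_inv_cancel_left c p : c * (c⁻¹ * p) = p)))

/-- `q^l = (q^{l_1}, …, q^{l_N})`. -/
def qpow {n : ℕ} (q : QParam) (l : Lat n) : Torus n := fun i => q.unit ^ l i

/-- The automorphism `f(t, γ) ↦ f(q^{-l} t, q^m γ)` of `𝕂`. -/
def shift {n : ℕ} (q : QParam) (l m : Lat n) : Mero n ≃ₐ[ℂ] Mero n :=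
  IsFractionRing.algEquivOfAlgEquiv (dilate (qpow q (-l), qpow q m))

/-- `t^l = t_1^{l_1} ⋯ t_N^{l_N}`. -/
def tpow {n : ℕ} (t : Torus n) (l : Lat n) : ℂˣ := ∏ i, t i ^ l i

theorem analyticOnNhd_zpow (m : ℤ) : AnalyticOnNhd ℂ (fun z : ℂ => z ^ m) {0}ᶜ :=
  fun _ hz => analyticAt_id.zpow hz

theorem isHolo_monomial {n : ℕ} (l m : Lat n) :
    ∃ F : Ambient n → ℂ, AnalyticOnNhd ℂ F (torusSet n) ∧
      ∀ p, F (coords p) = ((tpow p.1 l * tpow p.2 m : ℂˣ) : ℂ) := by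
  refine ⟨fun z => (∏ i, z.1 i ^ l i) * ∏ i, z.2 i ^ m i, ?_, fun p => ?_⟩
  · intro z hz
    refine AnalyticAt.mul ?_ ?_
    · refine Finset.analyticAt_fun_prod _ fun i _ => AnalyticAt.zpow ?_ (hz.1 i)
      exact ((ContinuousLinearMap.proj (R := ℂ) (φ := fun _ : Fin (n + 2) => ℂ) i).comp
        (ContinuousLinearMap.fst ℂ _ _)).analyticAt z
    · refine Finset.analyticAt_fun_prod _ fun i _ => AnalyticAt.zpow ?_ (hz.2 i)
      exact ((ContinuousLinearMap.proj (R := ℂ) (φ := fun _ : Fin (n + 2) => ℂ) i).comp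
        (ContinuousLinearMap.snd ℂ _ _)).analyticAt z
  · simp [tpow, coords]

/-- The function `t^l γ^m` on `T × T`. -/
def monoHolo {n : ℕ} (l m : Lat n) : Holo n :=
  ⟨fun p => ((tpow p.1 l * tpow p.2 m : ℂˣ) : ℂ), isHolo_monomial l m⟩

/-! ### The cocycle and the bispectral quantum KZ equations -/

/-- The function `f(t)` on `T × T`, for `f ∈ ℂ[T]`. -/
def evalX {n : ℕ} (f : Reg n) : Holo n := f.coeff.sum fun v c => c • monoHolo v 0

/-- The function `f(γ⁻¹)` on `T × T`, for `f ∈ ℂ[T]`. -/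
def evalYInv {n : ℕ} (f : Reg n) : Holo n := f.coeff.sum fun v c => c • monoHolo 0 (-v)

/-- The space `H_0^𝕂 = 𝕂 ⊗ H_0` of meromorphic `H_0`-valued functions on `T × T`; its elements
are given by their coefficients in the basis `T_w`, `w ∈ S_N`. -/
abbrev HeckeMero (n : ℕ) : Type := Perm n → Mero n

/-- The inclusion of `ℍ ≃ ℂ[T × T] ⊗ H_0` in `H_0^𝕂`, applied to an element of `ℍ`. -/
def toHeckeMero {n : ℕ} (q : QParam) (k : ℂˣ) (h : Op n) : HeckeMero n := fun v =>
  (pbwCoord q k h).sum fun b c =>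
    if b.2 = v then algebraMap (Holo n) (Mero n) (c • monoHolo b.1.1 b.1.2) else 0

/-- The matrix, in the basis `T_w`, of the cocycle value `C_{(w, w')} ∈ GL(H_0^𝕂)`. It is
`𝕂`-linear with
`C_{(w, w')} T_u = τ(w, w') T_u = d_w(t)⁻¹ d_{w'}(γ⁻¹)⁻¹ · S_w T_u S_{w'}^*`. -/
def cocycle {n : ℕ} (q : QParam) (k : ℂˣ) (w w' : Weyl n) : Matrix (Perm n) (Perm n) (Mero n) :=
  Matrix.of fun v u =>
    (algebraMap (Holo n) (Mero n) (evalX (dFun q k w) * evalYInv (dFun q k w')))⁻¹ *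
      toHeckeMero q k (inter q k w * opTw q k u * dual q k (inter q k w')) v

/-- `f(q^{-l} t, q^m γ)`, for a meromorphic `H_0`-valued function `f(t, γ)`. -/
def shiftVec {n : ℕ} (q : QParam) (l m : Lat n) (f : HeckeMero n) : HeckeMero n :=
  fun v => shift q l m (f v)

/-- The solutions `f` of the bispectral quantum KZ equations
`C_{(l, m)}(t, γ) f(q^{-l} t, q^m γ) = f(t, γ)`, `l, m ∈ ℤ^N`. -/
def SOL {n : ℕ} (q : QParam) (k : ℂˣ) : Set (HeckeMero n) :=
  {f | ∀ l m : Lat n, (cocycle q k (transl l) (transl m)).mulVec (shiftVec q l m f) = f}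

/-! ### The gauge factor -/

/-- The renormalized Jacobi theta function `∏_{m ≥ 0} (1 - q^m z) (1 - q^{m+1} / z)`. -/
def theta (q : QParam) (z : ℂ) : ℂ :=
  ∏' m : ℕ, ((1 - (q.unit : ℂ) ^ m * z) * (1 - (q.unit : ℂ) ^ (m + 1) / z))

theorem analyticOnNhd_theta (q : QParam) : AnalyticOnNhd ℂ (theta q) {0}ᶜ := by
  have hq0 : 0 ≤ (q : ℝ) := q.2.1.le
  have hq1 : (q : ℝ) < 1 := q.2.2
  have hqn : ‖(q.unit : ℂ)‖ = (q : ℝ) := by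
    simp [QParam.unit, abs_of_pos q.2.1]
  let f : ℕ → ℂ → ℂ := fun m z =>
    (1 - (q.unit : ℂ) ^ m * z) * (1 - (q.unit : ℂ) ^ (m + 1) / z) - 1
  have hcont : ∀ m, ContinuousOn (f m) {0}ᶜ := fun m => by
    have : ∀ z ∈ ({0}ᶜ : Set ℂ), z ≠ 0 := fun _ h => h
    fun_prop (disch := assumption)
  have hdiff : ∀ m, DifferentiableOn ℂ (fun z => 1 + f m z) {0}ᶜ := fun m => by
    have : ∀ z ∈ ({0}ᶜ : Set ℂ), z ≠ 0 := fun _ h => h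
    fun_prop (disch := assumption)
  have hprod : HasProdLocallyUniformlyOn (fun m z => 1 + f m z) (fun z => ∏' m, (1 + f m z))
      {0}ᶜ := by
    refine hasProdLocallyUniformlyOn_of_forall_compact isOpen_compl_singleton fun S hS hC => ?_
    obtain ⟨M, hM⟩ := hC.exists_bound_of_continuousOn (f := fun z : ℂ => ‖z‖ + ‖z⁻¹‖ + 1) (by
      have : ∀ z ∈ S, z ≠ 0 := fun _ h => hS h
      fun_prop (disch := assumption))
    refine ((summable_geometric_of_lt_one hq0 hq1).mul_right M).hasProdUniformlyOn_nat_one_add hC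
      (Filter.Eventually.of_forall fun m z hz => ?_) fun m => (hcont m).mono hS
    have hz0 : z ≠ 0 := hS hz
    have e : f m z = -((q.unit : ℂ) ^ m * z) + -((q.unit : ℂ) ^ m * ((q.unit : ℂ) * z⁻¹)) +
        (q.unit : ℂ) ^ m * (q.unit : ℂ) ^ (m + 1) := by
      simp only [f]; field_simp; ring
    have h1 : ‖f m z‖ ≤ (q : ℝ) ^ m * ‖z‖ + (q : ℝ) ^ m * ((q : ℝ) * ‖z⁻¹‖) +
        (q : ℝ) ^ m * (q : ℝ) ^ (m + 1) := by
      rw [e]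
      refine (norm_add₃_le).trans (le_of_eq ?_)
      simp only [norm_neg, norm_mul, norm_pow, hqn]
    have h2 : ‖z‖ + ‖z⁻¹‖ + 1 ≤ M := (le_abs_self _).trans (hM z hz)
    have h3 : (q : ℝ) ^ (m + 1) ≤ 1 := pow_le_one₀ hq0 hq1.le
    have h4 : (q : ℝ) * ‖z⁻¹‖ ≤ ‖z⁻¹‖ := mul_le_of_le_one_left (norm_nonneg _) hq1.le
    calc ‖f m z‖ ≤ (q : ℝ) ^ m * (‖z‖ + (q : ℝ) * ‖z⁻¹‖ + (q : ℝ) ^ (m + 1)) := by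
          rw [mul_add, mul_add]; exact h1
      _ ≤ (q : ℝ) ^ m * M :=
          mul_le_mul_of_nonneg_left (by linarith) (pow_nonneg hq0 m)
  have hd : DifferentiableOn ℂ (fun z => ∏' m, (1 + f m z)) {0}ᶜ :=
    hprod.differentiableOn (Filter.Eventually.of_forall fun s => by
      simpa [Finset.prod_fn] using
        DifferentiableOn.finsetProd (u := s) (fun m _ => hdiff m)) isOpen_compl_singleton
  have he : theta q = fun z => ∏' m, (1 + f m z) := by
    funext z; simp [theta, f]
  rw [he]
  exact hd.analyticOnNhd isOpen_compl_singleton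

/-- The function `θ(c t^l γ^m)` on `T × T`. -/
def thetaHolo {n : ℕ} (q : QParam) (c : ℂˣ) (l m : Lat n) : Holo n :=
  ⟨fun p => theta q ((c * (tpow p.1 l * tpow p.2 m) : ℂˣ) : ℂ), by
    obtain ⟨F, hF, hf⟩ := isHolo_monomial l m
    refine ⟨fun z => theta q (c * F z),
      (analyticOnNhd_theta q).comp (analyticOnNhd_const.mul hF) ?_, fun p => ?_⟩
    · intro z hz
      obtain ⟨p, rfl⟩ := exists_coords hz
      simp only [hf]
      exact mul_ne_zero c.ne_zero (Units.ne_zero _)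
    · simp only [hf, Units.val_mul]⟩

/-- `δ = (N - 1, N - 3, …, 1 - N)`. -/
def delta {n : ℕ} : Lat n := fun i => (n : ℤ) + 1 - 2 * (i : ℕ)

/-- `W_κ(t, γ) = ∏_{i=1}^N θ(κ t_i γ_{N-i+1}⁻¹) / (θ(κ k^{δ_i} t_i) θ(κ k^{-δ_i} γ_{N-i+1}⁻¹))`. -/
def gauge {n : ℕ} (q : QParam) (k κ : ℂˣ) : Mero n :=
  ∏ i : Fin (n + 2),
    algebraMap (Holo n) (Mero n) (thetaHolo q κ (eps i) (-eps i.rev)) /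
      (algebraMap (Holo n) (Mero n) (thetaHolo q (κ * k ^ delta i) (eps i) 0) *
        algebraMap (Holo n) (Mero n) (thetaHolo q (κ * k ^ (-delta i)) 0 (-eps i.rev)))

/-- The gauged matrices
`D_{(l, m)}(t, γ) = W_κ(t, γ)⁻¹ C_{(l, m)}(t, γ) W_κ(q^{-l} t, q^m γ)`. -/
def gaugedCocycle {n : ℕ} (q : QParam) (k κ : ℂˣ) (l m : Lat n) :
    Matrix (Perm n) (Perm n) (Mero n) :=
  ((gauge q k κ : Mero n)⁻¹ * shift q l m (gauge q k κ)) • cocycle q k (transl l) (transl m)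

/-- `g` solves the gauged equations `D_{(l, m)}(t, γ) g(q^{-l} t, q^m γ) = g(t, γ)`,
`l, m ∈ ℤ^N`. -/
def IsGaugedSolution {n : ℕ} (q : QParam) (k κ : ℂˣ) (g : HeckeMero n) : Prop :=
  ∀ l m : Lat n, (gaugedCocycle q k κ l m).mulVec (shiftVec q l m g) = g

/-! ### Asymptotic expansions -/

/-- The simple root `α_i = ε_i - ε_{i+1}`. -/
def simpleRoot {n : ℕ} (i : Fin (n + 1)) : Lat n := eps i.castSucc - eps i.succ

/-- The element `∑ a_i α_i` of the cone `Q_+`, for nonnegative integers `a_i`. -/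
def posRoot {n : ℕ} (a : Fin (n + 1) → ℕ) : Lat n := ∑ i, a i • simpleRoot i

/-- `B_ε = {t ∈ T : |t^{α_i}| < ε for all i}`. -/
def regionB (n : ℕ) (ε : ℝ) : Set (Torus n) :=
  {t | ∀ i : Fin (n + 1), ‖(tpow t (simpleRoot i) : ℂ)‖ < ε}

/-- `B_ε⁻¹ × B_ε`. -/
def region (n : ℕ) (ε : ℝ) : Set (Torus n × Torus n) :=
  {p | p.1⁻¹ ∈ regionB n ε ∧ p.2 ∈ regionB n ε}

/-- The term `K_{α,β} t^{-α} γ^β` of an `H_0`-valued power series; elements of `H_0` are given by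
their coefficients in the basis `T_w`, and `α, β ∈ Q_+` by their coefficients in the basis of
simple roots. -/
def seriesTerm {n : ℕ} (K : (Fin (n + 1) → ℕ) × (Fin (n + 1) → ℕ) → Perm n → ℂ)
    (ab : (Fin (n + 1) → ℕ) × (Fin (n + 1) → ℕ)) (p : Torus n × Torus n) : Perm n → ℂ :=
  ((tpow p.1 (-posRoot ab.1) * tpow p.2 (posRoot ab.2) : ℂˣ) : ℂ) • K ab

/-- `Ψ(t, γ) = ∑_{α,β} K_{α,β} t^{-α} γ^β` on `B_ε⁻¹ × B_ε`, normally convergent on compacta.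
A meromorphic function is equal to a given function `s` on a set if it can be written as `f / g`
with `f, g` analytic on `T × T`, `g ≠ 0`, and `g s = f` on that set. -/
structure HasExpansion {n : ℕ} (Ψ : HeckeMero n) (ε : ℝ)
    (K : (Fin (n + 1) → ℕ) × (Fin (n + 1) → ℕ) → Perm n → ℂ) : Prop where
  normal : ∀ C ⊆ region n ε, IsCompact C →
    ∃ M : (Fin (n + 1) → ℕ) × (Fin (n + 1) → ℕ) → ℝ, Summable M ∧
      ∀ p ∈ C, ∀ ab, ‖seriesTerm K ab p‖ ≤ M ab
  eq_sum : ∀ v : Perm n, ∃ f g : Holo n, g ≠ 0 ∧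
    Ψ v = algebraMap (Holo n) (Mero n) f / algebraMap (Holo n) (Mero n) g ∧
      ∀ p ∈ region n ε, g.1 p * ∑' ab, seriesTerm K ab p v = f.1 p

/-- `Ψ` has, for some `ε > 0`, an expansion on `B_ε⁻¹ × B_ε` with `K_{0,0} = T_{w_0}`, where
`w_0(i) = N - i + 1`. -/
def IsAsymptoticallyFree {n : ℕ} (Ψ : HeckeMero n) : Prop :=
  ∃ ε : ℝ, 0 < ε ∧ ∃ K, HasExpansion Ψ ε K ∧ K (0, 0) = Pi.single Fin.revPerm 1

end BqKZ

end

/-! The equations are first rewritten as invariance under commuting operators. By the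
Poincaré-Birkhoff-Witt theorem (`pbwMap_injective`) an operator `∑ f(X) T_u Y^m`, even with rational
coefficients `f`, has a well-defined symbol `∑ f(t) γ^m T_u`. Left multiplication by the translation
`l ∈ W` induces a semilinear map `translX` on symbols. The anti-involution of `ℍ` becomes `(t, γ) ↦
(γ⁻¹, t⁻¹)` combined with `T_w ↦ T_{w⁻¹}`, and conjugating with it gives a second map `translY`. The
factors `d_w` in the definition of `C` cancel against the intertwiners, so that the left side of the
BqKZ equation of `(l, m)` is `translX l (translY m f)` (`cocycle_mulVec`). The two families commute
because left and right multiplication do (`translX_translY`). Quasi-periodicity of theta functions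
turns the gauge transformation into multiplication by an explicit monomial in which `κ` no longer
occurs (`shift_gauge`). Solutions of the gauged equations are therefore the common fixed vectors of
the commuting operators `gaugedTransl`.

The point of the gauge is the behaviour at the origin of the variables `z = (t^{-α_i}, γ^{α_i})`.
For a fundamental weight, the translation is `π^r` times a permutation, and `π^r T_u` is again a
basis element times a monomial in `Y` (`weylOp_piW_pow_opTw`). Hence the matrix of the gauged
equation can be computed at the origin. It is a rational function of `z`, regular at `0`, whose
value there is an idempotent fixing `T_{w_0}` (`exists_hasVal_fund_idem`). Such values commute, so
sums of fundamental weights behave in the same way.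

Let `ρ` be the sum of the fundamental weights. The shift by `(ρ, ρ)` multiplies each variable by
`q`, and its equation reads `f(z) = A(z) f(qz)`, where `M = A(0)` is idempotent and `M T_{w_0} =
T_{w_0}`. Because `M² = M`, the products `A(z) A(qz) ⋯ A(q^{m-1} z)` stay bounded (`prod_bound`).
Write `A = P / e` with polynomials and `e(0) = 1`. The products of the `P(q^i z)` applied to
`T_{w_0}` converge to a vector `F` of entire power series, and those of the `e(q^i z)` to an entire
series `S` (`exists_entire_solution`). As entire series in `z` give analytic functions on all of `T
× T`, the quotient `Ψ = F / S` is meromorphic on `T × T`, and it has a convergent expansion near the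
origin (`exists_fixed_rho`).

The same bound gives uniqueness. The difference of two solutions of the `(ρ, ρ)` equation with equal
leading term tends to `0` along every orbit `z, qz, q²z, …`, while its value at `z` is a bounded
matrix times its value at `q^m z`; so it vanishes (`eq_zero_of_orbitLim`). Finally, if `(l, m)`
consists of a fundamental weight and `0`, then the transform of `Ψ` by `(l, m)` again solves the
`(ρ, ρ)` equation, by commutativity, and has the same leading term, because the value of its matrix
at the origin fixes `T_{w_0}`. Uniqueness shows that it equals `Ψ` (`gaugedTransl_eq_of_hasIdem`),
and the fundamental weights generate all equations. -/

noncomputable section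
namespace BqKZ

/-! ### A length function on the extended affine Weyl group -/

/-- The translation part of `w ∈ W`, as an element of `ℤ^N`. -/
def lat {n : ℕ} (w : Weyl n) (i : Fin (n + 2)) : ℤ := (w.left i).toAdd

/-- The rotation `i ↦ i + 1`. -/
abbrev rot (n : ℕ) : Perm n := finRotate (n + 2)

@[simp] theorem right_mul {n : ℕ} (w w' : Weyl n) : (w * w').right = w.right * w'.right := rfl

@[simp] theorem lat_mul {n : ℕ} (w w' : Weyl n) (i : Fin (n + 2)) :
    lat (w * w') i = lat w i + lat w' (w.right⁻¹ i) := rfl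

@[simp] theorem right_one {n : ℕ} : (1 : Weyl n).right = 1 := rfl
@[simp] theorem lat_one {n : ℕ} (i : Fin (n + 2)) : lat (1 : Weyl n) i = 0 := rfl
@[simp] theorem right_ofPerm {n : ℕ} (u : Perm n) : (ofPerm u).right = u := rfl
@[simp] theorem lat_ofPerm {n : ℕ} (u : Perm n) (i : Fin (n + 2)) : lat (ofPerm u) i = 0 := rfl
@[simp] theorem right_transl {n : ℕ} (l : Lat n) : (transl l).right = 1 := rfl
@[simp] theorem lat_transl {n : ℕ} (l : Lat n) (i : Fin (n + 2)) : lat (transl l) i = l i := rfl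
@[simp] theorem right_piW {n : ℕ} : (piW n).right = rot n := rfl
@[simp] theorem lat_piW {n : ℕ} (i : Fin (n + 2)) :
    lat (piW n) i = eps (Fin.last (n + 1)) ((rot n)⁻¹ i) := by
  simp [piW]

@[simp] theorem perm_inv_apply {n : ℕ} (u : Perm n) (i : Fin (n + 2)) : u⁻¹ (u i) = i :=
  u.symm_apply_apply i

@[simp] theorem perm_apply_inv {n : ℕ} (u : Perm n) (i : Fin (n + 2)) : u (u⁻¹ i) = i :=
  u.apply_symm_apply i

theorem weyl_ext {n : ℕ} {w w' : Weyl n} (h : w.right = w'.right) (h' : ∀ i, lat w i = lat w' i) :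
    w = w' :=
  SemidirectProduct.ext (funext h') h

theorem ofPerm_mul {n : ℕ} (u v : Perm n) : (ofPerm (u * v)) = ofPerm u * ofPerm v := by
  simp [ofPerm]

@[simp] theorem ofPerm_one {n : ℕ} : (ofPerm (1 : Perm n)) = 1 := by simp [ofPerm]

theorem ofPerm_inv {n : ℕ} (u : Perm n) : (ofPerm (u⁻¹)) = (ofPerm u)⁻¹ := by
  simp [ofPerm]

theorem transl_add {n : ℕ} (l m : Lat n) : transl (l + m) = transl l * transl m :=
  weyl_ext rfl fun i => by simp

theorem transl_zero {n : ℕ} : transl (0 : Lat n) = 1 := weyl_ext rfl fun _ => rfl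

theorem ofPerm_mul_transl {n : ℕ} (u : Perm n) (l : Lat n) :
    ofPerm u * transl l = transl (fun i => l (u⁻¹ i)) * ofPerm u :=
  weyl_ext rfl fun i => by simp

theorem val_rot {n : ℕ} (i : Fin (n + 2)) :
    ((rot n i : Fin (n + 2)) : ℕ) = if i = Fin.last (n + 1) then 0 else (i : ℕ) + 1 := by
  split_ifs with h
  · subst h; simp
  · exact coe_finRotate_of_ne_last h

theorem simplePerm_apply {n : ℕ} (a : Fin (n + 1)) (i : Fin (n + 2)) :
    ((simplePerm a i : Fin (n + 2)) : ℕ) =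
      if (i : ℕ) = a then (a : ℕ) + 1 else if (i : ℕ) = a + 1 then (a : ℕ) else i := by
  simp only [simplePerm, Equiv.swap_apply_def, Fin.ext_iff, Fin.val_castSucc, Fin.val_succ]
  split_ifs <;> simp_all

@[simp] theorem simplePerm_castSucc {n : ℕ} (a : Fin (n + 1)) :
    simplePerm a a.castSucc = a.succ := by simp [simplePerm]

@[simp] theorem simplePerm_succ {n : ℕ} (a : Fin (n + 1)) :
    simplePerm a a.succ = a.castSucc := by simp [simplePerm]

@[simp] theorem simplePerm_inv {n : ℕ} (a : Fin (n + 1)) : (simplePerm a)⁻¹ = simplePerm a := by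
  simp [simplePerm]

@[simp] theorem simplePerm_mul_self {n : ℕ} (a : Fin (n + 1)) :
    simplePerm a * simplePerm a = 1 := by simp [simplePerm]

theorem mul_simplePerm_cancel {n : ℕ} (u : Perm n) (a : Fin (n + 1)) :
    u * simplePerm a * simplePerm a = u := by rw [mul_assoc, simplePerm_mul_self, mul_one]

@[simp] theorem simplePerm_simplePerm {n : ℕ} (a : Fin (n + 1)) (i : Fin (n + 2)) :
    simplePerm a (simplePerm a i) = i := by simp [simplePerm]

/-- The indicator of a proposition. -/
def ind (p : Prop) : ℤ := open Classical in if p then 1 else 0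

theorem ind_true {p : Prop} (h : p) : ind p = 1 := by simp [ind, h]
theorem ind_false {p : Prop} (h : ¬p) : ind p = 0 := by simp [ind, h]

/-- The summands of the length function. -/
def gap {n : ℕ} (w : Weyl n) (i j : Fin (n + 2)) : ℤ :=
  lat w (w.right i) - lat w (w.right j) + ind (w.right j < w.right i) - ind (j < i)

/-- Twice the length of `w ∈ W`. -/
def ell {n : ℕ} (w : Weyl n) : ℤ := ∑ i, ∑ j, |gap w i j|

theorem ind_rot {n : ℕ} (i j : Fin (n + 2)) (h : i ≠ j) :
    ind (rot n j < rot n i) =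
      ind (j < i) - ind (i = Fin.last (n + 1)) + ind (j = Fin.last (n + 1)) := by
  have h1 := val_rot i
  have h2 := val_rot j
  have h3 := i.isLt
  have h4 := j.isLt
  simp only [ind, Fin.lt_def, h1, h2]
  rw [Ne, Fin.ext_iff] at h
  simp only [Fin.ext_iff, Fin.val_last]
  split_ifs <;> omega

theorem eps_eq_ind {n : ℕ} (i j : Fin (n + 2)) : (eps i : Lat n) j = ind (j = i) := by
  simp [eps, ind, Pi.single_apply]

theorem gap_self {n : ℕ} (w : Weyl n) (i : Fin (n + 2)) : gap w i i = 0 := by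
  simp [gap, ind]

/-- The rotation preserves the order of two indices unless one of them is the last (`ind_rot`), and
the translation part of `π` accounts exactly for this defect. So right multiplication by `π` only
permutes the summands, and left multiplication (`ell_piW_mul`) leaves each of them unchanged. -/
theorem ell_mul_piW {n : ℕ} (w : Weyl n) : ell (w * piW n) = ell w := by
  have h : ∀ i j, gap (w * piW n) i j = gap w (rot n i) (rot n j) := fun i j => by
    by_cases hij : i = j
    · subst hij; simp [gap_self]
    · simp only [gap, right_mul, lat_mul, Equiv.Perm.mul_apply, right_piW, lat_piW,
        perm_inv_apply, eps_eq_ind, ind_rot i j hij]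
      ring
  simp only [ell, h]
  rw [Equiv.sum_comp (rot n) fun i => ∑ j, |gap w i (rot n j)|]
  exact Finset.sum_congr rfl fun i _ => Equiv.sum_comp (rot n) fun j => |gap w i j|

theorem ell_piW_mul {n : ℕ} (w : Weyl n) : ell (piW n * w) = ell w := by
  have h : ∀ i j, gap (piW n * w) i j = gap w i j := fun i j => by
    by_cases hij : i = j
    · subst hij; simp [gap_self]
    · have hij' : w.right i ≠ w.right j := fun h => hij (w.right.injective h)
      simp only [gap, right_mul, lat_mul, Equiv.Perm.mul_apply, right_piW, lat_piW,
        perm_inv_apply, eps_eq_ind, ind_rot _ _ hij']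
      ring
  simp only [ell, h]

theorem gap_swap {n : ℕ} (w : Weyl n) (i j : Fin (n + 2)) : gap w j i = -gap w i j := by
  by_cases hij : i = j
  · subst hij; simp [gap_self]
  · have hij' : w.right i ≠ w.right j := fun h => hij (w.right.injective h)
    have aux : ∀ a b : Fin (n + 2), a ≠ b → ind (a < b) = 1 - ind (b < a) := fun a b hab => by
      simp only [ind]; rcases lt_or_gt_of_ne hab with h | h <;> simp [h, not_lt.mpr h.le]
    simp only [gap, aux i j hij, aux _ _ hij']
    ring

theorem ind_simplePerm {n : ℕ} (a : Fin (n + 1)) (i j : Fin (n + 2)) :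
    ind (simplePerm a j < simplePerm a i) =
      ind (j < i) + ind (i = a.succ ∧ j = a.castSucc) * (-1) +
        ind (i = a.castSucc ∧ j = a.succ) := by
  have h1 := simplePerm_apply a i
  have h2 := simplePerm_apply a j
  simp only [ind, Fin.lt_def, h1, h2, Fin.ext_iff, Fin.val_castSucc, Fin.val_succ]
  split_ifs <;> omega

/-- The transposition `s_a` preserves the order of every pair of indices other than its own. After
reindexing only the two summands of that pair change, and they change equally because `gap` is
antisymmetric. -/
theorem ell_mul_simple {n : ℕ} (w : Weyl n) (a : Fin (n + 1)) :
    ell (w * ofPerm (simplePerm a)) =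
      ell w + 2 * (|gap w a.castSucc a.succ - 1| - |gap w a.castSucc a.succ|) := by
  have h : ∀ i j, gap (w * ofPerm (simplePerm a)) i j =
      gap w (simplePerm a i) (simplePerm a j) + ind (simplePerm a j < simplePerm a i) -
        ind (j < i) := fun i j => by
    simp only [gap, right_mul, lat_mul, Equiv.Perm.mul_apply, right_ofPerm, lat_ofPerm]
    ring
  have h' : ell (w * ofPerm (simplePerm a)) = ∑ i, ∑ j,
      |gap w i j + (ind (i = a.succ ∧ j = a.castSucc) - ind (i = a.castSucc ∧ j = a.succ))| := by
    simp only [ell, h]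
    rw [← Equiv.sum_comp (simplePerm a)]
    refine Finset.sum_congr rfl fun i _ => ?_
    rw [← Equiv.sum_comp (simplePerm a)]
    refine Finset.sum_congr rfl fun j _ => ?_
    rw [simplePerm_simplePerm, simplePerm_simplePerm, ind_simplePerm]
    congr 1; ring
  have hne : a.castSucc ≠ a.succ := by simp [Fin.ext_iff]
  have h'' : ∀ i j, |gap w i j + (ind (i = a.succ ∧ j = a.castSucc) -
      ind (i = a.castSucc ∧ j = a.succ))| = |gap w i j| +
        (if i = a.castSucc then (if j = a.succ then
          |gap w a.castSucc a.succ - 1| - |gap w a.castSucc a.succ| else 0) else 0) +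
        (if i = a.succ then (if j = a.castSucc then
          |gap w a.castSucc a.succ - 1| - |gap w a.castSucc a.succ| else 0) else 0) := fun i j => by
    have hs := gap_swap w a.castSucc a.succ
    by_cases h1 : i = a.castSucc
    · by_cases h2 : j = a.succ
      · subst h1 h2; simp [ind, hne, sub_eq_add_neg]
      · subst h1; simp [ind, h2, hne]
    · by_cases h2 : i = a.succ
      · by_cases h3 : j = a.castSucc
        · subst h2 h3
          rw [hs]
          rw [ind_true ⟨rfl, rfl⟩, ind_false fun h => hne h.2, if_neg h1, if_pos rfl, if_pos rfl,
            ← abs_neg (-gap w a.castSucc a.succ + (1 - 0)), abs_neg (gap w a.castSucc a.succ)]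
          ring_nf
        · subst h2; simp [ind, h3, h1]
      · simp [ind, h1, h2]
  rw [h']
  simp only [h'', Finset.sum_add_distrib, Finset.sum_ite_irrel, Finset.sum_ite_eq', Finset.mem_univ,
    if_true, Finset.sum_const_zero, ell]
  ring

theorem ell_mul_simple_le {n : ℕ} (w : Weyl n) (a : Fin (n + 1)) :
    ell (w * ofPerm (simplePerm a)) ≤ ell w + 2 := by
  rw [ell_mul_simple]
  have := abs_sub (gap w a.castSucc a.succ) 1
  rw [abs_one] at this
  linarith

theorem ell_one {n : ℕ} : ell (1 : Weyl n) = 0 := by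
  simp [ell, gap]

theorem ell_mul_piW_zpow {n : ℕ} (w : Weyl n) (m : ℤ) : ell (w * piW n ^ m) = ell w := by
  have h : ∀ w : Weyl n, ell (w * (piW n)⁻¹) = ell w := fun w => by
    rw [← ell_mul_piW, inv_mul_cancel_right]
  induction m generalizing w with
  | zero => simp
  | succ m ih => rw [zpow_add_one, ← mul_assoc, ell_mul_piW, ih]
  | pred m ih => rw [zpow_sub_one, ← mul_assoc, h, ih]

theorem ell_nonneg {n : ℕ} (w : Weyl n) : 0 ≤ ell w :=
  Finset.sum_nonneg fun _ _ => Finset.sum_nonneg fun _ _ => abs_nonneg _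

theorem gap_perm {n : ℕ} (u : Perm n) (a : Fin (n + 1)) :
    gap (ofPerm u) a.castSucc a.succ = ind (u a.succ < u a.castSucc) := by
  have : ¬ (a.succ < a.castSucc) := by simp [Fin.lt_def]
  simp [gap, ind_false this]

/-! ### Reduced words of permutations -/

theorem ell_ascent {n : ℕ} {u : Perm n} {a : Fin (n + 1)} (h : u a.castSucc < u a.succ) :
    ell (ofPerm (u * simplePerm a)) = ell (ofPerm u) + 2 := by
  rw [ofPerm_mul, ell_mul_simple, gap_perm, ind_false (not_lt.mpr h.le)]
  norm_num

theorem ell_descent {n : ℕ} {u : Perm n} {a : Fin (n + 1)} (h : u a.succ < u a.castSucc) :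
    ell (ofPerm (u * simplePerm a)) = ell (ofPerm u) - 2 := by
  rw [ofPerm_mul, ell_mul_simple, gap_perm, ind_true h]
  norm_num
  ring

theorem ascent_or_descent {n : ℕ} (u : Perm n) (a : Fin (n + 1)) :
    u a.castSucc < u a.succ ∨ u a.succ < u a.castSucc :=
  lt_or_gt_of_ne fun h => by simpa [Fin.ext_iff] using u.injective h

theorem eq_one_of_forall_ascent {n : ℕ} {u : Perm n}
    (h : ∀ a : Fin (n + 1), u a.castSucc < u a.succ) : u = 1 := by
  have hm : StrictMono u := Fin.strictMono_iff_lt_succ.mpr h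
  have := (StrictMono.orderIsoOfSurjective u hm u.surjective)
  have h2 : (StrictMono.orderIsoOfSurjective u hm u.surjective) = OrderIso.refl _ :=
    Subsingleton.elim _ _
  ext i
  have h3 := congrArg (fun f => f i) h2
  simpa using congrArg Fin.val h3

/-- Induction on permutations along ascents. -/
theorem perm_induction {n : ℕ} {P : Perm n → Prop} (one : P 1)
    (step : ∀ u a, u a.castSucc < u a.succ → P u → P (u * simplePerm a)) (u : Perm n) : P u := by
  -- Induction on a bound for `ell`: a permutation without descents is the identity, and removing a
  -- descent lowers `ell` by 2.
  obtain ⟨m, hm⟩ : ∃ m : ℕ, ell (ofPerm u) ≤ m := ⟨(ell (ofPerm u)).toNat, Int.self_le_toNat _⟩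
  induction m generalizing u with
  | zero =>
    by_cases h : ∀ a : Fin (n + 1), u a.castSucc < u a.succ
    · rwa [eq_one_of_forall_ascent h]
    · obtain ⟨a, ha⟩ := not_forall.mp h
      have := ell_descent ((ascent_or_descent u a).resolve_left ha)
      have := ell_nonneg (ofPerm (u * simplePerm a))
      push_cast at hm
      omega
  | succ m ih =>
    by_cases h : ∀ a : Fin (n + 1), u a.castSucc < u a.succ
    · rwa [eq_one_of_forall_ascent h]
    · obtain ⟨a, ha⟩ := not_forall.mp h
      have ha := (ascent_or_descent u a).resolve_left ha
      have h1 := ell_descent ha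
      have h2 : u = u * simplePerm a * simplePerm a := by rw [mul_assoc, simplePerm_mul_self, mul_one]
      rw [h2]
      refine step _ _ (by simpa using ha) (ih _ ?_)
      push_cast at hm
      omega

/-- The permutation `s_{i_1} ⋯ s_{i_r}`. -/
def word {n : ℕ} (l : List (Fin (n + 1))) : Perm n := (l.map simplePerm).prod

@[simp] theorem word_nil {n : ℕ} : word ([] : List (Fin (n + 1))) = 1 := rfl
@[simp] theorem word_append_singleton {n : ℕ} (l : List (Fin (n + 1))) (a : Fin (n + 1)) :
    word (l ++ [a]) = word l * simplePerm a := by simp [word]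

theorem ell_word_le {n : ℕ} (l : List (Fin (n + 1))) : ell (ofPerm (word l)) ≤ 2 * l.length := by
  induction l using List.reverseRecOn with
  | nil => simp [ell_one]
  | append_singleton l a ih =>
    rw [word_append_singleton, ofPerm_mul]
    have := ell_mul_simple_le (ofPerm (word l)) a
    simp only [List.length_append, List.length_singleton]
    push_cast
    linarith

theorem exists_word {n : ℕ} (u : Perm n) :
    ∃ l, word l = u ∧ 2 * (l.length : ℤ) = ell (ofPerm u) := by
  induction u using perm_induction with
  | one => exact ⟨[], rfl, by simp [ell_one]⟩
  | step u a h ih =>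
    obtain ⟨l, hl, hl'⟩ := ih
    refine ⟨l ++ [a], by simp [hl], ?_⟩
    rw [ell_ascent h, ← hl']
    simp; ring

/-- No word is shorter than half of `ell`, and some word attains this value. Minimality thus becomes
an equation, which is the form suited to inductions. -/
theorem isReducedPermExpr_iff {n : ℕ} (u : Perm n) (l : List (Fin (n + 1))) :
    IsReducedPermExpr u l ↔ word l = u ∧ 2 * (l.length : ℤ) = ell (ofPerm u) := by
  constructor
  · rintro ⟨h, h'⟩
    obtain ⟨l', hl, hl'⟩ := exists_word u
    have h1 := h' l' hl
    have h2 := ell_word_le l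
    rw [show word l = u from h] at h2
    exact ⟨h, by omega⟩
  · rintro ⟨h, h'⟩
    refine ⟨h, fun l' hl' => ?_⟩
    have h2 := ell_word_le l'
    rw [show word l' = u from hl'] at h2
    omega

theorem reducedPermExpr_spec {n : ℕ} (u : Perm n) :
    word (reducedPermExpr u) = u ∧ 2 * ((reducedPermExpr u).length : ℤ) = ell (ofPerm u) := by
  rw [← isReducedPermExpr_iff]
  obtain ⟨l, hl⟩ := exists_word u
  exact Classical.epsilon_spec (p := IsReducedPermExpr u) ⟨l, (isReducedPermExpr_iff u l).mpr hl⟩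

/-- If `a` were an ascent of `u`, the word without its last letter would be too short for `u s_a`.
-/
theorem descent_of_word {n : ℕ} {u : Perm n} {l : List (Fin (n + 1))} {a : Fin (n + 1)}
    (h : word (l ++ [a]) = u) (h' : 2 * ((l ++ [a]).length : ℤ) = ell (ofPerm u)) :
    u a.succ < u a.castSucc ∧ word l = u * simplePerm a ∧
      2 * (l.length : ℤ) = ell (ofPerm (u * simplePerm a)) := by
  have h1 : word l = u * simplePerm a := by
    rw [← h, word_append_singleton, mul_assoc, simplePerm_mul_self, mul_one]
  have h2 := ell_word_le l
  rw [h1] at h2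
  simp only [List.length_append, List.length_singleton] at h'
  push_cast at h'
  rcases ascent_or_descent u a with h3 | h3
  · have := ell_ascent h3
    omega
  · have := ell_descent h3
    exact ⟨h3, h1, by omega⟩

theorem simplePerm_comm {n : ℕ} {a b : Fin (n + 1)} (h : (a : ℕ) + 2 ≤ b) :
    simplePerm a * simplePerm b = simplePerm b * simplePerm a := by
  ext i
  simp only [Equiv.Perm.mul_apply, simplePerm_apply]
  split_ifs <;> omega

theorem simplePerm_braid {n : ℕ} {a b : Fin (n + 1)} (h : (a : ℕ) + 1 = b) :
    simplePerm a * simplePerm b * simplePerm a = simplePerm b * simplePerm a * simplePerm b := by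
  have hba : b.castSucc = a.succ := by ext; simp [h]
  have h1 : a.castSucc ≠ a.succ := by simp [Fin.ext_iff]
  have h2 : a.castSucc ≠ b.succ := by simp only [ne_eq, Fin.ext_iff, Fin.val_castSucc, Fin.val_succ]; omega
  have h3 : b.succ ≠ a.succ := by simp only [ne_eq, Fin.ext_iff, Fin.val_succ]; omega
  simp only [simplePerm, hba]
  rw [Equiv.swap_mul_swap_mul_swap h1 h2, Equiv.swap_comm a.castSucc, Equiv.swap_comm a.succ b.succ,
    Equiv.swap_mul_swap_mul_swap h3 h2.symm, Equiv.swap_comm]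

set_option maxHeartbeats 800000 in
/-- **Matsumoto's theorem** for the symmetric group. -/
theorem matsumoto {n : ℕ} {M : Type*} [Monoid M] (t : Fin (n + 1) → M)
    (comm : ∀ a b : Fin (n + 1), (a : ℕ) + 2 ≤ b → t a * t b = t b * t a)
    (braid : ∀ a b : Fin (n + 1), (a : ℕ) + 1 = b → t a * t b * t a = t b * t a * t b)
    (u : Perm n) (l l' : List (Fin (n + 1))) (hl : word l = u)
    (hl' : 2 * (l.length : ℤ) = ell (ofPerm u)) (hm : word l' = u)
    (hm' : 2 * (l'.length : ℤ) = ell (ofPerm u)) : (l.map t).prod = (l'.map t).prod := by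
  obtain ⟨N, hN⟩ : ∃ N : ℕ, l.length ≤ N := ⟨_, le_rfl⟩
  induction N generalizing u l l' with
  | zero =>
    have h1 : l = [] := List.length_eq_zero_iff.mp (by omega)
    have h2 : l' = [] := List.length_eq_zero_iff.mp (by subst h1; simp at hl'; omega)
    rw [h1, h2]
  | succ N ih =>
    rcases List.eq_nil_or_concat' l with rfl | ⟨l, a, rfl⟩
    · have h2 : l' = [] := List.length_eq_zero_iff.mp (by simp at hl'; omega)
      rw [h2]
    rcases List.eq_nil_or_concat' l' with rfl | ⟨l', b, rfl⟩
    · exfalso; simp at hl' hm'; omega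
    obtain ⟨ha, h1, h2⟩ := descent_of_word hl hl'
    obtain ⟨hb, h3, h4⟩ := descent_of_word hm hm'
    have hlen : l.length ≤ N := by simpa using hN
    have hlen' : l'.length ≤ N := by
      rw [← hm'] at hl'; simp at hl'; omega
    simp only [List.map_append, List.prod_append, List.map_singleton, List.prod_singleton]
    -- Both `a` and `b` are descents of `u`, so `u` has reduced words `l0 b a` and `l0 a b`. The
    -- induction hypothesis for `u s_a` and `u s_b` replaces the given words by these.
    have far : ∀ (a b : Fin (n + 1)) (l l' : List (Fin (n + 1))), l.length ≤ N → l'.length ≤ N →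
        u a.succ < u a.castSucc → word l = u * simplePerm a →
        2 * (l.length : ℤ) = ell (ofPerm (u * simplePerm a)) →
        u b.succ < u b.castSucc → word l' = u * simplePerm b →
        2 * (l'.length : ℤ) = ell (ofPerm (u * simplePerm b)) →
        (a : ℕ) + 2 ≤ b → (l.map t).prod * t a = (l'.map t).prod * t b := by
      intro a b l l' hlen hlen' ha h1 h2 hb h3 h4 hab
      obtain ⟨l0, h5, h6⟩ := exists_word (u * simplePerm a * simplePerm b)
      have ea : simplePerm b a.castSucc = a.castSucc ∧ simplePerm b a.succ = a.succ := by
        constructor <;> ext <;> simp only [simplePerm_apply, Fin.val_castSucc, Fin.val_succ] <;>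
          split_ifs <;> omega
      have eb : simplePerm a b.castSucc = b.castSucc ∧ simplePerm a b.succ = b.succ := by
        constructor <;> ext <;> simp only [simplePerm_apply, Fin.val_castSucc, Fin.val_succ] <;>
          split_ifs <;> omega
      have h7 : ell (ofPerm (u * simplePerm a * simplePerm b)) =
          ell (ofPerm (u * simplePerm a)) - 2 :=
        ell_descent (by simpa [eb.1, eb.2] using hb)
      have e1 : (l.map t).prod = ((l0 ++ [b]).map t).prod := by
        refine ih (u * simplePerm a) _ _ h1 h2 ?_ ?_ hlen
        · rw [word_append_singleton, h5, mul_simplePerm_cancel]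
        · simp; omega
      have h8 := ell_descent ha
      have h9 := ell_descent hb
      have e2 : (l'.map t).prod = ((l0 ++ [a]).map t).prod := by
        refine ih (u * simplePerm b) _ _ h3 h4 ?_ ?_ hlen'
        · rw [word_append_singleton, h5, mul_assoc u, simplePerm_comm hab, ← mul_assoc u,
            mul_simplePerm_cancel]
        · simp; omega
      rw [e1, e2]
      simp only [List.map_append, List.prod_append, List.map_singleton, List.prod_singleton,
        mul_assoc, comm a b hab]
    -- For adjacent descents, `u` has reduced words `l0 a b a` and `l0 b a b`, to which the braid
    -- relation applies.
    have near : ∀ (a b : Fin (n + 1)) (l l' : List (Fin (n + 1))), l.length ≤ N → l'.length ≤ N →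
        u a.succ < u a.castSucc → word l = u * simplePerm a →
        2 * (l.length : ℤ) = ell (ofPerm (u * simplePerm a)) →
        u b.succ < u b.castSucc → word l' = u * simplePerm b →
        2 * (l'.length : ℤ) = ell (ofPerm (u * simplePerm b)) →
        (a : ℕ) + 1 = b → (l.map t).prod * t a = (l'.map t).prod * t b := by
      intro a b l l' hlen hlen' ha h1 h2 hb h3 h4 hab
      have hba : b.castSucc = a.succ := by ext; simp [hab]
      obtain ⟨l0, h5, h6⟩ := exists_word (u * simplePerm a * simplePerm b * simplePerm a)
      have e1 : simplePerm a b.succ = b.succ := by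
        ext; simp only [simplePerm_apply, Fin.val_succ]; split_ifs <;> omega
      have e2 : simplePerm b a.castSucc = a.castSucc := by
        ext; simp only [simplePerm_apply, Fin.val_castSucc]; split_ifs <;> omega
      have e3 : simplePerm b a.succ = b.succ := by rw [← hba, simplePerm_castSucc]
      have e4 : simplePerm a b.castSucc = a.castSucc := by rw [hba, simplePerm_succ]
      have e5 : simplePerm b b.succ = a.succ := by rw [simplePerm_succ, hba]
      rw [hba] at hb
      have d1 := ell_descent ha
      have d2 : ell (ofPerm (u * simplePerm a * simplePerm b)) =
          ell (ofPerm (u * simplePerm a)) - 2 :=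
        ell_descent (by simpa [e1, e4] using hb.trans ha)
      have d3 : ell (ofPerm (u * simplePerm a * simplePerm b * simplePerm a)) =
          ell (ofPerm (u * simplePerm a * simplePerm b)) - 2 :=
        ell_descent (by simpa [e1, e2, e3] using hb)
      have d4 := ell_descent (u := u) (a := b) (by rwa [hba])
      have f1 : (l.map t).prod = ((l0 ++ [a] ++ [b]).map t).prod := by
        refine ih (u * simplePerm a) _ _ h1 h2 ?_ ?_ hlen
        · rw [word_append_singleton, word_append_singleton, h5, mul_simplePerm_cancel,
            mul_simplePerm_cancel]
        · simp; omega
      have f2 : (l'.map t).prod = ((l0 ++ [b] ++ [a]).map t).prod := by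
        refine ih (u * simplePerm b) _ _ h3 h4 ?_ ?_ hlen'
        · have : u * simplePerm a * simplePerm b * simplePerm a =
              u * simplePerm b * simplePerm a * simplePerm b := by
            rw [mul_assoc u, mul_assoc u, simplePerm_braid hab]; simp only [mul_assoc]
          rw [word_append_singleton, word_append_singleton, h5, this, mul_simplePerm_cancel,
            mul_simplePerm_cancel]
        · simp; omega
      rw [f1, f2]
      simp only [List.map_append, List.prod_append, List.map_singleton, List.prod_singleton]
      have := braid a b hab
      simp only [mul_assoc] at this ⊢
      rw [this]
    rcases lt_trichotomy (a : ℕ) b with hab | hab | hab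
    · rcases Nat.lt_or_ge ((a : ℕ) + 1) b with h | h
      · exact far a b l l' hlen hlen' ha h1 h2 hb h3 h4 h
      · exact near a b l l' hlen hlen' ha h1 h2 hb h3 h4 (by omega)
    · obtain rfl : a = b := Fin.ext hab
      rw [ih _ l l' h1 h2 h3 h4 hlen]
    · rcases Nat.lt_or_ge ((b : ℕ) + 1) a with h | h
      · exact (far b a l' l hlen' hlen hb h3 h4 ha h1 h2 h).symm
      · exact (near b a l' l hlen' hlen hb h3 h4 ha h1 h2 (by omega)).symm

end BqKZ
end
noncomputable section
namespace BqKZ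

/-! ### Relations between the operators `T_i`, `π` and `X^l` -/

variable {n : ℕ} (q : QParam) (k : ℂˣ)

theorem mulOp_apply (f g : RatFn n) : mulOp f g = f * g := rfl

theorem mulOp_mul (f g : RatFn n) : mulOp (f * g) = mulOp f * mulOp g := by
  ext h; simp [mulOp_apply, mul_assoc]

theorem mulOp_add (f g : RatFn n) : mulOp (f + g) = mulOp f + mulOp g := by
  ext h; simp [mulOp_apply, add_mul]

theorem mulOp_one : mulOp (1 : RatFn n) = 1 := by
  ext h; simp [mulOp_apply]

theorem mulOp_algebraMap (c : ℂ) : mulOp (algebraMap ℂ (RatFn n) c) = algebraMap ℂ (Op n) c := by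
  ext h; simp [mulOp_apply, Algebra.smul_def]

theorem mulOp_smul (c : ℂ) (f : RatFn n) : mulOp (c • f) = c • mulOp f := by
  ext h; simp [mulOp_apply]

/-- The image of `x^l` in `ℂ(T)`. -/
def ratMono (l : Lat n) : RatFn n := algebraMap (Reg n) (RatFn n) (mono l)

theorem opX_eq (l : Lat n) : opX l = mulOp (ratMono l) := rfl

theorem mono_add (l m : Lat n) : mono (l + m) = (mono l * mono m : Reg n) := by
  simp [mono, AddMonoidAlgebra.single_mul_single]

theorem mono_zero : mono (0 : Lat n) = (1 : Reg n) := rfl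

theorem ratMono_add (l m : Lat n) : ratMono (l + m) = ratMono l * ratMono m := by
  simp [ratMono, mono_add]

theorem ratMono_zero : ratMono (0 : Lat n) = 1 := by simp [ratMono, mono_zero]

theorem ratMono_ne_zero (l : Lat n) : ratMono l ≠ 0 := by
  intro h
  have := ratMono_add l (-l)
  rw [add_neg_cancel, ratMono_zero, h, zero_mul] at this
  exact one_ne_zero this

theorem ratMono_neg (l : Lat n) : ratMono (-l) = (ratMono l)⁻¹ := by
  refine eq_inv_of_mul_eq_one_left ?_
  rw [← ratMono_add, neg_add_cancel, ratMono_zero]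

theorem opX_add (l m : Lat n) : opX (l + m) = opX l * opX m := by
  rw [opX_eq, ratMono_add, mulOp_mul]; rfl

theorem opX_zero : opX (0 : Lat n) = 1 := by rw [opX_eq, ratMono_zero, mulOp_one]

theorem weylFieldEquiv_mul (w w' : Weyl n) (f : RatFn n) :
    weylFieldEquiv q (w * w') f = weylFieldEquiv q w (weylFieldEquiv q w' f) :=
  LinearMap.congr_fun (weylOp_mul q w w') f

theorem weylFieldEquiv_one (f : RatFn n) : weylFieldEquiv q (1 : Weyl n) f = f :=
  LinearMap.congr_fun (weylOp_one q) f

theorem weylOp_mulOp (w : Weyl n) (f : RatFn n) :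
    weylOp q w * mulOp f = mulOp (weylFieldEquiv q w f) * weylOp q w := by
  ext g
  exact map_mul (weylFieldEquiv q w) f g

theorem weylFieldEquiv_ratMono (w : Weyl n) (l : Lat n) :
    weylFieldEquiv q w (ratMono l) =
      ((q.unit ^ (-∑ i, lat w i * l (w.right⁻¹ i)) : ℂˣ) : ℂ) •
        ratMono (fun i => l (w.right⁻¹ i)) := by
  rw [ratMono, weylFieldEquiv_algebraMap, weylAct_mono]
  rw [Algebra.smul_def, map_mul, ← IsScalarTower.algebraMap_apply, ← Algebra.smul_def]
  rfl

theorem weylFieldEquiv_perm_ratMono (u : Perm n) (l : Lat n) :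
    weylFieldEquiv q (ofPerm u) (ratMono l) = ratMono (fun i => l (u⁻¹ i)) := by
  rw [weylFieldEquiv_ratMono]; simp

theorem weylFieldEquiv_piW_ratMono (l : Lat n) :
    weylFieldEquiv q (piW n) (ratMono l) =
      ((q.unit ^ (-l (Fin.last (n + 1))) : ℂˣ) : ℂ) • ratMono (fun i => l ((rot n)⁻¹ i)) := by
  rw [weylFieldEquiv_ratMono]
  have : ∑ i, lat (piW n) i * l ((piW n).right⁻¹ i) = l (Fin.last (n + 1)) := by
    rw [← Equiv.sum_comp (rot n)]
    simp [eps, Pi.single_apply]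
  rw [this]; rfl

theorem ratioX_eq (a : Fin (n + 1)) : ratioX a = ratMono (simpleRoot a) := rfl

theorem opT_mul_mulOp (a : Fin (n + 1)) (f : RatFn n) :
    opT q k a * mulOp f = mulOp (weylFieldEquiv q (ofPerm (simplePerm a)) f) * opT q k a +
      mulOp ((algebraMap ℂ _ (k : ℂ) - ckX k a) *
        (f - weylFieldEquiv q (ofPerm (simplePerm a)) f)) := by
  ext g
  simp only [Module.End.mul_apply, LinearMap.add_apply, mulOp_apply, opT_apply, map_mul]
  ring

theorem k_sub_ckX (a : Fin (n + 1)) :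
    algebraMap ℂ (RatFn n) (k : ℂ) - ckX k a =
      algebraMap ℂ (RatFn n) ((k : ℂ) - (k : ℂ)⁻¹) / (1 - ratioX a) := by
  have h1 : (1 : RatFn n) - ratioX a ≠ 0 := sub_ne_zero.mpr (ratioX_ne_one a).symm
  rw [ckX, eq_div_iff h1, sub_mul, div_mul_cancel₀ _ h1, map_sub]
  ring

/-- The rule `T_a X^l = X^{s_a l} T_a + c X^m`, given the divided difference of `x^l`. -/
theorem opT_opX_aux (a : Fin (n + 1)) {l l' m : Lat n} (c : ℂ)
    (hl : (fun i => l (simplePerm a i)) = l')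
    (h : ratMono l - ratMono l' = algebraMap ℂ (RatFn n) c * (1 - ratioX a) * ratMono m) :
    opT q k a * opX l = opX l' * opT q k a + (c * ((k : ℂ) - (k : ℂ)⁻¹)) • opX m := by
  have h1 : (1 : RatFn n) - ratioX a ≠ 0 := sub_ne_zero.mpr (ratioX_ne_one a).symm
  rw [opX_eq, opT_mul_mulOp, weylFieldEquiv_perm_ratMono, simplePerm_inv, hl, h, k_sub_ckX]
  rw [opX_eq, opX_eq, ← mulOp_smul]
  congr 2
  rw [Algebra.smul_def, map_mul]
  field_simp

theorem one_sub_ratioX_mul (a : Fin (n + 1)) (m : Lat n) :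
    (1 - ratioX a) * ratMono m = ratMono m - ratMono (simpleRoot a + m) := by
  rw [ratMono_add, ratioX_eq]; ring

theorem comp_simplePerm_eps (a : Fin (n + 1)) (j : Fin (n + 2)) :
    (fun i => (eps j : Lat n) (simplePerm a i)) = eps (simplePerm a j) := by
  funext i
  simp only [eps, Pi.single_apply]
  congr 1
  rw [eq_iff_iff]
  exact ⟨fun h => by rw [← h]; simp, fun h => by rw [h]; simp⟩

theorem opT_opX_castSucc (a : Fin (n + 1)) :
    opT q k a * opX (eps a.castSucc) = opX (eps a.succ) * opT q k a +
      ((-1) * ((k : ℂ) - (k : ℂ)⁻¹)) • opX (eps a.succ) :=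
  opT_opX_aux q k a (-1) (by rw [comp_simplePerm_eps, simplePerm_castSucc]) (by
    rw [mul_assoc, one_sub_ratioX_mul, simpleRoot, sub_add_cancel]; simp)

theorem opT_opX_succ (a : Fin (n + 1)) :
    opT q k a * opX (eps a.succ) = opX (eps a.castSucc) * opT q k a +
      (1 * ((k : ℂ) - (k : ℂ)⁻¹)) • opX (eps a.succ) :=
  opT_opX_aux q k a 1 (by rw [comp_simplePerm_eps, simplePerm_succ]) (by
    rw [mul_assoc, one_sub_ratioX_mul, simpleRoot, sub_add_cancel]; simp)

theorem neg_comp_simplePerm_eps (a : Fin (n + 1)) (j : Fin (n + 2)) :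
    (fun i => (-eps j : Lat n) (simplePerm a i)) = -eps (simplePerm a j) := by
  rw [← comp_simplePerm_eps]; rfl

theorem opT_opX_neg_succ (a : Fin (n + 1)) :
    opT q k a * opX (-eps a.succ) = opX (-eps a.castSucc) * opT q k a +
      ((-1) * ((k : ℂ) - (k : ℂ)⁻¹)) • opX (-eps a.castSucc) :=
  opT_opX_aux q k a (-1) (by rw [neg_comp_simplePerm_eps, simplePerm_succ]) (by
    rw [mul_assoc, one_sub_ratioX_mul, simpleRoot,
      show eps a.castSucc - eps a.succ + -eps a.castSucc = (-eps a.succ : Lat n) by abel]; simp)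

theorem opT_opX_neg_castSucc (a : Fin (n + 1)) :
    opT q k a * opX (-eps a.castSucc) = opX (-eps a.succ) * opT q k a +
      (1 * ((k : ℂ) - (k : ℂ)⁻¹)) • opX (-eps a.castSucc) :=
  opT_opX_aux q k a 1 (by rw [neg_comp_simplePerm_eps, simplePerm_castSucc]) (by
    rw [mul_assoc, one_sub_ratioX_mul, simpleRoot,
      show eps a.castSucc - eps a.succ + -eps a.castSucc = (-eps a.succ : Lat n) by abel]; simp)

theorem opT_opX_comm (a : Fin (n + 1)) {l : Lat n} (h : l a.castSucc = l a.succ) :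
    opT q k a * opX l = opX l * opT q k a := by
  have := opT_opX_aux q k a (l := l) (l' := l) (m := l) 0 (by
    funext i
    by_cases h1 : i = a.castSucc
    · rw [h1, simplePerm_castSucc, h]
    · by_cases h2 : i = a.succ
      · rw [h2, simplePerm_succ, h]
      · rw [simplePerm, Equiv.swap_apply_of_ne_of_ne h1 h2]) (by simp)
  simpa using this

theorem weylOp_piW_opX (l : Lat n) : weylOp q (piW n) * opX l =
    ((q.unit ^ (-l (Fin.last (n + 1))) : ℂˣ) : ℂ) •
      (opX (fun i => l ((rot n)⁻¹ i)) * weylOp q (piW n)) := by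
  rw [opX_eq, weylOp_mulOp, weylFieldEquiv_piW_ratMono, mulOp_smul, smul_mul_assoc]; rfl

/-! Braid relations. -/

theorem weylFieldEquiv_ckX (w : Weyl n) (a b : Fin (n + 1))
    (h : weylFieldEquiv q w (ratioX a) = ratioX b) : weylFieldEquiv q w (ckX k a) = ckX k b := by
  simp only [ckX, map_div₀, map_sub, map_mul, AlgEquiv.commutes, map_one, h]

/-- The operator `T_a` is built from `x_a / x_{a+1}` and `s_a` alone, so an element of `W` that
transports both of them transports `T_a`. All relations between `π` and the `T_a` come from this. -/
theorem weylOp_opT (w : Weyl n) (a b : Fin (n + 1))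
    (h : weylFieldEquiv q w (ratioX a) = ratioX b)
    (h' : w * ofPerm (simplePerm a) = ofPerm (simplePerm b) * w) :
    weylOp q w * opT q k a = opT q k b * weylOp q w := by
  rw [opT, opT, mul_add, add_mul, ← mul_assoc, weylOp_mulOp, weylFieldEquiv_ckX q k w a b h,
    mul_assoc, mul_assoc, mul_sub, sub_mul, ← weylOp_mul, ← weylOp_mul, h', mul_one, one_mul,
    Algebra.commutes]

theorem simpleRoot_apply (a : Fin (n + 1)) (i : Fin (n + 2)) :
    simpleRoot a i = ind (i = a.castSucc) - ind (i = a.succ) := by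
  simp [simpleRoot, eps_eq_ind]

theorem ind_congr {p p' : Prop} (h : p ↔ p') : ind p = ind p' := by rw [propext h]

theorem opT_comm {a b : Fin (n + 1)} (h : (a : ℕ) + 2 ≤ b) :
    opT q k a * opT q k b = opT q k b * opT q k a := by
  have e : weylFieldEquiv q (ofPerm (simplePerm a)) (ratioX b) = ratioX b := by
    rw [ratioX_eq, weylFieldEquiv_perm_ratMono]
    congr 1; funext i
    simp only [simpleRoot_apply]
    congr 1 <;> apply ind_congr <;>
      simp only [Fin.ext_iff, simplePerm_inv, simplePerm_apply, Fin.val_castSucc, Fin.val_succ] <;>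
      split_ifs <;> omega
  have e' := weylOp_opT q k _ b b e (by rw [← ofPerm_mul, simplePerm_comm h, ofPerm_mul])
  have e2 : opT q k b * mulOp (ckX k a) = mulOp (ckX k a) * opT q k b := by
    have e : weylFieldEquiv q (ofPerm (simplePerm b)) (ratioX a) = ratioX a := by
      rw [ratioX_eq, weylFieldEquiv_perm_ratMono]
      congr 1; funext i
      simp only [simpleRoot_apply]
      congr 1 <;> apply ind_congr <;>
        simp only [Fin.ext_iff, simplePerm_inv, simplePerm_apply, Fin.val_castSucc,
          Fin.val_succ] <;> split_ifs <;> omega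
    rw [opT_mul_mulOp, weylFieldEquiv_ckX q k _ a a e, sub_self, mul_zero]
    ext; simp [mulOp_apply]
  rw [opT.eq_def q k a, mul_add, add_mul, mul_assoc, sub_mul, e', one_mul, ← mul_assoc _ (mulOp _),
    e2, mul_assoc, mul_sub (opT q k b), mul_one, Algebra.commutes, mul_sub]

theorem weyl_ratioX_adj {a b : Fin (n + 1)} (h : (a : ℕ) + 1 = b) :
    weylFieldEquiv q (ofPerm (simplePerm a)) (ratioX b) = ratioX a * ratioX b ∧
    weylFieldEquiv q (ofPerm (simplePerm b)) (ratioX a) = ratioX a * ratioX b := by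
  simp only [ratioX_eq, weylFieldEquiv_perm_ratMono, ← ratMono_add]
  constructor <;> congr 1 <;> funext i <;>
    simp only [simpleRoot_apply, Pi.add_apply, ind, Fin.ext_iff, simplePerm_inv, simplePerm_apply,
      Fin.val_castSucc, Fin.val_succ] <;> split_ifs <;> omega

/-- This is the braid relation for `T_a`, `T_b` evaluated on a function `f₀`, with its images `f₁ =
s_a f₀`, `f₂ = s_b f₀`, `f₁₂ = s_a s_b f₀`, `f₂₁ = s_b s_a f₀` and `f₃ = s_a s_b s_a f₀` treated as
independent unknowns. Here `x`, `y` and `x y` are the ratios of the three positive roots involved,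
and `A' z` is `A z⁻¹`. -/
theorem braid_identity {F : Type*} [Field F] (K K' x y f₀ f₁ f₂ f₁₂ f₂₁ f₃ : F) (hx : x ≠ 0)
    (hy : y ≠ 0) (h1 : 1 - x ≠ 0) (h2 : 1 - y ≠ 0) (h3 : 1 - x * y ≠ 0) :
    let A := fun z : F => (K' - K * z) / (1 - z)
    let A' := fun z : F => (K' * z - K) / (z - 1)
    K * (K * (K * f₀ + A x * (f₁ - f₀)) + A y * (K * f₂ + A (x * y) * (f₂₁ - f₂) -
        (K * f₀ + A x * (f₁ - f₀)))) +
      A x * (K * (K * f₁ + A' x * (f₀ - f₁)) + A (x * y) *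
        (K * f₁₂ + A y * (f₃ - f₁₂) - (K * f₁ + A' x * (f₀ - f₁))) -
        (K * (K * f₀ + A x * (f₁ - f₀)) + A y * (K * f₂ + A (x * y) * (f₂₁ - f₂) -
          (K * f₀ + A x * (f₁ - f₀))))) =
    K * (K * (K * f₀ + A y * (f₂ - f₀)) + A x * (K * f₁ + A (x * y) * (f₁₂ - f₁) -
        (K * f₀ + A y * (f₂ - f₀)))) +
      A y * (K * (K * f₂ + A' y * (f₀ - f₂)) + A (x * y) *
        (K * f₂₁ + A x * (f₃ - f₂₁) - (K * f₂ + A' y * (f₀ - f₂))) -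
        (K * (K * f₀ + A y * (f₂ - f₀)) + A x * (K * f₁ + A (x * y) * (f₁₂ - f₁) -
          (K * f₀ + A y * (f₂ - f₀))))) := by
  have h1' : x - 1 ≠ 0 := fun h => h1 (by linear_combination -h)
  have h2' : y - 1 ≠ 0 := fun h => h2 (by linear_combination -h)
  have ex : x - 1 = -(1 - x) := by ring
  have ey : y - 1 = -(1 - y) := by ring
  simp only [ex, ey]
  -- With the denominators as variables, clearing fractions is immediate. Afterwards `x = 1 - u`, `y
  -- = 1 - v` and `w = u + v - u v` leave a polynomial identity.
  generalize hu : 1 - x = u at *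
  generalize hv : 1 - y = v at *
  generalize hw : 1 - x * y = w at *
  field_simp
  obtain rfl : x = 1 - u := by linear_combination -hu
  obtain rfl : y = 1 - v := by linear_combination -hv
  obtain rfl : w = u + v - u * v := by linear_combination -hw
  ring

theorem opT_braid {a b : Fin (n + 1)} (h : (a : ℕ) + 1 = b) :
    opT q k a * opT q k b * opT q k a = opT q k b * opT q k a * opT q k b := by
  obtain ⟨e1, e2⟩ := weyl_ratioX_adj q h
  have hx := eq_inv_of_mul_eq_one_left (weyl_ratioX q a)
  have hy := eq_inv_of_mul_eq_one_left (weyl_ratioX q b)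
  have hx0 : ratioX a ≠ (0 : RatFn n) := ratMono_ne_zero _
  have hy0 : ratioX b ≠ (0 : RatFn n) := ratMono_ne_zero _
  have h1 : (1 : RatFn n) - ratioX a ≠ 0 := sub_ne_zero.mpr (ratioX_ne_one a).symm
  have h2 : (1 : RatFn n) - ratioX b ≠ 0 := sub_ne_zero.mpr (ratioX_ne_one b).symm
  have h3 : (1 : RatFn n) - ratioX a * ratioX b ≠ 0 := by
    rw [← e1, ← map_one (weylFieldEquiv q (ofPerm (simplePerm a))), ← map_sub]
    exact (map_ne_zero_iff _ (weylFieldEquiv q (ofPerm (simplePerm a))).injective).mpr h2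
  have inv : ∀ z K K' : RatFn n, z ≠ 0 → 1 - z ≠ 0 →
      (K' - K * z⁻¹) / (1 - z⁻¹) = (K' * z - K) / (z - 1) := fun z K K' hz hz' => by
    have : z - 1 ≠ 0 := fun h => hz' (by linear_combination -h)
    have h' : 1 - z⁻¹ ≠ 0 := fun h => this (by
      have : z * (1 - z⁻¹) = 0 := by rw [h, mul_zero]
      rwa [mul_sub, mul_inv_cancel₀ hz, mul_one] at this)
    rw [div_eq_div_iff h' this]
    field_simp
  have ss : ∀ (c : Fin (n + 1)) (f : RatFn n), weylFieldEquiv q (ofPerm (simplePerm c))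
      (weylFieldEquiv q (ofPerm (simplePerm c)) f) = f := fun c f => by
    rw [← weylFieldEquiv_mul, ← ofPerm_mul, simplePerm_mul_self, ofPerm_one, weylFieldEquiv_one]
  refine LinearMap.ext fun f => ?_
  have sss : weylFieldEquiv q (ofPerm (simplePerm b)) (weylFieldEquiv q (ofPerm (simplePerm a))
      (weylFieldEquiv q (ofPerm (simplePerm b)) f)) = weylFieldEquiv q (ofPerm (simplePerm a))
      (weylFieldEquiv q (ofPerm (simplePerm b)) (weylFieldEquiv q (ofPerm (simplePerm a)) f)) := by
    simp only [← weylFieldEquiv_mul, ← ofPerm_mul, ← mul_assoc, simplePerm_braid h]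
  have key := braid_identity (algebraMap ℂ (RatFn n) (k : ℂ)) (algebraMap ℂ (RatFn n) ((k : ℂ)⁻¹))
    (ratioX a) (ratioX b) f (weylFieldEquiv q (ofPerm (simplePerm a)) f)
    (weylFieldEquiv q (ofPerm (simplePerm b)) f)
    (weylFieldEquiv q (ofPerm (simplePerm a)) (weylFieldEquiv q (ofPerm (simplePerm b)) f))
    (weylFieldEquiv q (ofPerm (simplePerm b)) (weylFieldEquiv q (ofPerm (simplePerm a)) f))
    (weylFieldEquiv q (ofPerm (simplePerm a)) (weylFieldEquiv q (ofPerm (simplePerm b))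
      (weylFieldEquiv q (ofPerm (simplePerm a)) f))) hx0 hy0 h1 h2 h3
  simp only [Module.End.mul_apply, opT_apply, map_add, map_mul, map_sub, AlgEquiv.commutes, ckX,
    map_div₀, map_one, e1, e2, hx, hy, ss, sss, inv _ _ _ hx0 h1, inv _ _ _ hy0 h2]
  have c1 : (ratioX a)⁻¹ * (ratioX a * ratioX b) = (ratioX b : RatFn n) := by field_simp
  have c2 : ratioX a * ratioX b * (ratioX b)⁻¹ = (ratioX a : RatFn n) := by field_simp
  simp only [c1, c2]
  linear_combination key

theorem piW_simplePerm (a : Fin n) :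
    piW n * ofPerm (simplePerm a.castSucc) = ofPerm (simplePerm a.succ) * piW n := by
  have h : rot n * simplePerm a.castSucc = simplePerm a.succ * rot n := by
    ext i
    simp only [Equiv.Perm.mul_apply, simplePerm_apply, val_rot, Fin.ext_iff, Fin.val_castSucc,
      Fin.val_succ, Fin.val_last]
    split_ifs <;> omega
  refine weyl_ext h fun i => ?_
  have h' : (rot n)⁻¹ * simplePerm a.succ = simplePerm a.castSucc * (rot n)⁻¹ := by
    rw [inv_mul_eq_iff_eq_mul, ← mul_assoc, h, mul_assoc, mul_inv_cancel, mul_one]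
  have h2 : (rot n)⁻¹ (simplePerm a.succ i) = simplePerm a.castSucc ((rot n)⁻¹ i) :=
    DFunLike.congr_fun h' i
  simp only [lat_mul, lat_piW, lat_ofPerm, right_ofPerm, simplePerm_inv, h2, eps_eq_ind, add_zero,
    zero_add]
  apply ind_congr
  simp only [Fin.ext_iff, simplePerm_apply, Fin.val_castSucc, Fin.val_last]
  split_ifs <;> omega

theorem weylOp_piW_opT (a : Fin n) :
    weylOp q (piW n) * opT q k a.castSucc = opT q k a.succ * weylOp q (piW n) := by
  refine weylOp_opT q k _ _ _ ?_ (piW_simplePerm a)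
  rw [ratioX_eq, weylFieldEquiv_piW_ratMono, ratioX_eq]
  have h0 : simpleRoot a.castSucc (Fin.last (n + 1)) = 0 := by
    simp only [simpleRoot_apply, ind, Fin.ext_iff, Fin.val_castSucc, Fin.val_succ, Fin.val_last]
    split_ifs <;> omega
  rw [h0]
  simp only [neg_zero, zpow_zero, Units.val_one, one_smul]
  congr 1; funext i
  obtain ⟨j, rfl⟩ := (rot n).surjective i
  simp only [perm_inv_apply, simpleRoot_apply, ind, Fin.ext_iff, val_rot, Fin.val_castSucc,
    Fin.val_succ, Fin.val_last]
  split_ifs <;> omega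

theorem rot_sq_simplePerm : rot n * rot n * simplePerm (Fin.last n) =
    simplePerm 0 * (rot n * rot n) := by
  ext i
  simp only [Equiv.Perm.mul_apply, simplePerm_apply, val_rot, Fin.ext_iff,
    Fin.val_last, Fin.val_zero]
  grind

theorem piW_sq_simplePerm : piW n * piW n * ofPerm (simplePerm (Fin.last n)) =
    ofPerm (simplePerm 0) * (piW n * piW n) := by
  refine weyl_ext rot_sq_simplePerm fun i => ?_
  obtain ⟨j, rfl⟩ := (simplePerm (n := n) 0).surjective i
  obtain ⟨j, rfl⟩ := (rot n).surjective j
  obtain ⟨j, rfl⟩ := (rot n).surjective j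
  have h2 : simplePerm 0 (rot n (rot n j)) = rot n (rot n (simplePerm (Fin.last n) j)) :=
    (DFunLike.congr_fun rot_sq_simplePerm j).symm
  simp only [lat_mul, lat_piW, lat_ofPerm, right_ofPerm, right_piW, simplePerm_inv, h2,
    eps_eq_ind, add_zero, zero_add, perm_inv_apply]
  rw [← h2]
  simp only [simplePerm_simplePerm, perm_inv_apply]
  simp only [ind, Fin.ext_iff, simplePerm_apply, Fin.val_last, val_rot]
  grind

/-- Under `π²` both of the last two variables pass through the last position, one with exponent `1`
and the other with `-1`. The two powers of `q` therefore cancel. -/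
theorem weylOp_piW_sq_opT :
    weylOp q (piW n) * weylOp q (piW n) * opT q k (Fin.last n) =
      opT q k 0 * (weylOp q (piW n) * weylOp q (piW n)) := by
  rw [← weylOp_mul]
  refine weylOp_opT q k _ _ _ ?_ piW_sq_simplePerm
  rw [ratioX_eq, weylFieldEquiv_mul, weylFieldEquiv_piW_ratMono, map_smul,
    weylFieldEquiv_piW_ratMono, ratioX_eq, smul_smul, ← Units.val_mul, ← zpow_add]
  have e0 : ((rot n)⁻¹ (Fin.last (n + 1)) : Fin (n + 2)) = (Fin.last n).castSucc := by
    rw [Equiv.Perm.inv_eq_iff_eq]; ext; simp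
  have e1 : simpleRoot (Fin.last n) (Fin.last (n + 1)) = -1 := by
    simp [simpleRoot_apply, ind, Fin.ext_iff]
  have e2 : simpleRoot (Fin.last n) (Fin.last n).castSucc = 1 := by
    simp [simpleRoot_apply, ind, Fin.ext_iff]
  rw [e0, e1, e2]
  simp only [neg_neg, add_neg_cancel, zpow_zero, Units.val_one, one_smul]
  congr 1; funext i
  obtain ⟨j, rfl⟩ := (rot n).surjective i
  obtain ⟨j, rfl⟩ := (rot n).surjective j
  simp only [perm_inv_apply, simpleRoot_apply, ind, Fin.ext_iff, val_rot, Fin.val_castSucc,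
    Fin.val_succ, Fin.val_last, Fin.val_zero]
  grind

end BqKZ
end
noncomputable section
namespace BqKZ

/-! ### The basis `T_w` of the finite Hecke algebra -/

section
variable {n : ℕ} (q : QParam) (k : ℂˣ)

/-- Matsumoto's theorem frees `T_u` from the particular reduced expression chosen in its definition.
-/
theorem opTw_eq {u : Perm n} {l : List (Fin (n + 1))} (h : word l = u)
    (h' : 2 * (l.length : ℤ) = ell (ofPerm u)) : opTw q k u = (l.map (opT q k)).prod := by
  obtain ⟨h1, h2⟩ := reducedPermExpr_spec u
  exact matsumoto (opT q k) (fun _ _ h => opT_comm q k h) (fun _ _ h => opT_braid q k h) u _ _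
    h1 h2 h h'

theorem opTw_one : opTw q k (1 : Perm n) = 1 :=
  opTw_eq q k (l := []) rfl (by simp [ell_one])

theorem opTw_mul_of_ascent {u : Perm n} {a : Fin (n + 1)} (h : u a.castSucc < u a.succ) :
    opTw q k u * opT q k a = opTw q k (u * simplePerm a) := by
  obtain ⟨l, h1, h2⟩ := exists_word u
  rw [opTw_eq q k h1 h2, opTw_eq q k (l := l ++ [a]) (by simp [h1])
    (by rw [ell_ascent h, ← h2]; simp; ring)]
  simp

theorem ell_inv {n : ℕ} (u : Perm n) : ell (ofPerm u⁻¹) = ell (ofPerm u) := by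
  simp only [ell, gap, lat_ofPerm, right_ofPerm]
  rw [← Equiv.sum_comp u]
  refine Finset.sum_congr rfl fun i _ => ?_
  rw [← Equiv.sum_comp u]
  refine Finset.sum_congr rfl fun j _ => ?_
  rw [perm_inv_apply, perm_inv_apply, ← abs_neg]
  congr 1; ring

theorem opT_mul_of_ascent {u : Perm n} {a : Fin (n + 1)} (h : u⁻¹ a.castSucc < u⁻¹ a.succ) :
    opT q k a * opTw q k u = opTw q k (simplePerm a * u) := by
  obtain ⟨l, h1, h2⟩ := exists_word u
  have e : ell (ofPerm (simplePerm a * u)) = ell (ofPerm u) + 2 := by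
    rw [← ell_inv, mul_inv_rev, simplePerm_inv, ell_ascent h, ell_inv]
  rw [opTw_eq q k h1 h2, opTw_eq q k (l := a :: l) (by simp [← h1, word])
    (by rw [e, ← h2]; simp; ring)]
  simp

/-- The scalar `k - k⁻¹`. -/
def kk (k : ℂˣ) : ℂ := (k : ℂ) - (k : ℂ)⁻¹

theorem opT_sq (a : Fin (n + 1)) : opT q k a * opT q k a = kk k • opT q k a + 1 := by
  rw [opT_quadratic, Algebra.smul_def]; rfl

theorem unitT_val (a : Fin (n + 1)) : (unitT q k a : Op n) = opT q k a := rfl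

theorem unitT_inv (a : Fin (n + 1)) :
    ((unitT q k a)⁻¹ : (Op n)ˣ) = opT q k a - kk k • (1 : Op n) := by
  rw [← Algebra.algebraMap_eq_smul_one]; rfl

theorem opTw_mul_of_descent {u : Perm n} {a : Fin (n + 1)} (h : u a.succ < u a.castSucc) :
    opTw q k u * opT q k a = opTw q k (u * simplePerm a) + kk k • opTw q k u := by
  have h1 := opTw_mul_of_ascent q k (u := u * simplePerm a) (a := a) (by simpa using h)
  rw [mul_simplePerm_cancel] at h1
  rw [← h1, mul_assoc, opT_sq, mul_add, mul_one, mul_smul_comm, add_comm]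

theorem opT_mul_of_descent {u : Perm n} {a : Fin (n + 1)} (h : u⁻¹ a.succ < u⁻¹ a.castSucc) :
    opT q k a * opTw q k u = opTw q k (simplePerm a * u) + kk k • opTw q k u := by
  have h1 := opT_mul_of_ascent q k (u := simplePerm a * u) (a := a) (by simpa using h)
  rw [← mul_assoc, simplePerm_mul_self, one_mul] at h1
  rw [← h1, ← mul_assoc, opT_sq, add_mul, one_mul, smul_mul_assoc, add_comm]

theorem opTw_mul_inv_of_descent {u : Perm n} {a : Fin (n + 1)} (h : u a.succ < u a.castSucc) :
    opTw q k u * ((unitT q k a)⁻¹ : (Op n)ˣ) = opTw q k (u * simplePerm a) := by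
  rw [unitT_inv, mul_sub, opTw_mul_of_descent q k h, mul_smul_comm, mul_one, add_sub_cancel_right]

theorem inv_mul_opTw_of_descent {u : Perm n} {a : Fin (n + 1)} (h : u⁻¹ a.succ < u⁻¹ a.castSucc) :
    ((unitT q k a)⁻¹ : (Op n)ˣ) * opTw q k u = opTw q k (simplePerm a * u) := by
  rw [unitT_inv, sub_mul, opT_mul_of_descent q k h, smul_mul_assoc, one_mul, add_sub_cancel_right]

/-- The hypothesis says that `u` undoes no inversion created by `v`, so the lengths of `u` and `v`
add. In the induction on `v`, each new letter is an ascent of `u v` as well as of `v`. -/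
theorem opTw_mul_opTw (u v : Perm n)
    (h : ∀ i j, i < j → v⁻¹ j < v⁻¹ i → u i < u j) :
    opTw q k u * opTw q k v = opTw q k (u * v) := by
  induction v using perm_induction with
  | one => simp [opTw_one]
  | step v a hv ih =>
    -- The only pair whose order `s_a` changes is not inverted by `v`, so the inversions of `v`
    -- persist in `v s_a`.
    have ih' := ih fun i j hij hji => h i j hij (by
      rw [mul_inv_rev, simplePerm_inv, Equiv.Perm.mul_apply, Equiv.Perm.mul_apply]
      have h1 := simplePerm_apply a (v⁻¹ i)
      have h2 := simplePerm_apply a (v⁻¹ j)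
      have h3 : ¬ ((v⁻¹ j : Fin (n + 2)) = a.castSucc ∧ (v⁻¹ i : Fin (n + 2)) = a.succ) := by
        rintro ⟨h3, h4⟩
        rw [← h3, ← h4] at hv
        simp only [perm_apply_inv] at hv
        exact absurd hv (not_lt.mpr hij.le)
      simp only [Fin.ext_iff, Fin.val_castSucc, Fin.val_succ, Fin.lt_def] at h1 h2 h3 hji ⊢
      grind)
    rw [← opTw_mul_of_ascent q k hv, ← mul_assoc, ih', opTw_mul_of_ascent, mul_assoc]
    refine h _ _ hv ?_
    simp [Fin.lt_def]

end

/-! ### Braid group computations -/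

section
variable {G : Type*} [Group G] (t : ℕ → G)

/-- `t_{i-1} ⋯ t_0`. -/
def descProd : ℕ → G
  | 0 => 1
  | i + 1 => t i * descProd i

/-- `t_0 ⋯ t_{i-1}`. -/
def ascProd : ℕ → G
  | 0 => 1
  | i + 1 => ascProd i * t i

/-- The elements `y_{i+1} = t_i⁻¹ y_i t_i⁻¹`. -/
def braidY (y₀ : G) : ℕ → G
  | 0 => y₀
  | i + 1 => (t i)⁻¹ * braidY y₀ i * (t i)⁻¹

variable {t} {m : ℕ}
  (hb : ∀ a, a + 1 < m → t a * t (a + 1) * t a = t (a + 1) * t a * t (a + 1))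
  (hc : ∀ a b, a + 2 ≤ b → b < m → Commute (t a) (t b))

include hc in
theorem descProd_comm {a b : ℕ} (h : a < b) (hbm : b < m) : Commute (descProd t a) (t b) := by
  induction a with
  | zero => exact Commute.one_left _
  | succ a ih => exact (hc a b (by omega) hbm).mul_left (ih (by omega))

include hb hc in
-- For `b = a + 2` this is the braid relation, and all further factors commute with `t a`.
theorem descProd_shift {a b : ℕ} (h : a + 2 ≤ b) (hbm : b ≤ m) :
    descProd t b * t (a + 1) = t a * descProd t b := by
  induction b, h using Nat.le_induction with
  | base =>
    have h1 := (descProd_comm hc (a := a) (b := a + 1) (by omega) (by omega)).eq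
    simp only [descProd]
    rw [mul_assoc, mul_assoc, h1, ← mul_assoc, ← mul_assoc, ← hb a (by omega)]
    simp only [mul_assoc]
  | succ b h ih =>
    simp only [descProd]
    rw [mul_assoc, ih (by omega), ← mul_assoc, ← mul_assoc, (hc a b h (by omega)).eq]

variable {p : G} (hp : ∀ a, a + 1 < m → p * t a = t (a + 1) * p)

include hb hc hp in
theorem braidY_zero_comm {a : ℕ} (h : a + 1 < m) :
    Commute (t (a + 1)) (p * descProd t m) := by
  change _ * _ = _ * _
  rw [mul_assoc, descProd_shift hb hc (by omega) le_rfl, ← mul_assoc, ← mul_assoc, hp a h]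

include hb hc hp in
-- For `i = 0` the shift of `t` across the descending product is compensated by `p`. Larger `i` are
-- reached through the recursion for `braidY`, where only `i = j + 2` requires the braid relation.
theorem braidY_comm {j i : ℕ} (hj : j < m) (hi : i ≤ m) (h1 : j ≠ i) (h2 : j + 1 ≠ i) :
    Commute (t j) (braidY t (p * descProd t m) i) := by
  induction i using Nat.strong_induction_on generalizing j with
  | _ i ih =>
    rcases i with _ | i
    · obtain ⟨j, rfl⟩ : ∃ a, j = a + 1 := ⟨j - 1, by omega⟩
      exact braidY_zero_comm hb hc hp hj
    -- In this case `y_{j+2} = t_{j+1}⁻¹ t_j⁻¹ y_j t_j⁻¹ t_{j+1}⁻¹`. The braid relation carries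
    -- `t_j` through the outer factors as `t_{j+1}`, which commutes with `y_j` by induction.
    · by_cases h3 : j + 1 = i
      · subst h3
        have h4 := ih j (by omega) (j := j + 1) (by omega) (by omega) (by omega) (by omega)
        have h5 := hb j (by omega)
        simp only [braidY]
        have e1 : t j * (t (j + 1))⁻¹ * (t j)⁻¹ = (t (j + 1))⁻¹ * (t j)⁻¹ * t (j + 1) := by
          rw [mul_inv_eq_iff_eq_mul, mul_inv_eq_iff_eq_mul]
          simp only [mul_assoc, eq_inv_mul_iff_mul_eq] at h5 ⊢
          rw [← h5]
        have e2 : (t j)⁻¹ * (t (j + 1))⁻¹ * t j = t (j + 1) * (t j)⁻¹ * (t (j + 1))⁻¹ := by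
          rw [← inv_inj]
          simp only [mul_inv_rev, inv_inv]
          rw [← mul_assoc, ← mul_assoc, eq_mul_inv_iff_mul_eq, mul_assoc, mul_assoc,
            inv_mul_eq_iff_eq_mul]
          simp only [mul_assoc] at h5 ⊢
          rw [h5]
        change t j * _ = _ * t j
        calc _ = (t j * (t (j + 1))⁻¹ * (t j)⁻¹) * braidY t (p * descProd t m) j *
              ((t j)⁻¹ * (t (j + 1))⁻¹) := by simp only [mul_assoc]
          _ = (t (j + 1))⁻¹ * (t j)⁻¹ * (t (j + 1) * braidY t (p * descProd t m) j) *
              ((t j)⁻¹ * (t (j + 1))⁻¹) := by rw [e1]; simp only [mul_assoc]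
          _ = (t (j + 1))⁻¹ * (t j)⁻¹ * braidY t (p * descProd t m) j *
              (t (j + 1) * (t j)⁻¹ * (t (j + 1))⁻¹) := by rw [h4.eq]; simp only [mul_assoc]
          _ = _ := by rw [← e2]; simp only [mul_assoc]
      · have h4 : Commute (t j) (t i) := by
          rcases lt_or_gt_of_ne (show j ≠ i by omega) with h | h
          · exact hc j i (by omega) (by omega)
          · exact (hc i j (by omega) hj).symm
        exact ((h4.inv_right.mul_right (ih i (by omega) hj (by omega) (by omega) (by omega))).mul_right
          h4.inv_right)

include hb hc in
-- Moving the factors of the shorter descending product across the longer one lowers each index by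
-- one (`descProd_shift`), and the inverse of `t 0` absorbs the factor that cannot be lowered.
theorem desc_mul_desc {M : ℕ} (hM : m = M + 1) :
    (t M)⁻¹ * (descProd t M * descProd t m) = descProd t M * (descProd t m * (t 0)⁻¹) := by
  have key : ∀ b, b ≤ M → descProd t m * (descProd t (b + 1) * (t 0)⁻¹) =
      descProd t b * descProd t m := fun b hbM => by
    induction b with
    | zero => simp [descProd]
    | succ b ih =>
      change descProd t m * (t (b + 1) * descProd t (b + 1) * (t 0)⁻¹) =
        t b * descProd t b * descProd t m
      rw [mul_assoc, ← mul_assoc, descProd_shift hb hc (by omega) le_rfl,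
        mul_assoc, ih (by omega), mul_assoc]
  have := key M le_rfl
  rw [← this, hM]
  simp only [descProd, mul_assoc, inv_mul_cancel_left]

variable (hp2 : ∀ M, m = M + 1 → p * p * t M = t 0 * (p * p))

include hb hc hp hp2 in
-- Write `D_b` for `descProd t b`. Substituting `D_m = p D_M p⁻¹ t_0` for the first factor gives
-- `y_0 y_1 = p² D_M D_m t_0⁻¹`. Then `desc_mul_desc` and `p² t_M = t_0 p²` bring the product into
-- the opposite order.
theorem braidY_zero_one_comm (hm : 0 < m) :
    Commute (braidY t (p * descProd t m) 0) (braidY t (p * descProd t m) 1) := by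
  obtain ⟨M, hM⟩ : ∃ M, m = M + 1 := ⟨m - 1, by omega⟩
  have hpd : ∀ b, b ≤ M → p * descProd t b * p⁻¹ * t 0 = descProd t (b + 1) := fun b hbM => by
    induction b with
    | zero => simp [descProd]
    | succ b ih =>
      rw [descProd, ← mul_assoc, hp b (by omega), descProd, ← ih (by omega)]
      simp only [mul_assoc]
  have h1 : descProd t m = p * descProd t M * p⁻¹ * t 0 := by rw [hM, hpd M le_rfl]
  have h2 := desc_mul_desc hb hc hM
  have h3 : (t 0)⁻¹ * (p * p) = p * p * (t M)⁻¹ := by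
    rw [inv_mul_eq_iff_eq_mul, ← mul_assoc, ← hp2 M hM, mul_inv_cancel_right]
  change _ * _ = _ * _
  simp only [braidY]
  calc p * descProd t m * ((t 0)⁻¹ * (p * descProd t m) * (t 0)⁻¹)
      = p * (p * descProd t M * p⁻¹ * t 0) * ((t 0)⁻¹ * (p * descProd t m) * (t 0)⁻¹) := by rw [← h1]
    _ = p * p * (descProd t M * (descProd t m * (t 0)⁻¹)) := by group
    _ = (p * p * (t M)⁻¹) * (descProd t M * descProd t m) := by rw [← h2]; group
    _ = (t 0)⁻¹ * (p * p) * (descProd t M * descProd t m) := by rw [h3]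
    _ = (t 0)⁻¹ * (p * (p * descProd t M * p⁻¹ * t 0) * (t 0)⁻¹ * (p * descProd t m)) := by group
    _ = _ := by rw [← h1]; group

include hb hc hp hp2 in
-- The element `y_0` commutes with `y_1` and with `t_j` for `j ≥ 1`, hence with every `y_j`. Passing
-- from `y_i` to `y_{i+1}` only involves `t_i`, which commutes with `y_j` for `j > i + 1`.
theorem braidY_comm_braidY {i j : ℕ} (hi : i ≤ m) (hj : j ≤ m) :
    Commute (braidY t (p * descProd t m) i) (braidY t (p * descProd t m) j) := by
  have h0 : ∀ j, j ≤ m → Commute (braidY t (p * descProd t m) 0)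
      (braidY t (p * descProd t m) j) := fun j => by
    induction j with
    | zero => exact fun _ => Commute.refl _
    | succ j ih =>
      intro hj
      rcases j with _ | j
      · exact braidY_zero_one_comm hb hc hp hp2 (by omega)
      · have h1 : Commute (braidY t (p * descProd t m) 0) (t (j + 1)) :=
          (braidY_comm hb hc hp (by omega) (by omega) (by omega) (by omega)).symm
        exact (h1.inv_right.mul_right (ih (by omega))).mul_right h1.inv_right
  have h1 : ∀ i j, i < j → j ≤ m → Commute (braidY t (p * descProd t m) i)
      (braidY t (p * descProd t m) j) := fun i => by
    induction i with
    | zero => exact fun j _ hj => h0 j hj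
    | succ i ih =>
      intro j hij hj
      have h2 : Commute (t i) (braidY t (p * descProd t m) j) :=
        braidY_comm hb hc hp (by omega) hj (by omega) (by omega)
      exact (h2.inv_left.mul_left (ih j (by omega) hj)).mul_left h2.inv_left
  rcases lt_trichotomy i j with h | rfl | h
  · exact h1 i j h hj
  · exact Commute.refl _
  · exact (h1 j i h hi).symm

theorem braidY_eq (y : G) (i : ℕ) :
    braidY t y i = (ascProd t i)⁻¹ * y * (descProd t i)⁻¹ := by
  induction i with
  | zero => simp [braidY, ascProd, descProd]
  | succ i ih => simp only [braidY, ascProd, descProd, ih, mul_inv_rev, mul_assoc]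

theorem braidY_last : braidY t (p * descProd t m) m = (ascProd t m)⁻¹ * p := by
  rw [braidY_eq]; group

variable {x : ℕ → G} {c : G} (hx : ∀ a, a < m → t a * x a * t a = x (a + 1))
  (hxt : ∀ a, a + 1 < m → Commute (t a) (x m))
  (hpx : ∀ a, a < m → p * x a = x (a + 1) * p)
  (hcc : ∀ g, Commute c g) (hpm : p * x m = c * x 0 * p)

include hx in
theorem x_eq {i : ℕ} (hi : i ≤ m) : x i = descProd t i * x 0 * ascProd t i := by
  induction i with
  | zero => simp [descProd, ascProd]
  | succ i ih => rw [← hx i (by omega), ih (by omega)]; simp only [descProd, ascProd, mul_assoc]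

include hx in
theorem dualPi_eq : (x m)⁻¹ * descProd t m = (ascProd t m)⁻¹ * (x 0)⁻¹ := by
  rw [x_eq hx le_rfl]; group

include hx hcc hpm in
-- Since `y_m` is `p` up to the inverse of `t_0 ⋯ t_{m-1}`, the claim reduces to `p x_m⁻¹ = c⁻¹
-- x_0⁻¹ p`. The element `x_m⁻¹ t_{m-1} ⋯ t_0` is to become the image of `π` under the
-- anti-involution. This rule and the next one mirror the commutation rules of `π` with the `X_i`.
theorem dualPi_mul_braidY_zero :
    (x m)⁻¹ * descProd t m * braidY t (p * descProd t m) 0 =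
      c * (braidY t (p * descProd t m) m * ((x m)⁻¹ * descProd t m)) := by
  have h : p * (x m)⁻¹ = c⁻¹ * (x 0)⁻¹ * p := by
    rw [mul_inv_eq_iff_eq_mul, mul_assoc, hpm, ← mul_assoc, ← mul_assoc, mul_assoc c⁻¹,
      ← (hcc (x 0)⁻¹).eq]
    group
  rw [braidY_last, braidY, dualPi_eq hx, ← dualPi_eq hx]
  calc _ = (ascProd t m)⁻¹ * (x 0)⁻¹ * p * descProd t m := by rw [dualPi_eq hx]; group
    _ = c * c⁻¹ * (ascProd t m)⁻¹ * (x 0)⁻¹ * p * descProd t m := by group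
    _ = c * (ascProd t m)⁻¹ * (c⁻¹ * (x 0)⁻¹ * p) * descProd t m := by
      rw [mul_assoc c, ((hcc (ascProd t m)⁻¹).inv_left).eq]; group
    _ = _ := by rw [← h]; group

include hb hc hp hx hxt hpx in
-- The case `i = 0` combines `desc_mul_desc` with the ways in which `t` and `p` move the `x_a`.
-- Going from `i` to `i + 1` introduces `t_{i+1}⁻¹` on both sides of `y_{i+1}`, and the mirror image
-- of `π` turns `t_{i+1}` into `t_i`.
theorem dualPi_mul_braidY {i : ℕ} (hi : i < m) :
    (x m)⁻¹ * descProd t m * braidY t (p * descProd t m) (i + 1) =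
      braidY t (p * descProd t m) i * ((x m)⁻¹ * descProd t m) := by
  have ht : ∀ a, a + 1 < m → (x m)⁻¹ * descProd t m * t (a + 1) =
      t a * ((x m)⁻¹ * descProd t m) := fun a ha => by
    rw [mul_assoc, descProd_shift hb hc (by omega) le_rfl, ← mul_assoc, ← mul_assoc,
      ((hxt a ha).inv_right).eq]
  induction i with
  | zero =>
    obtain ⟨M, hM⟩ : ∃ M, m = M + 1 := ⟨m - 1, by omega⟩
    have h2 := desc_mul_desc hb hc hM
    have hpd : ∀ b, b ≤ M → p * descProd t b * p⁻¹ * t 0 = descProd t (b + 1) := fun b hbM => by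
      induction b with
      | zero => simp [descProd]
      | succ b ih =>
        rw [descProd, ← mul_assoc, hp b (by omega), descProd, ← ih (by omega)]
        simp only [mul_assoc]
    have h1 : descProd t m = p * descProd t M * p⁻¹ * t 0 := by rw [hM, hpd M le_rfl]
    have h3 : ∀ b, b ≤ M → Commute (descProd t b) (x m) := fun b hbM => by
      induction b with
      | zero => exact Commute.one_left _
      | succ b ih => exact (hxt b (by omega)).mul_left (ih (by omega))
    have h4 : t M * (x m)⁻¹ = (x M)⁻¹ * (t M)⁻¹ := by
      have := hx M (by omega)
      rw [← hM] at this
      rw [← this]; group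
    have h5 : p * (x M)⁻¹ = (x m)⁻¹ * p := by
      rw [mul_inv_eq_iff_eq_mul, mul_assoc, hpx M (by omega), ← hM]; group
    simp only [braidY]
    calc (x m)⁻¹ * descProd t m * ((t 0)⁻¹ * (p * descProd t m) * (t 0)⁻¹)
        = (x m)⁻¹ * (p * descProd t M * p⁻¹ * t 0) * ((t 0)⁻¹ * (p * descProd t m) * (t 0)⁻¹) := by
          rw [← h1]
      _ = (x m)⁻¹ * p * (descProd t M * (descProd t m * (t 0)⁻¹)) := by group
      _ = (p * (x M)⁻¹) * ((t M)⁻¹ * (descProd t M * descProd t m)) := by rw [← h2, h5]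
      _ = p * (t M * (x m)⁻¹) * descProd t M * descProd t m := by rw [h4]; group
      _ = p * t M * (descProd t M * (x m)⁻¹) * descProd t m := by
          rw [((h3 M le_rfl).inv_right).eq]; group
      _ = p * (t M * descProd t M) * ((x m)⁻¹ * descProd t m) := by group
      _ = _ := by rw [hM]; simp only [descProd]
  | succ i ih =>
    have h1 := ht i (by omega)
    have h2 : (x m)⁻¹ * descProd t m * (t (i + 1))⁻¹ = (t i)⁻¹ * ((x m)⁻¹ * descProd t m) := by
      rw [mul_inv_eq_iff_eq_mul, mul_assoc, h1]; group
    have h3 := ih (by omega)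
    rw [braidY]
    calc _ = ((x m)⁻¹ * descProd t m * (t (i + 1))⁻¹) * braidY t (p * descProd t m) (i + 1) *
          (t (i + 1))⁻¹ := by group
      _ = (t i)⁻¹ * ((x m)⁻¹ * descProd t m * braidY t (p * descProd t m) (i + 1)) *
          (t (i + 1))⁻¹ := by rw [h2]; group
      _ = (t i)⁻¹ * braidY t (p * descProd t m) i * ((x m)⁻¹ * descProd t m * (t (i + 1))⁻¹) := by
          rw [h3]; group
      _ = _ := by rw [h2, braidY]; group

end

end BqKZ
end
noncomputable section
namespace BqKZ

/-! ### The commuting elements `Y_i` -/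

section
variable {n : ℕ} (q : QParam) (k : ℂˣ)

/-- The units `T_{j+1}`, extended by `1`. -/
def tU (j : ℕ) : (Op n)ˣ := if h : j < n + 1 then unitT q k ⟨j, h⟩ else 1

/-- `X^l` as a unit. -/
def unitX (l : Lat n) : (Op n)ˣ where
  val := opX l
  inv := opX (-l)
  val_inv := by rw [← opX_add, add_neg_cancel, opX_zero]
  inv_val := by rw [← opX_add, neg_add_cancel, opX_zero]

/-- The units `X_{j+1}`, extended by `1`. -/
def xU (j : ℕ) : (Op n)ˣ := if h : j < n + 2 then unitX (eps ⟨j, h⟩) else 1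

theorem tU_eq (a : Fin (n + 1)) : tU q k (a : ℕ) = unitT q k a := by
  rw [tU, dif_pos a.isLt]

theorem xU_eq (i : Fin (n + 2)) : xU (i : ℕ) = unitX (eps i) := by
  rw [xU, dif_pos i.isLt]

theorem tU_braid (a : ℕ) (h : a + 1 < n + 1) :
    tU (n := n) q k a * tU q k (a + 1) * tU q k a = tU q k (a + 1) * tU q k a * tU q k (a + 1) := by
  have h1 := tU_eq (n := n) q k ⟨a, by omega⟩
  have h2 := tU_eq (n := n) q k ⟨a + 1, h⟩
  simp only at h1 h2
  rw [h1, h2]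
  exact Units.ext (opT_braid q k rfl)

theorem tU_comm (a b : ℕ) (h : a + 2 ≤ b) (hb : b < n + 1) :
    Commute (tU (n := n) q k a) (tU q k b) := by
  have h1 := tU_eq (n := n) q k ⟨a, by omega⟩
  have h2 := tU_eq (n := n) q k ⟨b, hb⟩
  simp only at h1 h2
  rw [h1, h2]
  exact Units.ext (opT_comm q k h)

theorem unitPi_tU (a : ℕ) (h : a + 1 < n + 1) :
    unitPi (n := n) q * tU q k a = tU q k (a + 1) * unitPi q := by
  have h1 := tU_eq (n := n) q k ⟨a, by omega⟩
  have h2 := tU_eq (n := n) q k ⟨a + 1, h⟩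
  simp only at h1 h2
  rw [h1, h2]
  exact Units.ext (weylOp_piW_opT q k ⟨a, by omega⟩)

theorem unitPi_sq_tU (M : ℕ) (h : n + 1 = M + 1) :
    unitPi (n := n) q * unitPi q * tU q k M = tU q k 0 * (unitPi q * unitPi q) := by
  obtain rfl : n = M := by omega
  have h1 := tU_eq (n := n) q k (Fin.last n)
  have h2 := tU_eq (n := n) q k 0
  simp only [Fin.val_last, Fin.val_zero] at h1 h2
  rw [h1, h2]
  exact Units.ext (weylOp_piW_sq_opT q k)

theorem list_filter_map (m : ℕ) {M : Type*} (f : Fin m → M) (g : ℕ → M) (h : ∀ j, f j = g j)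
    (r : ℕ → Bool) : (List.filter (fun j : Fin m => r (j : ℕ)) (List.finRange m)).reverse.map f =
      ((List.range m).filter r).reverse.map g := by
  have e : List.range m = (List.finRange m).map Fin.val := by simp
  rw [e, List.filter_map, List.map_reverse, List.map_reverse, List.map_map]
  exact congrArg List.reverse (List.map_congr_left fun j _ => h j)

theorem prod_filter_lt {G : Type*} [Group G] (t : ℕ → G) (m i : ℕ) (h : i ≤ m) :
    (((List.range m).filter (fun j => j < i)).reverse.map (fun j => (t j)⁻¹)).prod =
      (ascProd t i)⁻¹ := by
  have e : (List.range m).filter (fun j => j < i) = List.range i := by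
    clear t
    induction m, h using Nat.le_induction with
    | base => exact List.filter_eq_self.mpr fun j hj => by simpa using hj
    | succ m hm ih => simp [List.range_succ, ih, hm]
  rw [e]
  clear e h
  induction i with
  | zero => simp [ascProd]
  | succ i ih =>
    rw [List.range_succ, List.reverse_append, List.map_append, List.prod_append, ih]
    simp [ascProd]

theorem prod_filter_ge {G : Type*} [Group G] (t : ℕ → G) (m i : ℕ) (h : i ≤ m) :
    (((List.range m).filter (fun j => i ≤ j)).reverse.map t).prod * descProd t i =
      descProd t m := by
  induction m, h using Nat.le_induction with
  | base =>
    have : (List.range i).filter (fun j => i ≤ j) = [] :=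
      List.filter_eq_nil_iff.mpr fun j hj => by simpa using hj
    simp [this]
  | succ m hm ih =>
    rw [List.range_succ]
    simp [hm, descProd, ← ih, mul_assoc]

/-- Brings `Y_i` into the recursive form `Y_{i+1} = T_i⁻¹ Y_i T_i⁻¹`, to which the computations in
the braid group apply. -/
theorem unitY_eq (i : Fin (n + 2)) :
    unitY q k i = braidY (tU q k) (unitPi q * descProd (tU q k) (n + 1)) i := by
  have h1 := prod_filter_lt (tU (n := n) q k) (n + 1) i (by omega)
  have h2 := prod_filter_ge (tU (n := n) q k) (n + 1) i (by omega)
  have e1 := list_filter_map (n + 1) (fun j => (unitT q k j)⁻¹) (fun j => (tU (n := n) q k j)⁻¹)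
    (fun j => by rw [tU_eq]) (fun j => j < i)
  have e2 := list_filter_map (n + 1) (unitT q k) (tU (n := n) q k)
    (fun j => by rw [tU_eq]) (fun j => (i : ℕ) ≤ j)
  rw [braidY_eq, ← h1, ← h2, ← e1, ← e2, ← mul_assoc, ← mul_assoc, mul_inv_cancel_right]
  rfl

theorem unitY_comm (i j : Fin (n + 2)) : Commute (unitY q k i) (unitY q k j) := by
  rw [unitY_eq, unitY_eq]
  exact braidY_comm_braidY (tU_braid q k) (tU_comm q k) (unitPi_tU q k) (unitPi_sq_tU q k)
    (by omega) (by omega)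

/-- `Y^l` as a unit. -/
def unitYpow (l : Lat n) : (Op n)ˣ := ((List.finRange (n + 2)).map fun i => unitY q k i ^ l i).prod

theorem opY_eq (l : Lat n) : opY q k l = (unitYpow q k l : Op n) := rfl

theorem list_prod_zpow_add {ι G : Type*} [Group G] (f : ι → G) (hf : ∀ i j, Commute (f i) (f j))
    (a b : ι → ℤ) (L : List ι) : (L.map fun i => f i ^ (a i + b i)).prod =
      (L.map fun i => f i ^ a i).prod * (L.map fun i => f i ^ b i).prod := by
  induction L with
  | nil => simp
  | cons i L ih =>
    have : Commute (f i ^ b i) (L.map fun i => f i ^ a i).prod := by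
      refine Commute.list_prod_right _ _ fun g hg => ?_
      obtain ⟨j, -, rfl⟩ := List.mem_map.mp hg
      exact (hf i j).zpow_zpow _ _
    rw [List.map_cons, List.prod_cons, ih, zpow_add, mul_assoc, ← mul_assoc (f i ^ b i), this.eq]
    simp only [List.map_cons, List.prod_cons, mul_assoc]

theorem unitYpow_add (l m : Lat n) : unitYpow q k (l + m) = unitYpow q k l * unitYpow q k m :=
  list_prod_zpow_add _ (unitY_comm q k) l m _

theorem unitYpow_zero : unitYpow q k (0 : Lat n) = 1 := by simp [unitYpow]

theorem unitYpow_neg (l : Lat n) : unitYpow q k (-l) = (unitYpow q k l)⁻¹ := by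
  rw [eq_inv_iff_mul_eq_one, ← unitYpow_add, neg_add_cancel, unitYpow_zero]

theorem unitYpow_eps (i : Fin (n + 2)) : unitYpow q k (eps i) = unitY q k i := by
  rw [unitYpow, List.prod_map_eq_pow_single i, List.count_eq_one_of_mem (List.nodup_finRange _)
    (List.mem_finRange i)]
  · simp [eps]
  · intro j hj _
    simp [eps, hj]

theorem opY_add (l m : Lat n) : opY q k (l + m) = opY q k l * opY q k m := by
  rw [opY_eq, unitYpow_add]; rfl

theorem opY_zero : opY q k (0 : Lat n) = 1 := by rw [opY_eq, unitYpow_zero]; rfl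

/-- Induction on `ℤ^N` along the standard basis. -/
theorem lat_induction {P : Lat n → Prop} (zero : P 0) (add : ∀ l i, P l → P (l + eps i))
    (sub : ∀ l i, P l → P (l - eps i)) (l : Lat n) : P l := by
  have h1 : ∀ (i : Fin (n + 2)) (m : ℤ) (l : Lat n), P l → P (l + m • eps i) := fun i m l hl => by
    induction m with
    | zero => simpa using hl
    | succ m ih =>
      have := add _ i ih
      rwa [add_assoc, ← add_one_zsmul] at this
    | pred m ih =>
      have := sub _ i ih
      have e : l + (-(m : ℤ) - 1) • eps i = l + -(m : ℤ) • eps i - eps i := by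
        rw [sub_smul, one_smul]; abel
      rwa [e]
  have h2 : ∀ s : Finset (Fin (n + 2)), P (∑ i ∈ s, l i • eps i) := fun s => by
    induction s using Finset.induction_on with
    | empty => simpa using zero
    | insert i s hi ih =>
      rw [Finset.sum_insert hi, add_comm]
      exact h1 _ _ _ ih
  have h3 := h2 Finset.univ
  have e : ∑ i, l i • eps i = l := by
    funext j
    simp [eps, Pi.single_apply, Finset.sum_apply]
  rwa [e] at h3

theorem opY_comm_opT {a : Fin (n + 1)} {i : Fin (n + 2)} (h1 : i ≠ a.castSucc) (h2 : i ≠ a.succ) :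
    Commute (unitT q k a) (unitYpow q k (eps i)) := by
  rw [unitYpow_eps, unitY_eq, ← tU_eq]
  simp only [ne_eq, Fin.ext_iff, Fin.val_castSucc, Fin.val_succ] at h1 h2
  exact braidY_comm (tU_braid q k) (tU_comm q k) (unitPi_tU q k) a.isLt (by omega)
    (by omega) (by omega)

theorem unitYpow_succ (a : Fin (n + 1)) : unitYpow q k (eps a.succ) =
    (unitT q k a)⁻¹ * unitYpow q k (eps a.castSucc) * (unitT q k a)⁻¹ := by
  rw [unitYpow_eps, unitYpow_eps, unitY_eq, unitY_eq, ← tU_eq]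
  rfl

theorem opY_succ_mul_opT (a : Fin (n + 1)) : opY q k (eps a.succ) * opT q k a =
    ((unitT q k a)⁻¹ : (Op n)ˣ) * opY q k (eps a.castSucc) := by
  have : unitYpow q k (eps a.succ) * unitT q k a =
      (unitT q k a)⁻¹ * unitYpow q k (eps a.castSucc) := by
    rw [unitYpow_succ, inv_mul_cancel_right]
  exact congrArg Units.val this

theorem opY_mul_opT_of_ne {a : Fin (n + 1)} {i : Fin (n + 2)} (h1 : i ≠ a.castSucc)
    (h2 : i ≠ a.succ) : opY q k (eps i) * opT q k a = opT q k a * opY q k (eps i) :=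
  congrArg Units.val (opY_comm_opT q k h1 h2).eq.symm

theorem opY_neg_comm {a : Fin (n + 1)} {i : Fin (n + 2)} (h1 : i ≠ a.castSucc) (h2 : i ≠ a.succ) :
    opY q k (-eps i) * opT q k a = opT q k a * opY q k (-eps i) := by
  have := (opY_comm_opT q k h1 h2).inv_right
  rw [← unitYpow_neg] at this
  exact congrArg Units.val this.eq.symm

/-! The relations for `Y⁻¹` that mirror those for `X`. -/

theorem opY_neg_castSucc (a : Fin (n + 1)) :
    opY q k (-eps a.castSucc) * opT q k a = opT q k a * opY q k (-eps a.succ) +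
      ((-1) * ((k : ℂ) - (k : ℂ)⁻¹)) • opY q k (-eps a.succ) := by
  have h : unitYpow q k (-eps a.castSucc) * unitT q k a =
      (unitT q k a)⁻¹ * unitYpow q k (-eps a.succ) := by
    rw [unitYpow_neg, unitYpow_neg, unitYpow_succ]; group
  have h' := congrArg Units.val h
  simp only [Units.val_mul] at h'
  rw [opY_eq, opY_eq, ← unitT_val, h', unitT_inv, sub_mul, smul_mul_assoc, one_mul, unitT_val, kk]
  module

theorem opY_neg_succ (a : Fin (n + 1)) :
    opY q k (-eps a.succ) * opT q k a = opT q k a * opY q k (-eps a.castSucc) +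
      (1 * ((k : ℂ) - (k : ℂ)⁻¹)) • opY q k (-eps a.succ) := by
  have h : unitYpow q k (-eps a.succ) * (unitT q k a)⁻¹ =
      unitT q k a * unitYpow q k (-eps a.castSucc) := by
    rw [unitYpow_neg, unitYpow_neg, unitYpow_succ]; group
  have h' := congrArg Units.val h
  simp only [Units.val_mul, unitT_inv, mul_sub, mul_smul_comm, mul_one] at h'
  rw [opY_eq, opY_eq, ← unitT_val, ← h', unitT_val, kk]
  module

theorem opY_castSucc (a : Fin (n + 1)) :
    opY q k (eps a.castSucc) * opT q k a = opT q k a * opY q k (eps a.succ) +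
      (1 * ((k : ℂ) - (k : ℂ)⁻¹)) • opY q k (eps a.castSucc) := by
  have h : unitYpow q k (eps a.castSucc) * (unitT q k a)⁻¹ =
      unitT q k a * unitYpow q k (eps a.succ) := by
    rw [unitYpow_succ]; group
  have h' := congrArg Units.val h
  simp only [Units.val_mul, unitT_inv, mul_sub, mul_smul_comm, mul_one] at h'
  rw [opY_eq, opY_eq, ← unitT_val, ← h', unitT_val, kk]
  module

theorem opY_succ (a : Fin (n + 1)) :
    opY q k (eps a.succ) * opT q k a = opT q k a * opY q k (eps a.castSucc) +
      ((-1) * ((k : ℂ) - (k : ℂ)⁻¹)) • opY q k (eps a.castSucc) := by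
  rw [opY_succ_mul_opT, unitT_inv, sub_mul, smul_mul_assoc, one_mul, kk]
  module

/-- The relations between `T_a` and `X^{±ε_i}`, together with their mirror images. -/
theorem exists_cross_relation (a : Fin (n + 1)) (e : Lat n) (he : ∃ i, e = eps i ∨ e = -eps i) :
    ∃ (e' e'' : Lat n) (c : ℂ),
      opT q k a * opX e = opX e' * opT q k a + c • opX e'' ∧
      opY q k (-e) * opT q k a = opT q k a * opY q k (-e') + c • opY q k (-e'') := by
  obtain ⟨i, rfl | rfl⟩ := he
  · by_cases h1 : i = a.castSucc
    · subst h1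
      exact ⟨_, _, _, opT_opX_castSucc q k a, opY_neg_castSucc q k a⟩
    · by_cases h2 : i = a.succ
      · subst h2
        exact ⟨_, _, _, opT_opX_succ q k a, opY_neg_succ q k a⟩
      · refine ⟨eps i, 0, 0, ?_, ?_⟩
        · rw [zero_smul, add_zero, opT_opX_comm]
          simp [eps, Ne.symm h1, Ne.symm h2]
        · rw [zero_smul, add_zero, opY_neg_comm q k h1 h2]
  · rw [neg_neg]
    by_cases h1 : i = a.castSucc
    · subst h1
      refine ⟨_, _, _, opT_opX_neg_castSucc q k a, ?_⟩
      rw [neg_neg, neg_neg]; exact opY_castSucc q k a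
    · by_cases h2 : i = a.succ
      · subst h2
        refine ⟨_, _, _, opT_opX_neg_succ q k a, ?_⟩
        rw [neg_neg]; exact opY_succ q k a
      · refine ⟨-eps i, 0, 0, ?_, ?_⟩
        · rw [zero_smul, add_zero, opT_opX_comm]
          simp [eps, Ne.symm h1, Ne.symm h2]
        · rw [zero_smul, add_zero, neg_neg, opY_mul_opT_of_ne q k h1 h2]

/-! ### The mirror image of `π` -/

/-- The mirror image `X_N⁻¹ T_{N-1} ⋯ T_1` of `π`. -/
def unitP : (Op n)ˣ := (xU (n + 1))⁻¹ * descProd (tU q k) (n + 1)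

/-- The scalar `q⁻¹` as a unit operator. -/
def qInv : (Op n)ˣ := Units.map (algebraMap ℂ (Op n)).toMonoidHom (q.unit)⁻¹

theorem qInv_comm (g : (Op n)ˣ) : Commute (qInv (n := n) q) g :=
  Units.ext (Algebra.commutes _ _)

theorem tU_xU (a : ℕ) (ha : a < n + 1) : tU (n := n) q k a * xU a * tU q k a = xU (a + 1) := by
  have h1 := tU_eq (n := n) q k ⟨a, ha⟩
  have h2 := xU_eq (n := n) (Fin.castSucc ⟨a, ha⟩)
  have h3 := xU_eq (n := n) (Fin.succ ⟨a, ha⟩)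
  simp only [Fin.val_castSucc, Fin.val_succ] at h1 h2 h3
  rw [h1, h2, h3, mul_eq_of_eq_mul_inv]
  refine Units.ext ?_
  simp only [Units.val_mul, unitT_inv, unitT_val, mul_sub, mul_smul_comm, mul_one]
  refine (opT_opX_castSucc q k ⟨a, ha⟩).trans ?_
  change _ = opX _ * _ - kk k • opX _
  rw [kk]; module

theorem tU_comm_xU (a : ℕ) (ha : a + 1 < n + 1) : Commute (tU (n := n) q k a) (xU (n + 1)) := by
  have h1 := tU_eq (n := n) q k ⟨a, by omega⟩
  have h2 := xU_eq (n := n) (Fin.last (n + 1))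
  simp only [Fin.val_last] at h1 h2
  rw [h1, h2]
  refine Units.ext (opT_opX_comm q k _ ?_)
  simp only [eps_eq_ind]
  apply ind_congr
  simp [Fin.ext_iff]
  omega

theorem eps_rot (i : Fin (n + 2)) : (fun j => (eps i : Lat n) ((rot n)⁻¹ j)) = eps (rot n i) := by
  funext j
  simp only [eps_eq_ind]
  apply ind_congr
  exact Equiv.Perm.inv_eq_iff_eq

theorem unitPi_xU (a : ℕ) (ha : a < n + 1) : unitPi (n := n) q * xU a = xU (a + 1) * unitPi q := by
  have h2 := xU_eq (n := n) (Fin.castSucc ⟨a, ha⟩)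
  have h3 := xU_eq (n := n) (Fin.succ ⟨a, ha⟩)
  simp only [Fin.val_castSucc, Fin.val_succ] at h2 h3
  rw [h2, h3]
  refine Units.ext ((weylOp_piW_opX q _).trans ?_)
  have e1 : (eps (Fin.castSucc ⟨a, ha⟩) : Lat n) (Fin.last (n + 1)) = 0 := by
    rw [eps_eq_ind, ind_false]; simp [Fin.ext_iff]; omega
  have e2 : rot n (Fin.castSucc ⟨a, ha⟩) = Fin.succ ⟨a, ha⟩ := by
    ext; rw [val_rot, if_neg]
    · rfl
    · simp [Fin.ext_iff]; omega
  rw [e1, eps_rot, e2]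
  simp; rfl

theorem unitPi_xU_last :
    unitPi (n := n) q * xU (n + 1) = qInv q * xU 0 * unitPi q := by
  have h2 := xU_eq (n := n) (Fin.last (n + 1))
  have h3 := xU_eq (n := n) 0
  simp only [Fin.val_last, Fin.val_zero] at h2 h3
  rw [h2, h3]
  refine Units.ext ((weylOp_piW_opX q _).trans ?_)
  have e1 : (eps (Fin.last (n + 1)) : Lat n) (Fin.last (n + 1)) = 1 := by simp [eps]
  have e2 : rot n (Fin.last (n + 1)) = 0 := by ext; simp
  rw [e1, eps_rot, e2, zpow_neg_one, Algebra.smul_def, ← mul_assoc]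
  rfl

theorem unitP_opY (i : Fin (n + 2)) :
    unitP q k * unitYpow q k (eps (rot n i)) =
      (if i = Fin.last (n + 1) then qInv q else 1) * (unitYpow q k (eps i) * unitP q k) := by
  simp only [unitYpow_eps, unitY_eq]
  split_ifs with h
  · subst h
    have := dualPi_mul_braidY_zero (t := tU (n := n) q k) (m := n + 1) (tU_xU q k) (qInv_comm q)
      (unitPi_xU_last q)
    simpa [unitP] using this
  · have hi : (i : ℕ) < n + 1 := by
      have := i.isLt
      rw [Fin.ext_iff, Fin.val_last] at h
      omega
    rw [one_mul, val_rot, if_neg h]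
    exact dualPi_mul_braidY (tU_braid q k) (tU_comm q k) (unitPi_tU q k) (tU_xU q k)
      (tU_comm_xU q k) (unitPi_xU q) hi

/-- Scalars as unit operators. -/
def unitScalar : ℂˣ →* (Op n)ˣ := Units.map (algebraMap ℂ (Op n)).toMonoidHom

theorem unitScalar_comm (z : ℂˣ) (g : (Op n)ˣ) : Commute (unitScalar z) g :=
  Units.ext (Algebra.commutes _ _)

theorem unitYpow_mul_unitP (l : Lat n) : unitYpow q k l * unitP q k =
    unitScalar (q.unit ^ (l (Fin.last (n + 1)))) *
      (unitP q k * unitYpow q k fun i => l ((rot n)⁻¹ i)) := by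
  have hs : ∀ i, unitYpow q k (eps i) * unitP q k = unitScalar
      (q.unit ^ ((eps i : Lat n) (Fin.last (n + 1)))) *
        (unitP q k * unitYpow q k (eps (rot n i))) := fun i => by
    rw [unitP_opY, ← mul_assoc, eps_eq_ind]
    by_cases h : i = Fin.last (n + 1)
    · rw [if_pos h, ind_true h.symm, zpow_one]
      have : qInv (n := n) q = unitScalar (q.unit)⁻¹ := rfl
      rw [this, ← map_mul, mul_inv_cancel, map_one, one_mul]
    · rw [if_neg h, ind_false (Ne.symm h)]; simp
  -- An equivalence, so that it serves for adding as well as for subtracting `ε_i`.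
  have hadd : ∀ l i, unitYpow q k l * unitP q k =
      unitScalar (q.unit ^ (l (Fin.last (n + 1)))) *
      (unitP q k * unitYpow q k fun i => l ((rot n)⁻¹ i)) ↔ unitYpow q k (l + eps i) * unitP q k =
    unitScalar (q.unit ^ ((l + eps i) (Fin.last (n + 1)))) *
      (unitP q k * unitYpow q k fun j => (l + eps i) ((rot n)⁻¹ j)) := fun l i => by
    have e : (fun j => (l + eps i) ((rot n)⁻¹ j)) =
        eps (rot n i) + fun j => l ((rot n)⁻¹ j) := by
      rw [← eps_rot]; funext j; exact add_comm _ _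
    rw [add_comm l, unitYpow_add, ← add_comm l, e, unitYpow_add, Pi.add_apply, add_comm (l _),
      zpow_add, map_mul]
    have h1 := hs i
    have h2 := unitScalar_comm (q.unit ^ l (Fin.last (n + 1))) (unitYpow q k (eps i))
    have h4 := unitScalar_comm (q.unit ^ l (Fin.last (n + 1)))
      (unitScalar (n := n) (q.unit ^ (eps i : Lat n) (Fin.last (n + 1))))
    generalize unitScalar (q.unit ^ l (Fin.last (n + 1))) = s at h2 h4 ⊢
    generalize unitScalar (q.unit ^ (eps i : Lat n) (Fin.last (n + 1))) = s' at h1 h4 ⊢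
    generalize unitYpow q k (eps i) = A at h1 h2 ⊢
    generalize unitP q k = p at h1 ⊢
    have h3 : A * (s * (p * unitYpow q k fun i => l ((rot n)⁻¹ i))) = s * (s' * (p *
        (unitYpow q k (eps (rot n i)) * unitYpow q k fun i => l ((rot n)⁻¹ i)))) := by
      rw [← mul_assoc, ← h2.eq, mul_assoc, ← mul_assoc A, h1]
      simp only [mul_assoc]
    rw [← mul_assoc s s', h4.eq] at h3
    rw [mul_assoc A, ← h3, mul_right_inj]
  induction l using lat_induction with
  | zero => simp [unitYpow_zero, show (fun _ : Fin (n + 2) => (0 : ℤ)) = 0 from rfl]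
  | add l i ih => exact (hadd l i).mp ih
  | sub l i ih => exact (hadd _ i).mpr (by rwa [sub_add_cancel])

theorem opY_neg_mul_unitP (l : Lat n) :
    opY q k (-l) * ((unitP q k : (Op n)ˣ) : Op n) = ((q.unit ^ (-l (Fin.last (n + 1))) : ℂˣ) : ℂ) •
      (((unitP q k : (Op n)ˣ) : Op n) * opY q k (-fun i => l ((rot n)⁻¹ i))) := by
  have := congrArg Units.val (unitYpow_mul_unitP q k (-l))
  rw [Algebra.smul_def]
  exact this

end

end BqKZ
end
noncomputable section
namespace BqKZ

/-! ### Products `π^r T_u` -/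

section
variable {n : ℕ} (q : QParam) (k : ℂˣ)

/-- Each further generator meets an ascent of the cycle built so far, so the product remains a
single basis element. -/
theorem exists_cycle (i : ℕ) (hi : i ≤ n + 1) : ∃ u : Perm n,
    (∀ j, ((u j : Fin (n + 2)) : ℕ) = if (j : ℕ) < i then (j : ℕ) + 1 else if (j : ℕ) = i then 0 else j) ∧
      ((ascProd (tU q k) i : (Op n)ˣ) : Op n) = opTw q k u ∧
      ((descProd (tU q k) i : (Op n)ˣ) : Op n) = opTw q k u⁻¹ := by
  induction i with
  | zero =>
    refine ⟨1, fun j => ?_, by simp [ascProd, opTw_one], by simp [descProd, opTw_one]⟩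
    simp
  | succ i ih =>
    obtain ⟨u, h1, h2, h3⟩ := ih (by omega)
    have ht := tU_eq (n := n) q k ⟨i, by omega⟩
    simp only at ht
    have hasc : u (Fin.castSucc ⟨i, by omega⟩) < u (Fin.succ ⟨i, by omega⟩) := by
      rw [Fin.lt_def, h1, h1]; simp
    refine ⟨u * simplePerm ⟨i, by omega⟩, fun j => ?_, ?_, ?_⟩
    · rw [Equiv.Perm.mul_apply, h1, simplePerm_apply]
      grind
    · rw [ascProd, Units.val_mul, ht, h2, unitT_val, opTw_mul_of_ascent q k hasc]
    · rw [descProd, Units.val_mul, ht, h3, unitT_val, opT_mul_of_ascent q k (by rwa [inv_inv]),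
        mul_inv_rev, simplePerm_inv]

theorem cycle_eq_rot {u : Perm n} (h : ∀ j, ((u j : Fin (n + 2)) : ℕ) =
    if (j : ℕ) < n + 1 then (j : ℕ) + 1 else if (j : ℕ) = n + 1 then 0 else j) : u = rot n := by
  ext j
  rw [h, val_rot]
  have := j.isLt
  simp only [Fin.ext_iff, Fin.val_last]
  grind

theorem ascProd_eq : ((ascProd (tU q k) (n + 1) : (Op n)ˣ) : Op n) = opTw q k (rot n) := by
  obtain ⟨u, h1, h2, -⟩ := exists_cycle q k (n + 1) le_rfl
  rw [h2, cycle_eq_rot h1]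

theorem descProd_eq : ((descProd (tU q k) (n + 1) : (Op n)ˣ) : Op n) = opTw q k (rot n)⁻¹ := by
  obtain ⟨u, h1, -, h2⟩ := exists_cycle q k (n + 1) le_rfl
  rw [h2, cycle_eq_rot h1]

theorem rot_lt_rot {i j : Fin (n + 2)} (hi : i ≠ Fin.last (n + 1)) (hj : j ≠ Fin.last (n + 1)) :
    rot n i < rot n j ↔ i < j := by
  rw [Fin.lt_def, val_rot, val_rot, if_neg hi, if_neg hj, Fin.lt_def]; omega

theorem rot_lt_rot_last {i j : Fin (n + 2)} (hi : i ≠ Fin.last (n + 1))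
    (hj : j = Fin.last (n + 1)) : rot n j < rot n i := by
  rw [Fin.lt_def, val_rot, val_rot, if_neg hi, if_pos hj]; omega

/-- For `u = 1` this is the definition of `Y_N`. When `u` is multiplied by `s_a` at an ascent, `Y`
commutes with `T_a` unless its index is `a + 1`. In that case `Y_{a+1} T_a = T_a⁻¹ Y_a`, and the
inverse is the right factor because the rotation has made the largest value smallest, turning the
ascent into a descent. -/
theorem weylOp_piW_opTw (u : Perm n) : weylOp q (piW n) * opTw q k u =
    opTw q k (rot n * u) * opY q k (eps (u⁻¹ (Fin.last (n + 1)))) := by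
  induction u using perm_induction with
  | one =>
    have h := braidY_last (t := tU (n := n) q k) (m := n + 1) (p := unitPi q)
    rw [opTw_one, mul_one, mul_one, inv_one, Equiv.Perm.one_apply, ← ascProd_eq, opY_eq,
      unitYpow_eps, unitY_eq, Fin.val_last, h, ← Units.val_mul, mul_inv_cancel_left]
    rfl
  | step u a h ih =>
    rw [← opTw_mul_of_ascent q k h, ← mul_assoc, ih, mul_assoc, mul_inv_rev, simplePerm_inv,
      Equiv.Perm.mul_apply, ← mul_assoc]
    -- At an ascent the first of the two values is not the maximal one.
    have h0 : u⁻¹ (Fin.last (n + 1)) ≠ a.castSucc := fun e => by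
      rw [Equiv.Perm.inv_eq_iff_eq] at e
      rw [← e] at h
      exact absurd h (not_lt.mpr (Fin.le_last _))
    by_cases h1 : u⁻¹ (Fin.last (n + 1)) = a.succ
    · have e := h1
      rw [Equiv.Perm.inv_eq_iff_eq] at e
      rw [h1, simplePerm_succ, mul_assoc, opY_succ_mul_opT, ← mul_assoc,
        opTw_mul_inv_of_descent q k, mul_assoc (rot n)]
      rw [Equiv.Perm.mul_apply, Equiv.Perm.mul_apply]
      exact rot_lt_rot_last (ne_of_lt (h.trans_le (Fin.le_last _))) e.symm
    · have e : simplePerm a (u⁻¹ (Fin.last (n + 1))) = u⁻¹ (Fin.last (n + 1)) :=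
        Equiv.swap_apply_of_ne_of_ne h0 h1
      rw [e, mul_assoc, opY_mul_opT_of_ne q k h0 h1, ← mul_assoc, opTw_mul_of_ascent q k, mul_assoc]
      rw [Equiv.Perm.mul_apply, Equiv.Perm.mul_apply, rot_lt_rot]
      · exact h
      · exact fun e' => h0 (Equiv.Perm.inv_eq_iff_eq.mpr e'.symm)
      · exact fun e' => h1 (Equiv.Perm.inv_eq_iff_eq.mpr e'.symm)

theorem opT_mul_opX_neg_succ (a : Fin (n + 1)) : opT q k a * opX (-eps a.succ) =
    opX (-eps a.castSucc) * ((unitT q k a)⁻¹ : (Op n)ˣ) := by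
  have h := opT_opX_neg_succ q k a
  rw [h, unitT_inv, mul_sub (opX _), mul_smul_comm, mul_one, kk]
  module

/-- The mirror image of `weylOp_piW_opTw`: now `T_a X_{a+1}⁻¹ = X_a⁻¹ T_a⁻¹` produces the inverse at
the index where the rotation creates a descent. -/
theorem opTw_mul_unitP (u : Perm n) : opTw q k u⁻¹ * ((unitP q k : (Op n)ˣ) : Op n) =
    opX (-eps (u⁻¹ (Fin.last (n + 1)))) * opTw q k (rot n * u)⁻¹ := by
  induction u using perm_induction with
  | one =>
    rw [inv_one, opTw_one, one_mul, mul_one, Equiv.Perm.one_apply, ← descProd_eq, unitP]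
    have h := xU_eq (n := n) (Fin.last (n + 1))
    rw [Fin.val_last] at h
    rw [h]
    rfl
  | step u a h ih =>
    have hu : opTw q k (u * simplePerm a)⁻¹ = opT q k a * opTw q k u⁻¹ := by
      rw [mul_inv_rev, simplePerm_inv, opT_mul_of_ascent q k (by rwa [inv_inv])]
    have e0 : (rot n * (u * simplePerm a))⁻¹ = simplePerm a * (rot n * u)⁻¹ := by
      rw [← mul_assoc, mul_inv_rev _ (simplePerm a), simplePerm_inv]
    rw [hu, mul_assoc, ih, e0, ← mul_assoc, mul_inv_rev u, simplePerm_inv, Equiv.Perm.mul_apply]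
    have h0 : u⁻¹ (Fin.last (n + 1)) ≠ a.castSucc := fun e => by
      rw [Equiv.Perm.inv_eq_iff_eq] at e
      rw [← e] at h
      exact absurd h (not_lt.mpr (Fin.le_last _))
    by_cases h1 : u⁻¹ (Fin.last (n + 1)) = a.succ
    · have e := h1
      rw [Equiv.Perm.inv_eq_iff_eq] at e
      rw [h1, simplePerm_succ, opT_mul_opX_neg_succ, mul_assoc, inv_mul_opTw_of_descent q k]
      rw [inv_inv, Equiv.Perm.mul_apply, Equiv.Perm.mul_apply]
      exact rot_lt_rot_last (ne_of_lt (h.trans_le (Fin.le_last _))) e.symm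
    · have e : simplePerm a (u⁻¹ (Fin.last (n + 1))) = u⁻¹ (Fin.last (n + 1)) :=
        Equiv.swap_apply_of_ne_of_ne h0 h1
      rw [e, opT_opX_comm, mul_assoc, opT_mul_of_ascent q k]
      · rw [inv_inv, Equiv.Perm.mul_apply, Equiv.Perm.mul_apply, rot_lt_rot]
        · exact h
        · exact fun e' => h0 (Equiv.Perm.inv_eq_iff_eq.mpr e'.symm)
        · exact fun e' => h1 (Equiv.Perm.inv_eq_iff_eq.mpr e'.symm)
      · simp only [Pi.neg_apply, eps_eq_ind]
        rw [ind_false (Ne.symm h0), ind_false (Ne.symm h1)]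

/-- The indicator of `{j : N - r ≤ u j}`. -/
def topInd (u : Perm n) (r : ℕ) : Lat n := fun j => ind (n + 2 ≤ (u j : ℕ) + r)

theorem val_rot_pow (r : ℕ) (i : Fin (n + 2)) :
    (((rot n ^ r) i : Fin (n + 2)) : ℕ) = ((i : ℕ) + r) % (n + 2) := by
  induction r with
  | zero => simp [Nat.mod_eq_of_lt i.isLt]
  | succ r ih =>
    have h := ((rot n ^ r) i).isLt
    rw [pow_succ', Equiv.Perm.mul_apply, val_rot, ← add_assoc, ← Nat.mod_add_mod, ← ih]
    simp only [Fin.ext_iff, Fin.val_last]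
    split_ifs with h1
    · rw [h1, Nat.mod_self]
    · rw [Nat.mod_eq_of_lt]
      omega

theorem topInd_succ (u : Perm n) {r : ℕ} (hr : r + 1 ≤ n + 2) :
    topInd u (r + 1) = eps ((rot n ^ r * u)⁻¹ (Fin.last (n + 1))) + topInd u r := by
  funext j
  rw [Pi.add_apply, eps_eq_ind]
  have h : (j = (rot n ^ r * u)⁻¹ (Fin.last (n + 1))) ↔ (u j : ℕ) + r = n + 1 := by
    rw [eq_comm, Equiv.Perm.inv_eq_iff_eq, Equiv.Perm.mul_apply, eq_comm, Fin.ext_iff, val_rot_pow,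
      Fin.val_last]
    have := (u j).isLt
    constructor
    · intro h
      by_contra h'
      have h2 : n + 2 ≤ (u j : ℕ) + r := by
        by_contra h3
        rw [Nat.mod_eq_of_lt (by omega)] at h
        omega
      rw [Nat.mod_eq_sub_mod h2, Nat.mod_eq_of_lt (by omega)] at h
      omega
    · intro h; rw [Nat.mod_eq_of_lt (by omega), h]
  rw [ind_congr h, topInd, topInd]
  by_cases h1 : (u j : ℕ) + r = n + 1
  · rw [ind_true h1, ind_true (by omega), ind_false (by omega)]; rfl
  · rw [ind_false h1, zero_add]
    exact ind_congr (by omega)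

theorem topInd_zero (u : Perm n) : topInd u 0 = 0 := by
  funext j; exact ind_false (by have := (u j).isLt; omega)

/-- The successive factors `π` contribute `ε_j` for the positions `j` that carry the last value, the
last but one, and so on. For `r ≤ N` these positions are distinct, and together they give `topInd u
r`. -/
theorem weylOp_piW_pow_opTw {r : ℕ} (hr : r ≤ n + 2) (u : Perm n) :
    weylOp q (piW n ^ r) * opTw q k u = opTw q k (rot n ^ r * u) * opY q k (topInd u r) := by
  induction r with
  | zero => simp [topInd_zero, opY_zero, weylOp_one]
  | succ r ih =>
    rw [pow_succ', weylOp_mul, mul_assoc, ih (by omega), ← mul_assoc, weylOp_piW_opTw,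
      mul_assoc, ← opY_add, topInd_succ u hr, pow_succ' (rot n), mul_assoc (rot n)]

theorem piW_mul_ofPerm (u : Perm n) : piW n * ofPerm u =
    ofPerm (rot n * u) * transl (eps (u⁻¹ (Fin.last (n + 1)))) := by
  rw [ofPerm_mul, mul_assoc, ofPerm_mul_transl, piW, mul_assoc]
  congr 3
  funext i
  rw [eps_eq_ind, eps_eq_ind]
  exact ind_congr (by simp)

theorem piW_pow_mul_ofPerm {r : ℕ} (hr : r ≤ n + 2) (u : Perm n) :
    piW n ^ r * ofPerm u = ofPerm (rot n ^ r * u) * transl (topInd u r) := by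
  induction r with
  | zero => simp [topInd_zero, transl_zero]
  | succ r ih =>
    rw [pow_succ', mul_assoc, ih (by omega), ← mul_assoc, piW_mul_ofPerm, mul_assoc, ← transl_add,
      topInd_succ u hr, pow_succ' (rot n), mul_assoc (rot n)]

/-- The fundamental weight `ε_1 + ⋯ + ε_r`. -/
def fund (r : ℕ) : Lat n := fun j => ind ((j : ℕ) < r)

theorem topInd_rot (r : ℕ) : topInd (rot n ^ r)⁻¹ r = fund r := by
  funext j
  refine ind_congr ?_
  have h := val_rot_pow r ((rot n ^ r)⁻¹ j)
  rw [perm_apply_inv] at h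
  have h1 := ((rot n ^ r)⁻¹ j).isLt
  have h2 := j.isLt
  rw [h]
  constructor
  · intro h3
    rw [Nat.mod_eq_sub_mod h3]
    exact (Nat.mod_le _ _).trans_lt (by omega)
  · intro h3
    by_contra h4
    rw [Nat.mod_eq_of_lt (by omega)] at h3
    omega

/-- For `u = (rot n ^ r)⁻¹` the factor `T` in `weylOp_piW_pow_opTw` becomes `1`. The translation by
the same weight factors in the same way (`transl_fund`), which makes the fundamental weights
accessible to computation. -/
theorem opY_fund {r : ℕ} (hr : r ≤ n + 2) :
    opY q k (fund r) = weylOp q (piW n ^ r) * opTw q k (rot n ^ r)⁻¹ := by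
  rw [weylOp_piW_pow_opTw q k hr, mul_inv_cancel, opTw_one, one_mul, topInd_rot]

theorem transl_fund {r : ℕ} (hr : r ≤ n + 2) :
    transl (fund r : Lat n) = piW n ^ r * ofPerm (rot n ^ r)⁻¹ := by
  rw [piW_pow_mul_ofPerm hr, mul_inv_cancel, ofPerm_one, one_mul, topInd_rot]

end

/-! ### Operators on a field with leading terms -/

section
variable {n : ℕ} {R : Type*} [Field R] [Algebra ℂ R]

/-- Linear independence over the multiplication operators. -/
def OpIndep {ι : Type*} (h : ι → Module.End ℂ R) : Prop :=
  ∀ (s : Finset ι) (g : ι → R), ∑ i ∈ s, LinearMap.mulLeft ℂ (g i) * h i = 0 → ∀ i ∈ s, g i = 0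

theorem opIndep_iff {ι : Type*} (h : ι → Module.End ℂ R) : OpIndep h ↔ LinearIndependent R h :=
  linearIndependent_iff'.symm

theorem opIndep_toLinearMap {ι : Type*} (φ : ι → (R →ₐ[ℂ] R)) (hφ : Function.Injective φ) :
    OpIndep fun i => (φ i).toLinearMap :=
  (opIndep_iff _).mpr ((linearIndependent_toLinearMap ℂ R R).comp φ hφ)

variable (b : Weyl n → Module.End ℂ R)

/-- The span of the operators `w ∈ W` of less than a given length. -/
def lowSpan (r : ℤ) : Submodule R (Module.End ℂ R) := Submodule.span R (b '' {v | ell v < r})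

/-- Right multiplication on the operators. -/
def rightMul (g : Module.End ℂ R) : Module.End ℂ R →ₗ[R] Module.End ℂ R where
  toFun h := h * g
  map_add' a b := add_mul a b g
  map_smul' _ _ := rfl

/-- The operator `h` is a nonzero multiple of `w`, up to elements of length less than `r`. -/
def HasLead (h : Module.End ℂ R) (w : Weyl n) (r : ℤ) : Prop :=
  ∃ c : R, c ≠ 0 ∧ h - c • b w ∈ lowSpan b r

variable {b}

theorem mem_lowSpan {w : Weyl n} {r : ℤ} (h : ell w < r) : b w ∈ lowSpan b r :=
  Submodule.subset_span ⟨w, h, rfl⟩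

/-- The lower terms gain at most 2 in `ell`. The part of `b w * g` that keeps `w` is lower as well,
since `ell w ≤ r < r + 2`. -/
theorem HasLead.mul {h g : Module.End ℂ R} {w x : Weyl n} {r : ℤ} (hl : HasLead b h w r)
    (hw : ell w ≤ r) {d e : Weyl n → R} (he : ∀ v, e v ≠ 0)
    (hg : ∀ v, b v * g = LinearMap.mulLeft ℂ (d v) * b v + LinearMap.mulLeft ℂ (e v) * b (v * x))
    (hx : ∀ v, ell (v * x) ≤ ell v + 2) : HasLead b (h * g) (w * x) (r + 2) := by
  obtain ⟨c, hc, h1⟩ := hl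
  replace hg : ∀ v, b v * g = d v • b v + e v • b (v * x) := hg
  refine ⟨c * e w, mul_ne_zero hc (he w), ?_⟩
  have h2 : (h - c • b w) * g ∈ lowSpan b (r + 2) := by
    have : lowSpan b r ≤ (lowSpan b (r + 2)).comap (rightMul g) := by
      refine Submodule.span_le.mpr ?_
      rintro _ ⟨v, hv, rfl⟩
      change b v * g ∈ lowSpan b _
      rw [hg]
      have hv' : ell v < r := hv
      have := hx v
      exact add_mem (Submodule.smul_mem _ _ (mem_lowSpan (by omega)))
        (Submodule.smul_mem _ _ (mem_lowSpan (by omega)))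
    exact this h1
  have h3 : h * g - (c * e w) • b (w * x) = (h - c • b w) * g + c • d w • b w := by
    have h4 : c • b w * g = c • (b w * g) := rfl
    rw [sub_mul, h4, hg, mul_smul, smul_add]
    abel
  rw [h3]
  exact add_mem h2 (Submodule.smul_mem _ _ (Submodule.smul_mem _ _ (mem_lowSpan (by omega))))

theorem HasLead.mul_of_ell_eq {h g : Module.End ℂ R} {w x : Weyl n} {r : ℤ} (hl : HasLead b h w r)
    (hg : ∀ v, b v * g = b (v * x)) (hx : ∀ v, ell (v * x) = ell v) :
    HasLead b (h * g) (w * x) r := by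
  obtain ⟨c, hc, h1⟩ := hl
  refine ⟨c, hc, ?_⟩
  have : lowSpan b r ≤ (lowSpan b r).comap (rightMul g) := by
    refine Submodule.span_le.mpr ?_
    rintro _ ⟨v, hv, rfl⟩
    change b v * g ∈ lowSpan b _
    rw [hg]
    exact mem_lowSpan ((hx v).trans_lt hv)
  have h2 := this h1
  change (h - c • b w) * g ∈ lowSpan b r at h2
  rwa [sub_mul, show c • b w * g = c • (b w * g) from rfl, hg] at h2

theorem hasLead_one (h : b 1 = 1) : HasLead b 1 (1 : Weyl n) 0 :=
  ⟨1, one_ne_zero, by rw [h, one_smul, sub_self]; exact zero_mem _⟩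

/-- In a linear relation, consider a nonzero coefficient whose `w i` has maximal length. Every other
contribution lies in the span of the operators different from `w i`, so `w i` would lie there too.
-/
theorem opIndep_of_hasLead (hb : OpIndep b) {ι : Type*} {h : ι → Module.End ℂ R} {w : ι → Weyl n}
    (hw : Function.Injective w) (hl : ∀ i, HasLead b (h i) (w i) (ell (w i))) :
    OpIndep h := by
  classical
  rw [opIndep_iff] at hb ⊢
  choose c hc h1 using hl
  rw [linearIndependent_iff']
  intro s g hg
  by_contra hne
  push Not at hne
  obtain ⟨i₀, hi₀, hgi₀⟩ := hne
  obtain ⟨i, hi, hmax⟩ := (s.filter fun i => g i ≠ 0).exists_max_image (fun i => ell (w i))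
    ⟨i₀, Finset.mem_filter.mpr ⟨hi₀, hgi₀⟩⟩
  rw [Finset.mem_filter] at hi
  set S := Submodule.span R (b '' {v | v ≠ w i}) with hS
  have hlow : ∀ j, g j ≠ 0 → j ∈ s → h j - c j • b (w j) ∈ S := fun j hj hjs => by
    refine Submodule.span_mono (Set.image_mono fun v hv => ?_) (h1 j)
    rintro rfl
    exact absurd (hmax j (Finset.mem_filter.mpr ⟨hjs, hj⟩)) (not_le.mpr hv)
  have h2 : (g i * c i) • b (w i) ∈ S := by
    rw [← Finset.add_sum_erase _ _ hi.1] at hg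
    have h3 : (g i * c i) • b (w i) =
        -(g i • (h i - c i • b (w i))) - ∑ x ∈ s.erase i, g x • h x := by
      rw [smul_sub, mul_smul, eq_sub_iff_add_eq, eq_neg_iff_add_eq_zero, ← hg]; abel
    rw [h3]
    refine sub_mem (neg_mem (Submodule.smul_mem _ _ (hlow i hi.2 hi.1))) (sum_mem fun j hj => ?_)
    rw [Finset.mem_erase] at hj
    by_cases hgj : g j = 0
    · rw [hgj, zero_smul]; exact zero_mem _
    · refine Submodule.smul_mem _ _ ?_
      rw [← sub_add_cancel (h j) (c j • b (w j))]
      exact add_mem (hlow j hgj hj.2) (Submodule.smul_mem _ _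
        (Submodule.subset_span ⟨w j, fun e => hj.1 (hw e), rfl⟩))
  have h4 : b (w i) ∈ S := by
    have := Submodule.smul_mem S (g i * c i)⁻¹ h2
    rwa [smul_smul, inv_mul_cancel₀ (mul_ne_zero hi.2 (hc i)), one_smul] at this
  exact hb.notMem_span_image (s := {v | v ≠ w i}) (x := w i)
    (by simp) h4

end

/-! ### The Poincaré-Birkhoff-Witt theorem -/

section
variable {n : ℕ} (q : QParam) (k : ℂˣ)

/-- The exponents of the images of monomials determine the permutation, and the scalars determine
the translation, since the powers of `q` are distinct for `0 < q < 1`. -/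
theorem weylFieldEquiv_injective : Function.Injective fun w : Weyl n => weylFieldEquiv q w := by
  intro w w' h
  have h1 : ∀ l : Lat n, weylFieldEquiv q w (ratMono l) = weylFieldEquiv q w' (ratMono l) :=
    fun l => by
      change (fun w : Weyl n => weylFieldEquiv q w) w (ratMono l) = _
      rw [h]
  have h2 : ∀ l : Lat n, weylAct q w (mono l) = weylAct q w' (mono l) := fun l => by
    refine IsFractionRing.injective (Reg n) (RatFn n) ?_
    rw [← weylFieldEquiv_algebraMap, ← weylFieldEquiv_algebraMap]
    exact h1 l
  have h3 : ∀ l : Lat n, (fun i => l (w.right⁻¹ i)) = (fun i => l (w'.right⁻¹ i)) ∧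
      -∑ i, lat w i * l (w.right⁻¹ i) = -∑ i, lat w' i * l (w'.right⁻¹ i) := fun l => by
    have h4 := h2 l
    rw [weylAct_mono, weylAct_mono, mono, mono, AddMonoidAlgebra.smul_single,
      AddMonoidAlgebra.smul_single] at h4
    have h5 := AddMonoidAlgebra.single_inj.mp h4
    have hu : Function.Injective fun m : ℤ => ((q.unit ^ m : ℂˣ) : ℂ) := fun a b hab => by
      have h6 : ((q : ℝ) : ℂ) ^ a = ((q : ℝ) : ℂ) ^ b := by
        simpa [QParam.unit] using hab
      have h7 : (q : ℝ) ^ a = (q : ℝ) ^ b := by exact_mod_cast h6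
      exact zpow_right_injective₀ q.2.1 q.2.2.ne h7
    rcases h5 with h5 | h5
    · exact ⟨h5.1, hu (by simp only [smul_eq_mul, mul_one] at h5; exact h5.2)⟩
    · rw [smul_eq_mul, mul_one] at h5
      exact absurd h5.1 (Units.ne_zero _)
  have h6 : w.right = w'.right := by
    refine inv_injective (Equiv.ext fun i => ?_)
    have := congrFun (h3 (eps (w.right⁻¹ i))).1 i
    rw [eps_eq_ind, eps_eq_ind, ind_true rfl] at this
    by_contra h7
    rw [ind_false (Ne.symm h7)] at this
    exact one_ne_zero this
  refine weyl_ext h6 fun i => ?_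
  have := (h3 (eps (w.right⁻¹ i))).2
  rw [h6] at this
  simpa [eps_eq_ind, ind] using this

/-- Dedekind's independence of distinct homomorphisms. -/
theorem opIndep_weylOp : OpIndep fun w : Weyl n => weylOp q w :=
  opIndep_toLinearMap (fun w : Weyl n => (weylFieldEquiv q w : RatFn n →ₐ[ℂ] RatFn n))
    fun _ _ hw => weylFieldEquiv_injective q (AlgEquiv.ext fun f => DFunLike.congr_fun hw f)

theorem ratioX_ne_algebraMap (a : Fin (n + 1)) (c : ℂ) :
    ratioX a ≠ algebraMap ℂ (RatFn n) c := by
  intro h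
  have h1 : mono (eps a.castSucc - eps a.succ) = algebraMap ℂ (Reg n) c :=
    IsFractionRing.injective (Reg n) (RatFn n) h
  rw [mono, AddMonoidAlgebra.coe_algebraMap] at h1
  rcases AddMonoidAlgebra.single_inj.mp h1 with h2 | h2
  · have h3 := congrFun h2.1 a.castSucc
    simp [eps, Fin.ext_iff] at h3
  · exact one_ne_zero h2.1

theorem ckX_ne_zero (a : Fin (n + 1)) : ckX k a ≠ 0 := by
  refine div_ne_zero (fun h => ?_) (sub_ne_zero.mpr (ratioX_ne_one a).symm)
  refine ratioX_ne_algebraMap a ((k : ℂ)⁻¹ * (k : ℂ)⁻¹) ?_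
  have hk : algebraMap ℂ (RatFn n) ((k : ℂ)⁻¹) * algebraMap ℂ (RatFn n) (k : ℂ) = 1 := by
    rw [← map_mul]; simp
  rw [map_mul]
  linear_combination -algebraMap ℂ (RatFn n) ((k : ℂ)⁻¹) * h + (-ratioX a) * hk

variable {q}

theorem weylOp_mul_opT (w : Weyl n) (a : Fin (n + 1)) : weylOp q w * opT q k a =
    mulOp (weylFieldEquiv q w (algebraMap ℂ _ (k : ℂ) - ckX k a)) * weylOp q w +
      mulOp (weylFieldEquiv q w (ckX k a)) * weylOp q (w * ofPerm (simplePerm a)) := by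
  have h1 : mulOp (algebraMap ℂ _ (k : ℂ) - ckX k a) = algebraMap ℂ (Op n) k - mulOp (ckX k a) := by
    rw [eq_sub_iff_add_eq, ← mulOp_add, sub_add_cancel, mulOp_algebraMap]
  have : opT q k a = mulOp (algebraMap ℂ _ (k : ℂ) - ckX k a) +
      mulOp (ckX k a) * weylOp q (ofPerm (simplePerm a)) := by
    rw [opT, h1, mul_sub, mul_one]
    abel
  rw [this, mul_add, ← mul_assoc, weylOp_mulOp, weylOp_mulOp, mul_assoc, ← weylOp_mul]

theorem HasLead.mul_opT {h : Op n} {w : Weyl n} {r : ℤ} (hl : HasLead (weylOp q) h w r)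
    (hw : ell w ≤ r) (a : Fin (n + 1)) :
    HasLead (weylOp q) (h * opT q k a) (w * ofPerm (simplePerm a)) (r + 2) :=
  hl.mul hw (fun v => (map_ne_zero_iff _ (weylFieldEquiv q v).injective).mpr (ckX_ne_zero k a))
    (fun v => weylOp_mul_opT k v a) fun v => ell_mul_simple_le v a

theorem HasLead.mul_piW_pow {h : Op n} {w : Weyl n} {r : ℤ} (hl : HasLead (weylOp q) h w r)
    (m : ℕ) : HasLead (weylOp q) (h * weylOp q (piW n ^ m)) (w * piW n ^ m) r :=
  hl.mul_of_ell_eq (fun v => (weylOp_mul q v _).symm) fun v => by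
    rw [← zpow_natCast, ell_mul_piW_zpow]

theorem ell_mul_ofPerm_le (w : Weyl n) (u : Perm n) :
    ell (w * ofPerm u) ≤ ell w + ell (ofPerm u) := by
  induction u using perm_induction with
  | one => simp [ell_one]
  | step u a h ih =>
    rw [ell_ascent h, ofPerm_mul, ← mul_assoc]
    have := ell_mul_simple_le (w * ofPerm u) a
    omega

theorem HasLead.mul_opTw {h : Op n} {w : Weyl n} {r : ℤ} (hl : HasLead (weylOp q) h w r) (hw : ell w ≤ r)
    (u : Perm n) : HasLead (weylOp q) (h * opTw q k u) (w * ofPerm u) (r + ell (ofPerm u)) := by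
  induction u using perm_induction with
  | one => simpa [ell_one, opTw_one] using hl
  | step u a h ih =>
    rw [ell_ascent h, ofPerm_mul, ← mul_assoc, ← opTw_mul_of_ascent q k h, ← mul_assoc, ← add_assoc]
    exact ih.mul_opT k ((ell_mul_ofPerm_le w u).trans (by omega)) a

theorem lat_perm_transl (u : Perm n) (l : Lat n) (i : Fin (n + 2)) :
    lat (ofPerm u * transl l) (u i) = l i := by simp

/-- For dominant weights, `gap` is nonnegative for all `i ≤ j`, so that no cancellation occurs in
the absolute values. -/
theorem ell_mul_transl {l m : Lat n} (hl : Antitone l) (hm : Antitone m) (u : Perm n) :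
    ell (ofPerm u * transl (l + m)) = ell (ofPerm u * transl l) + ell (transl m) := by
  simp only [ell]
  rw [← Finset.sum_add_distrib]
  refine Finset.sum_congr rfl fun i _ => ?_
  rw [← Finset.sum_add_distrib]
  refine Finset.sum_congr rfl fun j _ => ?_
  have h1 : gap (ofPerm u * transl (l + m)) i j =
      gap (ofPerm u * transl l) i j + gap (transl m) i j := by
    simp [gap]; ring
  rw [h1]
  have hn : ∀ p, 0 ≤ ind p := fun p => by unfold ind; split_ifs <;> simp
  have key : ∀ i j : Fin (n + 2), i ≤ j →
      0 ≤ gap (ofPerm u * transl l) i j ∧ 0 ≤ gap (transl m) i j := fun i j hij => by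
    have h2 := hl hij
    have h3 := hm hij
    have h4 : ind (j < i) = 0 := ind_false (not_lt.mpr hij)
    have h5 := hn (u j < u i)
    constructor
    · simp [gap, h4]; omega
    · simp [gap]; omega
  rcases le_total i j with hij | hij
  · obtain ⟨h2, h3⟩ := key i j hij
    rw [abs_of_nonneg h2, abs_of_nonneg h3, abs_of_nonneg (add_nonneg h2 h3)]
  · obtain ⟨h2, h3⟩ := key j i hij
    rw [gap_swap, gap_swap (transl m), ← neg_add, abs_neg, abs_neg, abs_neg, abs_of_nonneg h2,
      abs_of_nonneg h3, abs_of_nonneg (add_nonneg h2 h3)]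

theorem antitone_fund (r : ℕ) : Antitone (fund r : Lat n) := fun i j hij => by
  unfold fund ind
  have : (i : ℕ) ≤ j := hij
  split_ifs <;> omega

/-- The sums of fundamental weights. -/
def fundCone (n : ℕ) : AddSubmonoid (Lat n) :=
  AddSubmonoid.closure (Set.range fun r : Fin (n + 2) => fund ((r : ℕ) + 1))

/-- By `opY_fund`, a dominant `Y^l` is a product of powers of `π` and elements `T_w`. The lengths of
all these factors add up, so the leading term is exactly the product of the corresponding elements
of `W`. -/
theorem hasLead_opTw_opY (u : Perm n) {l : Lat n} (hl : l ∈ fundCone n) :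
    HasLead (weylOp q) (opTw q k u * opY q k l) (ofPerm u * transl l) (ell (ofPerm u * transl l)) := by
  suffices h : Antitone l ∧ HasLead (weylOp q) (opTw q k u * opY q k l) (ofPerm u * transl l)
    (ell (ofPerm u * transl l)) from h.2
  refine AddSubmonoid.closure_induction_right (motive := fun l _ => Antitone l ∧
    HasLead (weylOp q) (opTw q k u * opY q k l) (ofPerm u * transl l) (ell (ofPerm u * transl l)))
    ⟨antitone_const, ?_⟩ ?_ hl
  · rw [opY_zero, transl_zero, mul_one, mul_one]
    simpa using (hasLead_one (weylOp_one q)).mul_opTw k (by rw [ell_one]) u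
  · rintro l - _ ⟨r, rfl⟩ ⟨h1, h2⟩
    have hr : (r : ℕ) + 1 ≤ n + 2 := r.isLt
    refine ⟨h1.add (antitone_fund _), ?_⟩
    rw [opY_add, ← mul_assoc, opY_fund q k hr, ell_mul_transl h1 (antitone_fund _), transl_add,
      transl_fund hr, ← mul_assoc, ← mul_assoc, ← mul_assoc]
    have h3 := (h2.mul_piW_pow ((r : ℕ) + 1)).mul_opTw k (w := ofPerm u * transl l * piW n ^ ((r : ℕ) + 1))
      (by rw [← zpow_natCast, ell_mul_piW_zpow]) (rot n ^ ((r : ℕ) + 1))⁻¹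
    have h4 : ell (piW n ^ ((r : ℕ) + 1) * ofPerm (rot n ^ ((r : ℕ) + 1))⁻¹) =
        ell (ofPerm (rot n ^ ((r : ℕ) + 1))⁻¹) := by
      have : ∀ (m : ℕ) (w : Weyl n), ell (piW n ^ m * w) = ell w := fun m w => by
        induction m with
        | zero => simp
        | succ m ih => rw [pow_succ', mul_assoc, ell_piW_mul, ih]
      exact this _ _
    rw [h4]
    exact h3

theorem eps_eq_fund (i : Fin (n + 2)) : (eps i : Lat n) = fund ((i : ℕ) + 1) - fund i := by
  funext j
  rw [Pi.sub_apply, eps_eq_ind]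
  simp only [fund, ind, Fin.ext_iff]
  split_ifs <;> omega

theorem fund_mem (r : ℕ) (hr : r ≤ n + 2) : (fund r : Lat n) ∈ fundCone n := by
  rcases r with _ | r
  · convert zero_mem (fundCone n)
    funext j; exact ind_false (by omega)
  · exact AddSubmonoid.subset_closure ⟨⟨r, by omega⟩, rfl⟩

theorem exists_shift_mem (s : Finset (Lat n)) : ∃ m, ∀ l ∈ s, l + m ∈ fundCone n := by
  have h : ∀ l : Lat n, ∃ m ∈ fundCone n, l + m ∈ fundCone n := fun l => by
    induction l using lat_induction with
    | zero => exact ⟨0, zero_mem _, zero_mem _⟩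
    | add l i ih =>
      obtain ⟨m, hm, h⟩ := ih
      refine ⟨m + fund i, add_mem hm (fund_mem _ i.isLt.le), ?_⟩
      have := add_mem h (fund_mem ((i : ℕ) + 1) i.isLt)
      rw [eps_eq_fund]
      convert this using 1; abel
    | sub l i ih =>
      obtain ⟨m, hm, h⟩ := ih
      refine ⟨m + fund ((i : ℕ) + 1), add_mem hm (fund_mem _ i.isLt), ?_⟩
      have := add_mem h (fund_mem (i : ℕ) i.isLt.le)
      rw [eps_eq_fund]
      convert this using 1; abel
  choose m hm h using h
  refine ⟨∑ l ∈ s, m l, fun l hl => ?_⟩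
  classical
  rw [← Finset.add_sum_erase _ _ hl, ← add_assoc]
  exact add_mem (h l) (sum_mem fun j _ => hm j)

/-- Right multiplication by a suitable `Y^m` makes the finitely many exponents in a relation
dominant. The leading terms `u · (l + m)` are then known and pairwise distinct. -/
theorem opIndep_opTw_opY : OpIndep fun b : Perm n × Lat n => opTw q k b.1 * opY q k b.2 := by
  classical
  intro s g hg
  obtain ⟨m, hm⟩ := exists_shift_mem (s.image Prod.snd)
  have h : OpIndep fun b : s => opTw q k b.1.1 * opY q k (b.1.2 + m) :=
    opIndep_of_hasLead (opIndep_weylOp q) (w := fun b : s => ofPerm b.1.1 * transl (b.1.2 + m))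
      (fun b b' hb => by
        have h1 : b.1.1 = b'.1.1 := by simpa using congrArg (fun w : Weyl n => w.right) hb
        refine Subtype.ext (Prod.ext h1 (funext fun i => ?_))
        have h2 := congrArg (fun w : Weyl n => lat w (b.1.1 i)) hb
        simp only [lat_perm_transl] at h2
        rw [h1, lat_perm_transl] at h2
        simpa using h2)
      fun b => hasLead_opTw_opY k _ (hm _ (Finset.mem_image_of_mem _ b.2))
  intro b hb
  refine h s.attach (fun b => g b.1) ?_ ⟨b, hb⟩ (Finset.mem_attach _ _)
  have h1 := congrArg (fun x => x * opY q k m) hg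
  simp only [Finset.sum_mul, zero_mul] at h1
  refine Eq.trans ?_ ((Finset.sum_attach s fun b => LinearMap.mulLeft ℂ (g b) *
    (opTw q k b.1 * opY q k b.2) * opY q k m).trans h1)
  refine Finset.sum_congr rfl fun b _ => ?_
  simp only [opY_add, mul_assoc]

/-- `∑ f_{u,m}(X) T_u Y^m` for rational functions `f_{u,m}`. -/
def ratMap (q : QParam) (k : ℂˣ) : (Perm n × Lat n →₀ RatFn n) →+ Op n :=
  Finsupp.liftAddHom fun b =>
    { toFun := fun f => mulOp f * (opTw q k b.1 * opY q k b.2)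
      map_zero' := by rw [← map_zero (algebraMap ℂ (RatFn n)), mulOp_algebraMap, map_zero, zero_mul]
      map_add' := fun f g => by rw [mulOp_add, add_mul] }

theorem ratMap_single (b : Perm n × Lat n) (f : RatFn n) :
    ratMap q k (Finsupp.single b f) = mulOp f * (opTw q k b.1 * opY q k b.2) :=
  Finsupp.liftAddHom_apply_single _ _ _

theorem ratMap_injective : Function.Injective (ratMap (n := n) q k) := by
  rw [injective_iff_map_eq_zero]
  intro x hx
  ext b
  by_contra h
  exact h (opIndep_opTw_opY k x.support x hx b (Finsupp.mem_support_iff.mpr h))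

/-- The coefficients of the elements of `ℍ` as rational functions. -/
def toRat : (PBWIndex n →₀ ℂ) →+ (Perm n × Lat n →₀ RatFn n) :=
  Finsupp.liftAddHom fun b =>
    { toFun := fun c => Finsupp.single (b.2, b.1.2) (c • ratMono b.1.1)
      map_zero' := by rw [zero_smul, Finsupp.single_zero]
      map_add' := fun c d => by rw [add_smul, Finsupp.single_add] }

theorem toRat_single (b : PBWIndex n) (c : ℂ) :
    toRat (Finsupp.single b c) = Finsupp.single (b.2, b.1.2) (c • ratMono b.1.1) :=
  Finsupp.liftAddHom_apply_single _ _ _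

theorem pbwMap_single (b : PBWIndex n) (c : ℂ) : pbwMap q k (Finsupp.single b c) =
    c • (opX b.1.1 * opTw q k b.2 * opY q k b.1.2) :=
  Finsupp.linearCombination_single _ _ _

theorem pbwMap_eq (x : PBWIndex n →₀ ℂ) : pbwMap q k x = ratMap q k (toRat x) := by
  have : (pbwMap (n := n) q k).toAddMonoidHom = (ratMap q k).comp toRat := by
    refine Finsupp.addHom_ext fun b c => ?_
    refine (pbwMap_single k b c).trans ?_
    rw [AddMonoidHom.comp_apply, toRat_single, ratMap_single, mulOp_smul, smul_mul_assoc, mul_assoc]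
    rfl
  exact DFunLike.congr_fun this x

theorem toRat_apply (x : PBWIndex n →₀ ℂ) (u : Perm n) (m : Lat n) : toRat x (u, m) =
    algebraMap (Reg n) (RatFn n) (AddMonoidAlgebra.ofCoeff
      (x.comapDomain (fun l => ((l, m), u)) fun l _ l' _ h => by simpa using h)) := by
  classical
  induction x using Finsupp.induction_linear with
  | zero => 
    rw [map_zero, Finsupp.comapDomain_zero]; simp
  | add x y hx hy =>
    rw [map_add, Finsupp.add_apply, hx, hy, ← map_add, ← AddMonoidAlgebra.ofCoeff_add]
    congr 2
    ext l
    rfl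
  | single b c =>
    obtain ⟨⟨l, m'⟩, u'⟩ := b
    rw [toRat_single]
    by_cases h : u' = u ∧ m' = m
    · obtain ⟨rfl, rfl⟩ := h
      rw [Finsupp.single_eq_same, ratMono, Algebra.smul_def, IsScalarTower.algebraMap_apply ℂ (Reg n),
        ← map_mul, ← Algebra.smul_def]
      congr 1
      rw [mono, AddMonoidAlgebra.smul_single, smul_eq_mul, mul_one, AddMonoidAlgebra.single]
      congr 1
      ext l'
      change _ = Finsupp.single ((l, m'), u') c ((l', m'), u')
      simp [Finsupp.single_apply]
    · rw [Finsupp.single_apply, if_neg (by simpa using h)]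
      have : (Finsupp.single ((l, m'), u') c).comapDomain (fun l => ((l, m), u))
          (fun l _ l' _ h => by simpa using h) = 0 := by
        ext l'
        change Finsupp.single ((l, m'), u') c ((l', m), u) = 0
        rw [Finsupp.single_apply, if_neg (by simp; tauto)]
      rw [this]; simp

theorem toRat_injective : Function.Injective (toRat (n := n)) := by
  intro x y h
  ext ⟨⟨l, m⟩, u⟩
  have h1 := DFunLike.congr_fun h (u, m)
  rw [toRat_apply, toRat_apply] at h1
  have h2 := AddMonoidAlgebra.ofCoeff_injective (IsFractionRing.injective (Reg n) (RatFn n) h1)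
  exact DFunLike.congr_fun h2 l

/-- Independence over `ℂ(T)` implies independence over `ℂ[T]`, and the monomials in `X` are
independent over `ℂ`. Injectivity suffices in what follows: `dualGraph` records an expansion for
each element to which the anti-involution is applied. -/
theorem pbwMap_injective : Function.Injective (pbwMap (n := n) q k) := fun x y h => by
  rw [pbwMap_eq, pbwMap_eq] at h
  exact toRat_injective (ratMap_injective k h)

theorem pbwCoord_pbwMap (x : PBWIndex n →₀ ℂ) : pbwCoord q k (pbwMap q k x) = x :=
  Function.leftInverse_invFun (pbwMap_injective k) x

end

end BqKZ
end
noncomputable section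
namespace BqKZ

/-! ### The duality anti-involution -/

section
variable {n : ℕ} (q : QParam) (k : ℂˣ)

/-- The map on the index set of the basis that describes the anti-involution. -/
def dualIndex (b : PBWIndex n) : PBWIndex n := ((-b.1.2, -b.1.1), b.2⁻¹)

/-- The graph of the anti-involution. -/
def dualGraph : Submodule ℂ (Op n × Op n) :=
  LinearMap.range ((pbwMap q k).prod ((pbwMap q k).comp (Finsupp.lmapDomain ℂ ℂ dualIndex)))

variable {q k}

theorem dual_eq {h h' : Op n} (hh : (h, h') ∈ dualGraph q k) : dual q k h = h' := by
  obtain ⟨x, hx⟩ := hh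
  have h1 : pbwMap q k x = h := congrArg Prod.fst hx
  have h2 : pbwMap q k (x.mapDomain dualIndex) = h' := congrArg Prod.snd hx
  rw [dual, ← h1, pbwCoord_pbwMap, ← h2]
  rfl

theorem mem_dualGraph (b : PBWIndex n) : (opX b.1.1 * opTw q k b.2 * opY q k b.1.2,
    opX (-b.1.2) * opTw q k b.2⁻¹ * opY q k (-b.1.1)) ∈ dualGraph q k := by
  refine ⟨Finsupp.single b 1, ?_⟩
  refine Prod.ext ?_ ?_
  · exact (pbwMap_single k b 1).trans (one_smul _ _)
  · change pbwMap q k (Finsupp.mapDomain dualIndex (Finsupp.single b 1)) = _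
    rw [Finsupp.mapDomain_single, pbwMap_single, one_smul]
    rfl

variable (q k) in
/-- The pairs `(a, b)` such that `(a h, h' b)` is in the graph of the anti-involution whenever
`(h, h')` is. -/
def IsDualPair (a b : Op n) : Prop :=
  ∀ h h' : Op n, (h, h') ∈ dualGraph q k → (a * h, h' * b) ∈ dualGraph q k

theorem isDualPair_of_basis {a b : Op n} (hab : ∀ l w m,
    (a * (opX l * opTw q k w * opY q k m), opX (-m) * opTw q k w⁻¹ * opY q k (-l) * b) ∈
      dualGraph q k) : IsDualPair q k a b := by
  rintro h h' ⟨x, hx⟩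
  have h1 : pbwMap q k x = h := congrArg Prod.fst hx
  have h2 : pbwMap q k (x.mapDomain dualIndex) = h' := congrArg Prod.snd hx
  subst h1 h2
  clear hx
  induction x using Finsupp.induction_linear with
  | zero =>
    rw [Finsupp.mapDomain_zero, map_zero, mul_zero, zero_mul]
    exact zero_mem _
  | add x y hx hy =>
    rw [Finsupp.mapDomain_add, map_add, map_add, mul_add, add_mul]
    exact add_mem hx hy
  | single i c =>
    rw [Finsupp.mapDomain_single, pbwMap_single, pbwMap_single, mul_smul_comm, smul_mul_assoc]
    exact Submodule.smul_mem _ c (hab i.1.1 i.2 i.1.2)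

theorem IsDualPair.mul {a b a' b' : Op n} (h : IsDualPair q k a b) (h' : IsDualPair q k a' b') :
    IsDualPair q k (a * a') (b' * b) := fun x y hxy => by
  rw [mul_assoc, ← mul_assoc y]; exact h _ _ (h' _ _ hxy)

theorem IsDualPair.add {a b a' b' : Op n} (h : IsDualPair q k a b) (h' : IsDualPair q k a' b') :
    IsDualPair q k (a + a') (b + b') := fun x y hxy => by
  rw [add_mul, mul_add]; exact add_mem (h _ _ hxy) (h' _ _ hxy)

theorem IsDualPair.smul {a b : Op n} (c : ℂ) (h : IsDualPair q k a b) :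
    IsDualPair q k (c • a) (c • b) := fun x y hxy => by
  rw [smul_mul_assoc, mul_smul_comm]; exact Submodule.smul_mem _ c (h _ _ hxy)

theorem isDualPair_one : IsDualPair q k (1 : Op n) 1 := fun x y hxy => by
  rwa [one_mul, mul_one]

theorem isDualPair_opX (l : Lat n) : IsDualPair q k (opX l) (opY q k (-l)) :=
  isDualPair_of_basis fun l' w m => by
    have := mem_dualGraph (q := q) (k := k) ((l + l', m), w)
    simp only at this
    rw [neg_add, opX_add, add_comm (-l), opY_add] at this
    simpa only [mul_assoc] using this

/-- Induction on the exponent of `X`. A cross relation and its mirror image have the same exponents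
and the same scalar, so both components of the pair change by the same combination. For exponent `0`
the left and right multiplication rules of `H_0` correspond under `w ↦ w⁻¹`. -/
theorem isDualPair_opT (a : Fin (n + 1)) : IsDualPair q k (opT q k a) (opT q k a) := by
  refine isDualPair_of_basis fun l => ?_
  have key : ∀ l e : Lat n, (∃ i, e = eps i ∨ e = -eps i) → (∀ w m,
      (opT q k a * (opX l * opTw q k w * opY q k m),
        opX (-m) * opTw q k w⁻¹ * opY q k (-l) * opT q k a) ∈ dualGraph q k) → ∀ w m,
      (opT q k a * (opX (l + e) * opTw q k w * opY q k m),
        opX (-m) * opTw q k w⁻¹ * opY q k (-(l + e)) * opT q k a) ∈ dualGraph q k := by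
    intro l e he ih w m
    obtain ⟨e', e'', c, h1, h2⟩ := exists_cross_relation q k a e he
    have h3 := isDualPair_opX e' _ _ (ih w m)
    have h4 := Submodule.smul_mem _ c (mem_dualGraph (q := q) (k := k) ((e'' + l, m), w))
    have h5 := add_mem h3 h4
    convert h5 using 1
    refine Prod.ext ?_ ?_
    · change opT q k a * (opX (l + e) * opTw q k w * opY q k m) =
        opX e' * (opT q k a * (opX l * opTw q k w * opY q k m)) +
          c • (opX (e'' + l) * opTw q k w * opY q k m)
      rw [add_comm l, opX_add, opX_add]
      simp only [← mul_assoc]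
      rw [h1]
      simp only [add_mul, smul_mul_assoc]
    · change opX (-m) * opTw q k w⁻¹ * opY q k (-(l + e)) * opT q k a =
        opX (-m) * opTw q k w⁻¹ * opY q k (-l) * opT q k a * opY q k (-e') +
          c • (opX (-m) * opTw q k w⁻¹ * opY q k (-(e'' + l)))
      rw [neg_add, opY_add, add_comm e'', neg_add, opY_add]
      simp only [mul_assoc]
      rw [h2]
      simp only [mul_add, mul_smul_comm]
  induction l using lat_induction with
  | zero =>
    intro w m
    rw [neg_zero, opX_zero, one_mul, opY_zero, mul_one, ← mul_assoc, mul_assoc (opX _)]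
    have hG := fun w => mem_dualGraph (q := q) (k := k) (n := n) ((0, m), w)
    simp only [neg_zero, opX_zero, one_mul, opY_zero, mul_one] at hG
    have h0 := hG (simplePerm a * w)
    rw [mul_inv_rev, simplePerm_inv] at h0
    rcases ascent_or_descent w⁻¹ a with h | h
    · rw [opT_mul_of_ascent q k h, opTw_mul_of_ascent q k h]
      exact h0
    · rw [opT_mul_of_descent q k h, opTw_mul_of_descent q k h, add_mul, mul_add, smul_mul_assoc,
        mul_smul_comm]
      exact add_mem h0 (Submodule.smul_mem _ (kk k) (hG w))
  | add l i ih => exact key l (eps i) ⟨i, Or.inl rfl⟩ ih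
  | sub l i ih =>
    rw [sub_eq_add_neg]
    exact key l (-eps i) ⟨i, Or.inr rfl⟩ ih

/-- The same scalar and the same index occur in both products. This identifies `unitP` as the image
of `π` under the anti-involution. -/
theorem piW_basis (l m : Lat n) (w : Perm n) : ∃ (c : ℂˣ) (b : PBWIndex n),
    b = (((fun i => l ((rot n)⁻¹ i)), eps (w⁻¹ (Fin.last (n + 1))) + m), rot n * w) ∧
    weylOp q (piW n) * (opX l * opTw q k w * opY q k m) =
      (c : ℂ) • (opX b.1.1 * opTw q k b.2 * opY q k b.1.2) ∧
    opX (-m) * opTw q k w⁻¹ * opY q k (-l) * ((unitP q k : (Op n)ˣ) : Op n) =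
      (c : ℂ) • (opX (-b.1.2) * opTw q k b.2⁻¹ * opY q k (-b.1.1)) := by
  refine ⟨q.unit ^ (-l (Fin.last (n + 1))), _, rfl, ?_, ?_⟩
  · simp only
    rw [← mul_assoc, ← mul_assoc, weylOp_piW_opX, smul_mul_assoc, smul_mul_assoc,
      mul_assoc (opX _), weylOp_piW_opTw, opY_add]
    simp only [mul_assoc]
  · simp only
    rw [mul_assoc, opY_neg_mul_unitP, mul_smul_comm, ← mul_assoc, mul_assoc (opX (-m)),
      opTw_mul_unitP, neg_add, add_comm (-eps _), opX_add]
    simp only [mul_assoc]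

theorem isDualPair_piW :
    IsDualPair q k (weylOp q (piW n)) ((unitP q k : (Op n)ˣ) : Op n) :=
  isDualPair_of_basis fun l w m => by
    obtain ⟨c, b, -, h1, h2⟩ := piW_basis (q := q) (k := k) l m w
    rw [h1, h2]
    exact Submodule.smul_mem _ _ (mem_dualGraph b)

theorem isDualPair_inv (a b : (Op n)ˣ) (h : ∀ l w m, ∃ x y : Op n, (x, y) ∈ dualGraph q k ∧
    (a : Op n) * x = opX l * opTw q k w * opY q k m ∧
      y * (b : Op n) = opX (-m) * opTw q k w⁻¹ * opY q k (-l)) :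
    IsDualPair q k ((a⁻¹ : (Op n)ˣ) : Op n) ((b⁻¹ : (Op n)ˣ) : Op n) :=
  isDualPair_of_basis fun l w m => by
    obtain ⟨x, y, hxy, h1, h2⟩ := h l w m
    rwa [← h1, ← h2, Units.inv_mul_cancel_left, Units.mul_inv_cancel_right]

theorem isDualPair_piW_inv :
    IsDualPair q k (weylOp q (piW n)⁻¹) (((unitP q k)⁻¹ : (Op n)ˣ) : Op n) := by
  refine isDualPair_inv (unitPi q) (unitP q k) fun l w m => ?_
  -- The indices are chosen so that `π` maps this basis element to a multiple of the given one, `X^l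
  -- T_w Y^m`.
  obtain ⟨c, b, hb, h1, h2⟩ := piW_basis (q := q) (k := k) (fun i => l (rot n i))
    (m - eps (((rot n)⁻¹ * w)⁻¹ (Fin.last (n + 1)))) ((rot n)⁻¹ * w)
  have e : (fun i => l ((rot n) ((rot n)⁻¹ i))) = l := by funext i; rw [perm_apply_inv]
  rw [e, mul_inv_cancel_left, add_sub_cancel] at hb
  subst hb
  have h3 := Submodule.smul_mem _ (c : ℂ)⁻¹ (mem_dualGraph (q := q) (k := k)
    (((fun i => l (rot n i)), m - eps (((rot n)⁻¹ * w)⁻¹ (Fin.last (n + 1)))), (rot n)⁻¹ * w))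
  refine ⟨_, _, h3, ?_, ?_⟩
  · exact (mul_smul_comm _ _ _).trans ((congrArg _ h1).trans (inv_smul_smul₀ c.ne_zero _))
  · exact (smul_mul_assoc _ _ _).trans ((congrArg _ h2).trans (inv_smul_smul₀ c.ne_zero _))

variable (q k) in
/-- The operator is in the domain of the anti-involution, compatibly with products. -/
def HasDual (a : Op n) : Prop := ∃ b, IsDualPair q k a b

theorem IsDualPair.mem {a b : Op n} (h : IsDualPair q k a b) : (a, b) ∈ dualGraph q k := by
  have h1 := mem_dualGraph (q := q) (k := k) (n := n) ((0, 0), 1)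
  simp only [neg_zero, opX_zero, opY_zero, inv_one, opTw_one, mul_one] at h1
  simpa using h _ _ h1

theorem HasDual.isDualPair {a : Op n} (h : HasDual q k a) : IsDualPair q k a (dual q k a) := by
  obtain ⟨b, hb⟩ := h
  rwa [dual_eq hb.mem]

theorem HasDual.mul {a b : Op n} (ha : HasDual q k a) (hb : HasDual q k b) :
    HasDual q k (a * b) :=
  ⟨_, ha.isDualPair.mul hb.isDualPair⟩

theorem HasDual.list_prod {L : List (Op n)} (h : ∀ a ∈ L, HasDual q k a) : HasDual q k L.prod := by
  induction L with
  | nil => exact ⟨1, isDualPair_one⟩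
  | cons a L ih =>
    rw [List.prod_cons]
    exact (h a (by simp)).mul (ih fun b hb => h b (by simp [hb]))

theorem hasDual_piW_zpow (m : ℤ) : HasDual q k (weylOp q (piW n ^ m)) := by
  have h1 : HasDual q k (weylOp q (piW n)) := ⟨_, isDualPair_piW⟩
  have h2 : HasDual q k (weylOp q (piW n)⁻¹) := ⟨_, isDualPair_piW_inv⟩
  induction m with
  | zero => rw [zpow_zero, weylOp_one]; exact ⟨1, isDualPair_one⟩
  | succ m ih => rw [zpow_add_one, weylOp_mul]; exact ih.mul h1
  | pred m ih => rw [zpow_sub_one, weylOp_mul]; exact ih.mul h2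

/-! ### Intertwiners -/

theorem opT_eq (a : Fin (n + 1)) : opT q k a = mulOp (algebraMap ℂ _ (k : ℂ) - ckX k a) +
    mulOp (ckX k a) * weylOp q (ofPerm (simplePerm a)) := by
  have h1 : mulOp (algebraMap ℂ _ (k : ℂ) - ckX k a) = algebraMap ℂ (Op n) k - mulOp (ckX k a) := by
    rw [eq_sub_iff_add_eq, ← mulOp_add, sub_add_cancel, mulOp_algebraMap]
  rw [opT, h1, mul_sub, mul_one]
  abel

theorem ratMono_neg_simpleRoot (a : Fin (n + 1)) :
    ratMono (eps a.succ - eps a.castSucc) = (ratioX a)⁻¹ := by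
  rw [ratioX_eq, ← ratMono_neg, simpleRoot, neg_sub]

theorem ratioX_ne_zero (a : Fin (n + 1)) : ratioX a ≠ 0 := ratMono_ne_zero _

theorem algebraMap_dGen_succ (a : Fin (n + 1)) :
    algebraMap (Reg n) (RatFn n) (dGen q k a.succ) =
      algebraMap ℂ _ (k : ℂ) - algebraMap ℂ _ ((k : ℂ)⁻¹) * (ratioX a)⁻¹ := by
  rw [← ratMono_neg_simpleRoot]
  change algebraMap (Reg n) (RatFn n) ((k : ℂ) • 1 - (k : ℂ)⁻¹ • mono (eps a.succ - eps a.castSucc))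
    = _
  rw [map_sub, Algebra.smul_def, Algebra.smul_def, map_mul, map_mul, map_one, mul_one,
    ← IsScalarTower.algebraMap_apply, ← IsScalarTower.algebraMap_apply]
  rfl

theorem dGen_identity {F : Type*} [Field F] {z : F} (c d : F) (h0 : z ≠ 0) (h1 : 1 - z ≠ 0) :
    (1 - z⁻¹) * (c - (d - c * z) / (1 - z)) + (c - d) * z⁻¹ = 0 ∧
      (1 - z⁻¹) * ((d - c * z) / (1 - z)) = c - d * z⁻¹ := by
  constructor <;> · field_simp; ring

/-- The factor `1 - x_{a+1} / x_a` cancels the denominator of `c_k`, so the intertwiner is a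
polynomial expression in `X` and `T_a`, to which the anti-involution extends. -/
theorem interGen_succ_eq_opT (a : Fin (n + 1)) : interGen q k a.succ =
    mulOp (1 - (ratioX a)⁻¹) * opT q k a +
      mulOp (algebraMap ℂ _ ((k : ℂ) - (k : ℂ)⁻¹) * (ratioX a)⁻¹) := by
  have h0 := ratioX_ne_zero a
  have h1 : (1 : RatFn n) - ratioX a ≠ 0 := sub_ne_zero.mpr (ratioX_ne_one a).symm
  rw [opT_eq, mul_add, ← mul_assoc, ← mulOp_mul, ← mulOp_mul, add_right_comm, ← mulOp_add, interGen,
    algebraMap_dGen_succ]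
  obtain ⟨e1, e2⟩ := dGen_identity (algebraMap ℂ (RatFn n) (k : ℂ))
    (algebraMap ℂ (RatFn n) ((k : ℂ)⁻¹)) h0 h1
  rw [← map_sub, ← map_zero (algebraMap ℂ (RatFn n))] at e1
  change _ * (_ - ckX k a) + _ = _ at e1
  change _ * ckX k a = _ at e2
  rw [e1, e2, mulOp_algebraMap, map_zero, zero_add]
  rfl

theorem algebraMap_dGen_zero : algebraMap (Reg n) (RatFn n) (dGen q k 0) =
    algebraMap ℂ _ (k : ℂ) - algebraMap ℂ _ ((k : ℂ)⁻¹) *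
      (algebraMap ℂ _ ((q.unit : ℂ)⁻¹) * ratMono (eps 0 - eps (Fin.last (n + 1)))) := by
  change algebraMap (Reg n) (RatFn n) ((k : ℂ) • 1 - ((k : ℂ)⁻¹ * (q.unit : ℂ)⁻¹) •
    mono (eps 0 - eps (Fin.last (n + 1)))) = _
  rw [map_sub, Algebra.smul_def, Algebra.smul_def, map_mul, map_mul, map_one, mul_one,
    ← IsScalarTower.algebraMap_apply, ← IsScalarTower.algebraMap_apply, map_mul, mul_assoc]
  rfl

theorem weylFieldEquiv_piW_ratioX_last :
    weylFieldEquiv q (piW n) (ratioX (Fin.last n))⁻¹ =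
      algebraMap ℂ _ ((q.unit : ℂ)⁻¹) * ratMono (eps 0 - eps (Fin.last (n + 1))) := by
  have e1 : (fun i => (eps (Fin.last n).succ - eps (Fin.last n).castSucc : Lat n) ((rot n)⁻¹ i)) =
      eps 0 - eps (Fin.last (n + 1)) := by
    have h2 := eps_rot (n := n) (Fin.last n).succ
    have h3 := eps_rot (n := n) (Fin.last n).castSucc
    have h4 : rot n (Fin.last n).succ = 0 := by ext; simp
    have h5 : rot n (Fin.last n).castSucc = Fin.last (n + 1) := by
      ext; rw [val_rot, if_neg]
      · rfl
      · simp [Fin.ext_iff]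
    rw [h4] at h2
    rw [h5] at h3
    rw [← h2, ← h3]
    rfl
  have e2 : (eps (Fin.last n).succ - eps (Fin.last n).castSucc : Lat n) (Fin.last (n + 1)) = 1 := by
    rw [Pi.sub_apply, eps_eq_ind, eps_eq_ind, ind_true (by simp), ind_false]
    · rfl
    · simp [Fin.ext_iff]
  rw [← ratMono_neg_simpleRoot, weylFieldEquiv_piW_ratMono, e1, e2, Algebra.smul_def, zpow_neg_one,
    Units.val_inv_eq_inv_val]

theorem interGen_zero : interGen q k (0 : Fin (n + 2)) =
    weylOp q (piW n) * interGen q k (Fin.last n).succ * weylOp q (piW n)⁻¹ := by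
  have h1 : (simpleW (0 : Fin (n + 2)) : Weyl n) =
    piW n * simpleW (Fin.last n).succ * (piW n)⁻¹ := rfl
  have h2 : algebraMap (Reg n) (RatFn n) (dGen q k 0) =
      weylFieldEquiv q (piW n) (algebraMap (Reg n) (RatFn n) (dGen q k (Fin.last n).succ)) := by
    rw [algebraMap_dGen_zero, algebraMap_dGen_succ, map_sub, map_mul, AlgEquiv.commutes,
      AlgEquiv.commutes, weylFieldEquiv_piW_ratioX_last]
  rw [interGen, interGen, h1, h2, weylOp_mul, weylOp_mul]
  simp only [← mul_assoc]
  rw [weylOp_mulOp]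

theorem mulOp_sub (f g : RatFn n) : mulOp (f - g) = mulOp f - mulOp g := by
  rw [eq_sub_iff_add_eq, ← mulOp_add, sub_add_cancel]

theorem hasDual_interGen (j : Fin (n + 2)) : HasDual q k (interGen q k j) := by
  have hs : ∀ a : Fin (n + 1), HasDual q k (interGen q k a.succ) := fun a => by
    have h1 := isDualPair_opX (q := q) (k := k) (eps a.succ - eps a.castSucc)
    have h2 := isDualPair_opT (q := q) (k := k) a
    have h3 : ∀ x : Op n, (-1 : ℂ) • x = -x := fun x => LinearMap.ext fun f => neg_one_smul ℂ (x f)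
    have e : interGen q k a.succ = opT q k a + (-1 : ℂ) • (opX (eps a.succ - eps a.castSucc) *
        opT q k a) + ((k : ℂ) - (k : ℂ)⁻¹) • opX (eps a.succ - eps a.castSucc) := by
      rw [interGen_succ_eq_opT, mulOp_sub, mulOp_one, mulOp_mul, mulOp_algebraMap,
        ← ratMono_neg_simpleRoot, ← opX_eq, sub_mul, one_mul, ← Algebra.smul_def,
        sub_eq_add_neg, h3]
    rw [e]
    exact ⟨_, (h2.add ((h1.mul h2).smul _)).add (h1.smul _)⟩
  induction j using Fin.cases with
  | zero =>
    rw [interGen_zero]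
    exact (HasDual.mul ⟨_, isDualPair_piW⟩ (hs _)).mul ⟨_, isDualPair_piW_inv⟩
  | succ a => exact hs a

theorem hasDual_inter (w : Weyl n) : HasDual q k (inter q k w) := by
  refine (HasDual.list_prod fun a ha => ?_).mul (hasDual_piW_zpow _)
  obtain ⟨j, -, rfl⟩ := List.mem_map.mp ha
  exact hasDual_interGen j

/-! ### Reduced expressions -/

/-- Conjugation by `π` permutes `s_0, …, s_{N-1}` cyclically, so that powers of `π` can be collected
at the right end of any word. -/
theorem exists_piW_mul_simpleW (j : Fin (n + 2)) :
    ∃ j', piW n * simpleW j = simpleW j' * piW n := by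
  induction j using Fin.cases with
  | zero =>
    refine ⟨(0 : Fin (n + 1)).succ, ?_⟩
    change piW n * (piW n * ofPerm (simplePerm (Fin.last n)) * (piW n)⁻¹) =
      ofPerm (simplePerm 0) * piW n
    rw [← mul_assoc, ← mul_assoc, piW_sq_simplePerm]
    group
  | succ a =>
    induction a using Fin.lastCases with
    | last =>
      refine ⟨0, ?_⟩
      change piW n * ofPerm (simplePerm (Fin.last n)) =
        piW n * ofPerm (simplePerm (Fin.last n)) * (piW n)⁻¹ * piW n
      group
    | cast a => exact ⟨a.succ.succ, piW_simplePerm a⟩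

theorem exists_piW_inv_mul_simpleW (j : Fin (n + 2)) :
    ∃ j', (piW n)⁻¹ * simpleW j = simpleW j' * (piW n)⁻¹ := by
  suffices h : ∃ j', piW n * simpleW j' = simpleW j * piW n by
    obtain ⟨j', h⟩ := h
    exact ⟨j', by rw [inv_mul_eq_iff_eq_mul, ← mul_assoc, h, mul_inv_cancel_right]⟩
  induction j using Fin.cases with
  | zero =>
    refine ⟨(Fin.last n).succ, ?_⟩
    change piW n * ofPerm (simplePerm (Fin.last n)) =
      piW n * ofPerm (simplePerm (Fin.last n)) * (piW n)⁻¹ * piW n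
    group
  | succ a =>
    induction a using Fin.cases with
    | zero =>
      refine ⟨0, ?_⟩
      change piW n * (piW n * ofPerm (simplePerm (Fin.last n)) * (piW n)⁻¹) =
        ofPerm (simplePerm 0) * piW n
      rw [← mul_assoc, ← mul_assoc, piW_sq_simplePerm]
      group
    | succ a =>
      obtain ⟨m, rfl⟩ : ∃ m, n = m + 1 := ⟨n - 1, by have := a.isLt; omega⟩
      exact ⟨a.castSucc.succ, piW_simplePerm a⟩

/-- `W` is generated by `s_1, …, s_{N-1}` and `π^{±1}`. -/
theorem weyl_induction {P : Weyl n → Prop} (one : P 1) (mul : ∀ w w', P w → P w' → P (w * w'))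
    (simple : ∀ a, P (ofPerm (simplePerm a))) (pi : P (piW n)) (pi_inv : P (piW n)⁻¹)
    (w : Weyl n) : P w := by
  have hperm : ∀ u, P (ofPerm u) := fun u => by
    induction u using perm_induction with
    | one => rwa [ofPerm_one]
    | step u a _ ih => rw [ofPerm_mul]; exact mul _ _ ih (simple a)
  have hpow : ∀ r : ℕ, P (piW n ^ r) ∧ P ((piW n ^ r)⁻¹) := fun r => by
    induction r with
    | zero => simpa using one
    | succ r ih =>
      rw [pow_succ, mul_inv_rev]
      exact ⟨mul _ _ ih.1 pi, mul _ _ pi_inv ih.2⟩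
  have hfund : ∀ r : ℕ, r ≤ n + 2 → P (transl (fund r)) ∧ P (transl (-fund r)) := fun r hr => by
    have h : (transl (-fund r) : Weyl n) = (transl (fund r))⁻¹ := by
      rw [eq_inv_iff_mul_eq_one, ← transl_add, neg_add_cancel, transl_zero]
    rw [h, transl_fund hr, mul_inv_rev, ← ofPerm_inv]
    exact ⟨mul _ _ (hpow r).1 (hperm _), mul _ _ (hperm _) (hpow r).2⟩
  have htransl : ∀ l, P (transl l) := fun l => by
    induction l using lat_induction with
    | zero => rwa [transl_zero]
    | add l i ih =>
      rw [eps_eq_fund, sub_eq_add_neg, transl_add, transl_add]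
      exact mul _ _ ih (mul _ _ (hfund _ i.isLt).1 (hfund _ i.isLt.le).2)
    | sub l i ih =>
      rw [eps_eq_fund, sub_sub_eq_add_sub, sub_eq_add_neg, transl_add, transl_add]
      exact mul _ _ (mul _ _ ih (hfund _ i.isLt.le).1) (hfund _ i.isLt).2
  have h : w = transl (lat w) * ofPerm w.right := by
    refine weyl_ext ?_ fun i => ?_ <;> simp
  rw [h]
  exact mul _ _ (htransl _) (hperm _)

theorem wordValue_cons (j : Fin (n + 2)) (L : List (Fin (n + 2))) (m : ℤ) :
    wordValue (j :: L, m) = simpleW j * wordValue (L, m) := by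
  simp [wordValue, mul_assoc]

theorem exists_wordValue (w : Weyl n) : ∃ p, wordValue p = w := by
  have key : ∀ (g : Weyl n) (p : List (Fin (n + 2)) × ℤ), ∃ p', wordValue p' = g * wordValue p := by
    intro g
    have hpi : ∀ (e : ℤ), (∀ j : Fin (n + 2), ∃ j', piW n ^ e * simpleW j = simpleW j' * piW n ^ e) →
        ∀ p : List (Fin (n + 2)) × ℤ, ∃ p', wordValue p' = piW n ^ e * wordValue p := by
      rintro e he ⟨L, m⟩
      induction L with
      | nil => exact ⟨([], e + m), by simp [wordValue, zpow_add]⟩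
      | cons j L ih =>
        obtain ⟨j', hj⟩ := he j
        obtain ⟨⟨L', m'⟩, h⟩ := ih
        exact ⟨(j' :: L', m'), by rw [wordValue_cons, wordValue_cons, h, ← mul_assoc, ← mul_assoc, hj]⟩
    induction g using weyl_induction with
    | one => exact fun p => ⟨p, (one_mul _).symm⟩
    | mul w w' h h' =>
      intro p
      obtain ⟨p', h1⟩ := h' p
      obtain ⟨p'', h2⟩ := h p'
      exact ⟨p'', by rw [h2, h1, mul_assoc]⟩
    | simple a => exact fun p => ⟨(a.succ :: p.1, p.2), wordValue_cons _ _ _⟩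
    | pi => simpa using hpi 1 (by simpa using exists_piW_mul_simpleW)
    | pi_inv => simpa using hpi (-1) (by simpa using exists_piW_inv_mul_simpleW)
  obtain ⟨p, hp⟩ := key w ([], 0)
  exact ⟨p, by rw [hp]; simp [wordValue]⟩

/-- Of the chosen expression only the value matters in what follows: `d_w` is formed from the same
word as the intertwiner, and it cancels in the cocycle. -/
theorem wordValue_reducedExpr (w : Weyl n) : wordValue (reducedExpr w) = w := by
  suffices h : ∃ p, IsReducedExpr w p from (Classical.epsilon_spec h).1
  have hne : {m | ∃ p, wordValue p = w ∧ p.1.length = m}.Nonempty := by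
    obtain ⟨p, hp⟩ := exists_wordValue w
    exact ⟨_, p, hp, rfl⟩
  obtain ⟨p, hp, hm⟩ := Nat.sInf_mem hne
  exact ⟨p, hp, fun p' hp' => hm.trans_le (Nat.sInf_le ⟨p', hp', rfl⟩)⟩

theorem inter_eq (w : Weyl n) :
    inter q k w = mulOp (algebraMap (Reg n) (RatFn n) (dFun q k w)) * weylOp q w := by
  have h : ∀ L : List (Fin (n + 2)), (L.map (interGen q k)).prod =
      mulOp (algebraMap (Reg n) (RatFn n) (dWord q k L)) * weylOp q (L.map simpleW).prod := fun L => by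
    induction L with
    | nil => simp [dWord, weylOp_one, mulOp_one]
    | cons j L ih =>
      rw [List.map_cons, List.prod_cons, ih, List.map_cons, List.prod_cons, weylOp_mul, interGen,
        dWord, map_mul, mulOp_mul, ← weylFieldEquiv_algebraMap, mul_assoc, mul_assoc,
        ← mul_assoc (weylOp q _), weylOp_mulOp, mul_assoc]
  have h1 := wordValue_reducedExpr w
  rw [inter, h, mul_assoc, ← weylOp_mul, dFun]
  exact congrArg (fun x => _ * weylOp q x) h1

theorem dFun_ne_zero (w : Weyl n) : dFun q k w ≠ 0 := by
  have hgen : ∀ j : Fin (n + 2), dGen q k j ≠ 0 := by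
    -- The coefficient of the trivial monomial is `c`, because `l ≠ 0`.
    have aux : ∀ (c d : ℂ) (l : Lat n), c ≠ 0 → l ≠ 0 → (c • 1 - d • mono l : Reg n) ≠ 0 := by
      intro c d l hc hl h
      have h1 := congrArg (fun x : Reg n => x.coeff 0) h
      simp only [AddMonoidAlgebra.one_def, mono, AddMonoidAlgebra.smul_single, smul_eq_mul,
        mul_one, AddMonoidAlgebra.coeff_sub, AddMonoidAlgebra.coeff_single, Finsupp.sub_apply,
        Finsupp.single_eq_same, AddMonoidAlgebra.coeff_zero, Finsupp.coe_zero, Pi.zero_apply] at h1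
      rw [Finsupp.single_apply, if_neg hl, sub_zero] at h1
      exact hc h1
    intro j
    induction j using Fin.cases with
    | zero =>
      refine aux _ _ _ k.ne_zero fun h => ?_
      have := congrFun h 0
      simp [eps, Fin.ext_iff] at this
    | succ a =>
      refine aux _ _ _ k.ne_zero fun h => ?_
      have := congrFun h a.succ
      simp [eps, Fin.ext_iff] at this
  have h : ∀ L : List (Fin (n + 2)), dWord q k L ≠ 0 := fun L => by
    induction L with
    | nil => exact one_ne_zero
    | cons j L ih =>
      exact mul_ne_zero (hgen j)
        ((map_ne_zero_iff _ (weylEquiv q (simpleW j)).injective).mpr ih)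
  exact h _

end

end BqKZ
end
noncomputable section
namespace BqKZ

/-! Shortcuts for the inference of instances. -/

scoped instance (n : ℕ) : CommRing (Mero n) := inferInstance
scoped instance (n : ℕ) : Field (Mero n) := inferInstance
scoped instance (n : ℕ) : CommSemiring (Mero n) := inferInstance
scoped instance (n : ℕ) : Semiring (Mero n) := inferInstance
scoped instance (n : ℕ) : AddCommMonoid (Mero n) := inferInstance
scoped instance (n : ℕ) : Mul (Mero n) := inferInstance
scoped instance (n : ℕ) : Add (Mero n) := inferInstance
scoped instance (n : ℕ) : Zero (Mero n) := inferInstance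
scoped instance (n : ℕ) : One (Mero n) := inferInstance
scoped instance (n : ℕ) : MulZeroClass (Mero n) := inferInstance
scoped instance (n : ℕ) : Monoid (Mero n) := inferInstance
scoped instance (n : ℕ) : Algebra ℂ (Mero n) := inferInstance
scoped instance (n : ℕ) : Module (Mero n) (HeckeMero n) := inferInstance
scoped instance (n : ℕ) : SMul (Mero n) (HeckeMero n) := inferInstance
scoped instance (n : ℕ) : AddCommMonoid (HeckeMero n) := inferInstance
scoped instance (n : ℕ) : AddCommGroup (HeckeMero n) := inferInstance
scoped instance (n : ℕ) : Add (HeckeMero n) := inferInstance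
scoped instance (n : ℕ) : FunLike (Mero n ≃ₐ[ℂ] Mero n) (Mero n) (Mero n) := AlgEquiv.instFunLike
scoped instance (n : ℕ) : Module ℂ (RatFn n) := inferInstance
scoped instance (n : ℕ) : Algebra ℂ (RatFn n) := inferInstance
scoped instance (n : ℕ) : Field (RatFn n) := inferInstance
scoped instance (n : ℕ) : CommRing (RatFn n) := inferInstance
scoped instance (n : ℕ) : Mul (RatFn n) := inferInstance
scoped instance (n : ℕ) : Mul (Op n) := inferInstance
scoped instance (n : ℕ) : Ring (Op n) := inferInstance
scoped instance (n : ℕ) : SMul ℂ (Mero n) := inferInstance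

/-! ### Meromorphic functions -/

section
variable {n : ℕ} (q : QParam)

theorem tpow_add (t : Torus n) (l m : Lat n) : tpow t (l + m) = tpow t l * tpow t m := by
  simp [tpow, zpow_add, Finset.prod_mul_distrib]

theorem tpow_zero (t : Torus n) : tpow t 0 = 1 := by simp [tpow]

theorem tpow_neg (t : Torus n) (l : Lat n) : tpow t (-l) = (tpow t l)⁻¹ := by
  simp [tpow, Finset.prod_inv_distrib]

theorem tpow_inv (t : Torus n) (l : Lat n) : tpow t⁻¹ l = tpow t (-l) := by
  simp [tpow]

theorem tpow_mul (t s : Torus n) (l : Lat n) : tpow (t * s) l = tpow t l * tpow s l := by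
  simp [tpow, mul_zpow, Finset.prod_mul_distrib]

theorem tpow_qpow (l m : Lat n) : tpow (qpow q l) m = q.unit ^ (∑ i, l i * m i) := by
  simp only [tpow, qpow, ← zpow_mul]
  induction (Finset.univ : Finset (Fin (n + 2))) using Finset.induction_on with
  | empty => simp
  | insert i s hi ih => rw [Finset.prod_insert hi, Finset.sum_insert hi, zpow_add, ih]

theorem monoHolo_val (l m : Lat n) (p : Torus n × Torus n) :
    (monoHolo l m).1 p = ((tpow p.1 l * tpow p.2 m : ℂˣ) : ℂ) := rfl

theorem monoHolo_add (l m l' m' : Lat n) :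
    monoHolo (l + l') (m + m') = monoHolo l m * monoHolo l' m' := by
  refine Subtype.ext (funext fun p => ?_)
  change _ = (monoHolo l m).1 p * (monoHolo l' m').1 p
  simp only [monoHolo_val, tpow_add, Units.val_mul]
  ring

theorem monoHolo_zero : monoHolo (0 : Lat n) 0 = 1 := by
  refine Subtype.ext (funext fun p => ?_)
  rw [monoHolo_val, tpow_zero, tpow_zero]; simp

theorem mero_hom_ext {f g : Mero n →+* Mero n}
    (h : ∀ a, f (algebraMap (Holo n) (Mero n) a) = g (algebraMap (Holo n) (Mero n) a)) (x : Mero n) :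
    f x = g x :=
  DFunLike.congr_fun (IsLocalization.ringHom_ext (nonZeroDivisors (Holo n)) (RingHom.ext h)) x

theorem shift_algebraMap (l m : Lat n) (f : Holo n) : shift q l m (algebraMap (Holo n) (Mero n) f) =
    algebraMap (Holo n) (Mero n) (dilate (qpow q (-l), qpow q m) f) :=
  IsFractionRing.ringEquivOfRingEquiv_algebraMap (dilate _).toRingEquiv f

theorem shift_add (l m : Lat n) (f g : Mero n) :
    shift q l m (f + g) = shift q l m f + shift q l m g := (shift q l m).map_add' f g

theorem shift_mul (l m : Lat n) (f g : Mero n) :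
    shift q l m (f * g) = shift q l m f * shift q l m g := (shift q l m).map_mul' f g

theorem shift_map_zero (l m : Lat n) : shift q l m (0 : Mero n) = 0 := map_zero (shift q l m)

theorem shift_map_one (l m : Lat n) : shift q l m (1 : Mero n) = 1 := map_one (shift q l m)

theorem dilate_val (c : Torus n × Torus n) (f : Holo n) (p : Torus n × Torus n) :
    (dilate c f).1 p = f.1 (c * p) := rfl

theorem qpow_add (l m : Lat n) : qpow q (l + m) = qpow q l * qpow q m :=
  funext fun _ => zpow_add _ _ _

theorem qpow_zero : qpow q (0 : Lat n) = 1 := funext fun _ => zpow_zero _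

theorem shift_shift (l m l' m' : Lat n) (x : Mero n) :
    shift q l m (shift q l' m' x) = shift q (l + l') (m + m') x := by
  refine mero_hom_ext (f := ((shift q l m : Mero n →+* Mero n)).comp
    (shift q l' m' : Mero n →+* Mero n)) (g := (shift q (l + l') (m + m') : Mero n →+* Mero n))
    (fun a => ?_) x
  change shift q l m (shift q l' m' _) = shift q (l + l') (m + m') _
  simp only [shift_algebraMap]
  congr 1
  refine Subtype.ext (funext fun p => ?_)
  simp only [dilate_val, neg_add, qpow_add]
  refine congrArg a.1 (Prod.ext ?_ ?_) <;> simp only [Prod.fst_mul, Prod.snd_mul, ← mul_assoc] <;>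
    rw [mul_comm (qpow q _) (qpow q _)]

theorem shift_zero (x : Mero n) : shift q (0 : Lat n) 0 x = x := by
  refine mero_hom_ext (f := (shift q (0 : Lat n) 0 : Mero n →+* Mero n)) (g := RingHom.id _) (fun a => ?_) x
  change shift q (0 : Lat n) 0 _ = _
  rw [shift_algebraMap, neg_zero, qpow_zero]
  exact congrArg _ (Subtype.ext (funext fun p => congrArg a.1 (one_mul p)))

/-- The involution `(t, γ) ↦ (γ⁻¹, t⁻¹)`, on analytic functions. -/
def swapInvHom : Holo n →ₐ[ℂ] Holo n where
  toFun f := ⟨fun p => f.1 (p.2⁻¹, p.1⁻¹), by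
    obtain ⟨F, hF, hf⟩ := f.2
    refine ⟨fun z => F (fun i => (z.2 i)⁻¹, fun i => (z.1 i)⁻¹), ?_, fun p => ?_⟩
    · intro z hz
      refine (hF (fun i => (z.2 i)⁻¹, fun i => (z.1 i)⁻¹) ⟨fun i => inv_ne_zero (hz.2 i),
        fun i => inv_ne_zero (hz.1 i)⟩).comp (f := fun z : Ambient n =>
          ((fun i => (z.2 i)⁻¹, fun i => (z.1 i)⁻¹) : Ambient n)) ?_
      refine AnalyticAt.prod (analyticAt_pi_iff.mpr fun i => AnalyticAt.inv ?_ (hz.2 i))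
        (analyticAt_pi_iff.mpr fun i => AnalyticAt.inv ?_ (hz.1 i))
      · exact ((ContinuousLinearMap.proj (R := ℂ) (φ := fun _ : Fin (n + 2) => ℂ) i).comp
          (ContinuousLinearMap.snd ℂ _ _)).analyticAt z
      · exact ((ContinuousLinearMap.proj (R := ℂ) (φ := fun _ : Fin (n + 2) => ℂ) i).comp
          (ContinuousLinearMap.fst ℂ _ _)).analyticAt z
    · refine Eq.trans (congrArg F ?_) (hf (p.2⁻¹, p.1⁻¹))
      refine Prod.ext ?_ ?_ <;> funext i <;> simp [coords]⟩
  map_one' := rfl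
  map_mul' _ _ := rfl
  map_zero' := rfl
  map_add' _ _ := rfl
  commutes' _ := rfl

theorem swapInvHom_val (f : Holo n) (p : Torus n × Torus n) :
    (swapInvHom f).1 p = f.1 (p.2⁻¹, p.1⁻¹) := rfl

theorem swapInvHom_swapInvHom (f : Holo n) : swapInvHom (swapInvHom f) = f := by
  refine Subtype.ext (funext fun p => ?_)
  simp only [swapInvHom_val, inv_inv]

variable (n) in
/-- The involution `(t, γ) ↦ (γ⁻¹, t⁻¹)`, as an automorphism. -/
def swapInvEquiv : Holo n ≃ₐ[ℂ] Holo n :=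
  AlgEquiv.ofAlgHom swapInvHom swapInvHom (AlgHom.ext swapInvHom_swapInvHom)
    (AlgHom.ext swapInvHom_swapInvHom)

variable (n) in
/-- The involution `(t, γ) ↦ (γ⁻¹, t⁻¹)`, as an automorphism of the field of meromorphic
functions. -/
def swapInvAlg : Mero n ≃ₐ[ℂ] Mero n := IsFractionRing.algEquivOfAlgEquiv (swapInvEquiv n)

/-- The meromorphic function `f(γ⁻¹, t⁻¹)`. -/
def swapInv (f : Mero n) : Mero n := swapInvAlg n f

theorem swapInv_add (f g : Mero n) : swapInv (f + g) = swapInv f + swapInv g :=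
  (swapInvAlg n).map_add' f g

theorem swapInv_mul (f g : Mero n) : swapInv (f * g) = swapInv f * swapInv g :=
  (swapInvAlg n).map_mul' f g

theorem swapInv_zero : swapInv (0 : Mero n) = 0 := map_zero (swapInvAlg n)

theorem swapInv_one : swapInv (1 : Mero n) = 1 := map_one (swapInvAlg n)

theorem swapInv_smul (c : ℂ) (f : Mero n) : swapInv (c • f) = c • swapInv f :=
  (swapInvAlg n).toLinearMap.map_smul c f

theorem swapInv_ne_zero {f : Mero n} (h : f ≠ 0) : swapInv f ≠ 0 :=
  (map_ne_zero_iff (swapInvAlg n) (swapInvAlg n).injective).mpr h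

theorem swapInv_algebraMap (f : Holo n) : swapInv (algebraMap (Holo n) (Mero n) f) =
    algebraMap (Holo n) (Mero n) (swapInvHom f) :=
  IsFractionRing.ringEquivOfRingEquiv_algebraMap (swapInvEquiv n).toRingEquiv f

theorem swapInv_swapInv (x : Mero n) : swapInv (swapInv x) = x := by
  refine mero_hom_ext (f := (swapInvAlg n : Mero n →+* Mero n).comp
    (swapInvAlg n : Mero n →+* Mero n)) (g := RingHom.id _) (fun a => ?_) x
  change swapInv (swapInv _) = _
  rw [swapInv_algebraMap, swapInv_algebraMap, swapInvHom_swapInvHom]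
  rfl

theorem qpow_neg (l : Lat n) : qpow q (-l) = (qpow q l)⁻¹ := funext fun _ => zpow_neg _ _

theorem shift_swapInv (l m : Lat n) (x : Mero n) :
    shift q l m (swapInv x) = swapInv (shift q m l x) := by
  refine mero_hom_ext (f := (shift q l m : Mero n →+* Mero n).comp
    (swapInvAlg n : Mero n →+* Mero n))
    (g := (swapInvAlg n : Mero n →+* Mero n).comp
      (shift q m l : Mero n →+* Mero n)) (fun a => ?_) x
  change shift q l m (swapInv _) = swapInv (shift q m l _)
  rw [swapInv_algebraMap, shift_algebraMap, shift_algebraMap, swapInv_algebraMap]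
  congr 1
  refine Subtype.ext (funext fun p => ?_)
  simp only [dilate_val, swapInvHom_val]
  refine congrArg a.1 (Prod.ext ?_ ?_) <;> simp [qpow_neg, mul_comm]

theorem swapInvHom_monoHolo (l m : Lat n) : swapInvHom (monoHolo l m) = monoHolo (-m) (-l) := by
  refine Subtype.ext (funext fun p => ?_)
  rw [swapInvHom_val, monoHolo_val, monoHolo_val, tpow_inv, tpow_inv, mul_comm]

theorem dilate_monoHolo (l m a b : Lat n) : dilate (qpow q (-l), qpow q m) (monoHolo a b) =
    ((q.unit ^ (-∑ i, l i * a i) * q.unit ^ (∑ i, m i * b i) : ℂˣ) : ℂ) • monoHolo a b := by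
  refine Subtype.ext (funext fun p => ?_)
  change (monoHolo a b).1 _ = _ * (monoHolo a b).1 p
  simp only [monoHolo_val, Prod.fst_mul, Prod.snd_mul, tpow_mul, tpow_qpow, Units.val_mul,
    Pi.neg_apply, neg_mul, Finset.sum_neg_distrib]
  ring

/-- `f ↦ f(t)` on `ℂ[T]`. -/
def evalXHom : Reg n →ₐ[ℂ] Holo n :=
  AddMonoidAlgebra.lift ℂ (Holo n) (Lat n)
    { toFun := fun v => monoHolo v.toAdd 0
      map_one' := monoHolo_zero
      map_mul' := fun a b => by rw [← monoHolo_add, add_zero]; rfl }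

theorem evalX_eq (f : Reg n) : evalX f = evalXHom f := by
  rw [evalXHom, AddMonoidAlgebra.lift_apply]; rfl

theorem evalXHom_mono (l : Lat n) : evalXHom (mono l) = monoHolo l 0 := by
  rw [evalXHom, mono, AddMonoidAlgebra.lift_single, one_smul]; rfl

theorem evalYInv_eq (f : Reg n) : evalYInv f = swapInvHom (evalXHom f) := by
  rw [← evalX_eq, evalX, evalYInv, Finsupp.sum, Finsupp.sum, map_sum]
  refine Finset.sum_congr rfl fun v _ => ?_
  rw [map_smul, swapInvHom_monoHolo, neg_zero]

/-- The character `t ↦ t^l`. -/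
def character (l : Lat n) : Torus n →* ℂ where
  toFun t := (tpow t l : ℂ)
  map_one' := by simp [tpow]
  map_mul' t s := by rw [tpow_mul, Units.val_mul]

theorem character_injective : Function.Injective (character (n := n)) := by
  intro l m h
  funext i
  -- The point with `i`-th coordinate 2 and all others 1 detects the `i`-th exponent.
  have h1 := DFunLike.congr_fun h (Pi.mulSingle i (Units.mk0 2 two_ne_zero))
  have h2 : ∀ l : Lat n, character l (Pi.mulSingle i (Units.mk0 (2 : ℂ) two_ne_zero)) =
      (((2 : ℝ) ^ l i : ℝ) : ℂ) := fun l => by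
    change ((∏ j, _ : ℂˣ) : ℂ) = _
    rw [Finset.prod_eq_single i]
    · simp
    · intro j _ hj; simp [Pi.mulSingle_eq_of_ne hj]
    · simp
  rw [h2, h2] at h1
  exact zpow_right_injective₀ (a := (2 : ℝ)) two_pos (by norm_num) (by exact_mod_cast h1)

/-- Distinct characters of the torus are linearly independent. Injectivity is what allows evaluation
to be extended to `ℂ(T)`. -/
theorem evalXHom_injective : Function.Injective (evalXHom (n := n)) := by
  rw [injective_iff_map_eq_zero]
  intro f hf
  have h1 := (linearIndependent_monoidHom (Torus n) ℂ).comp _ character_injective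
  rw [linearIndependent_iff] at h1
  have h2 : f.coeff = 0 := by
    refine h1 f.coeff (funext fun t => ?_)
    have h3 := congrArg (fun g : Holo n => g.1 (t, 1)) hf
    rw [← evalX_eq] at h3
    simp only [evalX, Finsupp.sum] at h3
    rw [Finsupp.linearCombination_apply, Finsupp.sum, Finset.sum_apply]
    refine Eq.trans ?_ h3
    rw [AddSubmonoidClass.coe_finsetSum, Finset.sum_apply]
    refine Finset.sum_congr rfl fun v _ => ?_
    change _ * (tpow t v : ℂ) = _ * (monoHolo v 0).1 (t, 1)
    rw [monoHolo_val, tpow_zero, mul_one]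
  exact AddMonoidAlgebra.coeff_injective h2

variable (n) in
/-- `f ↦ f(t)` on `ℂ(T)`, as a homomorphism. -/
def evXAlg : RatFn n →ₐ[ℂ] Mero n :=
  IsFractionRing.liftAlgHom (A := Reg n) (K := RatFn n)
    (g := (IsScalarTower.toAlgHom ℂ (Holo n) (Mero n)).comp evalXHom)
    ((IsFractionRing.injective (Holo n) (Mero n)).comp evalXHom_injective)

/-- The meromorphic function `f(t)`, for `f ∈ ℂ(T)`. -/
def evX (f : RatFn n) : Mero n := evXAlg n f

theorem evX_add (f g : RatFn n) : evX (f + g) = evX f + evX g := map_add (evXAlg n) f g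

theorem evX_mul (f g : RatFn n) : evX (f * g) = evX f * evX g := map_mul (evXAlg n) f g

theorem evX_zero : evX (0 : RatFn n) = 0 := map_zero (evXAlg n)

theorem evX_one : evX (1 : RatFn n) = 1 := map_one (evXAlg n)

theorem evX_smul (c : ℂ) (f : RatFn n) : evX (c • f) = c • evX f := map_smul (evXAlg n) c f

theorem evX_algebraMapC (c : ℂ) : evX (algebraMap ℂ (RatFn n) c) = algebraMap ℂ (Mero n) c :=
  AlgHom.commutes (evXAlg n) c

theorem evX_ne_zero {f : RatFn n} (h : f ≠ 0) : evX f ≠ 0 :=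
  (map_ne_zero_iff (evXAlg n) (evXAlg n).injective).mpr h

theorem evX_algebraMap (f : Reg n) : evX (algebraMap (Reg n) (RatFn n) f) =
    algebraMap (Holo n) (Mero n) (evalXHom f) :=
  IsFractionRing.lift_algebraMap (A := Reg n) (K := RatFn n)
    (g := ((IsScalarTower.toAlgHom ℂ (Holo n) (Mero n)).comp evalXHom).toRingHom)
    ((IsFractionRing.injective (Holo n) (Mero n)).comp evalXHom_injective) f

theorem ratFn_hom_ext {L : Type*} [CommRing L] {f g : RatFn n →+* L}
    (h : ∀ a, f (algebraMap (Reg n) (RatFn n) a) = g (algebraMap (Reg n) (RatFn n) a))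
    (x : RatFn n) : f x = g x :=
  DFunLike.congr_fun (IsLocalization.ringHom_ext (nonZeroDivisors (Reg n)) (RingHom.ext h)) x

theorem reg_hom_ext {L : Type*} [Semiring L] [Algebra ℂ L] {f g : Reg n →ₐ[ℂ] L}
    (h : ∀ l, f (mono l) = g (mono l)) (x : Reg n) : f x = g x :=
  DFunLike.congr_fun (AddMonoidAlgebra.algHom_ext (fun v => h v) (by ext)) x

theorem shift_evX (l m : Lat n) (f : RatFn n) :
    shift q l m (evX f) = evX (weylFieldEquiv q (transl l) f) := by
  refine ratFn_hom_ext (f := (shift q l m : Mero n →+* Mero n).comp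
    (evXAlg n : RatFn n →+* Mero n))
    (g := (evXAlg n : RatFn n →+* Mero n).comp
      (weylFieldEquiv q (transl l) : RatFn n →+* RatFn n)) (fun a => ?_) f
  change shift q l m (evX _) = evX (weylFieldEquiv q (transl l) _)
  rw [evX_algebraMap, shift_algebraMap, weylFieldEquiv_algebraMap, evX_algebraMap]
  congr 1
  refine reg_hom_ext (f := ((dilate (qpow q (-l), qpow q m) : Holo n ≃ₐ[ℂ] Holo n) :
    Holo n →ₐ[ℂ] Holo n).comp evalXHom) (g := evalXHom.comp (weylAct q (transl l))) (fun v => ?_) a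
  change dilate _ (evalXHom _) = evalXHom (weylAct q _ _)
  rw [weylAct_mono, map_smul, evalXHom_mono, dilate_monoHolo]
  simp [transl, evalXHom_mono]

end

/-! ### Symbols -/

section
variable {n : ℕ} (q : QParam) (k : ℂˣ)

/-- The function `γ^m`. -/
def gam (m : Lat n) : Mero n := algebraMap (Holo n) (Mero n) (monoHolo 0 m)

theorem gam_add (m m' : Lat n) : gam (m + m') = gam m * gam m' := by
  rw [gam, gam, gam, ← map_mul, ← monoHolo_add, add_zero]

theorem gam_zero : gam (0 : Lat n) = 1 := by rw [gam, monoHolo_zero, map_one]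

/-- The vector `f(t) γ^m T_u` attached to `f(X) T_u Y^m`. -/
def evM : (Perm n × Lat n →₀ RatFn n) →+ HeckeMero n :=
  Finsupp.liftAddHom fun b =>
    { toFun := fun f => Pi.single b.1 (evX f * gam b.2)
      map_zero' := by rw [evX_zero, zero_mul, Pi.single_zero]
      map_add' := fun f g => by rw [evX_add, add_mul, Pi.single_add] }

theorem evM_single (b : Perm n × Lat n) (f : RatFn n) :
    evM (Finsupp.single b f) = Pi.single b.1 (evX f * gam b.2) :=
  Finsupp.liftAddHom_apply_single _ _ _

theorem single_mul (u : Perm n) (f g : Mero n) :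
    (Pi.single u (f * g) : HeckeMero n) = f • Pi.single u g := by
  funext v
  rw [Pi.smul_apply, Pi.single_apply, Pi.single_apply, smul_eq_mul, mul_ite, mul_zero]

/-- The operator `h = ∑ f_{u,m}(X) T_u Y^m` has the symbol `x = ∑ f_{u,m}(t) γ^m T_u`. -/
def HasSymbol (h : Op n) (x : HeckeMero n) : Prop := ∃ c, ratMap q k c = h ∧ evM c = x

variable {q k}

/-- This is the independence of the `T_u Y^m` over `ℂ(T)`; identities between symbols will be
deduced from identities between operators. -/
theorem HasSymbol.unique {h : Op n} {x y : HeckeMero n} (hx : HasSymbol q k h x)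
    (hy : HasSymbol q k h y) : x = y := by
  obtain ⟨c, h1, rfl⟩ := hx
  obtain ⟨d, h2, rfl⟩ := hy
  rw [ratMap_injective k (h1.trans h2.symm)]

theorem HasSymbol.add {h h' : Op n} {x x' : HeckeMero n} (hx : HasSymbol q k h x)
    (hy : HasSymbol q k h' x') : HasSymbol q k (h + h') (x + x') := by
  obtain ⟨c, rfl, rfl⟩ := hx
  obtain ⟨d, rfl, rfl⟩ := hy
  exact ⟨c + d, map_add _ _ _, map_add _ _ _⟩

theorem hasSymbol_zero : HasSymbol q k (0 : Op n) 0 := ⟨0, map_zero _, map_zero _⟩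

theorem hasSymbol_basis (f : RatFn n) (u : Perm n) (m : Lat n) :
    HasSymbol q k (mulOp f * (opTw q k u * opY q k m)) (Pi.single u (evX f * gam m)) :=
  ⟨_, ratMap_single k (u, m) f, evM_single _ _⟩

theorem hasSymbol_opTw (u : Perm n) : HasSymbol q k (opTw q k u) (Pi.single u 1) := by
  have := hasSymbol_basis (q := q) (k := k) 1 u 0
  rwa [mulOp_one, one_mul, opY_zero, mul_one, evX_one, one_mul, gam_zero] at this

/-- Induction on the operators that have a symbol. -/
theorem HasSymbol.induction {P : Op n → HeckeMero n → Prop} (zero : P 0 0)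
    (add : ∀ h h' x x', P h x → P h' x' → P (h + h') (x + x'))
    (basis : ∀ f u m, P (mulOp f * (opTw q k u * opY q k m)) (Pi.single u (evX f * gam m)))
    {h : Op n} {x : HeckeMero n} (hx : HasSymbol q k h x) : P h x := by
  obtain ⟨c, rfl, rfl⟩ := hx
  induction c using Finsupp.induction_linear with
  | zero => rwa [map_zero, map_zero]
  | add c d hc hd => rw [map_add, map_add]; exact add _ _ _ _ hc hd
  | single b f => rw [ratMap_single, evM_single]; exact basis _ _ _

theorem HasSymbol.mulOp_mul {h : Op n} {x : HeckeMero n} (hx : HasSymbol q k h x) (f : RatFn n) :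
    HasSymbol q k (mulOp f * h) (evX f • x) := by
  refine HasSymbol.induction (P := fun h x => HasSymbol q k (mulOp f * h) (evX f • x)) ?_ ?_ ?_ hx
  · rw [mul_zero, smul_zero]; exact hasSymbol_zero
  · intro h h' x x' h1 h2
    rw [mul_add, smul_add]; exact h1.add h2
  · intro g u m
    have := hasSymbol_basis (q := q) (k := k) (f * g) u m
    rwa [BqKZ.mulOp_mul, mul_assoc, evX_mul, mul_assoc, single_mul] at this

theorem HasSymbol.mul_opY {h : Op n} {x : HeckeMero n} (hx : HasSymbol q k h x) (m : Lat n) :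
    HasSymbol q k (h * opY q k m) (gam m • x) := by
  refine HasSymbol.induction (P := fun h x => HasSymbol q k (h * opY q k m) (gam m • x)) ?_ ?_ ?_ hx
  · rw [zero_mul, smul_zero]; exact hasSymbol_zero
  · intro h h' x x' h1 h2
    rw [add_mul, smul_add]; exact h1.add h2
  · intro g u m'
    have := hasSymbol_basis (q := q) (k := k) g u (m' + m)
    rwa [opY_add, gam_add, mul_comm (gam m'), mul_left_comm, single_mul,
      ← mul_assoc (opTw q k u), ← mul_assoc] at this

theorem HasSymbol.smul {h : Op n} {x : HeckeMero n} (hx : HasSymbol q k h x) (c : ℂ) :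
    HasSymbol q k (c • h) (algebraMap ℂ (Mero n) c • x) := by
  have := hx.mulOp_mul (algebraMap ℂ (RatFn n) c)
  rwa [mulOp_algebraMap, ← Algebra.smul_def, evX_algebraMapC] at this

theorem exists_hasSymbol_of_basis (w : Op n) (h : ∀ f, ∃ g, w * mulOp f = mulOp g * w)
    (hT : ∀ u, ∃ x, HasSymbol q k (w * opTw q k u) x) {a : Op n} {x : HeckeMero n}
    (hx : HasSymbol q k a x) : ∃ y, HasSymbol q k (w * a) y := by
  refine HasSymbol.induction (P := fun a _ => ∃ y, HasSymbol q k (w * a) y) ?_ ?_ ?_ hx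
  · exact ⟨0, by rw [mul_zero]; exact hasSymbol_zero⟩
  · rintro h h' - - ⟨y, hy⟩ ⟨y', hy'⟩
    exact ⟨_, by rw [mul_add]; exact hy.add hy'⟩
  · intro f u m
    obtain ⟨g, hg⟩ := h f
    obtain ⟨y, hy⟩ := hT u
    exact ⟨_, by rw [← mul_assoc, hg, mul_assoc, ← mul_assoc w]; exact (hy.mul_opY m).mulOp_mul g⟩

theorem weylOp_simple_eq (a : Fin (n + 1)) : weylOp q (ofPerm (simplePerm a)) =
    mulOp (ckX k a)⁻¹ * (opT q k a - mulOp (algebraMap ℂ _ (k : ℂ) - ckX k a)) := by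
  rw [opT_eq, add_sub_cancel_left, ← mul_assoc, ← mulOp_mul, inv_mul_cancel₀ (ckX_ne_zero k a),
    mulOp_one, one_mul]

/-- Induction over generators of `W`. The reflection `s_a` is recovered from `T_a` by dividing by
`c_k`, which is why symbols are allowed rational coefficients in `X`. -/
theorem exists_hasSymbol_weylOp (w : Weyl n) {a : Op n} {x : HeckeMero n}
    (hx : HasSymbol q k a x) : ∃ y, HasSymbol q k (weylOp q w * a) y := by
  induction w using weyl_induction generalizing a x with
  | one => exact ⟨x, by rwa [weylOp_one, one_mul]⟩
  | mul w w' h h' =>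
    obtain ⟨y, hy⟩ := h' hx
    rw [weylOp_mul, mul_assoc]
    exact h hy
  | simple b =>
    refine exists_hasSymbol_of_basis _ (fun f => ⟨_, weylOp_mulOp q _ f⟩) (fun u => ?_) hx
    have h1 : ∃ y, HasSymbol q k (opT q k b * opTw q k u) y := by
      rcases ascent_or_descent u⁻¹ b with h | h
      · rw [opT_mul_of_ascent q k h]; exact ⟨_, hasSymbol_opTw _⟩
      · rw [opT_mul_of_descent q k h]
        exact ⟨_, (hasSymbol_opTw _).add ((hasSymbol_opTw _).smul _)⟩
    obtain ⟨y, hy⟩ := h1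
    have h2 := (hy.add ((hasSymbol_opTw u).mulOp_mul (-(algebraMap ℂ _ (k : ℂ) - ckX k b)))).mulOp_mul
      (ckX k b)⁻¹
    have e : weylOp q (ofPerm (simplePerm b)) * opTw q k u = mulOp (ckX k b)⁻¹ *
        (opT q k b * opTw q k u + mulOp (-(algebraMap ℂ _ (k : ℂ) - ckX k b)) * opTw q k u) := by
      have hneg : ∀ (f : RatFn n) (h h' : Op n), h' + mulOp (-f) * h = h' - mulOp f * h :=
        fun f h h' => LinearMap.ext fun x => by
          rw [LinearMap.add_apply, LinearMap.sub_apply]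
          exact (congrArg _ (neg_mul f (h x))).trans (sub_eq_add_neg _ _).symm
      rw [weylOp_simple_eq (k := k), mul_assoc, sub_mul, hneg]
    rw [e]
    exact ⟨_, h2⟩
  | pi =>
    refine exists_hasSymbol_of_basis _ (fun f => ⟨_, weylOp_mulOp q _ f⟩) (fun u => ?_) hx
    rw [weylOp_piW_opTw]
    exact ⟨_, (hasSymbol_opTw _).mul_opY _⟩
  | pi_inv =>
    refine exists_hasSymbol_of_basis _ (fun f => ⟨_, weylOp_mulOp q _ f⟩) (fun u => ?_) hx
    have h1 := weylOp_piW_opTw q k ((rot n)⁻¹ * u)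
    rw [mul_inv_cancel_left] at h1
    have h2 : weylOp q (piW n)⁻¹ * opTw q k u = opTw q k ((rot n)⁻¹ * u) *
        opY q k (-eps (((rot n)⁻¹ * u)⁻¹ (Fin.last (n + 1)))) := by
      have h3 := congrArg (fun x => weylOp q (piW n)⁻¹ * x *
        opY q k (-eps (((rot n)⁻¹ * u)⁻¹ (Fin.last (n + 1))))) h1
      simp only [← mul_assoc, ← weylOp_mul, inv_mul_cancel, weylOp_one, one_mul] at h3
      rw [h3, mul_assoc _ (opY q k _), ← opY_add, add_neg_cancel, opY_zero, mul_one]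
    rw [h2]
    exact ⟨_, (hasSymbol_opTw _).mul_opY _⟩

variable (q k)

/-- The symbol of `w T_u`. -/
def weylSymbol (w : Weyl n) (u : Perm n) : HeckeMero n :=
  (exists_hasSymbol_weylOp (k := k) (q := q) w (hasSymbol_opTw u)).choose

theorem hasSymbol_weylSymbol (w : Weyl n) (u : Perm n) :
    HasSymbol q k (weylOp q w * opTw q k u) (weylSymbol q k w u) :=
  (exists_hasSymbol_weylOp (k := k) (q := q) w (hasSymbol_opTw u)).choose_spec

/-- The action of the translation by `l` on symbols. -/
def translX (l : Lat n) (x : HeckeMero n) : HeckeMero n :=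
  ∑ u, shift q l 0 (x u) • weylSymbol q k (transl l) u

theorem translX_add (l : Lat n) (x y : HeckeMero n) :
    translX q k l (x + y) = translX q k l x + translX q k l y := by
  simp only [translX, Pi.add_apply, shift_add, add_smul, Finset.sum_add_distrib]

theorem translX_smul (l : Lat n) (f : Mero n) (x : HeckeMero n) :
    translX q k l (f • x) = shift q l 0 f • translX q k l x := by
  simp only [translX, Pi.smul_apply, smul_eq_mul, shift_mul, mul_smul, Finset.smul_sum]

theorem translX_zero (l : Lat n) : translX q k l (0 : HeckeMero n) = 0 := by
  simp only [translX, Pi.zero_apply, shift_map_zero, zero_smul, Finset.sum_const_zero]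

theorem translX_single (l : Lat n) (u : Perm n) :
    translX q k l (Pi.single u 1) = weylSymbol q k (transl l) u := by
  rw [translX, Finset.sum_eq_single u]
  · rw [Pi.single_eq_same, shift_map_one, one_smul]
  · intro v _ hv
    rw [Pi.single_eq_of_ne hv, shift_map_zero, zero_smul]
  · simp

theorem shift_gam (l m : Lat n) : shift q l 0 (gam m) = gam m := by
  rw [gam, shift_algebraMap, dilate_monoHolo]; simp

variable {q k}

/-- The translation shifts the coefficient `f(X)` on its left and does not meet `Y^m` on the right,
so on symbols it acts semilinearly with the shift in `t` only. -/
theorem HasSymbol.translX {h : Op n} {x : HeckeMero n} (hx : HasSymbol q k h x) (l : Lat n) :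
    HasSymbol q k (weylOp q (transl l) * h) (translX q k l x) := by
  refine HasSymbol.induction (P := fun h x =>
    HasSymbol q k (weylOp q (transl l) * h) (BqKZ.translX q k l x)) ?_ ?_ ?_ hx
  · rw [mul_zero, translX_zero]; exact hasSymbol_zero
  · intro h h' x x' h1 h2
    rw [mul_add, translX_add]; exact h1.add h2
  · intro f u m
    have h1 := ((hasSymbol_weylSymbol q k (transl l) u).mul_opY m).mulOp_mul
      (weylFieldEquiv q (transl l) f)
    rw [← mul_assoc, weylOp_mulOp, mul_assoc, ← mul_assoc (weylOp q _)]
    convert h1 using 1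
    rw [← mul_one (_ * _ : Mero n), single_mul, translX_smul, translX_single, shift_mul,
      shift_evX, shift_gam, mul_smul]

theorem heckeMero_eq_sum (x : HeckeMero n) : x = ∑ u, x u • Pi.single u 1 := by
  conv_lhs => rw [← Finset.univ_sum_single x]
  refine Finset.sum_congr rfl fun u _ => ?_
  rw [← Pi.single_smul, smul_eq_mul, mul_one]

/-- Semilinear maps are determined by their values on the basis. -/
theorem semilinear_ext {F G : HeckeMero n → HeckeMero n} (σ : Mero n → Mero n)
    (hF : ∀ x y, F (x + y) = F x + F y) (hG : ∀ x y, G (x + y) = G x + G y)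
    (hF' : ∀ (f : Mero n) x, F (f • x) = σ f • F x) (hG' : ∀ (f : Mero n) x, G (f • x) = σ f • G x)
    (h : ∀ u, F (Pi.single u 1) = G (Pi.single u 1)) (x : HeckeMero n) : F x = G x := by
  have h1 : ∀ F : HeckeMero n → HeckeMero n, (∀ x y, F (x + y) = F x + F y) →
      (∀ (f : Mero n) x, F (f • x) = σ f • F x) →
      F x = ∑ u, σ (x u) • F (Pi.single u 1) := fun F hF hF' => by
    let F' : HeckeMero n →+ HeckeMero n := AddMonoidHom.mk' F hF
    change F' x = _
    conv_lhs => rw [heckeMero_eq_sum x, map_sum]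
    exact Finset.sum_congr rfl fun u _ => hF' _ _
  rw [h1 F hF hF', h1 G hG hG']
  simp only [h]

variable (q k) in
-- Both sides are semilinear for the same shift, and on `T_u` both are the symbol of the product of
-- the two translations with `T_u`.
theorem translX_translX (l m : Lat n) (x : HeckeMero n) :
    translX q k l (translX q k m x) = translX q k (l + m) x := by
  refine semilinear_ext (F := fun x => translX q k l (translX q k m x)) (shift q (l + m) 0)
    (fun x y => by rw [translX_add, translX_add]) (fun x y => translX_add _ _ _ _ _)
    (fun f x => by rw [translX_smul, translX_smul, shift_shift, add_zero])
    (fun f x => translX_smul _ _ _ _ _) (fun u => ?_) x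
  refine HasSymbol.unique ((hasSymbol_opTw u).translX m |>.translX l) ?_
  rw [← mul_assoc, ← weylOp_mul, ← transl_add]
  exact (hasSymbol_opTw u).translX _

/-- The symbol version of the anti-involution. -/
def swapVec (x : HeckeMero n) : HeckeMero n := fun v => swapInv (x v⁻¹)

theorem swapVec_add (x y : HeckeMero n) : swapVec (x + y) = swapVec x + swapVec y :=
  funext fun _ => swapInv_add _ _

theorem swapVec_smul (f : Mero n) (x : HeckeMero n) : swapVec (f • x) = swapInv f • swapVec x :=
  funext fun _ => swapInv_mul _ _

theorem swapVec_swapVec (x : HeckeMero n) : swapVec (swapVec x) = x := by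
  funext v
  simp only [swapVec, inv_inv, swapInv_swapInv]

theorem swapVec_single (u : Perm n) (f : Mero n) :
    swapVec (Pi.single u f) = Pi.single u⁻¹ (swapInv f) := by
  funext v
  simp only [swapVec, Pi.single_apply, inv_eq_iff_eq_inv]
  split_ifs
  · rfl
  · exact swapInv_zero

theorem toHeckeMero_pbwMap (x : PBWIndex n →₀ ℂ) :
    toHeckeMero q k (pbwMap q k x) = evM (toRat x) := by
  rw [show toHeckeMero q k (pbwMap q k x) = fun v => x.sum fun b c =>
    if b.2 = v then algebraMap (Holo n) (Mero n) (c • monoHolo b.1.1 b.1.2) else 0 by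
      funext v; rw [toHeckeMero, pbwCoord_pbwMap]]
  classical
  induction x using Finsupp.induction_linear with
  | zero => rw [map_zero, map_zero]; rfl
  | add x y hx hy =>
    rw [map_add, map_add, ← hx, ← hy]
    funext v
    rw [Pi.add_apply, Finsupp.sum_add_index']
    · intro b; split_ifs <;> simp
    · intro b c d; split_ifs <;> simp [add_smul]
  | single b c =>
    rw [toRat_single, evM_single]
    funext v
    rw [Finsupp.sum_single_index (by split_ifs <;> simp), Pi.single_apply]
    by_cases h : b.2 = v
    · rw [if_pos h, if_pos h.symm, evX_smul, ratMono, evX_algebraMap, evalXHom_mono, gam,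
        smul_mul_assoc, ← map_mul, ← monoHolo_add, add_zero, zero_add, Algebra.smul_def, map_mul,
        ← IsScalarTower.algebraMap_apply, ← Algebra.smul_def]
    · rw [if_neg h, if_neg (Ne.symm h)]

theorem hasSymbol_toHeckeMero {h h' : Op n} (hh : (h, h') ∈ dualGraph q k) :
    HasSymbol q k h (toHeckeMero q k h) := by
  obtain ⟨x, hx⟩ := hh
  have h1 : pbwMap q k x = h := congrArg Prod.fst hx
  rw [← h1, toHeckeMero_pbwMap, pbwMap_eq]
  exact ⟨_, rfl, rfl⟩

/-- On a basis element the anti-involution exchanges the exponents of `X` and `Y` with a change of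
sign, and inverts `w`; these are the effects of `(t, γ) ↦ (γ⁻¹, t⁻¹)` and of the reindexing in
`swapVec`. -/
theorem HasSymbol.swapVec {h h' : Op n} (hh : (h, h') ∈ dualGraph q k) {y : HeckeMero n}
    (hy : HasSymbol q k h y) : HasSymbol q k h' (swapVec y) := by
  obtain ⟨x, hx⟩ := hh
  have h1 : pbwMap q k x = h := congrArg Prod.fst hx
  have h2 : pbwMap q k (x.mapDomain dualIndex) = h' := congrArg Prod.snd hx
  have h3 : y = evM (toRat x) := by
    refine hy.unique ?_
    rw [← h1, pbwMap_eq]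
    exact ⟨_, rfl, rfl⟩
  have h4 : BqKZ.swapVec (evM (toRat x)) = evM (toRat (x.mapDomain dualIndex)) := by
    clear * -
    induction x using Finsupp.induction_linear with
    | zero =>
      rw [Finsupp.mapDomain_zero, map_zero, map_zero]
      exact funext fun _ => swapInv_zero
    | add x y hx hy =>
      rw [Finsupp.mapDomain_add, map_add, map_add, map_add, map_add, swapVec_add, hx, hy]
    | single b c =>
      rw [Finsupp.mapDomain_single, toRat_single, toRat_single, evM_single, evM_single,
        swapVec_single]
      congr 1
      rw [evX_smul, evX_smul, ratMono, ratMono, evX_algebraMap, evX_algebraMap, evalXHom_mono,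
        evalXHom_mono, gam, gam, smul_mul_assoc, smul_mul_assoc, swapInv_smul, ← map_mul, ← map_mul,
        ← monoHolo_add, ← monoHolo_add, swapInv_algebraMap, swapInvHom_monoHolo]
      simp [dualIndex]
  rw [h3, h4, ← h2, pbwMap_eq]
  exact ⟨_, rfl, rfl⟩

theorem dualGraph_symm {h h' : Op n} (hh : (h, h') ∈ dualGraph q k) : (h', h) ∈ dualGraph q k := by
  obtain ⟨x, hx⟩ := hh
  refine ⟨x.mapDomain dualIndex, ?_⟩
  refine Prod.ext (congrArg Prod.snd hx) (Eq.trans ?_ (congrArg Prod.fst hx))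
  change pbwMap q k ((x.mapDomain dualIndex).mapDomain dualIndex) = pbwMap q k x
  rw [← Finsupp.mapDomain_comp]
  congr 1
  convert Finsupp.mapDomain_id
  funext b
  simp [dualIndex]

variable (q k)

/-- The mirror image of `translX`. -/
def translY (m : Lat n) (x : HeckeMero n) : HeckeMero n := swapVec (translX q k m (swapVec x))

theorem translY_add (l : Lat n) (x y : HeckeMero n) :
    translY q k l (x + y) = translY q k l x + translY q k l y := by
  simp only [translY, swapVec_add, translX_add]

theorem translY_smul (l : Lat n) (f : Mero n) (x : HeckeMero n) :
    translY q k l (f • x) = shift q 0 l f • translY q k l x := by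
  simp only [translY, swapVec_smul, translX_smul, shift_swapInv, swapInv_swapInv]

theorem translY_translY (l m : Lat n) (x : HeckeMero n) :
    translY q k l (translY q k m x) = translY q k (l + m) x := by
  simp only [translY, swapVec_swapVec, translX_translX]

/-- The functions `d_w(t)` and `d_w(γ⁻¹)`. -/
def dX (w : Weyl n) : Mero n := evX (algebraMap (Reg n) (RatFn n) (dFun q k w))

theorem dX_ne_zero (w : Weyl n) : dX q k w ≠ 0 := by
  refine evX_ne_zero ?_
  rw [map_ne_zero_iff _ (IsFractionRing.injective (Reg n) (RatFn n))]
  exact dFun_ne_zero w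

variable {q k}

theorem HasSymbol.inter {h : Op n} {x : HeckeMero n} (hx : HasSymbol q k h x) (l : Lat n) :
    HasSymbol q k (inter q k (transl l) * h) (dX q k (transl l) • BqKZ.translX q k l x) := by
  rw [inter_eq, mul_assoc]
  exact (hx.translX l).mulOp_mul _

theorem opTw_mem_dualGraph (u : Perm n) : (opTw q k u, opTw q k u⁻¹) ∈ dualGraph q k := by
  simpa [opX_zero, opY_zero] using mem_dualGraph (q := q) (k := k) (n := n) ((0, 0), u)

theorem shift_swapInv_evX (l : Lat n) (f : RatFn n) :
    shift q l 0 (swapInv (evX f)) = swapInv (evX f) := by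
  rw [shift_swapInv, shift_evX, transl_zero, weylFieldEquiv_one]

/-- The anti-involution carries right multiplication by `S_m^*` to left multiplication by `S_m` on
`T_{u⁻¹}`, where `HasSymbol.inter` applies. The primed version evaluates the same operator starting
with the left factor. -/
theorem hasSymbol_two_sided (l m : Lat n) (u : Perm n) :
    HasSymbol q k (inter q k (transl l) * (opTw q k u * dual q k (inter q k (transl m))))
      ((dX q k (transl l) * swapInv (dX q k (transl m))) •
        translX q k l (translY q k m (Pi.single u 1))) := by
  have h1 := (hasSymbol_opTw (q := q) (k := k) u⁻¹).inter m
  have hg := (hasDual_inter (q := q) (k := k) (transl m)).isDualPair _ _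
    (opTw_mem_dualGraph (q := q) (k := k) u⁻¹)
  rw [inv_inv] at hg
  have h2 := (h1.swapVec hg).inter l
  rw [swapVec_smul, translX_smul, dX, dX, shift_swapInv_evX, smul_smul] at h2
  rwa [translY, swapVec_single, swapInv_one]

theorem hasSymbol_two_sided' (l m : Lat n) (u : Perm n) :
    HasSymbol q k (inter q k (transl l) * (opTw q k u * dual q k (inter q k (transl m))))
      ((dX q k (transl l) * swapInv (dX q k (transl m))) •
        translY q k m (translX q k l (Pi.single u 1))) := by
  have h1 := (hasSymbol_opTw (q := q) (k := k) u).inter l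
  have hg := (hasDual_inter (q := q) (k := k) (transl l)).isDualPair _ _
    (opTw_mem_dualGraph (q := q) (k := k) u)
  have hg' := (hasDual_inter (q := q) (k := k) (transl m)).isDualPair _ _ (dualGraph_symm hg)
  have h2 := ((h1.swapVec hg).inter m).swapVec hg'
  rw [swapVec_smul, swapVec_smul, translX_smul, swapVec_smul, dX, dX, shift_swapInv_evX,
    swapInv_swapInv, smul_smul, mul_comm (swapInv _), mul_assoc] at h2
  exact h2

theorem two_sided_mem (l m : Lat n) (u : Perm n) : ∃ h',
    (inter q k (transl l) * (opTw q k u * dual q k (inter q k (transl m))), h') ∈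
      dualGraph q k := by
  have hg' := (hasDual_inter (q := q) (k := k) (transl m)).isDualPair _ _
    (opTw_mem_dualGraph (q := q) (k := k) u⁻¹)
  rw [inv_inv] at hg'
  exact ⟨_, (hasDual_inter (q := q) (k := k) (transl l)).isDualPair _ _ (dualGraph_symm hg')⟩

variable (q k) in
-- Left and right multiplication commute, so the two orders of evaluation give one and the same
-- symbol for `S_l T_u S_m^*`; the common nonzero factor is then cancelled.
theorem translX_translY (l m : Lat n) (x : HeckeMero n) :
    translX q k l (translY q k m x) = translY q k m (translX q k l x) := by
  refine semilinear_ext (F := fun x => translX q k l (translY q k m x))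
    (G := fun x => translY q k m (translX q k l x)) (shift q l m)
    (fun x y => by simp only [translX_add, translY_add])
    (fun x y => by simp only [translX_add, translY_add])
    (fun f x => by rw [translY_smul, translX_smul, shift_shift, add_zero, zero_add])
    (fun f x => by rw [translX_smul, translY_smul, shift_shift, add_zero, zero_add])
    (fun u => ?_) x
  have h := (hasSymbol_two_sided (q := q) (k := k) l m u).unique (hasSymbol_two_sided' l m u)
  have hd : dX q k (transl l) * swapInv (dX q k (transl m)) ≠ 0 :=
    mul_ne_zero (dX_ne_zero q k _) (swapInv_ne_zero (dX_ne_zero q k _))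
  exact (smul_right_injective _ hd) h

variable (q k) in
-- Dividing by the functions `d` leaves the bare translations. From here on the cocycle enters only
-- through two commuting actions of `ℤ^N`, so that its cocycle identity needs no separate proof.
theorem cocycle_mulVec (l m : Lat n) (f : HeckeMero n) :
    (cocycle q k (transl l) (transl m)).mulVec (shiftVec q l m f) =
      translX q k l (translY q k m f) := by
  have h1 : ∀ v u, cocycle q k (transl l) (transl m) v u =
      translX q k l (translY q k m (Pi.single u 1)) v := fun v u => by
    obtain ⟨h', hh⟩ := two_sided_mem (q := q) (k := k) l m u
    have h2 := (hasSymbol_toHeckeMero hh).unique (hasSymbol_two_sided l m u)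
    have h3 : algebraMap (Holo n) (Mero n)
        (evalX (dFun q k (transl l)) * evalYInv (dFun q k (transl m))) =
        dX q k (transl l) * swapInv (dX q k (transl m)) := by
      rw [dX, dX, evX_algebraMap, evX_algebraMap, swapInv_algebraMap, evalX_eq, evalYInv_eq, map_mul]
    have hd : dX q k (transl l) * swapInv (dX q k (transl m)) ≠ 0 :=
      mul_ne_zero (dX_ne_zero q k _) (swapInv_ne_zero (dX_ne_zero q k _))
    change _⁻¹ * toHeckeMero q k (inter q k (transl l) * opTw q k u * _) v = _
    rw [h3, mul_assoc (inter q k _), h2, Pi.smul_apply, smul_eq_mul, inv_mul_cancel_left₀ hd]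
  let F : HeckeMero n →+ HeckeMero n :=
    AddMonoidHom.mk' (fun x => translX q k l (translY q k m x)) fun x y => by
      rw [translY_add, translX_add]
  have h2 : F f = ∑ u, shift q l m (f u) • F (Pi.single u 1) := by
    conv_lhs => rw [heckeMero_eq_sum f, map_sum]
    refine Finset.sum_congr rfl fun u _ => ?_
    change translX q k l (translY q k m _) = _ • translX q k l (translY q k m _)
    rw [translY_smul, translX_smul, shift_shift, add_zero, zero_add]
  change _ = F f
  rw [h2]
  funext v
  rw [Finset.sum_apply]
  change ∑ u, _ * _ = _
  refine Finset.sum_congr rfl fun u _ => ?_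
  rw [h1, Pi.smul_apply, smul_eq_mul, mul_comm]
  rfl

end

end BqKZ
end
noncomputable section
namespace BqKZ

/-! ### Theta functions and the gauge factor -/

section
variable {n : ℕ} (q : QParam)

theorem norm_unit : ‖(q.unit : ℂ)‖ = (q : ℝ) := by
  simp [QParam.unit, abs_of_pos q.2.1]

theorem norm_unit_lt_one : ‖(q.unit : ℂ)‖ < 1 := (norm_unit q).trans_lt q.2.2

theorem multipliable_qprod (z : ℂ) : Multipliable fun m : ℕ => 1 - (q.unit : ℂ) ^ m * z := by
  have := multipliable_one_add_of_summable (R := ℂ) (f := fun m : ℕ => -((q.unit : ℂ) ^ m * z)) (by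
    simp only [norm_neg, norm_mul, norm_pow]
    exact (summable_geometric_of_lt_one (norm_nonneg _) (norm_unit_lt_one q)).mul_right _)
  simpa only [sub_eq_add_neg] using this

theorem theta_eq (z : ℂ) : theta q z = (∏' m : ℕ, (1 - (q.unit : ℂ) ^ m * z)) *
    ∏' m : ℕ, (1 - (q.unit : ℂ) ^ m * (q.unit / z)) := by
  rw [← (multipliable_qprod q z).tprod_mul (multipliable_qprod q _), theta]
  refine tprod_congr fun m => ?_
  rw [pow_succ, mul_div_assoc]

theorem qprod_eq (z : ℂ) : ∏' m : ℕ, (1 - (q.unit : ℂ) ^ m * z) =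
    (1 - z) * ∏' m : ℕ, (1 - (q.unit : ℂ) ^ m * (q.unit * z)) := by
  have h := tprod_eq_zero_mul' (f := fun m : ℕ => 1 - (q.unit : ℂ) ^ m * z)
    (by simpa only [pow_succ, mul_assoc] using multipliable_qprod q (q.unit * z))
  simpa only [pow_zero, one_mul, pow_succ, mul_assoc] using h

/-- Replacing `z` by `z / q` adds one factor to the first infinite product and removes one from the
second. -/
theorem theta_div (z : ℂ) (hz : z ≠ 0) :
    theta q (z / q.unit) = -(z / q.unit) * theta q z := by
  have hq : (q.unit : ℂ) ≠ 0 := q.unit.ne_zero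
  rw [theta_eq, theta_eq, qprod_eq q (z / q.unit), qprod_eq q (q.unit / z),
    mul_div_cancel₀ _ hq, show (q.unit : ℂ) / (z / q.unit) = q.unit * (q.unit / z) by field_simp]
  field_simp
  ring

/-- The triangular number `a (a + 1) / 2`. -/
def tri (a : ℤ) : ℤ := a * (a + 1) / 2

theorem two_mul_tri (a : ℤ) : 2 * tri a = a * (a + 1) :=
  Int.mul_ediv_cancel' (Int.even_mul_succ_self a).two_dvd

theorem tri_add (a b : ℤ) : tri (a + b) = tri a + tri b + a * b := by
  have h1 := two_mul_tri a
  have h2 := two_mul_tri b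
  have h3 := two_mul_tri (a + b)
  linarith

theorem theta_zpow (a : ℤ) (z : ℂˣ) : theta q ((q.unit ^ (-a) * z : ℂˣ) : ℂ) =
    (((-z) ^ a * q.unit ^ (-tri a) : ℂˣ) : ℂ) * theta q z := by
  have step : ∀ z : ℂˣ, theta q ((q.unit⁻¹ * z : ℂˣ) : ℂ) =
      ((-z * q.unit⁻¹ : ℂˣ) : ℂ) * theta q z := fun z => by
    have := theta_div q z z.ne_zero
    simp only [Units.val_mul, Units.val_neg, Units.val_inv_eq_inv_val]
    rw [mul_comm (_⁻¹), ← div_eq_mul_inv, this]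
    ring
  have h0 : tri 0 = 0 := rfl
  have h1 : tri 1 = 1 := rfl
  -- The formulas for consecutive exponents are equivalent, so the induction can run in both
  -- directions.
  have hst : ∀ a : ℤ, ∀ z : ℂˣ, (theta q ((q.unit ^ (-(a+1)) * z : ℂˣ) : ℂ) =
    (((-z) ^ (a+1) * q.unit ^ (-tri (a+1)) : ℂˣ) : ℂ) * theta q z ↔ theta q ((q.unit ^ (-a) * z : ℂˣ) : ℂ) =
    (((-z) ^ a * q.unit ^ (-tri a) : ℂˣ) : ℂ) * theta q z) := by
    intro a z
    rw [show q.unit ^ (-(a + 1)) * z = q.unit⁻¹ * (q.unit ^ (-a) * z) by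
        rw [neg_add, zpow_add, zpow_neg_one]; ac_rfl, step,
      show (-z) ^ (a + 1) * q.unit ^ (-tri (a + 1)) =
        (-(q.unit ^ (-a) * z) * q.unit⁻¹) * ((-z) ^ a * q.unit ^ (-tri a)) by
        rw [tri_add, zpow_add, h1, zpow_one, mul_one, neg_add, neg_add, zpow_add, zpow_add,
          zpow_neg_one, ← mul_neg]
        ac_rfl, Units.val_mul _ ((-z) ^ a * q.unit ^ (-tri a)), mul_assoc]
    exact mul_right_inj' (Units.ne_zero _)
  induction a using Int.induction_on with
  | zero => simp [h0]
  | succ i ih => exact (hst _ _).mpr ih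
  | pred i ih =>
    refine (hst _ _).mp ?_
    rwa [sub_add_cancel]

/-- At `-1` every factor has the form `1 + q^m r` with `r ≥ 0`, hence is positive. This one value
suffices to see that the theta factors of the gauge are not identically zero. -/
theorem theta_neg_one_ne_zero : theta q (-1) ≠ 0 := by
  have h : ∀ r : ℝ, 0 ≤ r → ∏' m : ℕ, (1 - (q.unit : ℂ) ^ m * (-r)) ≠ 0 := by
    intro r hr
    have := tprod_one_add_ne_zero_of_summable (R := ℂ)
      (f := fun m : ℕ => -((q.unit : ℂ) ^ m * (-r))) (fun m h => ?_) (by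
        simp only [norm_neg, norm_mul, norm_pow]
        exact (summable_geometric_of_lt_one (norm_nonneg _) (norm_unit_lt_one q)).mul_right _)
    · simpa only [sub_eq_add_neg] using this
    · have h1 : ((1 + (q : ℝ) ^ m * r : ℝ) : ℂ) = 0 := by
        rw [← h, QParam.unit, Units.val_mk0]; push_cast; ring
      have h2 : 0 ≤ (q : ℝ) ^ m * r := mul_nonneg (pow_nonneg q.2.1.le m) hr
      have h3 := Complex.ofReal_eq_zero.mp h1
      linarith
  rw [theta_eq]
  refine mul_ne_zero (by simpa using h 1 zero_le_one) ?_
  have := h q q.2.1.le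
  simpa [QParam.unit, div_neg] using this

end

end BqKZ
end
noncomputable section
namespace BqKZ

/-! ### Quasi-periodicity of the gauge factor and the gauged action. -/

section
variable {n : ℕ} (q : QParam) (k : ℂˣ)

theorem gauge_field_identity {F : Type*} [Field F] {u v : F} (hu : u ≠ 0) (hv : v ≠ 0)
    (a b c d : F) : a * (u * v) * b / (u * c * (v * d)) = a * (b / (c * d)) := by
  rw [show u * c * (v * d) = (u * v) * (c * d) by ring, mul_comm a, mul_assoc,
    mul_div_mul_left _ _ (mul_ne_zero hu hv), mul_div_assoc]

theorem inv_mul_mul_self {F : Type*} [Field F] {u : F} (hu : u ≠ 0) (a : F) :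
    u⁻¹ * (a * u) = a := by
  rw [mul_comm a, inv_mul_cancel_left₀ hu]

/-- The powers of `-κ` agree on both sides, which is the reason why `κ` disappears from the gauged
equations. The exponent `a b` of `u` is the cross term in `tri (a + b)`. -/
theorem gauge_scalar_identity (κ k u : ℂˣ) (d a b : ℤ) :
    (-κ) ^ (a + b) * u ^ (-tri (a + b)) = k ^ (d * (b - a)) * u ^ (-(a * b)) *
      ((-(κ * k ^ d)) ^ a * u ^ (-tri a) * ((-(κ * k ^ (-d))) ^ b * u ^ (-tri b))) := by
  have e : -tri (a + b) = -(a * b) + (-tri a + -tri b) := by rw [tri_add]; ring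
  have e' : d * (b - a) = d * b + -(d * a) := by ring
  have e'' : -d * b = -(d * b) := by ring
  rw [e, e', ← neg_mul κ, ← neg_mul κ, mul_zpow, mul_zpow, ← zpow_mul, ← zpow_mul, e'', zpow_add,
    zpow_add, zpow_add, zpow_add, zpow_neg k, zpow_neg k]
  generalize k ^ (d * b) = x
  generalize k ^ (d * a) = y
  rw [show x * y⁻¹ * u ^ (-(a * b)) * ((-κ) ^ a * y * u ^ (-tri a) * ((-κ) ^ b * x⁻¹ * u ^ (-tri b)))
    = (x * x⁻¹) * (y * y⁻¹) * ((-κ) ^ a * (-κ) ^ b * (u ^ (-(a * b)) * (u ^ (-tri a) * u ^ (-tri b))))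
    by ac_rfl, mul_inv_cancel, mul_inv_cancel, one_mul, one_mul]

theorem thetaHolo_val (c : ℂˣ) (l m : Lat n) (p : Torus n × Torus n) :
    (thetaHolo q c l m).1 p = theta q ((c * (tpow p.1 l * tpow p.2 m) : ℂˣ) : ℂ) := rfl

theorem dilate_thetaHolo (c : ℂˣ) (l m a b : Lat n) (r : ℤ)
    (hr : ∑ i, l i * a i - ∑ i, m i * b i = r) :
    dilate (qpow q (-l), qpow q m) (thetaHolo q c a b) =
      (((-c) ^ r * q.unit ^ (-tri r) : ℂˣ) : ℂ) •
        (monoHolo (r • a) (r • b) * thetaHolo q c a b) := by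
  refine Subtype.ext (funext fun p => ?_)
  have h : ∀ (t : Torus n) (l : Lat n), tpow t (r • l) = tpow t l ^ r := fun t l => by
    simp only [tpow, Pi.smul_apply, smul_eq_mul, mul_comm r, zpow_mul, Finset.prod_zpow]
  change (thetaHolo q c a b).1 _ = _ * ((monoHolo _ _).1 p * (thetaHolo q c a b).1 p)
  rw [thetaHolo_val, thetaHolo_val, monoHolo_val, h, h, ← mul_zpow]
  change theta q ((c * (tpow (qpow q (-l) * p.1) a * tpow (qpow q m * p.2) b) : ℂˣ) : ℂ) = _
  rw [tpow_mul, tpow_mul, tpow_qpow, tpow_qpow]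
  have e : ∑ i, (-l) i * a i = - ∑ i, l i * a i := by simp
  rw [e, show c * (q.unit ^ (-∑ i, l i * a i) * tpow p.1 a * (q.unit ^ (∑ i, m i * b i) * tpow p.2 b)) =
    q.unit ^ (-r) * (c * (tpow p.1 a * tpow p.2 b)) by
      rw [← hr, neg_sub, zpow_sub, zpow_neg]; ac_rfl, theta_zpow]
  generalize tpow p.1 a * tpow p.2 b = y
  rw [← mul_assoc, ← Units.val_mul, ← neg_mul c y, mul_zpow, mul_right_comm]

/-- If the monomial takes all nonzero values, the argument of theta reaches `-1`. -/
theorem thetaHolo_ne_zero (c : ℂˣ) {l m : Lat n} (h : ∀ z : ℂˣ, ∃ p : Torus n × Torus n,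
    tpow p.1 l * tpow p.2 m = z) : thetaHolo q c l m ≠ 0 := by
  intro h0
  obtain ⟨p, hp⟩ := h (c⁻¹ * -1)
  have h1 : (thetaHolo q c l m).1 p = 0 := by rw [h0]; rfl
  rw [thetaHolo_val, hp, mul_inv_cancel_left] at h1
  exact theta_neg_one_ne_zero q (by simpa using h1)

theorem tpow_mulSingle (i : Fin (n + 2)) (z : ℂˣ) (l : Lat n) :
    tpow (Pi.mulSingle i z) l = z ^ l i := by
  rw [tpow, Finset.prod_eq_single i]
  · rw [Pi.mulSingle_eq_same]
  · intro j _ hj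
    rw [Pi.mulSingle_eq_of_ne hj, one_zpow]
  · simp

theorem tpow_one (l : Lat n) : tpow (1 : Torus n) l = 1 := by simp [tpow]

theorem thetaHolo_ne_zero_left (c : ℂˣ) (i : Fin (n + 2)) (m : Lat n) :
    thetaHolo q c (eps i) m ≠ 0 :=
  thetaHolo_ne_zero q c fun z => ⟨(Pi.mulSingle i z, 1), by
    rw [tpow_mulSingle, tpow_one, eps, Pi.single_eq_same, zpow_one, mul_one]⟩

theorem thetaHolo_ne_zero_right (c : ℂˣ) (i : Fin (n + 2)) (l : Lat n) :
    thetaHolo q c l (-eps i) ≠ 0 :=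
  thetaHolo_ne_zero q c fun z => ⟨(1, Pi.mulSingle i z⁻¹), by
    rw [tpow_mulSingle, tpow_one, Pi.neg_apply, eps, Pi.single_eq_same, zpow_neg_one, inv_inv,
      one_mul]⟩

theorem holo_ne_zero {f : Holo n} (hf : f ≠ 0) : algebraMap (Holo n) (Mero n) f ≠ 0 :=
  (map_ne_zero_iff _ (IsFractionRing.injective (Holo n) (Mero n))).mpr hf

theorem gauge_ne_zero (κ : ℂˣ) : gauge q k κ ≠ (0 : Mero n) := by
  refine Finset.prod_ne_zero_iff.mpr fun i _ => div_ne_zero ?_ (mul_ne_zero ?_ ?_)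
  · exact holo_ne_zero (thetaHolo_ne_zero_left q _ _ _)
  · exact holo_ne_zero (thetaHolo_ne_zero_left q _ _ _)
  · exact holo_ne_zero (thetaHolo_ne_zero_right q _ _ _)

/-- The meromorphic function `c t^a γ^b`. -/
def monoMero (c : ℂˣ) (a b : Lat n) : Mero n :=
  algebraMap (Holo n) (Mero n) ((c : ℂ) • monoHolo a b)

theorem monoMero_mul (c c' : ℂˣ) (a b a' b' : Lat n) :
    monoMero c a b * monoMero c' a' b' = monoMero (c * c') (a + a') (b + b') := by
  rw [monoMero, monoMero, monoMero, ← map_mul, smul_mul_smul_comm, monoHolo_add, Units.val_mul]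

theorem monoMero_one : monoMero (1 : ℂˣ) (0 : Lat n) 0 = 1 := by
  rw [monoMero, monoHolo_zero, Units.val_one, one_smul, map_one]

theorem monoMero_ne_zero (c : ℂˣ) (a b : Lat n) : monoMero c a b ≠ 0 := by
  have h : monoMero c a b * monoMero c⁻¹ (-a) (-b) = 1 := by
    rw [monoMero_mul, mul_inv_cancel, add_neg_cancel, add_neg_cancel, monoMero_one]
  exact left_ne_zero_of_mul_eq_one h

theorem prod_monoMero {ι : Type*} (s : Finset ι) (c : ι → ℂˣ) (a b : ι → Lat n) :
    ∏ i ∈ s, monoMero (c i) (a i) (b i) =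
      monoMero (∏ i ∈ s, c i) (∑ i ∈ s, a i) (∑ i ∈ s, b i) := by
  induction s using Finset.cons_induction with
  | empty => simp [monoMero_one]
  | cons i s hi ih => rw [Finset.prod_cons, ih, monoMero_mul, Finset.prod_cons, Finset.sum_cons,
      Finset.sum_cons]

theorem shift_thetaHolo (c : ℂˣ) (l m a b : Lat n) (r : ℤ)
    (hr : ∑ i, l i * a i - ∑ i, m i * b i = r) :
    shift q l m (algebraMap (Holo n) (Mero n) (thetaHolo q c a b)) =
      monoMero ((-c) ^ r * q.unit ^ (-tri r)) (r • a) (r • b) *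
        algebraMap (Holo n) (Mero n) (thetaHolo q c a b) := by
  rw [shift_algebraMap, dilate_thetaHolo q c l m a b r hr, monoMero, ← map_mul, smul_mul_assoc]

theorem sum_mul_eps (l : Lat n) (i : Fin (n + 2)) : ∑ j, l j * eps i j = l i := by
  simp [eps, Pi.single_apply]

/-- The function `W(t, γ)⁻¹ W(q^{-l} t, q^m γ)`. -/
def gaugeRatio (l m : Lat n) : Mero n :=
  monoMero (∏ i : Fin (n + 2), (k ^ (delta i * (m i.rev - l i)) * q.unit ^ (-(l i * m i.rev))))
    (∑ i, m i.rev • eps i) (-∑ i, l i • eps i.rev)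

/-- In each factor of the gauge function the multipliers of the numerator and of the two
denominators combine, by `gauge_scalar_identity`, to a monomial in which `κ` does not occur. -/
theorem shift_gauge (κ : ℂˣ) (l m : Lat n) :
    shift q l m (gauge q k κ) = gaugeRatio q k l m * gauge q k κ := by
  have key : ∀ i : Fin (n + 2), shift q l m
      (algebraMap (Holo n) (Mero n) (thetaHolo q κ (eps i) (-eps i.rev)) /
      (algebraMap (Holo n) (Mero n) (thetaHolo q (κ * k ^ delta i) (eps i) 0) *
        algebraMap (Holo n) (Mero n) (thetaHolo q (κ * k ^ (-delta i)) 0 (-eps i.rev)))) =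
      monoMero (k ^ (delta i * (m i.rev - l i)) * q.unit ^ (-(l i * m i.rev)))
        (m i.rev • eps i) (-(l i • eps i.rev)) *
      (algebraMap (Holo n) (Mero n) (thetaHolo q κ (eps i) (-eps i.rev)) /
      (algebraMap (Holo n) (Mero n) (thetaHolo q (κ * k ^ delta i) (eps i) 0) *
        algebraMap (Holo n) (Mero n) (thetaHolo q (κ * k ^ (-delta i)) 0 (-eps i.rev)))) := by
    intro i
    have h1 := shift_thetaHolo q κ l m (eps i) (-eps i.rev) (l i + m i.rev) (by
      simp only [Pi.neg_apply, mul_neg, Finset.sum_neg_distrib, sum_mul_eps, sub_neg_eq_add])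
    have h2 := shift_thetaHolo q (κ * k ^ delta i) l m (eps i) 0 (l i) (by
      simp only [Pi.zero_apply, mul_zero, Finset.sum_const_zero, sum_mul_eps, sub_zero])
    have h3 := shift_thetaHolo q (κ * k ^ (-delta i)) l m 0 (-eps i.rev) (m i.rev) (by
      simp only [Pi.zero_apply, Pi.neg_apply, mul_neg, mul_zero, Finset.sum_neg_distrib,
        Finset.sum_const_zero, sum_mul_eps, zero_sub, neg_neg])
    have hd : ∀ f g : Mero n, shift q l m (f / g) = shift q l m f / shift q l m g :=
      fun f g => map_div₀ (shift q l m) f g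
    rw [hd, shift_mul, h1, h2, h3]
    have hm : monoMero ((-κ) ^ (l i + m i.rev) * q.unit ^ (-tri (l i + m i.rev)))
        ((l i + m i.rev) • eps i) ((l i + m i.rev) • -eps i.rev) =
        monoMero (k ^ (delta i * (m i.rev - l i)) * q.unit ^ (-(l i * m i.rev)))
        (m i.rev • eps i) (-(l i • eps i.rev)) *
        (monoMero ((-(κ * k ^ delta i)) ^ l i * q.unit ^ (-tri (l i))) (l i • eps i) (l i • 0) *
        monoMero ((-(κ * k ^ (-delta i))) ^ m i.rev * q.unit ^ (-tri (m i.rev))) (m i.rev • 0)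
          (m i.rev • -eps i.rev)) := by
      rw [monoMero_mul, monoMero_mul]
      congr 1
      · exact gauge_scalar_identity κ k q.unit (delta i) (l i) (m i.rev)
      · module
      · module
    rw [hm]
    have n2 : monoMero ((-(κ * k ^ delta i)) ^ l i * q.unit ^ (-tri (l i))) (l i • eps i) (l i • 0)
      ≠ 0 := monoMero_ne_zero _ _ _
    have n3 : monoMero ((-(κ * k ^ (-delta i))) ^ m i.rev * q.unit ^ (-tri (m i.rev)))
      (m i.rev • 0) (m i.rev • -eps i.rev) ≠ 0 := monoMero_ne_zero _ _ _
    revert n2 n3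
    generalize monoMero ((-(κ * k ^ delta i)) ^ l i * q.unit ^ (-tri (l i))) _ _ = u
    generalize monoMero ((-(κ * k ^ (-delta i))) ^ m i.rev * q.unit ^ (-tri (m i.rev))) _ _ = v
    intro n2 n3
    exact gauge_field_identity n2 n3 _ _ _ _
  have hp : ∀ f : Fin (n + 2) → Mero n, shift q l m (∏ i, f i) = ∏ i, shift q l m (f i) :=
    fun f => map_prod (shift q l m) f _
  rw [gauge, hp, Finset.prod_congr rfl fun i _ => key i, Finset.prod_mul_distrib, prod_monoMero,
    gaugeRatio, Finset.sum_neg_distrib]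

/-- The action of `(l, m)` on `H_0^𝕂` whose invariants are the solutions of the gauged
equations. -/
def gaugedTransl (l m : Lat n) (g : HeckeMero n) : HeckeMero n :=
  gaugeRatio q k l m • translX q k l (translY q k m g)

theorem translX_translY_smul (l m : Lat n) (f : Mero n) (g : HeckeMero n) :
    translX q k l (translY q k m (f • g)) = shift q l m f • translX q k l (translY q k m g) := by
  rw [translY_smul, translX_smul, shift_shift, add_zero, zero_add]

theorem smul_gaugedTransl (κ : ℂˣ) (l m : Lat n) (g : HeckeMero n) :
    (gauge q k κ : Mero n) • gaugedTransl q k l m g = translX q k l (translY q k m ((gauge q k κ : Mero n) • g)) := by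
  rw [translX_translY_smul, shift_gauge, gaugedTransl, ← mul_smul, mul_comm]

theorem smul_left_cancel_mero {n : ℕ} {f : Mero n} (hf : f ≠ 0) {x y : HeckeMero n} (h : f • x = f • y) :
    x = y :=
  funext fun v => mul_left_cancel₀ hf (congrFun h v)

/-- Multiplication by the gauge function, for any `κ`, conjugates this to the composition of
`translX` and `translY`, where the law is known. -/
theorem gaugedTransl_gaugedTransl (l m l' m' : Lat n) (g : HeckeMero n) :
    gaugedTransl q k l m (gaugedTransl q k l' m' g) = gaugedTransl q k (l + l') (m + m') g := by
  refine smul_left_cancel_mero (gauge_ne_zero q k 1) ?_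
  rw [smul_gaugedTransl, smul_gaugedTransl, smul_gaugedTransl, ← translX_translY q k l' m,
    translX_translX, translY_translY]

theorem gaugedTransl_comm (l m l' m' : Lat n) (g : HeckeMero n) :
    gaugedTransl q k l m (gaugedTransl q k l' m' g) =
      gaugedTransl q k l' m' (gaugedTransl q k l m g) := by
  rw [gaugedTransl_gaugedTransl, gaugedTransl_gaugedTransl, add_comm l, add_comm m]

theorem gaugedCocycle_mulVec (κ : ℂˣ) (l m : Lat n) (g : HeckeMero n) :
    (gaugedCocycle q k κ l m).mulVec (shiftVec q l m g) = gaugedTransl q k l m g := by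
  rw [gaugedCocycle, Matrix.smul_mulVec, cocycle_mulVec, shift_gauge, gaugedTransl]
  congr 1
  exact inv_mul_mul_self (gauge_ne_zero q k κ) _

theorem isGaugedSolution_iff (κ : ℂˣ) (g : HeckeMero n) :
    IsGaugedSolution q k κ g ↔ ∀ l m, gaugedTransl q k l m g = g :=
  forall₂_congr fun l m => by rw [gaugedCocycle_mulVec]

theorem gauge_mul_mem_SOL (κ : ℂˣ) {g : HeckeMero n} (h : ∀ l m, gaugedTransl q k l m g = g) :
    (fun w => gauge q k κ * g w) ∈ SOL q k := by
  intro l m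
  have h1 := smul_gaugedTransl q k κ l m g
  rw [h l m, ← cocycle_mulVec] at h1
  exact h1.symm

end

end BqKZ
end
noncomputable section
namespace BqKZ

/-! ### Rational functions of `t^{-α_i}` and `γ^{α_i}` that are regular at the origin -/

section
variable {n : ℕ}

/-- The index set of the variables `t^{-α_i}` and `γ^{α_i}`. -/
abbrev Var (n : ℕ) : Type := Fin (n + 1) ⊕ Fin (n + 1)

/-- Polynomials in the variables `t^{-α_i}` and `γ^{α_i}`. -/
abbrev Pol (n : ℕ) : Type := MvPolynomial (Var n) ℂ

/-- The functions `t^{-α_i}` and `γ^{α_i}`. -/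
def varHolo : Var n → Holo n :=
  Sum.elim (fun i => monoHolo (-simpleRoot i) 0) fun i => monoHolo 0 (simpleRoot i)

/-- The values of the functions `t^{-α_i}` and `γ^{α_i}` at a point. -/
def varVal (p : Torus n × Torus n) : Var n → ℂ := fun v => (varHolo v).1 p

/-- The function on `T × T` given by a polynomial in `t^{-α_i}` and `γ^{α_i}`. -/
def evPol : Pol n →ₐ[ℂ] Holo n := MvPolynomial.aeval varHolo

theorem evPol_val (f : Pol n) (p : Torus n × Torus n) :
    (evPol f).1 p = MvPolynomial.eval (varVal p) f := by
  induction f using MvPolynomial.induction_on with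
  | C a =>
    rw [evPol, MvPolynomial.aeval_C, MvPolynomial.eval_C]; rfl
  | add f g hf hg => rw [map_add, map_add, ← hf, ← hg]; rfl
  | mul_X f v hf =>
    rw [map_mul, map_mul, ← hf, MvPolynomial.eval_X]
    change (evPol f).1 p * (evPol (MvPolynomial.X v)).1 p = _
    rw [evPol, MvPolynomial.aeval_X]; rfl

theorem tpow_simpleRoot (t : Torus n) (i : Fin (n + 1)) :
    tpow t (simpleRoot i) = t i.castSucc * (t i.succ)⁻¹ := by
  have h : ∀ j, tpow t (eps j) = t j := fun j => by
    rw [tpow, Finset.prod_eq_single j]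
    · rw [eps, Pi.single_eq_same, zpow_one]
    · intro i _ hi
      rw [eps, Pi.single_eq_of_ne hi, zpow_zero]
    · simp
  rw [simpleRoot, sub_eq_add_neg, tpow_add, tpow_neg, h, h]

theorem varVal_inl (p : Torus n × Torus n) (i : Fin (n + 1)) :
    varVal p (Sum.inl i) = ((tpow p.1 (simpleRoot i))⁻¹ : ℂˣ) := by
  change (monoHolo (-simpleRoot i) 0).1 p = _
  rw [monoHolo_val, tpow_zero, mul_one, tpow_neg]

theorem varVal_inr (p : Torus n × Torus n) (i : Fin (n + 1)) :
    varVal p (Sum.inr i) = (tpow p.2 (simpleRoot i) : ℂˣ) := by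
  change (monoHolo 0 (simpleRoot i)).1 p = _
  rw [monoHolo_val, tpow_zero, one_mul]

theorem exists_varVal_eq (s : ℂˣ) : ∃ p : Torus n × Torus n, varVal p = fun _ => (s : ℂ) := by
  refine ⟨(fun i => s ^ (i : ℕ), fun i => (s ^ (i : ℕ))⁻¹), funext fun v => ?_⟩
  cases v with
  | inl i =>
    rw [varVal_inl, tpow_simpleRoot]
    simp [pow_succ]
  | inr i =>
    rw [varVal_inr, tpow_simpleRoot]
    simp [pow_succ]

/-- At suitable points of `T × T` all variables take the same value `1 / (m + 1)`, and letting `m`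
grow gives the value of the polynomial at the origin. This makes values at the origin well defined.
-/
theorem constantCoeff_eq_zero_of_evPol {f : Pol n} (h : evPol f = 0) :
    MvPolynomial.constantCoeff f = 0 := by
  have h1 : ∀ m : ℕ, MvPolynomial.eval (fun _ => (1 : ℂ) / ((m : ℂ) + 1)) f = 0 := fun m => by
    obtain ⟨p, hp⟩ := exists_varVal_eq (n := n)
      (Units.mk0 ((1 : ℂ) / ((m : ℂ) + 1)) (one_div_ne_zero (by exact_mod_cast m.succ_ne_zero)))
    rw [Units.val_mk0] at hp
    rw [← hp, ← evPol_val, h]; rfl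
  have h2 : Filter.Tendsto (fun m : ℕ => MvPolynomial.eval (fun _ => (1 : ℂ) / ((m : ℂ) + 1)) f)
      Filter.atTop (nhds (MvPolynomial.eval (fun _ => 0) f)) :=
    ((MvPolynomial.continuous_eval f).tendsto _).comp
      (tendsto_pi_nhds.mpr fun _ => tendsto_one_div_add_atTop_nhds_zero_nat)
  simp only [h1] at h2
  have h3 := tendsto_nhds_unique h2 tendsto_const_nhds
  rw [← h3, ← MvPolynomial.eval_zero]
  rfl

theorem evPol_ne_zero {e : Pol n} (h : MvPolynomial.constantCoeff e ≠ 0) : evPol e ≠ 0 :=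
  fun h0 => h (constantCoeff_eq_zero_of_evPol h0)

/-- The meromorphic function given by a polynomial in `t^{-α_i}` and `γ^{α_i}`. -/
def merPol (f : Pol n) : Mero n := algebraMap (Holo n) (Mero n) (evPol f)

theorem merPol_add (f g : Pol n) : merPol (f + g) = merPol f + merPol g := by
  rw [merPol, map_add, map_add]; rfl

theorem merPol_mul (f g : Pol n) : merPol (f * g) = merPol f * merPol g := by
  rw [merPol, map_mul, map_mul]; rfl

theorem merPol_one : merPol (1 : Pol n) = 1 := by rw [merPol, map_one, map_one]

theorem merPol_C (c : ℂ) : merPol (MvPolynomial.C c : Pol n) = algebraMap ℂ (Mero n) c := by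
  rw [merPol, evPol, MvPolynomial.aeval_C]; rfl

theorem merPol_ne_zero {e : Pol n} (h : MvPolynomial.constantCoeff e ≠ 0) : merPol e ≠ 0 :=
  holo_ne_zero (evPol_ne_zero h)

theorem merPol_injective_const {f g : Pol n} (h : merPol f = merPol g) :
    MvPolynomial.constantCoeff f = MvPolynomial.constantCoeff g := by
  have h1 : evPol f = evPol g := IsFractionRing.injective (Holo n) (Mero n) h
  have h2 := constantCoeff_eq_zero_of_evPol (f := f - g) (by rw [map_sub, h1, sub_self])
  rwa [map_sub, sub_eq_zero] at h2

/-- `x` is a rational function of the `t^{-α_i}` and `γ^{α_i}` which is regular at the origin,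
with value `c` there. -/
def Val (x : Mero n) (c : ℂ) : Prop := ∃ p e : Pol n, MvPolynomial.constantCoeff e = 1 ∧
  MvPolynomial.constantCoeff p = c ∧ x * merPol e = merPol p

theorem val_merPol (f : Pol n) : Val (merPol f) (MvPolynomial.constantCoeff f) :=
  ⟨f, 1, map_one _, rfl, by rw [merPol_one, mul_one]⟩

theorem val_C (c : ℂ) : Val (algebraMap ℂ (Mero n) c) c := by
  have := val_merPol (n := n) (MvPolynomial.C c)
  rwa [merPol_C, MvPolynomial.constantCoeff_C] at this

theorem val_one : Val (1 : Mero n) 1 := by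
  have := val_merPol (n := n) 1
  rwa [merPol_one, map_one] at this

theorem val_zero : Val (0 : Mero n) 0 := ⟨0, 1, map_one _, map_zero _, by
  rw [merPol, merPol, map_zero, map_zero, zero_mul]⟩

theorem Val.mul {x y : Mero n} {c d : ℂ} (hx : Val x c) (hy : Val y d) : Val (x * y) (c * d) := by
  obtain ⟨p, e, he, rfl, h⟩ := hx
  obtain ⟨p', e', he', rfl, h'⟩ := hy
  exact ⟨p * p', e * e', by rw [map_mul, he, he', one_mul], map_mul _ _ _, by
    rw [merPol_mul, merPol_mul, ← h, ← h', mul_mul_mul_comm]⟩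

theorem Val.add {x y : Mero n} {c d : ℂ} (hx : Val x c) (hy : Val y d) : Val (x + y) (c + d) := by
  obtain ⟨p, e, he, rfl, h⟩ := hx
  obtain ⟨p', e', he', rfl, h'⟩ := hy
  exact ⟨p * e' + p' * e, e * e', by rw [map_mul, he, he', one_mul], by
    rw [map_add, map_mul, map_mul, he, he', mul_one, mul_one], by
    rw [merPol_mul, merPol_add, merPol_mul, merPol_mul, ← h, ← h', add_mul, mul_assoc, mul_assoc,
      mul_comm (merPol e')]⟩

theorem Val.neg {x : Mero n} {c : ℂ} (hx : Val x c) : Val (-x) (-c) := by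
  obtain ⟨p, e, he, rfl, h⟩ := hx
  refine ⟨-p, e, he, map_neg _ _, ?_⟩
  rw [neg_mul, h, merPol, merPol, map_neg, map_neg]

theorem Val.sub {x y : Mero n} {c d : ℂ} (hx : Val x c) (hy : Val y d) : Val (x - y) (c - d) := by
  rw [sub_eq_add_neg, sub_eq_add_neg]
  exact hx.add hy.neg

theorem Val.sum {ι : Type*} {s : Finset ι} {x : ι → Mero n} {c : ι → ℂ}
    (h : ∀ i ∈ s, Val (x i) (c i)) : Val (∑ i ∈ s, x i) (∑ i ∈ s, c i) := by
  induction s using Finset.cons_induction with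
  | empty => exact val_zero
  | cons i s hi ih =>
    rw [Finset.sum_cons, Finset.sum_cons]
    exact (h i (Finset.mem_cons_self _ _)).add (ih fun j hj => h j (Finset.mem_cons_of_mem hj))

theorem Val.inv {x : Mero n} {c : ℂ} (hx : Val x c) (hc : c ≠ 0) : Val x⁻¹ c⁻¹ := by
  obtain ⟨p, e, he, rfl, h⟩ := hx
  set c := MvPolynomial.constantCoeff p with hcdef
  have hp : merPol p ≠ 0 := merPol_ne_zero hc
  have hx : x ≠ 0 := fun h0 => hp (by rw [← h, h0, zero_mul])
  refine ⟨MvPolynomial.C c⁻¹ * e, MvPolynomial.C c⁻¹ * p, ?_, ?_, ?_⟩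
  · rw [map_mul, MvPolynomial.constantCoeff_C, ← hcdef, inv_mul_cancel₀ hc]
  · rw [map_mul, MvPolynomial.constantCoeff_C, he, mul_one]
  · rw [merPol_mul, merPol_mul, ← h, mul_left_comm x⁻¹, inv_mul_cancel_left₀ hx]

theorem Val.unique {x : Mero n} {c d : ℂ} (hx : Val x c) (hy : Val x d) : c = d := by
  obtain ⟨p, e, he, rfl, h⟩ := hx
  obtain ⟨p', e', he', rfl, h'⟩ := hy
  have h1 : merPol (p * e') = merPol (p' * e) := by
    rw [merPol_mul, merPol_mul, ← h, ← h', mul_right_comm]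
  have h2 := merPol_injective_const h1
  rwa [map_mul, map_mul, he, he', mul_one, mul_one] at h2

theorem holo_hom_evPol {φ : Holo n →ₐ[ℂ] Holo n} {g : Var n → Pol n}
    (h : ∀ v, φ (varHolo v) = evPol (g v)) (f : Pol n) :
    φ (evPol f) = evPol (MvPolynomial.aeval g f) := by
  refine DFunLike.congr_fun (f := φ.comp evPol) (g := evPol.comp (MvPolynomial.aeval g))
    (MvPolynomial.algHom_ext fun v => ?_) f
  rw [AlgHom.comp_apply, AlgHom.comp_apply, evPol, MvPolynomial.aeval_X, MvPolynomial.aeval_X]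
  exact h v

theorem constantCoeff_aeval {g : Var n → Pol n} (hg : ∀ v, MvPolynomial.constantCoeff (g v) = 0)
    (f : Pol n) : MvPolynomial.constantCoeff (MvPolynomial.aeval g f) =
      MvPolynomial.constantCoeff f := by
  induction f using MvPolynomial.induction_on with
  | C a => simp
  | add f g hf hg => rw [map_add, map_add, map_add, hf, hg]
  | mul_X f v hf => rw [map_mul, map_mul, map_mul, MvPolynomial.aeval_X, hg,
      MvPolynomial.constantCoeff_X]; simp

/-- A substitution without constant terms fixes the origin, so it does not change values there. -/
theorem Val.map {φ : Holo n →ₐ[ℂ] Holo n} {Φ : Mero n → Mero n} {g : Var n → Pol n}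
    (hm : ∀ x y, Φ (x * y) = Φ x * Φ y)
    (hΦ : ∀ a, Φ (algebraMap (Holo n) (Mero n) a) = algebraMap (Holo n) (Mero n) (φ a))
    (h : ∀ v, φ (varHolo v) = evPol (g v)) (hg : ∀ v, MvPolynomial.constantCoeff (g v) = 0)
    {x : Mero n} {c : ℂ} (hx : Val x c) : Val (Φ x) c := by
  obtain ⟨p, e, he, rfl, hp⟩ := hx
  refine ⟨MvPolynomial.aeval g p, MvPolynomial.aeval g e, ?_, ?_, ?_⟩
  · rw [constantCoeff_aeval hg, he]
  · rw [constantCoeff_aeval hg]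
  · have h1 : ∀ f, Φ (merPol f) = merPol (MvPolynomial.aeval g f) := fun f => by
      rw [merPol, hΦ, holo_hom_evPol h]; rfl
    rw [← h1, ← h1, ← hp, hm]

/-- The factors by which `(t, γ) ↦ (q^{-l} t, q^m γ)` multiplies the functions `t^{-α_i}` and
`γ^{α_i}`. -/
def scaleFactor (q : QParam) (l m : Lat n) : Var n → ℂˣ :=
  Sum.elim (fun i => q.unit ^ (l i.castSucc - l i.succ)) fun i =>
    q.unit ^ (m i.castSucc - m i.succ)

theorem sum_mul_simpleRoot (l : Lat n) (i : Fin (n + 1)) :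
    ∑ j, l j * simpleRoot i j = l i.castSucc - l i.succ := by
  simp only [simpleRoot, Pi.sub_apply, mul_sub, Finset.sum_sub_distrib, sum_mul_eps]

theorem dilate_varHolo (q : QParam) (l m : Lat n) (v : Var n) :
    dilate (qpow q (-l), qpow q m) (varHolo v) = (scaleFactor q l m v : ℂ) • varHolo v := by
  cases v with
  | inl i =>
    change dilate _ (monoHolo (-simpleRoot i) 0) = _ • monoHolo (-simpleRoot i) 0
    rw [dilate_monoHolo]
    simp only [Pi.neg_apply, mul_neg, Finset.sum_neg_distrib, neg_neg, sum_mul_simpleRoot,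
      Pi.zero_apply, mul_zero, Finset.sum_const_zero, zpow_zero, mul_one]
    rfl
  | inr i =>
    change dilate _ (monoHolo 0 (simpleRoot i)) = _ • monoHolo 0 (simpleRoot i)
    rw [dilate_monoHolo]
    simp only [sum_mul_simpleRoot,
      Pi.zero_apply, mul_zero, Finset.sum_const_zero, neg_zero, zpow_zero, one_mul]
    rfl

theorem Val.shift (q : QParam) {x : Mero n} {c : ℂ} (hx : Val x c) (l m : Lat n) :
    Val (shift q l m x) c := by
  refine Val.map (φ := (dilate (qpow q (-l), qpow q m)).toAlgHom)
    (Φ := fun x => BqKZ.shift q l m x)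
    (g := fun v => (scaleFactor q l m v : ℂ) • MvPolynomial.X v) (shift_mul q l m)
    (shift_algebraMap q l m) (fun v => ?_) (fun v => ?_) hx
  · rw [map_smul, evPol, MvPolynomial.aeval_X]
    exact dilate_varHolo q l m v
  · rw [MvPolynomial.smul_eq_C_mul, map_mul, MvPolynomial.constantCoeff_X, mul_zero]

theorem Val.swapInv {x : Mero n} {c : ℂ} (hx : Val x c) : Val (swapInv x) c := by
  refine Val.map (φ := swapInvHom) (g := fun v => MvPolynomial.X v.swap) swapInv_mul
    swapInv_algebraMap (fun v => ?_) (fun v => MvPolynomial.constantCoeff_X _ _) hx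
  rw [evPol, MvPolynomial.aeval_X]
  cases v with
  | inl i =>
    change swapInvHom (monoHolo (-simpleRoot i) 0) = monoHolo 0 (simpleRoot i)
    rw [swapInvHom_monoHolo, neg_zero, neg_neg]
  | inr i =>
    change swapInvHom (monoHolo 0 (simpleRoot i)) = monoHolo (-simpleRoot i) 0
    rw [swapInvHom_monoHolo, neg_zero]

/-! ### Monomials with exponents in the positive cone -/

theorem posRoot_apply (a : Fin (n + 1) → ℕ) (j : Fin (n + 2)) : posRoot a j =
    (if h : (j : ℕ) < n + 1 then (a ⟨j, h⟩ : ℤ) else 0) -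
      (if h : 0 < (j : ℕ) then (a ⟨j - 1, by omega⟩ : ℤ) else 0) := by
  rw [posRoot, Finset.sum_apply]
  simp only [Pi.smul_apply, simpleRoot, Pi.sub_apply, smul_sub, Finset.sum_sub_distrib, eps,
    Pi.single_apply, nsmul_eq_mul, mul_ite, mul_one, mul_zero]
  congr 1
  · split_ifs with h
    · rw [Finset.sum_eq_single ⟨j, h⟩]
      · exact if_pos (Fin.ext rfl)
      · exact fun i _ hi => if_neg fun h' => hi (Fin.ext (by simp [h']))
      · simp
    · exact Finset.sum_eq_zero fun i _ => if_neg fun h' => h (by rw [h']; exact i.2)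
  · split_ifs with h
    · rw [Finset.sum_eq_single ⟨j - 1, by omega⟩]
      · exact if_pos (Fin.ext (by simp; omega))
      · exact fun i _ hi => if_neg fun h => hi (Fin.ext (by simp [h]))
      · simp
    · exact Finset.sum_eq_zero fun i _ => if_neg fun h' => h (by rw [h']; simp)

/-- The sum of the first `s` coordinates. -/
def psum (m : Lat n) (s : ℕ) : ℤ := ∑ i : Fin (n + 2), if (i : ℕ) < s then m i else 0

theorem exists_posRoot {m : Lat n} (h : ∀ s, 0 ≤ psum m s)
    (h0 : ∑ i, m i = 0) : ∃ a, posRoot a = m := by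
  refine ⟨fun i => (psum m (i + 1)).toNat, funext fun j => ?_⟩
  have hs : ∀ s : ℕ, (((psum m s).toNat : ℕ) : ℤ) = psum m s := fun s => Int.toNat_of_nonneg (h s)
  rw [posRoot_apply]
  simp only [hs]
  have e1 : (if h : (j : ℕ) < n + 1 then psum m (j + 1) else 0) =
      psum m (j + 1) := by
    split_ifs with hj
    · rfl
    · rw [← h0]
      exact Finset.sum_congr rfl fun i _ => (if_pos (by omega)).symm
  have e2 : (if h : 0 < (j : ℕ) then psum m (j - 1 + 1) else 0) =
      psum m j := by
    split_ifs with hj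
    · rw [Nat.sub_add_cancel hj]
    · exact (Finset.sum_eq_zero fun i _ => if_neg (by omega)).symm
  rw [e1, e2, psum, psum, ← Finset.sum_sub_distrib, Finset.sum_eq_single j]
  · simp
  · intro i _ hi
    have : (i : ℕ) ≠ j := fun h => hi (Fin.ext h)
    split_ifs <;> omega
  · simp

theorem monoHolo_posRoot (a b : Fin (n + 1) → ℕ) : monoHolo (-posRoot a) (posRoot b) =
    evPol ((∏ i, MvPolynomial.X (Sum.inl i) ^ a i) * ∏ i, MvPolynomial.X (Sum.inr i) ^ b i) := by
  have hl : ∀ s : Finset (Fin (n + 1)), monoHolo (-∑ i ∈ s, a i • simpleRoot i) 0 =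
      ∏ i ∈ s, (varHolo (Sum.inl i) : Holo n) ^ a i := fun s => by
    induction s using Finset.cons_induction with
    | empty => simp [monoHolo_zero]
    | cons i s hi ih =>
      rw [Finset.sum_cons, Finset.prod_cons, ← ih, neg_add, ← add_zero (0 : Lat n), monoHolo_add,
        add_zero]
      congr 1
      induction a i with
      | zero => simp [monoHolo_zero]
      | succ c ih => rw [pow_succ, ← ih, add_smul, one_smul, neg_add, ← add_zero (0 : Lat n),
          monoHolo_add, add_zero]; rfl
  have hr : ∀ s : Finset (Fin (n + 1)), monoHolo 0 (∑ i ∈ s, b i • simpleRoot i) =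
      ∏ i ∈ s, (varHolo (Sum.inr i) : Holo n) ^ b i := fun s => by
    induction s using Finset.cons_induction with
    | empty => simp [monoHolo_zero]
    | cons i s hi ih =>
      rw [Finset.sum_cons, Finset.prod_cons, ← ih, ← add_zero (0 : Lat n), monoHolo_add,
        add_zero]
      congr 1
      induction b i with
      | zero => simp [monoHolo_zero]
      | succ c ih => rw [pow_succ, ← ih, add_smul, one_smul, ← add_zero (0 : Lat n),
          monoHolo_add, add_zero]; rfl
  rw [map_mul, map_prod, map_prod]
  simp only [map_pow]
  simp only [evPol, MvPolynomial.aeval_X]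
  rw [← hl, ← hr, ← monoHolo_add, add_zero, zero_add]
  rfl

theorem constantCoeff_prod_X (a : Fin (n + 1) → ℕ) (f : Fin (n + 1) → Var n) (h : a ≠ 0) :
    MvPolynomial.constantCoeff (∏ i, (MvPolynomial.X (f i) : Pol n) ^ a i) = 0 := by
  obtain ⟨i, hi⟩ := Function.ne_iff.mp h
  rw [map_prod]
  refine Finset.prod_eq_zero (Finset.mem_univ i) ?_
  rw [map_pow, MvPolynomial.constantCoeff_X, zero_pow hi]

theorem posRoot_zero : posRoot (0 : Fin (n + 1) → ℕ) = 0 := by simp [posRoot]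

open Classical in
theorem val_gam {m : Lat n} (h : ∀ s, 0 ≤ psum m s)
    (h0 : ∑ i, m i = 0) : Val (gam m) (if m = 0 then 1 else 0) := by
  split_ifs with hm
  · rw [hm, gam_zero]; exact val_one
  · obtain ⟨b, rfl⟩ := exists_posRoot h h0
    have hb : b ≠ 0 := fun hb => hm (by rw [hb, posRoot_zero])
    have := val_merPol (n := n)
      ((∏ i, MvPolynomial.X (Sum.inl i) ^ (0 : Fin (n + 1) → ℕ) i) *
        ∏ i, MvPolynomial.X (Sum.inr i) ^ b i)
    rw [merPol, ← monoHolo_posRoot, map_mul, constantCoeff_prod_X b _ hb, mul_zero, posRoot_zero,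
      neg_zero] at this
    exact this

theorem val_monoHolo_neg {m : Lat n} (h : ∀ s, 0 ≤ psum m s)
    (h0 : ∑ i, m i = 0) (hm : m ≠ 0) : Val (algebraMap (Holo n) (Mero n) (monoHolo (-m) 0)) 0 := by
  classical
  have := (val_gam h h0).swapInv
  rwa [if_neg hm, gam, swapInv_algebraMap, swapInvHom_monoHolo, neg_zero] at this

end

end BqKZ
end
noncomputable section
namespace BqKZ

/-! ### Limits of the operators `w T_u` -/

section
variable {n : ℕ} (q : QParam) (k : ℂˣ)

/-- The element of `H_0` with the given coefficients in the basis `T_v`. -/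
def heckeOp (a : Perm n → ℂ) : Op n := ∑ v, a v • opTw q k v

theorem heckeOp_add (a b : Perm n → ℂ) : heckeOp q k (a + b) = heckeOp q k a + heckeOp q k b := by
  simp only [heckeOp, Pi.add_apply, add_smul, Finset.sum_add_distrib]

theorem heckeOp_smul (c : ℂ) (a : Perm n → ℂ) : heckeOp q k (c • a) = c • heckeOp q k a := by
  simp only [heckeOp, Pi.smul_apply, smul_eq_mul, mul_smul, Finset.smul_sum]

theorem heckeOp_single (u : Perm n) : heckeOp q k (Pi.single u 1) = opTw q k u := by
  rw [heckeOp, Finset.sum_eq_single u]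
  · rw [Pi.single_eq_same, one_smul]
  · intro v _ hv
    rw [Pi.single_eq_of_ne hv, zero_smul]
  · simp

theorem hasSymbol_heckeOp (a : Perm n → ℂ) :
    HasSymbol q k (heckeOp q k a) fun v => algebraMap ℂ (Mero n) (a v) := by
  have h : ∀ s : Finset (Perm n), HasSymbol q k (∑ v ∈ s, a v • opTw q k v)
      (∑ v ∈ s, algebraMap ℂ (Mero n) (a v) • Pi.single v 1) := fun s => by
    induction s using Finset.cons_induction with
    | empty => exact hasSymbol_zero
    | cons v s hv ih =>
      rw [Finset.sum_cons, Finset.sum_cons]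
      exact ((hasSymbol_opTw v).smul _).add ih
  rw [heckeMero_eq_sum fun v => algebraMap ℂ (Mero n) (a v)]
  exact h _

theorem heckeOp_injective : Function.Injective (heckeOp (n := n) q k) := by
  intro a b h
  have h1 := hasSymbol_heckeOp q k a
  rw [h] at h1
  have h2 := h1.unique (hasSymbol_heckeOp q k b)
  exact funext fun v => (algebraMap ℂ (Mero n)).injective (congrFun h2 v)

theorem isUnit_opTw (u : Perm n) : IsUnit (opTw q k u) := by
  induction u using perm_induction with
  | one => rw [opTw_one]; exact isUnit_one
  | step u a h ih =>
    rw [← opTw_mul_of_ascent q k h, ← unitT_val]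
    exact ih.mul (unitT q k a).isUnit

theorem exists_opT_mul_opTw (a : Fin (n + 1)) (u : Perm n) :
    ∃ b, opT q k a * opTw q k u = heckeOp q k b := by
  rcases ascent_or_descent u⁻¹ a with h | h
  · exact ⟨Pi.single (simplePerm a * u) 1, by rw [opT_mul_of_ascent q k h, heckeOp_single]⟩
  · exact ⟨Pi.single (simplePerm a * u) 1 + kk k • Pi.single u 1, by
      rw [opT_mul_of_descent q k h, heckeOp_add, heckeOp_smul, heckeOp_single, heckeOp_single]⟩

/-- `h = ∑ f_v(X) T_v`, where the coefficients of `g f_v` have the limits `a_v`. -/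
def LimRep (g : Weyl n) (h : Op n) (a : Perm n → ℂ) : Prop :=
  ∃ c : Perm n → RatFn n, h = ∑ v, mulOp (c v) * opTw q k v ∧
    ∀ v, Val (evX (weylFieldEquiv q g (c v))) (a v)

variable {q k}

theorem LimRep.add {g : Weyl n} {h h' : Op n} {a a' : Perm n → ℂ} (H : LimRep q k g h a)
    (H' : LimRep q k g h' a') : LimRep q k g (h + h') (a + a') := by
  obtain ⟨c, rfl, hc⟩ := H
  obtain ⟨c', rfl, hc'⟩ := H'
  refine ⟨c + c', ?_, fun v => ?_⟩
  · simp only [Pi.add_apply, mulOp_add, add_mul, Finset.sum_add_distrib]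
  · rw [Pi.add_apply, map_add, evX_add]
    exact (hc v).add (hc' v)

theorem limRep_zero (g : Weyl n) : LimRep q k g 0 0 := by
  refine ⟨0, ?_, fun v => ?_⟩
  · exact (Finset.sum_eq_zero fun v _ => by
      rw [show mulOp ((0 : Perm n → RatFn n) v) = 0 from LinearMap.mulLeft_zero_eq_zero _ _,
        zero_mul]).symm
  · rw [Pi.zero_apply, map_zero, evX_zero]
    exact val_zero

theorem LimRep.mulOp_mul {g : Weyl n} {h : Op n} {a : Perm n → ℂ} (H : LimRep q k g h a)
    {f : RatFn n} {z : ℂ} (hf : Val (evX (weylFieldEquiv q g f)) z) :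
    LimRep q k g (mulOp f * h) (z • a) := by
  obtain ⟨c, rfl, hc⟩ := H
  refine ⟨fun v => f * c v, ?_, fun v => ?_⟩
  · simp only [BqKZ.mulOp_mul, Finset.mul_sum, mul_assoc]
  · rw [map_mul, evX_mul]
    exact hf.mul (hc v)

theorem LimRep.smul {g : Weyl n} {h : Op n} {a : Perm n → ℂ} (H : LimRep q k g h a) (z : ℂ) :
    LimRep q k g (z • h) (z • a) := by
  have := H.mulOp_mul (f := algebraMap ℂ (RatFn n) z) (z := z) (by
    rw [AlgEquiv.commutes, evX_algebraMapC]; exact val_C z)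
  rwa [mulOp_algebraMap, ← Algebra.smul_def] at this

theorem LimRep.sum {g : Weyl n} {ι : Type*} {s : Finset ι} {h : ι → Op n} {a : ι → Perm n → ℂ}
    (H : ∀ i ∈ s, LimRep q k g (h i) (a i)) : LimRep q k g (∑ i ∈ s, h i) (∑ i ∈ s, a i) := by
  induction s using Finset.cons_induction with
  | empty => exact limRep_zero g
  | cons i s hi ih =>
    rw [Finset.sum_cons, Finset.sum_cons]
    exact (H i (Finset.mem_cons_self _ _)).add (ih fun j hj => H j (Finset.mem_cons_of_mem hj))

theorem limRep_opTw (g : Weyl n) (u : Perm n) : LimRep q k g (opTw q k u) (Pi.single u 1) := by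
  refine ⟨Pi.single u 1, ?_, fun v => ?_⟩
  · rw [Finset.sum_eq_single u]
    · rw [Pi.single_eq_same, mulOp_one, one_mul]
    · intro v _ hv
      rw [Pi.single_eq_of_ne hv,
        show mulOp (0 : RatFn n) = 0 from LinearMap.mulLeft_zero_eq_zero _ _, zero_mul]
    · simp
  · by_cases hv : v = u
    · subst hv
      rw [Pi.single_eq_same, Pi.single_eq_same, map_one, evX_one]
      exact val_one
    · rw [Pi.single_eq_of_ne hv, Pi.single_eq_of_ne hv, map_zero, evX_zero]
      exact val_zero

theorem psum_eps (i : Fin (n + 2)) (s : ℕ) : psum (eps i : Lat n) s = ind ((i : ℕ) < s) := by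
  rw [psum, Finset.sum_eq_single i]
  · rw [eps, Pi.single_eq_same, ind]
    congr
  · intro j _ hj
    rw [eps, Pi.single_eq_of_ne hj, ite_self]
  · simp

theorem psum_sub (l m : Lat n) (s : ℕ) : psum (l - m) s = psum l s - psum m s := by
  rw [psum, psum, psum, ← Finset.sum_sub_distrib]
  refine Finset.sum_congr rfl fun i _ => ?_
  split_ifs <;> simp

/-- As the permutation part of `g` inverts the positions `a` and `a + 1`, the transform of `x_a /
x_{a+1}` is a scalar times `t^{-α}` for a positive root `α`, which vanishes at the origin. -/
theorem val_ratioX {g : Weyl n} {a : Fin (n + 1)} (h : g.right a.succ < g.right a.castSucc) :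
    Val (evX (weylFieldEquiv q g (ratioX a))) 0 := by
  rw [show ratioX a = ratMono (simpleRoot a) from rfl, weylFieldEquiv_ratMono, evX_smul, ratMono, evX_algebraMap, evalXHom_mono,
    Algebra.smul_def]
  have e : (fun i => (simpleRoot a : Lat n) (g.right⁻¹ i)) =
      -(eps (g.right a.succ) - eps (g.right a.castSucc)) := by
    funext i
    simp only [simpleRoot, Pi.sub_apply, Pi.neg_apply, eps_eq_ind, neg_sub]
    rw [ind_congr (Equiv.Perm.inv_eq_iff_eq (f := g.right)),
      ind_congr (Equiv.Perm.inv_eq_iff_eq (f := g.right))]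
  rw [e]
  have h1 := val_monoHolo_neg (n := n) (m := eps (g.right a.succ) - eps (g.right a.castSucc))
    (fun s => by
      rw [psum_sub, psum_eps, psum_eps]
      rw [Fin.lt_def] at h
      unfold ind
      split_ifs <;> omega)
    (by simp [eps])
    (fun h0 => by
      have := congrFun h0 (g.right a.succ)
      rw [Pi.sub_apply, eps_eq_ind, eps_eq_ind, ind_true rfl, ind_false h.ne, Pi.zero_apply] at this
      norm_num at this)
  have := (val_C (n := n) ((q.unit ^ (-∑ i, lat g i * (simpleRoot a : Lat n)
    (g.right⁻¹ i)) : ℂˣ) : ℂ)).mul h1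
  rwa [mul_zero] at this

theorem map_ckX_inv {F : Type*} [Field F] (φ : RatFn n →+* F) (a : Fin (n + 1)) :
    φ (ckX k a)⁻¹ = (1 - φ (ratioX a)) * (φ (algebraMap ℂ (RatFn n) ((k : ℂ)⁻¹)) -
      φ (algebraMap ℂ (RatFn n) (k : ℂ)) * φ (ratioX a))⁻¹ := by
  rw [ckX, map_inv₀, map_div₀, map_sub, map_sub, map_mul, map_one, inv_div, div_eq_mul_inv]

/-- By `val_ratioX` the argument of `c_k` tends to `0`, and `c_k(0) = k⁻¹`. -/
theorem val_ckX_inv {g : Weyl n} {a : Fin (n + 1)} (h : g.right a.succ < g.right a.castSucc) :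
    Val (evX (weylFieldEquiv q g (ckX k a)⁻¹)) k := by
  have h1 := map_ckX_inv (k := k) (F := Mero n)
    ((evXAlg n : RatFn n →+* Mero n).comp (weylFieldEquiv q g : RatFn n →+* RatFn n)) a
  have h2 : ∀ c : ℂ, evX (weylFieldEquiv q g (algebraMap ℂ (RatFn n) c)) =
      algebraMap ℂ (Mero n) c := fun c => by rw [AlgEquiv.commutes, evX_algebraMapC]
  change evX (weylFieldEquiv q g (ckX k a)⁻¹) = (1 - evX (weylFieldEquiv q g (ratioX a))) *
    (evX (weylFieldEquiv q g (algebraMap ℂ (RatFn n) ((k : ℂ)⁻¹))) -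
      evX (weylFieldEquiv q g (algebraMap ℂ (RatFn n) (k : ℂ))) *
        evX (weylFieldEquiv q g (ratioX a)))⁻¹ at h1
  rw [h1, h2, h2]
  have h3 := val_ratioX (q := q) h
  have h4 := ((val_one (n := n)).sub h3).mul
    (((val_C ((k : ℂ)⁻¹)).sub ((val_C (k : ℂ)).mul h3)).inv
      (by rw [mul_zero, sub_zero]; exact inv_ne_zero k.ne_zero))
  rwa [mul_zero, sub_zero, sub_zero, inv_inv, one_mul] at h4

variable (k) in
theorem weylOp_simple_mul (a : Fin (n + 1)) (h : Op n) :
    weylOp q (ofPerm (simplePerm a)) * h = mulOp (ckX k a)⁻¹ * (opT q k a * h) +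
      mulOp (1 - algebraMap ℂ _ (k : ℂ) * (ckX k a)⁻¹) * h := by
  have h0 := ckX_ne_zero k a
  have e : (1 : RatFn n) - algebraMap ℂ _ (k : ℂ) * (ckX k a)⁻¹ =
      -((ckX k a)⁻¹ * (algebraMap ℂ (RatFn n) (k : ℂ) - ckX k a)) := by
    rw [mul_sub, inv_mul_cancel₀ h0, mul_comm, neg_sub]
  rw [weylOp_simple_eq (k := k), e, ← mul_assoc, ← add_mul, mul_sub, ← BqKZ.mulOp_mul,
    sub_eq_add_neg, show ∀ f : RatFn n, mulOp (-f) = -mulOp f from fun f => by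
      ext x; simp [mulOp_apply]]

theorem simplePerm_lt {a : Fin (n + 1)} {x y : Fin (n + 2)} (h : x < y)
    (hne : ¬(x = a.castSucc ∧ y = a.succ)) : simplePerm a x < simplePerm a y := by
  have h1 : ∀ z : Fin (n + 2), ((simplePerm a z : Fin (n + 2)) : ℕ) =
      if (z : ℕ) = a then (a : ℕ) + 1 else if (z : ℕ) = a + 1 then (a : ℕ) else z := fun z => by
    rw [simplePerm, Equiv.swap_apply_def]
    simp only [Fin.ext_iff, Fin.val_castSucc, Fin.val_succ]
    split_ifs <;> simp
  rw [Fin.lt_def, h1, h1]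
  simp only [Fin.ext_iff, Fin.val_castSucc, Fin.val_succ, Fin.lt_def] at h hne
  split_ifs <;> omega

theorem heckeOp_sum {ι : Type*} (s : Finset ι) (a : ι → Perm n → ℂ) :
    heckeOp q k (∑ i ∈ s, a i) = ∑ i ∈ s, heckeOp q k (a i) := by
  induction s using Finset.cons_induction with
  | empty => simp [heckeOp]
  | cons i s hi ih => rw [Finset.sum_cons, Finset.sum_cons, heckeOp_add, ih]

/-- In the limit, `w T_u` becomes `k^{ℓ(w)} T_{w⁻¹}⁻¹ T_u`: each simple reflection equals `c_k⁻¹ T_a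
+ (1 - k c_k⁻¹)`, with limit `k T_a + (1 - k²) = k T_a⁻¹`. The condition on `g` ensures that each
argument of `c_k` that occurs tends to `0` rather than to infinity. -/
theorem exists_limRep (w : Perm n) {g : Weyl n}
    (hg : ∀ i j, i < j → w⁻¹ j < w⁻¹ i → g.right j < g.right i) :
    ∃ m : ℤ, ell (ofPerm w) = 2 * m ∧ ∀ u, ∃ a,
      LimRep q k g (weylOp q (ofPerm w) * opTw q k u) a ∧
        opTw q k w⁻¹ * heckeOp q k a = ((k ^ m : ℂˣ) : ℂ) • opTw q k u := by
  induction w using perm_induction with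
  | one =>
    refine ⟨0, by simp [ell_one], fun u => ⟨Pi.single u 1, ?_, ?_⟩⟩
    · rw [ofPerm_one, weylOp_one, one_mul]
      exact limRep_opTw g u
    · rw [inv_one, opTw_one, one_mul, heckeOp_single, zpow_zero, Units.val_one, one_smul]
  | step w a ha ih =>
    -- As `a` is an ascent of `w`, the only pair reversed by `s_a` is not an inversion, so the
    -- inversions for `w` persist for `w s_a`.
    obtain ⟨m, hm, H⟩ := ih fun i j hij h => by
      refine hg i j hij ?_
      have hne : ¬(w⁻¹ j = a.castSucc ∧ w⁻¹ i = a.succ) := fun ⟨h1, h2⟩ => by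
        rw [Equiv.Perm.inv_eq_iff_eq] at h1 h2
        rw [h1, h2] at hij
        exact lt_asymm ha hij
      rw [mul_inv_rev, simplePerm_inv, Equiv.Perm.mul_apply, Equiv.Perm.mul_apply]
      exact simplePerm_lt h hne
    refine ⟨m + 1, by rw [ell_ascent ha, hm]; ring, fun u => ?_⟩
    choose b hb using H
    obtain ⟨c, hc⟩ := exists_opT_mul_opTw q k a u
    have hneg : (g * ofPerm w).right a.succ < (g * ofPerm w).right a.castSucc := by
      refine hg _ _ ha ?_
      simp [Fin.lt_def, simplePerm_inv]
    have hv := val_ckX_inv (q := q) (k := k) hneg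
    have hv' : Val (evX (weylFieldEquiv q (g * ofPerm w)
        (1 - algebraMap ℂ _ (k : ℂ) * (ckX k a)⁻¹))) (1 - (k : ℂ) * k) := by
      rw [map_sub, map_mul, map_one, AlgEquiv.commutes]
      have e : ∀ x y : RatFn n, evX (x - y) = evX x - evX y := fun x y => map_sub (evXAlg n) x y
      rw [e, evX_mul, evX_one, evX_algebraMapC]
      exact val_one.sub ((val_C _).mul hv)
    rw [weylFieldEquiv_mul] at hv hv'
    refine ⟨(k : ℂ) • ∑ v, c v • b v + (1 - (k : ℂ) * k) • b u, ?_, ?_⟩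
    · have key : ∀ f (h : Op n), weylOp q (ofPerm w) * (mulOp f * h) =
          mulOp (weylFieldEquiv q (ofPerm w) f) * (weylOp q (ofPerm w) * h) := fun f h => by
        rw [← mul_assoc, weylOp_mulOp, mul_assoc]
      rw [ofPerm_mul, weylOp_mul, mul_assoc, weylOp_simple_mul k, mul_add, key, key, hc, heckeOp, Finset.mul_sum]
      simp only [mul_smul_comm]
      exact ((LimRep.sum fun v _ => (hb v).1.smul _).mulOp_mul hv).add ((hb u).1.mulOp_mul hv')
    · have h1 : opTw q k (w * simplePerm a)⁻¹ = opT q k a * opTw q k w⁻¹ := by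
        rw [opT_mul_of_ascent q k (by rwa [inv_inv]), mul_inv_rev, simplePerm_inv]
      have h2 : opTw q k w⁻¹ * heckeOp q k (∑ v, c v • b v) =
          ((k ^ m : ℂˣ) : ℂ) • (opT q k a * opTw q k u) := by
        rw [heckeOp_sum, Finset.mul_sum, hc, heckeOp, Finset.smul_sum]
        refine Finset.sum_congr rfl fun v _ => ?_
        rw [heckeOp_smul, mul_smul_comm, (hb v).2, smul_comm]
      -- This scalar is what remains in front of `T_a T_u` when `T_a` is applied to `k T_a T_u + (1
      -- - k²) T_u` and the quadratic relation is used.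
      have hk : (k : ℂ) * kk k + (1 - (k : ℂ) * k) = 0 := by
        rw [kk, mul_sub, mul_inv_cancel₀ k.ne_zero]; ring
      rw [h1, mul_assoc, heckeOp_add, heckeOp_smul, heckeOp_smul, mul_add, mul_smul_comm,
        mul_smul_comm, h2, (hb u).2, mul_add, mul_smul_comm, mul_smul_comm, mul_smul_comm,
        mul_smul_comm, ← mul_assoc, opT_sq, add_mul, one_mul, smul_mul_assoc, smul_add, smul_add,
        zpow_add, zpow_one, Units.val_mul]
      have h3 : (k : ℂ) • ((k ^ m : ℂˣ) : ℂ) • kk k • (opT q k a * opTw q k u) +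
          (1 - (k : ℂ) * k) • ((k ^ m : ℂˣ) : ℂ) • (opT q k a * opTw q k u) = 0 := by
        rw [smul_smul, smul_smul, smul_smul, ← add_smul]
        rw [show (k : ℂ) * ((k ^ m : ℂˣ) : ℂ) * kk k + (1 - (k : ℂ) * k) * ((k ^ m : ℂˣ) : ℂ) =
          ((k : ℂ) * kk k + (1 - (k : ℂ) * k)) * ((k ^ m : ℂˣ) : ℂ) by ring, hk, zero_mul, zero_smul]
      rw [add_right_comm, h3, zero_add, smul_smul, mul_comm]

end

end BqKZ
end
noncomputable section
namespace BqKZ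

/-! ### The gauged equations at the origin -/

section
variable {n : ℕ} (q : QParam) (k : ℂˣ)

theorem translX_zero_left (x : HeckeMero n) : translX q k 0 x = x := by
  refine semilinear_ext (F := fun x => translX q k 0 x) (G := fun x => x) (fun f => f)
    (translX_add _ _ _) (fun _ _ => rfl) (fun f x => by rw [translX_smul, shift_zero])
    (fun _ _ => rfl) (fun u => ?_) x
  have h := (hasSymbol_opTw (q := q) (k := k) u).translX 0
  rw [transl_zero, weylOp_one, one_mul] at h
  exact h.unique (hasSymbol_opTw u)

theorem translY_zero_left (x : HeckeMero n) : translY q k 0 x = x := by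
  rw [translY, translX_zero_left, swapVec_swapVec]

theorem gaugedTransl_add (l m : Lat n) (x y : HeckeMero n) :
    gaugedTransl q k l m (x + y) = gaugedTransl q k l m x + gaugedTransl q k l m y := by
  rw [gaugedTransl, translY_add, translX_add, smul_add]; rfl

theorem gaugedTransl_smul (l m : Lat n) (f : Mero n) (x : HeckeMero n) :
    gaugedTransl q k l m (f • x) = shift q l m f • gaugedTransl q k l m x := by
  rw [gaugedTransl, translX_translY_smul, smul_smul, mul_comm, ← smul_smul]; rfl

theorem gaugedTransl_eq_sum (l m : Lat n) (x : HeckeMero n) :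
    gaugedTransl q k l m x = ∑ u, shift q l m (x u) • gaugedTransl q k l m (Pi.single u 1) := by
  have h0 : gaugedTransl q k l m (0 : HeckeMero n) = 0 := by
    have := gaugedTransl_smul q k l m 0 (0 : HeckeMero n)
    rwa [zero_smul, shift_map_zero, zero_smul] at this
  have h : ∀ s : Finset (Perm n), gaugedTransl q k l m (∑ u ∈ s, x u • Pi.single u 1) =
      ∑ u ∈ s, shift q l m (x u) • gaugedTransl q k l m (Pi.single u 1) := fun s => by
    induction s using Finset.cons_induction with
    | empty => exact h0
    | cons u s hu ih => rw [Finset.sum_cons, Finset.sum_cons, gaugedTransl_add, gaugedTransl_smul, ih]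
  conv_lhs => rw [heckeMero_eq_sum x]
  exact h _

theorem gaugedTransl_apply (l m : Lat n) (x : HeckeMero n) (v : Perm n) :
    gaugedTransl q k l m x v =
      ∑ u, gaugedTransl q k l m (Pi.single u 1) v * shift q l m (x u) := by
  conv_lhs => rw [gaugedTransl_eq_sum]
  rw [Finset.sum_apply]
  exact Finset.sum_congr rfl fun u _ => mul_comm _ _

theorem gaugeRatio_zero : gaugeRatio q k (0 : Lat n) 0 = 1 := by
  simp [gaugeRatio, monoMero_one]

theorem gaugedTransl_zero (x : HeckeMero n) : gaugedTransl q k 0 0 x = x := by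
  rw [gaugedTransl, gaugeRatio_zero, one_smul, translY_zero_left, translX_zero_left]

/-- The matrix of the gauged equation of `(l, m)` has the value `A` at the origin. -/
def HasVal (l m : Lat n) (A : Matrix (Perm n) (Perm n) ℂ) : Prop :=
  ∀ v u, Val (gaugedTransl q k l m (Pi.single u 1) v) (A v u)

variable {q k}

theorem hasVal_zero : HasVal q k (0 : Lat n) 0 1 := fun v u => by
  rw [gaugedTransl_zero, Matrix.one_apply, Pi.single_apply]
  split_ifs
  · exact val_one
  · exact val_zero

theorem HasVal.mul {l m l' m' : Lat n} {A B : Matrix (Perm n) (Perm n) ℂ}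
    (hA : HasVal q k l m A) (hB : HasVal q k l' m' B) : HasVal q k (l + l') (m + m') (A * B) := by
  intro v u
  rw [← gaugedTransl_gaugedTransl, gaugedTransl_apply, Matrix.mul_apply]
  exact Val.sum fun w _ => (hA v w).mul ((hB w u).shift q l m)

theorem HasVal.unique {l m : Lat n} {A B : Matrix (Perm n) (Perm n) ℂ}
    (hA : HasVal q k l m A) (hB : HasVal q k l m B) : A = B :=
  Matrix.ext fun v u => (hA v u).unique (hB v u)

/-- The gauged operators commute and values at the origin are unique. -/
theorem HasVal.commute {l m l' m' : Lat n} {A B : Matrix (Perm n) (Perm n) ℂ}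
    (hA : HasVal q k l m A) (hB : HasVal q k l' m' B) : A * B = B * A := by
  have h := hB.mul hA
  rw [add_comm l', add_comm m'] at h
  exact (hA.mul hB).unique h

theorem swapInv_monoMero (c : ℂˣ) (a b : Lat n) :
    swapInv (monoMero c a b) = monoMero c (-b) (-a) := by
  rw [monoMero, swapInv_algebraMap, map_smul, swapInvHom_monoHolo]; rfl

theorem delta_rev (i : Fin (n + 2)) : (delta i.rev : ℤ) = -delta i := by
  simp only [delta, Fin.val_rev]
  have := i.2
  omega

variable (q k) in
-- Reversal of the indices changes the sign of `δ`, which makes up for exchanging the roles of `l`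
-- and `m`.
theorem swapInv_gaugeRatio (l : Lat n) : swapInv (gaugeRatio q k l 0) = gaugeRatio q k 0 l := by
  rw [gaugeRatio, gaugeRatio, swapInv_monoMero]
  congr 1
  · refine Fintype.prod_equiv Fin.revPerm _ _ fun i => ?_
    simp [delta_rev]
  · rw [neg_neg]
    exact Fintype.sum_equiv Fin.revPerm _ _ fun i => by simp
  · simp

/-- The equations in `γ` are mirror images of those in `t`, so the values at the origin have to be
computed for the latter only. -/
theorem gaugedTransl_swap (l : Lat n) (x : HeckeMero n) :
    gaugedTransl q k 0 l x = swapVec (gaugedTransl q k l 0 (swapVec x)) := by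
  rw [gaugedTransl, gaugedTransl, swapVec_smul, swapInv_gaugeRatio, translX_zero_left,
    translY_zero_left]
  rfl

theorem HasVal.swap {l : Lat n} {A : Matrix (Perm n) (Perm n) ℂ} (hA : HasVal q k l 0 A) :
    HasVal q k 0 l (A.submatrix (fun v => v⁻¹) fun u => u⁻¹) := by
  intro v u
  rw [gaugedTransl_swap, swapVec_single, swapInv_one]
  exact (hA v⁻¹ u⁻¹).swapInv

/-! ### Fundamental weights -/

theorem ell_piW_pow_mul (r : ℕ) (w : Weyl n) : ell (piW n ^ r * w) = ell w := by
  induction r with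
  | zero => rw [pow_zero, one_mul]
  | succ r ih => rw [pow_succ', mul_assoc, ell_piW_mul, ih]

theorem sum_ind_sub_ind (i : Fin (n + 2)) : ∑ j, (ind (i < j) - ind (j < i)) = delta i := by
  have h1 : ∑ j, ind (i < j) = ((Finset.Ioi i).card : ℤ) := by
    rw [Finset.card_eq_sum_ones, Nat.cast_sum, ← Finset.sum_subset (Finset.subset_univ (Finset.Ioi i))]
    · exact Finset.sum_congr rfl fun j hj => ind_true (Finset.mem_Ioi.mp hj)
    · exact fun j _ hj => ind_false fun h => hj (Finset.mem_Ioi.mpr h)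
  have h2 : ∑ j, ind (j < i) = ((Finset.Iio i).card : ℤ) := by
    rw [Finset.card_eq_sum_ones, Nat.cast_sum, ← Finset.sum_subset (Finset.subset_univ (Finset.Iio i))]
    · exact Finset.sum_congr rfl fun j hj => ind_true (Finset.mem_Iio.mp hj)
    · exact fun j _ hj => ind_false fun h => hj (Finset.mem_Iio.mpr h)
  rw [Finset.sum_sub_distrib, h1, h2, Fin.card_Ioi, Fin.card_Iio, delta]
  have := i.2
  omega

/-- Shows that the power of `k` in the gauge ratio of a fundamental weight is the inverse of the
factor `k^{ℓ}` produced by `exists_limRep`. -/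
theorem ell_transl_fund (r : ℕ) : ell (transl (fund r : Lat n)) = 2 * ∑ i : Fin (n + 2), delta i * fund r i := by
  have h : ∀ i j : Fin (n + 2), |gap (transl (fund r)) i j| =
      (ind (i < j) - ind (j < i)) * fund r i - (ind (i < j) - ind (j < i)) * fund r j := by
    intro i j
    simp only [gap, lat_transl, right_transl, Equiv.Perm.one_apply, fund, ind, Fin.lt_def]
    split_ifs <;> first | omega | norm_num
  simp only [ell, h, Finset.sum_sub_distrib]
  rw [Finset.sum_comm (f := fun i j : Fin (n + 2) => (ind (i < j) - ind (j < i)) * fund r j)]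
  simp only [← Finset.sum_mul, sum_ind_sub_ind]
  refine (sub_eq_add_neg _ _).trans ((congrArg _ ?_).trans (two_mul _).symm)
  rw [← Finset.sum_neg_distrib]
  refine Finset.sum_congr rfl fun i _ => ?_
  rw [← neg_mul, ← sum_ind_sub_ind, ← Finset.sum_neg_distrib]
  simp only [neg_sub]

variable (k) in
theorem gaugeRatio_fund (r : ℕ) : gaugeRatio q k (fund r : Lat n) 0 =
    algebraMap ℂ (Mero n) ((k ^ (-∑ i : Fin (n + 2), delta i * fund r i) : ℂˣ) : ℂ) *
      gam (-topInd 1 r) := by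
  have e1 : ∏ i : Fin (n + 2), (k ^ (delta i * ((0 : Lat n) i.rev - fund r i)) *
      q.unit ^ (-(fund r i * (0 : Lat n) i.rev))) = k ^ (-∑ i : Fin (n + 2), delta i * fund r i) := by
    simp only [Pi.zero_apply, zero_sub, mul_zero, neg_zero, zpow_zero, mul_one, mul_neg]
    rw [← Finset.sum_neg_distrib]
    exact (map_sum (zmultiplesHom (Additive ℂˣ) (Additive.ofMul k)) _ _).symm
  have e2 : ∑ i, (fund r : Lat n) i • (eps i.rev : Lat n) = topInd 1 r := by
    funext j
    rw [Finset.sum_apply, Finset.sum_eq_single j.rev]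
    · simp only [Fin.rev_rev, Pi.smul_apply, eps, Pi.single_eq_same, smul_eq_mul, mul_one, fund,
        topInd, Fin.val_rev, Equiv.Perm.one_apply]
      refine ind_congr ?_
      have := j.2
      omega
    · intro i _ hi
      rw [Pi.smul_apply, eps, Pi.single_eq_of_ne (fun h => hi (by rw [h, Fin.rev_rev])), smul_zero]
    · simp
  rw [gaugeRatio, e1, e2, monoMero, gam, Algebra.smul_def, map_mul]
  simp only [Pi.zero_apply, zero_smul, Finset.sum_const_zero]
  rfl

theorem sum_topInd (v : Perm n) (r : ℕ) : ∑ j, topInd v r j = ∑ j : Fin (n + 2), topInd 1 r j :=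
  Fintype.sum_equiv v _ _ fun _ => rfl

/-- The function `topInd 1 r` is the indicator of the last `r` positions. Among indicators of sets
of that size its partial sums are the smallest, so the exponent of `γ` in the gauged equation lies
in `Q_+`. -/
theorem psum_topInd_sub (v : Perm n) (r s : ℕ) :
    0 ≤ psum (topInd v r - topInd 1 r) s := by
  rw [psum_sub, sub_nonneg]
  have h0 : ∀ u : Perm n, 0 ≤ psum (topInd u r) s := fun u => Finset.sum_nonneg fun j _ => by
    split_ifs
    · rw [topInd, ind]; split_ifs <;> norm_num
    · exact le_rfl
  -- If the first `s` positions reach into the last block, the complementary sums are compared,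
  -- since the positions not yet counted all belong to that block. Otherwise the partial sum of
  -- `topInd 1 r` is zero.
  rcases Nat.lt_or_ge (n + 2) (s + r) with h | h
  · have h1 : ∀ u : Perm n, psum (topInd u r) s = ∑ j, topInd u r j -
        ∑ j : Fin (n + 2), if s ≤ (j : ℕ) then topInd u r j else 0 := fun u => by
      rw [psum, ← Finset.sum_sub_distrib]
      refine Finset.sum_congr rfl fun j _ => ?_
      split_ifs <;> omega
    rw [h1, h1, sum_topInd v, sub_le_sub_iff_left]
    refine Finset.sum_le_sum fun j _ => ?_
    split_ifs with hj
    · rw [topInd, topInd, ind_true (p := n + 2 ≤ ((1 : Perm n) j : ℕ) + r) (by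
        rw [Equiv.Perm.one_apply]; omega), ind]
      split_ifs <;> norm_num
    · exact le_rfl
  · refine le_trans (le_of_eq ?_) (h0 v)
    refine Finset.sum_eq_zero fun j _ => ?_
    split_ifs with hj
    · rw [topInd, ind_false]
      rw [Equiv.Perm.one_apply]
      omega
    · rfl

theorem val_rot_pow_of_le {r : ℕ} (hr : r ≤ n + 2) (i : Fin (n + 2)) :
    (((rot n ^ r) i : Fin (n + 2)) : ℕ) =
      if n + 2 ≤ (i : ℕ) + r then (i : ℕ) + r - (n + 2) else (i : ℕ) + r := by
  rw [val_rot_pow]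
  have := i.2
  split_ifs with h
  · rw [Nat.mod_eq_sub_mod h, Nat.mod_eq_of_lt (by omega)]
  · rw [Nat.mod_eq_of_lt (by omega)]

theorem topInd_eq_iff {v : Perm n} {r : ℕ} :
    topInd v r = topInd 1 r ↔ ∀ j : Fin (n + 2), n + 2 ≤ (v j : ℕ) + r ↔ n + 2 ≤ (j : ℕ) + r := by
  rw [funext_iff]
  refine forall_congr' fun j => ?_
  simp only [topInd, Equiv.Perm.one_apply, ind]
  split_ifs with h1 h2 h2 <;> simp [h1, h2]

/-- The hypothesis says that `v` preserves the block of the last `r` indices, and the power of the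
rotation only inverts pairs from different blocks. No inversion of `v` is undone. -/
theorem opTw_rot_mul {r : ℕ} (hr : r ≤ n + 2) {v : Perm n} (hv : topInd v r = topInd 1 r) :
    opTw q k (rot n ^ r) * opTw q k v = opTw q k (rot n ^ r * v) := by
  refine opTw_mul_opTw q k _ _ fun i j hij h => ?_
  rw [topInd_eq_iff] at hv
  have h1 := hv (v⁻¹ i)
  have h2 := hv (v⁻¹ j)
  rw [← Equiv.Perm.mul_apply, mul_inv_cancel, Equiv.Perm.one_apply] at h1 h2
  rw [Fin.lt_def] at hij h ⊢
  rw [val_rot_pow_of_le hr, val_rot_pow_of_le hr]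
  have := i.2
  have := j.2
  split_ifs <;> omega

theorem translX_fund_single {r : ℕ} (hr : r ≤ n + 2) {u : Perm n} {c : Perm n → RatFn n}
    (h : weylOp q (ofPerm (rot n ^ r)⁻¹) * opTw q k u = ∑ v, mulOp (c v) * opTw q k v) (v : Perm n) :
    translX q k (fund r) (Pi.single u 1) (rot n ^ r * v) =
      evX (weylFieldEquiv q (piW n ^ r) (c v)) * gam (topInd v r) := by
  have h1 := (hasSymbol_opTw (q := q) (k := k) u).translX (fund r)
  rw [transl_fund hr, weylOp_mul, mul_assoc, h, Finset.mul_sum] at h1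
  have h2 : ∀ s : Finset (Perm n), HasSymbol q k
      (∑ v ∈ s, weylOp q (piW n ^ r) * (mulOp (c v) * opTw q k v))
      (∑ v ∈ s, Pi.single (rot n ^ r * v) (evX (weylFieldEquiv q (piW n ^ r) (c v)) *
        gam (topInd v r))) := fun s => by
    induction s using Finset.cons_induction with
    | empty => exact hasSymbol_zero
    | cons v s hv ih =>
      rw [Finset.sum_cons, Finset.sum_cons]
      refine HasSymbol.add ?_ ih
      rw [← mul_assoc, weylOp_mulOp, mul_assoc, weylOp_piW_pow_opTw q k hr]
      exact hasSymbol_basis _ _ _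
  rw [h1.unique (h2 Finset.univ), Finset.sum_apply, Finset.sum_eq_single v]
  · rw [Pi.single_eq_same]
  · intro w _ hw
    exact Pi.single_eq_of_ne (fun h => hw (mul_left_cancel h).symm) _
  · simp

open Classical in
variable (q k) in
-- Write `σ` for the rotation. The translation is `π^r σ^{-r}`. By `exists_limRep`, `σ^{-r} T_u` has
-- the limit `k^m T_{σ^r}⁻¹ T_u`, and `π^r` turns `T_v` into `T_{σ^r v}` times `γ^{topInd v r}`. The
-- gauge ratio removes `k^m` and leaves `γ^{topInd v r - topInd 1 r}`, which vanishes at the origin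
-- unless the exponent is zero. If it is zero then `T_{σ^r v} = T_{σ^r} T_v`, so for `u = σ^r v` the
-- limit is `k^m T_v`, and the column of `T_{σ^r v}` is a unit vector.
theorem exists_hasVal_fund {r : ℕ} (hr : r ≤ n + 2) : ∃ A : Matrix (Perm n) (Perm n) ℂ,
    HasVal q k (fund r) 0 A ∧
      (∀ v u, topInd v r ≠ topInd 1 r → A (rot n ^ r * v) u = 0) ∧
      ∀ v, topInd v r = topInd 1 r → ∀ w, A w (rot n ^ r * v) = (Pi.single (rot n ^ r * v) 1 : Perm n → ℂ) w := by
  obtain ⟨m, hm, H⟩ := exists_limRep (q := q) (k := k) (rot n ^ r)⁻¹ (g := piW n ^ r) (by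
    have : (piW n ^ r).right = rot n ^ r :=
      map_pow (SemidirectProduct.rightHom (N := Fin (n + 2) → Multiplicative ℤ) (G := Perm n)) _ _
    rw [this, inv_inv]
    exact fun _ _ _ h => h)
  rw [inv_inv] at H
  choose a ha hT using H
  have hm' : m = ∑ i : Fin (n + 2), delta i * fund r i := by
    have h1 := ell_transl_fund (n := n) r
    rw [transl_fund hr, ell_piW_pow_mul, hm] at h1
    linarith
  refine ⟨Matrix.of fun w u => a u ((rot n ^ r)⁻¹ * w) * (((k ^ (-m) : ℂˣ) : ℂ) *
    if topInd ((rot n ^ r)⁻¹ * w) r - topInd 1 r = 0 then 1 else 0), fun w u => ?_, fun v u hv => ?_,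
    fun v hv w => ?_⟩
  · obtain ⟨v, rfl⟩ : ∃ v, w = rot n ^ r * v := ⟨(rot n ^ r)⁻¹ * w, by rw [mul_inv_cancel_left]⟩
    obtain ⟨c, hc, hval⟩ := ha u
    rw [Matrix.of_apply, inv_mul_cancel_left]
    have e : gaugedTransl q k (fund r) 0 (Pi.single u 1) (rot n ^ r * v) =
        evX (weylFieldEquiv q (piW n ^ r) (c v)) *
          (algebraMap ℂ (Mero n) ((k ^ (-m) : ℂˣ) : ℂ) * gam (topInd v r - topInd 1 r)) := by
      rw [gaugedTransl, translY_zero_left, Pi.smul_apply, smul_eq_mul, translX_fund_single hr hc,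
        gaugeRatio_fund, ← hm', sub_eq_add_neg, gam_add, mul_left_comm, mul_assoc,
        mul_comm (gam (-_))]
    rw [e]
    exact (hval v).mul ((val_C _).mul (val_gam (psum_topInd_sub v r) (by
      simp only [Pi.sub_apply, Finset.sum_sub_distrib, sum_topInd v, sub_self])))
  · rw [Matrix.of_apply, inv_mul_cancel_left, if_neg (sub_ne_zero.mpr hv), mul_zero, mul_zero]
  · have h1 : heckeOp q k (a (rot n ^ r * v)) = ((k ^ m : ℂˣ) : ℂ) • opTw q k v := by
      refine (isUnit_opTw q k (rot n ^ r)).mul_left_cancel ?_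
      rw [hT, mul_smul_comm, opTw_rot_mul hr hv]
    rw [← heckeOp_single, ← heckeOp_smul] at h1
    rw [Matrix.of_apply, heckeOp_injective q k h1]
    obtain ⟨w, rfl⟩ : ∃ x, w = rot n ^ r * x := ⟨(rot n ^ r)⁻¹ * w, by rw [mul_inv_cancel_left]⟩
    rw [inv_mul_cancel_left, Pi.smul_apply]
    by_cases hw : w = v
    · subst hw
      rw [Pi.single_eq_same, Pi.single_eq_same, if_pos (sub_eq_zero.mpr hv), smul_eq_mul, mul_one,
        mul_one, ← Units.val_mul, ← zpow_add, add_neg_cancel, zpow_zero, Units.val_one]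
    · rw [Pi.single_eq_of_ne hw, Pi.single_eq_of_ne (fun h => hw (mul_left_cancel h)), smul_zero,
        zero_mul]

variable (q k) in
-- There is a set of indices outside of which all rows vanish and in which all columns are unit
-- vectors. Such a matrix is idempotent and fixes the basis vectors of that set, and `w_0` belongs
-- to it.
theorem exists_hasVal_fund_idem {r : ℕ} (hr : r ≤ n + 2) : ∃ A : Matrix (Perm n) (Perm n) ℂ,
    HasVal q k (fund r) 0 A ∧ A * A = A ∧
      A.mulVec (Pi.single Fin.revPerm 1) = Pi.single Fin.revPerm 1 := by
  obtain ⟨A, hA, h0, h1⟩ := exists_hasVal_fund (n := n) q k hr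
  refine ⟨A, hA, Matrix.ext fun v u => ?_, ?_⟩
  · rw [Matrix.mul_apply, Finset.sum_eq_single v]
    · obtain ⟨x, rfl⟩ : ∃ x, v = rot n ^ r * x := ⟨(rot n ^ r)⁻¹ * v, by rw [mul_inv_cancel_left]⟩
      by_cases hx : topInd x r = topInd 1 r
      · rw [h1 x hx, Pi.single_eq_same, one_mul]
      · rw [h0 x u hx, mul_zero]
    · intro w _ hw
      obtain ⟨x, rfl⟩ : ∃ x, w = rot n ^ r * x := ⟨(rot n ^ r)⁻¹ * w, by rw [mul_inv_cancel_left]⟩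
      by_cases hx : topInd x r = topInd 1 r
      · rw [h1 x hx, Pi.single_eq_of_ne hw.symm, zero_mul]
      · rw [h0 x u hx, mul_zero]
    · simp
  -- The longest element exchanges the last `r` indices with the first `r`, and the inverse power of
  -- the rotation brings these back to the end, so that the block of the last `r` indices is
  -- preserved.
  · have e : (Fin.revPerm : Perm n) = rot n ^ r * ((rot n ^ r)⁻¹ * Fin.revPerm) := by
      rw [mul_inv_cancel_left]
    rw [Matrix.mulVec_single_one]
    funext w
    rw [Matrix.col_apply, e]
    refine h1 _ (topInd_eq_iff.mpr fun j => ?_) w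
    have h2 := val_rot_pow_of_le hr (((rot n ^ r)⁻¹ * Fin.revPerm : Perm n) j)
    rw [← Equiv.Perm.mul_apply, mul_inv_cancel_left, Fin.revPerm_apply, Fin.val_rev] at h2
    have := j.2
    have := (((rot n ^ r)⁻¹ * Fin.revPerm : Perm n) j).2
    split_ifs at h2 <;> omega

end

end BqKZ
end
noncomputable section
namespace BqKZ

/-! ### Idempotent values for sums of fundamental weights. -/

section
variable {n : ℕ} (q : QParam) (k : ℂˣ)

/-- The matrix of the gauged equation of `(l, m)` has an idempotent value at the origin, which
fixes `T_{w_0}`. -/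
def HasIdem (l m : Lat n) : Prop := ∃ A : Matrix (Perm n) (Perm n) ℂ, HasVal q k l m A ∧ A * A = A ∧
  A.mulVec (Pi.single Fin.revPerm 1) = Pi.single Fin.revPerm 1

variable {q k}

theorem hasIdem_zero : HasIdem q k (0 : Lat n) 0 := ⟨1, hasVal_zero, mul_one _, Matrix.one_mulVec _⟩

/-- A product of commuting idempotents is idempotent. -/
theorem HasIdem.add {l m l' m' : Lat n} (h : HasIdem q k l m) (h' : HasIdem q k l' m') :
    HasIdem q k (l + l') (m + m') := by
  obtain ⟨A, hA, hA2, hA3⟩ := h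
  obtain ⟨B, hB, hB2, hB3⟩ := h'
  refine ⟨A * B, hA.mul hB, ?_, by rw [← Matrix.mulVec_mulVec, hB3, hA3]⟩
  rw [Matrix.mul_assoc, ← Matrix.mul_assoc B, ← hA.commute hB, Matrix.mul_assoc A B B, hB2,
    ← Matrix.mul_assoc, hA2]

variable (q k)

theorem hasIdem_fund_left {r : ℕ} (hr : r ≤ n + 2) : HasIdem q k (fund r : Lat n) 0 :=
  exists_hasVal_fund_idem q k hr

/-- Passing to the mirror image reindexes the matrix by `v ↦ v⁻¹`, and `w_0` is an involution. -/
theorem hasIdem_fund_right {r : ℕ} (hr : r ≤ n + 2) : HasIdem q k (0 : Lat n) (fund r) := by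
  obtain ⟨A, hA, hA2, hA3⟩ := hasIdem_fund_left (n := n) q k hr
  refine ⟨_, hA.swap, ?_, ?_⟩
  · have h := Matrix.submatrix_mul_equiv A A (fun v : Perm n => v⁻¹) (Equiv.inv (Perm n))
      (fun v : Perm n => v⁻¹)
    exact h.trans (by rw [hA2])
  · have h : ∀ v : Perm n, v⁻¹ = Fin.revPerm ↔ v = Fin.revPerm := fun v => by
      rw [inv_eq_iff_eq_inv]
      have : (Fin.revPerm : Perm n)⁻¹ = Fin.revPerm := by
        rw [inv_eq_iff_mul_eq_one]; ext j; simp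
      rw [this]
    rw [Matrix.mulVec_single_one] at hA3 ⊢
    funext v
    have h1 := congrFun hA3 v⁻¹
    have h2 : (Fin.revPerm : Perm n)⁻¹ = Fin.revPerm := by rw [h]
    rw [Matrix.col_apply, Pi.single_apply] at h1
    rw [Matrix.col_apply, Matrix.submatrix_apply, h2, h1, Pi.single_apply]
    simp only [h]

/-- The sum of the fundamental weights. -/
def rho : Lat n := ∑ r ∈ Finset.range (n + 2), fund r

theorem hasIdem_rho : HasIdem q k (rho : Lat n) rho := by
  have hl : ∀ s ≤ n + 2, HasIdem q k (∑ r ∈ Finset.range s, fund r : Lat n) 0 := fun s hs => by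
    induction s with
    | zero => exact hasIdem_zero
    | succ s ih =>
      rw [Finset.sum_range_succ, ← add_zero (0 : Lat n)]
      exact (ih (by omega)).add (hasIdem_fund_left q k (by omega))
  have hr : ∀ s ≤ n + 2, HasIdem q k (0 : Lat n) (∑ r ∈ Finset.range s, fund r) := fun s hs => by
    induction s with
    | zero => exact hasIdem_zero
    | succ s ih =>
      rw [Finset.sum_range_succ, ← add_zero (0 : Lat n)]
      exact (ih (by omega)).add (hasIdem_fund_right q k (by omega))
  have := (hl _ le_rfl).add (hr _ le_rfl)
  rwa [add_zero, zero_add] at this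

/-- All variables are multiplied by the same number `q`, so the equation of `(ρ, ρ)` relates `f(z)`
to `f(qz)` and can be iterated towards the origin. -/
theorem scaleFactor_rho (v : Var n) : scaleFactor q rho rho v = q.unit := by
  have h : ∀ i : Fin (n + 1), (rho : Lat n) i.castSucc - (rho : Lat n) i.succ = 1 := fun i => by
    rw [rho, Finset.sum_apply, Finset.sum_apply, ← Finset.sum_sub_distrib,
      Finset.sum_eq_single ((i : ℕ) + 1)]
    · rw [fund, fund, ind_true (by simp), ind_false (by simp), sub_zero]
    · intro r _ hr
      simp only [fund, ind, Fin.val_castSucc, Fin.val_succ]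
      split_ifs <;> omega
    · intro h
      exact absurd (Finset.mem_range.mpr (by omega)) h
  cases v <;> simp [scaleFactor, h]

end

end BqKZ
end
noncomputable section
namespace BqKZ

/-! ### Weighted norms of power series -/

section
variable {V : Type*}

/-- The sum of the `‖K_a‖ R^{|a|}` for `a ≤ b`. -/
def truncNorm (R : ℝ) (b : V →₀ ℕ) (K : MvPowerSeries V ℂ) : ℝ :=
  open Classical in ∑ a ∈ Finset.Iic b, ‖MvPowerSeries.coeff a K‖ * R ^ a.degree

theorem truncNorm_nonneg {R : ℝ} (hR : 0 ≤ R) (b : V →₀ ℕ) (K : MvPowerSeries V ℂ) :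
    0 ≤ truncNorm R b K :=
  Finset.sum_nonneg fun _ _ => mul_nonneg (norm_nonneg _) (pow_nonneg hR _)

theorem truncNorm_add_le {R : ℝ} (hR : 0 ≤ R) (b : V →₀ ℕ) (K L : MvPowerSeries V ℂ) :
    truncNorm R b (K + L) ≤ truncNorm R b K + truncNorm R b L := by
  rw [truncNorm, truncNorm, truncNorm, ← Finset.sum_add_distrib]
  refine Finset.sum_le_sum fun a _ => ?_
  rw [← add_mul, map_add]
  exact mul_le_mul_of_nonneg_right (norm_add_le _ _) (pow_nonneg hR _)

theorem truncNorm_zero (R : ℝ) (b : V →₀ ℕ) : truncNorm R b (0 : MvPowerSeries V ℂ) = 0 := by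
  simp [truncNorm]

/-- If `a ≤ b` then both parts of a decomposition of `a` are at most `b`, and different
decompositions give different terms of the product on the right. Truncation keeps all sums finite,
so submultiplicativity holds for formal series without any convergence. -/
theorem truncNorm_mul_le {R : ℝ} (hR : 0 ≤ R) (b : V →₀ ℕ) (K L : MvPowerSeries V ℂ) :
    truncNorm R b (K * L) ≤ truncNorm R b K * truncNorm R b L := by
  classical
  have h1 : truncNorm R b (K * L) ≤ ∑ a ∈ Finset.Iic b, ∑ x ∈ Finset.HasAntidiagonal.antidiagonal a,
      (‖MvPowerSeries.coeff x.1 K‖ * R ^ x.1.degree) *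
        (‖MvPowerSeries.coeff x.2 L‖ * R ^ x.2.degree) := by
    rw [truncNorm]
    refine (Finset.sum_le_sum fun a _ => ?_).trans (le_of_eq (Finset.sum_congr (by congr!) fun _ _ => rfl))
    rw [MvPowerSeries.coeff_mul]
    refine (mul_le_mul_of_nonneg_right (norm_sum_le _ _) (pow_nonneg hR _)).trans (le_of_eq ?_)
    rw [Finset.sum_mul]
    refine Finset.sum_congr rfl fun x hx => ?_
    rw [← Finset.HasAntidiagonal.mem_antidiagonal.mp hx, map_add, pow_add, norm_mul]
    ring
  refine h1.trans ?_
  rw [truncNorm, truncNorm, Finset.sum_mul_sum, ← Finset.sum_product', Finset.sum_sigma']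
  rw [← Finset.sum_image (s := (Finset.Iic b).sigma fun a => Finset.HasAntidiagonal.antidiagonal a)
    (g := fun x : (_ : V →₀ ℕ) × ((V →₀ ℕ) × (V →₀ ℕ)) => x.2)
    (f := fun x => (‖MvPowerSeries.coeff x.1 K‖ * R ^ x.1.degree) *
        (‖MvPowerSeries.coeff x.2 L‖ * R ^ x.2.degree))]
  · refine (Finset.sum_le_sum_of_subset_of_nonneg (fun x hx => ?_) fun _ _ _ => ?_).trans
      (le_of_eq (Finset.sum_congr (by congr!) fun _ _ => rfl))
    · obtain ⟨⟨a, y⟩, hy, rfl⟩ := Finset.mem_image.mp hx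
      obtain ⟨ha, hy⟩ := Finset.mem_sigma.mp hy
      have h2 := Finset.HasAntidiagonal.mem_antidiagonal.mp hy
      have h3 := Finset.mem_Iic.mp ha
      refine Finset.mem_product.mpr ⟨Finset.mem_Iic.mpr ?_, Finset.mem_Iic.mpr ?_⟩
      · exact le_self_add.trans (h2.le.trans h3)
      · exact le_add_self.trans (h2.le.trans h3)
    · exact mul_nonneg (mul_nonneg (norm_nonneg _) (pow_nonneg hR _))
        (mul_nonneg (norm_nonneg _) (pow_nonneg hR _))
  · rintro ⟨a, y⟩ hx ⟨a', y'⟩ hx' h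
    obtain rfl : y = y' := h
    have h1 := Finset.HasAntidiagonal.mem_antidiagonal.mp (Finset.mem_sigma.mp hx).2
    have h2 := Finset.HasAntidiagonal.mem_antidiagonal.mp (Finset.mem_sigma.mp hx').2
    obtain rfl : a = a' := h1.symm.trans h2
    rfl

theorem sum_le_truncNorm {R : ℝ} (hR : 0 ≤ R) (K : MvPowerSeries V ℂ) (s : Finset (V →₀ ℕ)) :
    ∃ b, ∑ a ∈ s, ‖MvPowerSeries.coeff a K‖ * R ^ a.degree ≤ truncNorm R b K := by
  classical
  refine ⟨s.sup id, ?_⟩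
  rw [truncNorm]
  refine Finset.sum_le_sum_of_subset_of_nonneg (fun a ha => ?_) fun _ _ _ =>
    mul_nonneg (norm_nonneg _) (pow_nonneg hR _)
  exact Finset.mem_Iic.mpr (Finset.le_sup (f := id) ha)

/-- The series `∑ ‖K_a‖ R^{|a|}` converges. -/
def Absol (R : ℝ) (K : MvPowerSeries V ℂ) : Prop :=
  Summable fun a : V →₀ ℕ => ‖MvPowerSeries.coeff a K‖ * R ^ a.degree

theorem absol_of_truncNorm_le {R C : ℝ} (hR : 0 ≤ R) {K : MvPowerSeries V ℂ}
    (h : ∀ b, truncNorm R b K ≤ C) : Absol R K :=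
  summable_of_sum_le (fun _ => mul_nonneg (norm_nonneg _) (pow_nonneg hR _)) fun s =>
    (sum_le_truncNorm hR K s).choose_spec.trans (h _)

theorem Absol.exists_truncNorm_le {R : ℝ} (hR : 0 ≤ R) {K : MvPowerSeries V ℂ} (h : Absol R K) :
    ∃ C, 0 ≤ C ∧ ∀ b, truncNorm R b K ≤ C :=
  ⟨∑' a : V →₀ ℕ, ‖MvPowerSeries.coeff a K‖ * R ^ a.degree,
    tsum_nonneg fun _ => mul_nonneg (norm_nonneg _) (pow_nonneg hR _),
    fun _ => h.sum_le_tsum _ fun _ _ => mul_nonneg (norm_nonneg _) (pow_nonneg hR _)⟩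

theorem Absol.mul {R : ℝ} (hR : 0 ≤ R) {K L : MvPowerSeries V ℂ} (hK : Absol R K)
    (hL : Absol R L) : Absol R (K * L) := by
  obtain ⟨C, hC, h1⟩ := hK.exists_truncNorm_le hR
  obtain ⟨D, -, h2⟩ := hL.exists_truncNorm_le hR
  exact absol_of_truncNorm_le hR fun b => (truncNorm_mul_le hR b K L).trans
    (mul_le_mul (h1 b) (h2 b) (truncNorm_nonneg hR b L) hC)

theorem absol_coe (R : ℝ) (p : MvPolynomial V ℂ) : Absol R (p : MvPowerSeries V ℂ) := by
  refine summable_of_ne_finset_zero (s := p.support) fun a ha => ?_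
  rw [MvPolynomial.coeff_coe, MvPolynomial.notMem_support_iff.mp ha, norm_zero, zero_mul]

theorem truncNorm_C (R : ℝ) (b : V →₀ ℕ) (c : ℂ) :
    truncNorm R b (MvPowerSeries.C (σ := V) c) = ‖c‖ := by
  classical
  rw [truncNorm, Finset.sum_eq_single 0]
  · simp
  · intro a _ ha
    rw [MvPowerSeries.coeff_C, if_neg ha, norm_zero, zero_mul]
  · exact fun h => absurd (Finset.mem_Iic.mpr (zero_le : (0 : V →₀ ℕ) ≤ b)) h

/-- The power series `K(s z)`. -/
def scale (s : ℂ) : MvPowerSeries V ℂ →+* MvPowerSeries V ℂ := MvPowerSeries.rescale fun _ => s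

variable [Fintype V]

theorem coeff_scale (s : ℂ) (K : MvPowerSeries V ℂ) (a : V →₀ ℕ) :
    MvPowerSeries.coeff a (scale s K) = s ^ a.degree * MvPowerSeries.coeff a K := by
  rw [scale, MvPowerSeries.coeff_rescale, Finsupp.degree_eq_sum, Finsupp.prod_fintype _ _ (by simp),
    Finset.prod_pow_eq_pow_sum]

theorem scale_scale (s s' : ℂ) (K : MvPowerSeries V ℂ) : scale s (scale s' K) = scale (s * s') K := by
  ext a
  rw [coeff_scale, coeff_scale, coeff_scale, mul_pow, mul_assoc]

theorem scale_one (K : MvPowerSeries V ℂ) : scale 1 K = K := by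
  ext a
  rw [coeff_scale, one_pow, one_mul]

/-- Without a constant term each monomial gains at least one factor `‖s‖`. This is the source of the
geometric decay of `P(s^i z) - P(0)`. -/
theorem truncNorm_scale_le {R : ℝ} (hR : 0 ≤ R) {s : ℂ} (hs : ‖s‖ ≤ 1) (b : V →₀ ℕ)
    {K : MvPowerSeries V ℂ} (hK : MvPowerSeries.constantCoeff K = 0) :
    truncNorm R b (scale s K) ≤ ‖s‖ * truncNorm R b K := by
  rw [truncNorm, truncNorm, Finset.mul_sum]
  refine Finset.sum_le_sum fun a _ => ?_
  rw [coeff_scale, norm_mul, norm_pow, mul_assoc]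
  by_cases ha : a = 0
  · subst ha
    rw [MvPowerSeries.coeff_zero_eq_constantCoeff_apply, hK]; simp
  · refine mul_le_mul_of_nonneg_right ?_ (mul_nonneg (norm_nonneg _) (pow_nonneg hR _))
    exact pow_le_of_le_one (norm_nonneg _) hs fun h => ha ((Finsupp.degree_eq_zero_iff a).mp h)

/-! ### Values of power series -/

/-- The sum of the power series `K` at `z`. -/
def evS (K : MvPowerSeries V ℂ) (z : V → ℂ) : ℂ :=
  ∑' a : V →₀ ℕ, MvPowerSeries.coeff a K * ∏ v, z v ^ a v

theorem norm_term_le {R : ℝ} {z : V → ℂ} (hz : ∀ v, ‖z v‖ ≤ R) (c : ℂ)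
    (a : V →₀ ℕ) : ‖c * ∏ v, z v ^ a v‖ ≤ ‖c‖ * R ^ a.degree := by
  rw [norm_mul, norm_prod, Finsupp.degree_eq_sum, ← Finset.prod_pow_eq_pow_sum]
  refine mul_le_mul_of_nonneg_left ?_ (norm_nonneg _)
  refine Finset.prod_le_prod (fun _ _ => norm_nonneg _) fun v _ => ?_
  rw [norm_pow]
  exact pow_le_pow_left₀ (norm_nonneg _) (hz v) _

theorem Absol.summable {R : ℝ} {K : MvPowerSeries V ℂ} (hK : Absol R K) {z : V → ℂ}
    (hz : ∀ v, ‖z v‖ ≤ R) :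
    Summable fun a : V →₀ ℕ => ‖MvPowerSeries.coeff a K * ∏ v, z v ^ a v‖ :=
  Summable.of_nonneg_of_le (fun _ => norm_nonneg _) (fun a => norm_term_le hz _ a) hK

theorem tsum_mul_eq_antidiagonal {A : Type*} [AddCommMonoid A] [Finset.HasAntidiagonal A] {f g : A → ℂ}
    (hf : Summable fun a => ‖f a‖) (hg : Summable fun a => ‖g a‖) :
    (∑' a, f a) * ∑' a, g a = ∑' a, ∑ x ∈ Finset.HasAntidiagonal.antidiagonal a, f x.1 * g x.2 :=
  hf.of_norm.tsum_mul_tsum_eq_tsum_sum_antidiagonal hg.of_norm (summable_mul_of_summable_norm hf hg)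

theorem coeff_mul_prod (K L : MvPowerSeries V ℂ) (z : V → ℂ) [DecidableEq V] (a : V →₀ ℕ) :
    MvPowerSeries.coeff a (K * L) * ∏ v, z v ^ a v =
      ∑ x ∈ Finset.HasAntidiagonal.antidiagonal a, (MvPowerSeries.coeff x.1 K * ∏ v, z v ^ x.1 v) *
        (MvPowerSeries.coeff x.2 L * ∏ v, z v ^ x.2 v) := by
  rw [MvPowerSeries.coeff_mul, Finset.sum_mul]
  refine Finset.sum_congr rfl fun x hx => ?_
  rw [← Finset.HasAntidiagonal.mem_antidiagonal.mp hx]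
  simp only [Finsupp.add_apply, pow_add, Finset.prod_mul_distrib]
  exact mul_mul_mul_comm _ _ _ _

theorem evS_mul {R : ℝ} {K L : MvPowerSeries V ℂ} (hK : Absol R K)
    (hL : Absol R L) {z : V → ℂ} (hz : ∀ v, ‖z v‖ ≤ R) : evS (K * L) z = evS K z * evS L z := by
  classical
  exact (tsum_congr fun a => coeff_mul_prod K L z a).trans
    (tsum_mul_eq_antidiagonal (hK.summable hz) (hL.summable hz)).symm

theorem evS_coe (p : MvPolynomial V ℂ) (z : V → ℂ) :
    evS (p : MvPowerSeries V ℂ) z = MvPolynomial.eval z p := by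
  rw [evS, tsum_eq_sum (s := p.support) fun a ha => by
    rw [MvPolynomial.coeff_coe, MvPolynomial.notMem_support_iff.mp ha, zero_mul],
    MvPolynomial.eval_eq']
  simp only [MvPolynomial.coeff_coe]

theorem evS_scale (s : ℂ) (K : MvPowerSeries V ℂ) (z : V → ℂ) :
    evS (scale s K) z = evS K fun v => s * z v := by
  refine tsum_congr fun a => ?_
  rw [coeff_scale]
  simp only [mul_pow, Finset.prod_mul_distrib, Finset.prod_pow_eq_pow_sum, ← Finsupp.degree_eq_sum]
  ring

theorem evS_zero (K : MvPowerSeries V ℂ) : evS K 0 = MvPowerSeries.constantCoeff K := by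
  rw [evS, tsum_eq_single 0]
  · simp
  · intro a ha
    obtain ⟨v, hv⟩ := DFunLike.ne_iff.mp ha
    rw [Finset.prod_eq_zero (Finset.mem_univ v) (zero_pow hv), mul_zero]

theorem evS_sum {ι : Type*} (s : Finset ι) {R : ℝ} {K : ι → MvPowerSeries V ℂ}
    (hK : ∀ i ∈ s, Absol R (K i)) {z : V → ℂ} (hz : ∀ v, ‖z v‖ ≤ R) :
    evS (∑ i ∈ s, K i) z = ∑ i ∈ s, evS (K i) z := by
  simp only [evS, map_sum, Finset.sum_mul]
  exact Summable.tsum_finsetSum fun i hi => ((hK i hi).summable hz).of_norm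

/-! ### Analyticity of entire power series -/

theorem exists_word_of_degree (a : V →₀ ℕ) : ∃ w : Fin a.degree → V,
    ∀ z : V → ℂ, ∏ j, z (w j) = ∏ v, z v ^ a v := by
  induction a using Finsupp.induction_linear with
  | zero =>
    rw [map_zero]
    exact ⟨Fin.elim0, fun z => by simp⟩
  | add a b ha hb =>
    obtain ⟨w, hw⟩ := ha
    obtain ⟨w', hw'⟩ := hb
    rw [map_add]
    refine ⟨Fin.append w w', fun z => ?_⟩
    rw [Fin.prod_univ_add]
    simp only [Fin.append_left, Fin.append_right, hw, hw', Finsupp.add_apply, pow_add,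
      Finset.prod_mul_distrib]
  | single v m =>
    refine ⟨fun _ => v, fun z => ?_⟩
    classical
    rw [Finset.prod_const, Finset.card_univ, Fintype.card_fin, Finsupp.degree_single,
      Finset.prod_eq_single v]
    · rw [Finsupp.single_eq_same]
    · intro u _ hu
      rw [Finsupp.single_eq_of_ne hu, pow_zero]
    · simp

theorem exists_multilinear (a : V →₀ ℕ) (m : ℕ) :
    ∃ M : ContinuousMultilinearMap ℂ (fun _ : Fin m => V → ℂ) ℂ, ‖M‖ ≤ 1 ∧
      (a.degree = m → ∀ z, M (fun _ => z) = ∏ v, z v ^ a v) := by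
  by_cases h : a.degree = m
  · subst h
    obtain ⟨w, hw⟩ := exists_word_of_degree a
    refine ⟨(ContinuousMultilinearMap.mkPiAlgebra ℂ (Fin a.degree) ℂ).compContinuousLinearMap
      fun j => ContinuousLinearMap.proj (w j), ?_, fun _ z => ?_⟩
    · refine ContinuousMultilinearMap.opNorm_le_bound zero_le_one fun z => ?_
      rw [ContinuousMultilinearMap.compContinuousLinearMap_apply,
        ContinuousMultilinearMap.mkPiAlgebra_apply, norm_prod, one_mul]
      exact Finset.prod_le_prod (fun _ _ => norm_nonneg _) fun j _ => norm_le_pi_norm (z j) (w j)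
    · rw [ContinuousMultilinearMap.compContinuousLinearMap_apply,
        ContinuousMultilinearMap.mkPiAlgebra_apply]
      exact hw z
  · exact ⟨0, by simp, fun h' => absurd h' h⟩

theorem hasSum_degree {E : Type*} [NormedAddCommGroup E] [CompleteSpace E]
    {f : (V →₀ ℕ) → E} {x : E} (h : HasSum f x) :
    HasSum (fun m => open Classical in ∑ a ∈ Finset.finsuppAntidiag (Finset.univ : Finset V) m, f a) x := by
  classical
  convert h.tsum_fiberwise (fun a => a.degree) using 2 with m
  have e : (fun a : V →₀ ℕ => a.degree) ⁻¹' {m} =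
      (Finset.finsuppAntidiag (Finset.univ : Finset V) m : Set (V →₀ ℕ)) := by
    ext a
    simp [Finset.mem_finsuppAntidiag, Finsupp.degree_eq_sum]
  rw [e]
  exact (Finset.tsum_subtype' _ f).symm

/-- Each monomial of degree `m` comes from an `m`-linear form of norm at most 1. Grouping by degree
gives a formal multilinear series, whose radius is infinite since the coefficients are summable for
every `R`. -/
theorem analyticOnNhd_evS {K : MvPowerSeries V ℂ} (hK : ∀ R : ℝ, 0 ≤ R → Absol R K) :
    AnalyticOnNhd ℂ (evS K) Set.univ := by
  classical
  choose M hM hM' using exists_multilinear (V := V)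
  let p : FormalMultilinearSeries ℂ (V → ℂ) ℂ := fun m =>
    ∑ a ∈ Finset.finsuppAntidiag (Finset.univ : Finset V) m, MvPowerSeries.coeff a K • M a m
  have hdeg : ∀ {m : ℕ} {a : V →₀ ℕ}, a ∈ Finset.finsuppAntidiag (Finset.univ : Finset V) m →
      a.degree = m := fun h => by
    rw [Finsupp.degree_eq_sum]; exact (Finset.mem_finsuppAntidiag.mp h).1
  have hp : ∀ z, HasSum (fun m => p m fun _ => z) (evS K z) := fun z => by
    have h1 : Summable fun a : V →₀ ℕ => MvPowerSeries.coeff a K * ∏ v, z v ^ a v :=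
      ((hK ‖z‖ (norm_nonneg z)).summable fun v => norm_le_pi_norm z v).of_norm
    have e : (fun m => p m fun _ => z) = fun m => ∑ a ∈ Finset.finsuppAntidiag (Finset.univ : Finset V) m,
        MvPowerSeries.coeff a K * ∏ v, z v ^ a v := funext fun m => by
      rw [show p m = ∑ a ∈ Finset.finsuppAntidiag (Finset.univ : Finset V) m,
        MvPowerSeries.coeff a K • M a m from rfl, sum_apply]
      refine Finset.sum_congr rfl fun a ha => ?_
      rw [smul_apply, hM' a m (hdeg ha), smul_eq_mul]
    rw [e]
    exact hasSum_degree h1.hasSum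
  have hr : p.radius = ⊤ := p.radius_eq_top_of_summable_norm fun r => by
    refine Summable.of_nonneg_of_le (fun m => mul_nonneg (norm_nonneg _) (pow_nonneg r.2 _))
      (fun m => ?_) (hasSum_degree (hK r r.2).hasSum).summable
    refine (mul_le_mul_of_nonneg_right (norm_sum_le _ _) (pow_nonneg r.2 _)).trans ?_
    rw [Finset.sum_mul]
    refine (Finset.sum_le_sum fun a ha => ?_).trans (le_of_eq (Finset.sum_congr (by congr!) fun _ _ => rfl))
    rw [norm_smul, hdeg ha]
    exact mul_le_mul_of_nonneg_right (mul_le_of_le_one_right (norm_nonneg _) (hM a m))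
      (pow_nonneg r.2 _)
  have hb : HasFPowerSeriesOnBall (evS K) p 0 ⊤ := ⟨hr.ge, ENNReal.zero_lt_top, fun {z} _ => by
    rw [zero_add]; exact hp z⟩
  intro z _
  exact hb.analyticAt_of_mem (by simp)

end

end BqKZ
end
noncomputable section
namespace BqKZ

/-! ### Infinite products of matrices -/

section
variable {ι : Type*} [Fintype ι]

/-- Idempotency prevents the accumulation of factors `N(M)`. With `Q_{m+1} = Q_m M + Q_m E_m` and
`Q_{m+1} M = Q_m M + Q_m E_m M`, a common bound for `Q_m` and `Q_m M` grows by at most the factor `1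
+ c s θ^m` in each step, and the product of these factors converges. -/
theorem prod_bound {A : Type*} [Ring A] {N : A → ℝ} (h0 : ∀ x, 0 ≤ N x)
    (hadd : ∀ x y, N (x + y) ≤ N x + N y) (hmul : ∀ x y, N (x * y) ≤ N x * N y) {M : A}
    (hM : M * M = M) {E Q : ℕ → A} {c θ s : ℝ} (hc : 0 ≤ c) (hE : ∀ i, N (E i) ≤ c * θ ^ i)
    (hθ : 0 ≤ θ) (hθ' : θ < 1) (hs : 1 ≤ s) (hN1 : N 1 ≤ s) (hNM : N M ≤ s) (hQ0 : Q 0 = 1)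
    (hQ : ∀ m, Q (m + 1) = Q m * (M + E m)) (m : ℕ) : N (Q m) ≤ s * Real.exp (c * s / (1 - θ)) := by
  have hs0 : 0 ≤ s := zero_le_one.trans hs
  -- The products followed by `M` are bounded at the same time, since the next step starts from
  -- them.
  have key : ∀ m, N (Q m) ≤ s * Real.exp (c * s * ∑ i ∈ Finset.range m, θ ^ i) ∧
      N (Q m * M) ≤ s * Real.exp (c * s * ∑ i ∈ Finset.range m, θ ^ i) := fun m => by
    induction m with
    | zero => simpa [hQ0] using ⟨hN1, hNM⟩
    | succ m ih =>
      obtain ⟨h1, h2⟩ := ih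
      rw [Finset.sum_range_succ, mul_add, Real.exp_add, ← mul_assoc]
      set t := s * Real.exp (c * s * ∑ i ∈ Finset.range m, θ ^ i)
      have ht : 0 ≤ t := mul_nonneg hs0 (Real.exp_pos _).le
      have hcθ : 0 ≤ c * θ ^ m := mul_nonneg hc (pow_nonneg hθ m)
      have h3 : t * (1 + c * s * θ ^ m) ≤ t * Real.exp (c * s * θ ^ m) :=
        mul_le_mul_of_nonneg_left (by rw [add_comm]; exact Real.add_one_le_exp _) ht
      have h4 : N (Q m * E m) ≤ t * (c * θ ^ m) :=
        (hmul _ _).trans (mul_le_mul h1 (hE m) (h0 _) ht)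
      constructor
      · refine le_trans ?_ h3
        rw [hQ, mul_add]
        refine (hadd _ _).trans ?_
        have : t * (c * θ ^ m) * 1 ≤ t * (c * θ ^ m) * s :=
          mul_le_mul_of_nonneg_left hs (mul_nonneg ht hcθ)
        linarith
      · refine le_trans ?_ h3
        rw [hQ, mul_assoc, add_mul, hM, mul_add, ← mul_assoc]
        refine (hadd _ _).trans ?_
        have : N (Q m * E m * M) ≤ t * (c * θ ^ m) * s :=
          (hmul _ _).trans (mul_le_mul h4 hNM (h0 _) (mul_nonneg ht hcθ))
        linarith
  refine (key m).1.trans (mul_le_mul_of_nonneg_left (Real.exp_le_exp.mpr ?_) hs0)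
  rw [mul_div_assoc, ← mul_one_div, ← mul_assoc, one_div]
  exact mul_le_mul_of_nonneg_left
    ((summable_geometric_of_lt_one hθ hθ').sum_le_tsum _ (fun _ _ => pow_nonneg hθ _) |>.trans
      (tsum_geometric_of_lt_one hθ hθ').le) (mul_nonneg hc hs0)

/-- The sum of the norms of the entries of a matrix. -/
def entryNorm {S : Type*} (N : S → ℝ) (A : Matrix ι ι S) : ℝ := ∑ u, ∑ v, N (A u v)

section
variable {S : Type*} [Ring S] {N : S → ℝ} (h0 : ∀ x, 0 ≤ N x)
  (hz : N 0 = 0) (hadd : ∀ x y, N (x + y) ≤ N x + N y) (hmul : ∀ x y, N (x * y) ≤ N x * N y)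
include h0

theorem entryNorm_nonneg (A : Matrix ι ι S) : 0 ≤ entryNorm N A :=
  Finset.sum_nonneg fun _ _ => Finset.sum_nonneg fun _ _ => h0 _

theorem row_le_entryNorm (A : Matrix ι ι S) (u : ι) : ∑ v, N (A u v) ≤ entryNorm N A :=
  Finset.single_le_sum (f := fun u => ∑ v, N (A u v))
    (fun _ _ => Finset.sum_nonneg fun _ _ => h0 _) (Finset.mem_univ u)

omit h0 in
include hadd in
theorem entryNorm_add_le (A B : Matrix ι ι S) :
    entryNorm N (A + B) ≤ entryNorm N A + entryNorm N B := by
  rw [entryNorm, entryNorm, entryNorm, ← Finset.sum_add_distrib]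
  refine Finset.sum_le_sum fun u _ => ?_
  rw [← Finset.sum_add_distrib]
  exact Finset.sum_le_sum fun v _ => hadd _ _

omit [Fintype ι] h0 in
include hz hadd in
theorem norm_sum_le_of (s : Finset ι) (f : ι → S) : N (∑ i ∈ s, f i) ≤ ∑ i ∈ s, N (f i) := by
  induction s using Finset.cons_induction with
  | empty => simp [hz]
  | cons i s hi ih =>
    rw [Finset.sum_cons, Finset.sum_cons]
    exact (hadd _ _).trans (add_le_add le_rfl ih)

include hz hadd hmul

theorem entryNorm_mul_le (A B : Matrix ι ι S) :
    entryNorm N (A * B) ≤ entryNorm N A * entryNorm N B := by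
  have h1 : entryNorm N (A * B) ≤ ∑ u, ∑ v, ∑ w, N (A u w) * N (B w v) :=
    Finset.sum_le_sum fun u _ => Finset.sum_le_sum fun v _ => by
      rw [Matrix.mul_apply]
      exact (norm_sum_le_of hz hadd _ _).trans (Finset.sum_le_sum fun w _ => hmul _ _)
  refine h1.trans ?_
  rw [entryNorm, Finset.sum_mul]
  refine Finset.sum_le_sum fun u _ => ?_
  rw [Finset.sum_comm, Finset.sum_mul]
  refine Finset.sum_le_sum fun w _ => ?_
  rw [← Finset.mul_sum]
  exact mul_le_mul_of_nonneg_left (row_le_entryNorm h0 B w) (h0 _)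

theorem mulVec_norm_le (A : Matrix ι ι S) (x : ι → S) {c : ℝ} (hx : ∀ u, N (x u) ≤ c) (v : ι) :
    N (A.mulVec x v) ≤ entryNorm N A * c := by
  have h1 : N (A.mulVec x v) ≤ ∑ u, N (A v u) * c :=
    (norm_sum_le_of hz hadd _ _).trans (Finset.sum_le_sum fun u _ =>
      (hmul _ _).trans (mul_le_mul_of_nonneg_left (hx u) (h0 _)))
  refine h1.trans ?_
  rw [← Finset.sum_mul]
  exact mul_le_mul_of_nonneg_right (row_le_entryNorm h0 A v) ((h0 _).trans (hx v))

theorem entryNorm_prod_bound [DecidableEq ι] {M : Matrix ι ι S} (hM : M * M = M)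
    {E Q : ℕ → Matrix ι ι S} {c θ s : ℝ} (hc : 0 ≤ c) (hE : ∀ i, entryNorm N (E i) ≤ c * θ ^ i)
    (hθ : 0 ≤ θ) (hθ' : θ < 1) (hs : 1 ≤ s) (hN1 : entryNorm N (1 : Matrix ι ι S) ≤ s)
    (hNM : entryNorm N M ≤ s) (hQ0 : Q 0 = 1) (hQ : ∀ m, Q (m + 1) = Q m * (M + E m)) (m : ℕ) :
    entryNorm N (Q m) ≤ s * Real.exp (c * s / (1 - θ)) :=
  prod_bound (A := Matrix ι ι S) (N := entryNorm N) (Q := Q) (E := E) (M := M) (entryNorm_nonneg h0) (entryNorm_add_le hadd) (entryNorm_mul_le h0 hz hadd hmul) hM hc hE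
    hθ hθ' hs hN1 hNM hQ0 hQ m

end

/-! ### Entire solutions of `q`-difference equations -/

variable {V : Type*} [Fintype V]

theorem scale_C (s c : ℂ) : scale s (MvPowerSeries.C (σ := V) c) = MvPowerSeries.C c := by
  classical
  ext a
  rw [coeff_scale, MvPowerSeries.coeff_C]
  split_ifs with h
  · rw [h, map_zero, pow_zero, one_mul]
  · rw [mul_zero]

theorem constantCoeff_scale (s : ℂ) (K : MvPowerSeries V ℂ) :
    MvPowerSeries.constantCoeff (scale s K) = MvPowerSeries.constantCoeff K := by
  rw [← MvPowerSeries.coeff_zero_eq_constantCoeff_apply, coeff_scale, map_zero, pow_zero, one_mul]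
  rfl

theorem Absol.add {R : ℝ} (hR : 0 ≤ R) {K L : MvPowerSeries V ℂ} (hK : Absol R K)
    (hL : Absol R L) : Absol R (K + L) := by
  obtain ⟨C, -, h1⟩ := hK.exists_truncNorm_le hR
  obtain ⟨D, -, h2⟩ := hL.exists_truncNorm_le hR
  exact absol_of_truncNorm_le hR fun b => (truncNorm_add_le hR b K L).trans (add_le_add (h1 b) (h2 b))

theorem absol_C {R : ℝ} (hR : 0 ≤ R) (c : ℂ) : Absol R (MvPowerSeries.C (σ := V) c) :=
  absol_of_truncNorm_le hR fun b => (truncNorm_C R b c).le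

variable [DecidableEq ι] {s : ℂ} (hs : ‖s‖ < 1) {P : Matrix ι ι (MvPowerSeries V ℂ)}
  (hP : ∀ R : ℝ, 0 ≤ R → ∀ u v, Absol R (P u v)) {M : Matrix ι ι ℂ}
  (hPM : ∀ u v, MvPowerSeries.constantCoeff (P u v) = M u v) (hM : M * M = M)

/-- The matrix `P(s z)`. -/
def scaleMat (s : ℂ) (P : Matrix ι ι (MvPowerSeries V ℂ)) : Matrix ι ι (MvPowerSeries V ℂ) :=
  P.map (scale s)

/-- A matrix of constants as a matrix of power series. -/
def constMat (V : Type*) (M : Matrix ι ι ℂ) : Matrix ι ι (MvPowerSeries V ℂ) :=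
  M.map (MvPowerSeries.C (σ := V))

omit [DecidableEq ι] in
theorem scaleMat_mul (s : ℂ) (P Q : Matrix ι ι (MvPowerSeries V ℂ)) :
    scaleMat s (P * Q) = scaleMat s P * scaleMat s Q :=
  Matrix.map_mul

theorem scaleMat_map_one (s : ℂ) : scaleMat s (1 : Matrix ι ι (MvPowerSeries V ℂ)) = 1 :=
  Matrix.map_one _ (map_zero _) (map_one _)

omit [Fintype ι] [DecidableEq ι] in
theorem scaleMat_scaleMat (s s' : ℂ) (P : Matrix ι ι (MvPowerSeries V ℂ)) :
    scaleMat s (scaleMat s' P) = scaleMat (s * s') P :=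
  Matrix.ext fun u v => scale_scale s s' (P u v)

omit [Fintype ι] [DecidableEq ι] in
theorem scaleMat_one (P : Matrix ι ι (MvPowerSeries V ℂ)) : scaleMat 1 P = P :=
  Matrix.ext fun u v => scale_one (P u v)

omit [DecidableEq ι] [Fintype V] in
theorem constMat_mul (M N : Matrix ι ι ℂ) : constMat V (M * N) = constMat V M * constMat V N :=
  Matrix.map_mul

omit [DecidableEq ι] [Fintype V] in
theorem constMat_mulVec (M : Matrix ι ι ℂ) (x : ι → ℂ) (v : ι) :
    (constMat V M).mulVec (fun u => MvPowerSeries.C (x u)) v = MvPowerSeries.C (M.mulVec x v) := by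
  rw [Matrix.mulVec, Matrix.mulVec, dotProduct, dotProduct, map_sum]
  exact Finset.sum_congr rfl fun u _ => by rw [RingHom.map_mul, constMat, Matrix.map_apply]

omit [DecidableEq ι] [Fintype V] in
theorem truncNorm_constMat (R : ℝ) (b : V →₀ ℕ) (M : Matrix ι ι ℂ) (u v : ι) :
    truncNorm R b (constMat V M u v) = ‖M u v‖ :=
  truncNorm_C R b (M u v)

omit [DecidableEq ι] [Fintype V] in
theorem entryNorm_constMat (R : ℝ) (b : V →₀ ℕ) (M : Matrix ι ι ℂ) :
    entryNorm (truncNorm R b) (constMat V M) = entryNorm norm M := by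
  unfold entryNorm
  simp only [truncNorm_constMat]

omit [Fintype V] in
theorem constMat_one : constMat V (1 : Matrix ι ι ℂ) = 1 :=
  Matrix.map_one _ (map_zero _) (map_one _)

omit [DecidableEq ι] in
theorem scaleMat_mulVec (s : ℂ) (Q : Matrix ι ι (MvPowerSeries V ℂ)) (x : ι → ℂ) (v : ι) :
    (scaleMat s Q).mulVec (fun u => MvPowerSeries.C (x u)) v =
      scale s (Q.mulVec (fun u => MvPowerSeries.C (x u)) v) := by
  rw [Matrix.mulVec, Matrix.mulVec, dotProduct, dotProduct, map_sum]
  refine Finset.sum_congr rfl fun u _ => ?_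
  rw [map_mul, scale_C]; rfl

variable (s P) in
/-- The product `P(z) P(s z) ⋯ P(s^{m-1} z)`. -/
def scaleProd : ℕ → Matrix ι ι (MvPowerSeries V ℂ)
  | 0 => 1
  | m + 1 => scaleProd m * scaleMat (s ^ m) P

variable (s P) in
theorem scaleProd_zero : scaleProd s P 0 = 1 := rfl

variable (s P) in
theorem scaleProd_succ (m : ℕ) : scaleProd s P (m + 1) = scaleProd s P m * scaleMat (s ^ m) P := rfl

variable (s P) in
theorem scaleProd_succ' (m : ℕ) : scaleProd s P (m + 1) = P * scaleMat s (scaleProd s P m) := by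
  induction m with
  | zero =>
    rw [scaleProd_succ, scaleProd_zero, pow_zero, one_mul, scaleMat_one, scaleMat_map_one, mul_one]
  | succ m ih =>
    rw [scaleProd_succ, ih, mul_assoc, pow_succ', ← scaleMat_scaleMat, ← scaleMat_mul,
      ← scaleProd_succ, ih]

variable (s P M) in
/-- The difference `P(s^i z) - P(0)`. -/
def scaleRem (i : ℕ) : Matrix ι ι (MvPowerSeries V ℂ) := scaleMat (s ^ i) P - constMat V M

variable (s P M) in
omit [DecidableEq ι] [Fintype ι] in
theorem scaleRem_apply (i : ℕ) (u v : ι) :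
    scaleRem s P M i u v = scale (s ^ i) (P u v + MvPowerSeries.C (-(M u v))) := by
  rw [map_add, scale_C, map_neg, ← sub_eq_add_neg]; rfl

variable (s P M) in
omit [DecidableEq ι] [Fintype ι] in
theorem add_scaleRem (i : ℕ) : constMat V M + scaleRem s P M i = scaleMat (s ^ i) P :=
  add_sub_cancel _ _

variable (s P) in
/-- The partial products applied to a constant vector. -/
def scaleVec (x : ι → ℂ) (m : ℕ) : ι → MvPowerSeries V ℂ :=
  (scaleProd s P m).mulVec fun u => MvPowerSeries.C (x u)

variable (s P) in
theorem scaleVec_zero (x : ι → ℂ) (v : ι) : scaleVec s P x 0 v = MvPowerSeries.C (x v) := by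
  rw [scaleVec, scaleProd_zero, Matrix.one_mulVec]

variable (s P) in
theorem scaleVec_succ (x : ι → ℂ) (m : ℕ) (v : ι) :
    scaleVec s P x (m + 1) v = ∑ u, P v u * scale s (scaleVec s P x m u) := by
  rw [scaleVec, scaleProd_succ', ← Matrix.mulVec_mulVec, Matrix.mulVec, dotProduct]
  exact Finset.sum_congr rfl fun u _ => congrArg _ (scaleMat_mulVec s _ x u)

variable (s P) in
theorem scaleVec_sub {x : ι → ℂ} (hx : M.mulVec x = x) (m : ℕ) :
    scaleVec s P x (m + 1) = scaleVec s P x m +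
      (scaleProd s P m * scaleRem s P M m).mulVec fun u => MvPowerSeries.C (x u) := by
  have h1 : (constMat V M).mulVec (fun u => MvPowerSeries.C (σ := V) (x u)) =
      fun u => MvPowerSeries.C (x u) :=
    funext fun v => (constMat_mulVec M x v).trans (congrArg MvPowerSeries.C (congrFun hx v))
  rw [scaleVec, scaleVec, scaleProd_succ, ← add_scaleRem s P M, mul_add, Matrix.add_mulVec,
    ← Matrix.mulVec_mulVec _ _ (constMat V M), h1]

include hs hP hPM

theorem exists_scaleRem_le {R : ℝ} (hR : 0 ≤ R) : ∃ c, 0 ≤ c ∧ ∀ b i,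
    entryNorm (truncNorm R b) (scaleRem s P M i) ≤ c * ‖s‖ ^ i := by
  have h1 : ∀ u v, Absol R (P u v + MvPowerSeries.C (-(M u v))) := fun u v =>
    (hP R hR u v).add hR (absol_C hR _)
  choose c hc hc' using fun u v => (h1 u v).exists_truncNorm_le hR
  refine ⟨∑ u, ∑ v, c u v, Finset.sum_nonneg fun u _ => Finset.sum_nonneg fun v _ => hc u v,
    fun b i => ?_⟩
  rw [entryNorm, Finset.sum_mul]
  refine Finset.sum_le_sum fun u _ => ?_
  rw [Finset.sum_mul]
  refine Finset.sum_le_sum fun v _ => ?_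
  rw [scaleRem_apply, mul_comm, ← norm_pow]
  refine (truncNorm_scale_le hR ?_ b ?_).trans (mul_le_mul_of_nonneg_left (hc' u v b) (norm_nonneg _))
  · rw [norm_pow]; exact pow_le_one₀ (norm_nonneg _) hs.le
  · rw [map_add, hPM, MvPowerSeries.constantCoeff_C, add_neg_cancel]

include hM

/-- The bound does not depend on the truncation `b`, so it will yield absolute convergence, for
every radius `R`. -/
theorem exists_scaleProd_le {R : ℝ} (hR : 0 ≤ R) : ∃ B, 0 ≤ B ∧ ∀ b m,
    entryNorm (truncNorm R b) (scaleProd s P m) ≤ B := by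
  obtain ⟨c, hc, hE⟩ := exists_scaleRem_le hs hP hPM hR
  obtain ⟨t, ht1, ht2, ht3⟩ : ∃ t : ℝ, 1 ≤ t ∧ entryNorm norm (1 : Matrix ι ι ℂ) ≤ t ∧
      entryNorm norm M ≤ t :=
    ⟨max 1 (max (entryNorm norm (1 : Matrix ι ι ℂ)) (entryNorm norm M)), le_max_left _ _,
      (le_max_left _ _).trans (le_max_right _ _), (le_max_right _ _).trans (le_max_right _ _)⟩
  refine ⟨t * Real.exp (c * t / (1 - ‖s‖)), mul_nonneg (zero_le_one.trans ht1) (Real.exp_pos _).le,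
    fun b m => ?_⟩
  have h0 := truncNorm_nonneg hR b
  have h1 : constMat V M * constMat V M = constMat V M := by rw [← constMat_mul, hM]
  have h2 : entryNorm (truncNorm R b) (1 : Matrix ι ι (MvPowerSeries V ℂ)) ≤ t := by
    rw [← constMat_one, entryNorm_constMat]
    exact ht2
  have h3 : entryNorm (truncNorm R b) (constMat V M) ≤ t := by
    rw [entryNorm_constMat]
    exact ht3
  have h4 : ∀ m, scaleProd s P (m + 1) = scaleProd s P m * (constMat V M + scaleRem s P M m) :=
    fun m => by rw [scaleProd_succ, add_scaleRem]
  exact entryNorm_prod_bound h0 (truncNorm_zero R b) (truncNorm_add_le hR b) (truncNorm_mul_le hR b)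
    h1 hc (hE b) (norm_nonneg s) hs ht1 h2 h3 (scaleProd_zero s P) h4 m

omit hs hP hPM hM [DecidableEq ι] [Fintype ι] [Fintype V] in
theorem norm_coeff_le_truncNorm (a : V →₀ ℕ) (K : MvPowerSeries V ℂ) :
    ‖MvPowerSeries.coeff a K‖ ≤ truncNorm 1 a K := by
  classical
  have := Finset.single_le_sum (s := Finset.Iic a) (f := fun a => ‖MvPowerSeries.coeff a K‖ * 1 ^ a.degree)
    (fun _ _ => mul_nonneg (norm_nonneg _) (pow_nonneg zero_le_one _)) (Finset.mem_Iic.mpr le_rfl)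
  simp only [one_pow, mul_one] at this
  refine this.trans (le_of_eq ?_)
  simp only [truncNorm, one_pow, mul_one]

/-- The solution is the limit of `P(z) P(sz) ⋯ P(s^{m-1} z) x`. Its coefficients converge because `M
x = x` makes consecutive differences geometrically small, and the equation follows by splitting off
the first factor. -/
theorem exists_entire_solution {x : ι → ℂ} (hx : M.mulVec x = x) :
    ∃ F : ι → MvPowerSeries V ℂ, (∀ v, MvPowerSeries.constantCoeff (F v) = x v) ∧
      (∀ R : ℝ, 0 ≤ R → ∀ v, Absol R (F v)) ∧ ∀ v, F v = ∑ u, P v u * scale s (F u) := by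
  obtain ⟨k, hk⟩ : ∃ k, ∀ u, ‖x u‖ ≤ k := ⟨‖x‖, fun u => norm_le_pi_norm x u⟩
  have hk' : ∀ R b u, truncNorm R b (MvPowerSeries.C (σ := V) (x u)) ≤ k := fun R b u =>
    (truncNorm_C R b _).trans_le (hk u)
  have hlim : ∀ v a, ∃ y, Filter.Tendsto (fun m => MvPowerSeries.coeff a (scaleVec s P x m v)) Filter.atTop (nhds y) := by
    intro v a
    -- For a single coefficient, radius 1 and truncation at its own index `a` are enough.
    obtain ⟨B, hB, hQ⟩ := exists_scaleProd_le hs hP hPM hM zero_le_one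
    obtain ⟨c, hc, hE⟩ := exists_scaleRem_le hs hP hPM zero_le_one
    refine cauchySeq_tendsto_of_complete (cauchySeq_of_le_geometric ‖s‖ (B * c * k) hs fun m => ?_)
    rw [dist_comm, dist_eq_norm, ← map_sub, scaleVec_sub s P hx, Pi.add_apply, add_sub_cancel_left]
    refine (norm_coeff_le_truncNorm a _).trans ?_
    have h0 := truncNorm_nonneg (V := V) zero_le_one a
    have h1 := truncNorm_add_le (V := V) zero_le_one a
    have h2 := truncNorm_mul_le (V := V) zero_le_one a
    refine (mulVec_norm_le h0 (truncNorm_zero 1 a) h1 h2 _ _ (hk' 1 a) v).trans ?_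
    have hk0 : 0 ≤ k := (norm_nonneg _).trans (hk v)
    calc _ ≤ (B * (c * ‖s‖ ^ m)) * k := mul_le_mul_of_nonneg_right
            ((entryNorm_mul_le h0 (truncNorm_zero 1 a) h1 h2 _ _).trans
              (mul_le_mul (hQ a m) (hE a m) (entryNorm_nonneg h0 _) hB)) hk0
      _ = _ := by ring
  choose y hy using hlim
  let F : ι → MvPowerSeries V ℂ := fun v a => y v a
  have hF : ∀ v a, Filter.Tendsto (fun m => MvPowerSeries.coeff a (scaleVec s P x m v)) Filter.atTop
      (nhds (MvPowerSeries.coeff a (F v))) := hy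
  refine ⟨F, fun v => ?_, fun R hR v => ?_, fun v => ?_⟩
  · have h1 : ∀ m v, MvPowerSeries.constantCoeff (scaleVec s P x m v) = x v := fun m => by
      induction m with
      | zero => intro v; rw [scaleVec_zero, MvPowerSeries.constantCoeff_C]
      | succ m ih =>
        intro v
        rw [scaleVec_succ, map_sum]
        simp only [map_mul, constantCoeff_scale, ih, hPM]
        exact congrFun hx v
    have h2 := hF v 0
    simp only [MvPowerSeries.coeff_zero_eq_constantCoeff_apply, h1] at h2
    exact tendsto_nhds_unique h2 tendsto_const_nhds |>.symm ▸ rfl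
  · obtain ⟨B, hB, hQ⟩ := exists_scaleProd_le hs hP hPM hM hR
    -- A truncated norm is a finite sum and thus continuous in the coefficients, so the uniform
    -- bound passes to the limit.
    refine absol_of_truncNorm_le (C := B * k) hR fun b => ?_
    refine le_of_tendsto (f := fun m => truncNorm R b (scaleVec s P x m v)) (x := Filter.atTop)
      (tendsto_finsetSum _ fun a _ => ((hF v a).norm.mul_const _))
      (Filter.Eventually.of_forall fun m => ?_)
    refine (mulVec_norm_le (truncNorm_nonneg hR b) (truncNorm_zero R b) (truncNorm_add_le hR b)
      (truncNorm_mul_le hR b) _ _ (hk' R b) v).trans ?_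
    exact mul_le_mul_of_nonneg_right (hQ b m) ((norm_nonneg _).trans (hk v))
  · classical
    ext a
    refine tendsto_nhds_unique ((hF v a).comp (Filter.tendsto_add_atTop_nat 1)) ?_
    simp only [Function.comp_def, scaleVec_succ, map_sum, MvPowerSeries.coeff_mul, coeff_scale]
    exact tendsto_finsetSum _ fun u _ => tendsto_finsetSum _ fun w _ =>
      ((hF u w.2).const_mul _).const_mul _

end

end BqKZ
end
noncomputable section
namespace BqKZ

/-! ### Inverses of power series -/

section
variable {V : Type*}

theorem truncNorm_le_mul {R : ℝ} (hR : 0 ≤ R) (hR' : R ≤ 1) (b : V →₀ ℕ) {K : MvPowerSeries V ℂ}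
    (hK : MvPowerSeries.constantCoeff K = 0) : truncNorm R b K ≤ R * truncNorm 1 b K := by
  rw [truncNorm, truncNorm, Finset.mul_sum]
  refine Finset.sum_le_sum fun a _ => ?_
  rw [one_pow, mul_one, mul_comm]
  by_cases ha : a = 0
  · subst ha
    rw [MvPowerSeries.coeff_zero_eq_constantCoeff_apply, hK]; simp
  · exact mul_le_mul_of_nonneg_right
      (pow_le_of_le_one hR hR' fun h => ha ((Finsupp.degree_eq_zero_iff a).mp h)) (norm_nonneg _)

variable [Fintype V]

/-- With `D = 1 - S` one has `S⁻¹ = 1 + D S⁻¹`. For small `R` the norm of `D` is at most `1/2`, so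
every truncated norm of `S⁻¹` is at most `1` plus half of itself. -/
theorem exists_absol_inv {S : MvPowerSeries V ℂ} (hS : Absol 1 S)
    (h1 : MvPowerSeries.constantCoeff S = 1) : ∃ R, 0 < R ∧ Absol R S⁻¹ := by
  have hd : Absol 1 (MvPowerSeries.C 1 + MvPowerSeries.C (-1) * S) :=
    (absol_C zero_le_one 1).add zero_le_one ((absol_C zero_le_one (-1)).mul zero_le_one hS)
  set D := MvPowerSeries.C 1 + MvPowerSeries.C (-1) * S with hD
  obtain ⟨c, hc, hc'⟩ := hd.exists_truncNorm_le zero_le_one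
  have hD0 : MvPowerSeries.constantCoeff D = 0 := by
    rw [hD, map_add, map_mul, MvPowerSeries.constantCoeff_C, MvPowerSeries.constantCoeff_C, h1]; ring
  -- As `D` has no constant term, its norm at radius `R ≤ 1` is at most `R c`, and this choice makes
  -- it at most `1/2`.
  have hR : 0 < 1 / (2 * (1 + c)) := by positivity
  refine ⟨1 / (2 * (1 + c)), hR, ?_⟩
  set R := 1 / (2 * (1 + c)) with hRdef
  have hR1 : R ≤ 1 := by
    rw [hRdef, div_le_one (by positivity)]; linarith
  have hRc : R * c ≤ 1 / 2 := by
    rw [hRdef, div_mul_eq_mul_div, div_le_div_iff₀ (by positivity) (by norm_num)]; linarith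
  have hG : S⁻¹ = MvPowerSeries.C 1 + D * S⁻¹ := by
    have h2 : S * S⁻¹ = 1 := MvPowerSeries.mul_inv_cancel S (by rw [h1]; exact one_ne_zero)
    rw [hD, add_mul, mul_assoc, h2, map_neg, map_one]; ring
  refine absol_of_truncNorm_le (C := 2) hR.le fun b => ?_
  have h3 : truncNorm R b S⁻¹ ≤ 1 + 1 / 2 * truncNorm R b S⁻¹ := by
    conv_lhs => rw [hG]
    refine (truncNorm_add_le hR.le b _ _).trans (add_le_add ?_ ?_)
    · rw [truncNorm_C, norm_one]
    · refine (truncNorm_mul_le hR.le b _ _).trans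
        (mul_le_mul_of_nonneg_right ?_ (truncNorm_nonneg hR.le b _))
      exact (truncNorm_le_mul hR.le hR1 b hD0).trans
        ((mul_le_mul_of_nonneg_left (hc' b) hR.le).trans hRc)
  linarith

theorem exists_eval_le {f : MvPolynomial V ℂ} (hf : MvPolynomial.constantCoeff f = 0) (z : V → ℂ) :
    ∃ c, 0 ≤ c ∧ ∀ s : ℂ, ‖s‖ ≤ 1 → ‖MvPolynomial.eval (fun v => s * z v) f‖ ≤ c * ‖s‖ := by
  refine ⟨∑ a ∈ f.support, ‖MvPolynomial.coeff a f * ∏ v, z v ^ a v‖,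
    Finset.sum_nonneg fun _ _ => norm_nonneg _, fun s hs => ?_⟩
  rw [MvPolynomial.eval_eq', Finset.sum_mul]
  refine (norm_sum_le _ _).trans (Finset.sum_le_sum fun a ha => ?_)
  simp only [mul_pow, Finset.prod_mul_distrib, Finset.prod_pow_eq_pow_sum]
  rw [mul_left_comm, norm_mul, mul_comm, norm_pow]
  refine mul_le_mul_of_nonneg_left (pow_le_of_le_one (norm_nonneg _) hs fun h => ?_) (norm_nonneg _)
  have h0 : a = 0 := Finsupp.ext fun v => (Finset.sum_eq_zero_iff.mp h) v (Finset.mem_univ v)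
  rw [h0] at ha
  exact MvPolynomial.mem_support_iff.mp ha hf

end

/-! ### Entire functions of `t^{-α_i}` and `γ^{α_i}` -/

section
variable {n : ℕ}

theorem exists_varVal_analytic : ∃ G : Ambient n → Var n → ℂ, AnalyticOnNhd ℂ G (torusSet n) ∧
    ∀ p, G (coords p) = varVal p := by
  choose F hF hF' using fun v : Var n => (varHolo v).2
  refine ⟨fun z v => F v z, AnalyticOnNhd.pi fun v => hF v, fun p => funext fun v => hF' v p⟩

/-- The function on `T × T` given by an entire power series in `t^{-α_i}` and `γ^{α_i}`. -/
def entHolo (K : MvPowerSeries (Var n) ℂ) (hK : ∀ R : ℝ, 0 ≤ R → Absol R K) : Holo n :=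
  ⟨fun p => evS K (varVal p), by
    obtain ⟨G, hG, hG'⟩ := exists_varVal_analytic (n := n)
    exact ⟨fun z => evS K (G z), (analyticOnNhd_evS hK).comp hG fun _ _ => Set.mem_univ _,
      fun p => congrArg (evS K) (hG' p)⟩⟩

theorem entHolo_ne_zero {K : MvPowerSeries (Var n) ℂ} (hK : ∀ R : ℝ, 0 ≤ R → Absol R K)
    (h : MvPowerSeries.constantCoeff K ≠ 0) : entHolo K hK ≠ 0 := fun h0 => by
  have h1 : ∀ m : ℕ, evS K (fun _ => (1 : ℂ) / ((m : ℂ) + 1)) = 0 := fun m => by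
    obtain ⟨p, hp⟩ := exists_varVal_eq (n := n)
      (Units.mk0 ((1 : ℂ) / ((m : ℂ) + 1)) (one_div_ne_zero (by exact_mod_cast m.succ_ne_zero)))
    rw [Units.val_mk0] at hp
    rw [← hp]
    exact congrFun (congrArg Subtype.val h0) p
  have h2 : Filter.Tendsto (fun m : ℕ => evS K (fun _ => (1 : ℂ) / ((m : ℂ) + 1)))
      Filter.atTop (nhds (evS K 0)) :=
    ((analyticOnNhd_evS hK 0 (Set.mem_univ _)).continuousAt.tendsto).comp
      (tendsto_pi_nhds.mpr fun _ => tendsto_one_div_add_atTop_nhds_zero_nat)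
  simp only [h1, evS_zero] at h2
  exact h (tendsto_nhds_unique h2 tendsto_const_nhds)

/-! ### Generic points -/

theorem mem_region_iff {ε : ℝ} {p : Torus n × Torus n} :
    p ∈ region n ε ↔ ∀ v, ‖varVal p v‖ < ε := by
  rw [Sum.forall]
  simp only [varVal_inl, varVal_inr, ← tpow_neg, ← tpow_inv]
  rfl

theorem dense_torusSet : Dense (torusSet n) := by
  rw [torusSet_eq]
  exact (dense_pi _ fun _ _ => dense_compl_singleton 0).prod
    (dense_pi _ fun _ _ => dense_compl_singleton 0)

/-- By the identity theorem on the connected set `torusSet n`, an analytic function that vanishes on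
a nonempty open set is zero. -/
theorem dense_ne_zero {f : Holo n} (hf : f ≠ 0) :
    ∃ U : Set (Ambient n), IsOpen U ∧ Dense U ∧ ∀ p, coords p ∈ U → f.1 p ≠ 0 := by
  obtain ⟨F, hF, hf'⟩ := f.2
  refine ⟨torusSet n ∩ F ⁻¹' {0}ᶜ, hF.continuousOn.isOpen_inter_preimage (isOpen_torusSet n)
    isOpen_compl_singleton, ?_, fun p hp => ?_⟩
  · rw [dense_iff_inter_open]
    intro U hU hne
    obtain ⟨z, hz, hz'⟩ := dense_torusSet.inter_open_nonempty U hU hne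
    by_contra h
    refine hf (Subtype.ext (funext fun p => ?_))
    change f.1 p = 0
    rw [← hf']
    refine hF.eqOn_zero_of_preconnected_of_eventuallyEq_zero (isPreconnected_torusSet n) hz' ?_
      (coords_mem p)
    filter_upwards [(isOpen_torusSet n).mem_nhds hz', hU.mem_nhds hz] with y hy hy'
    by_contra h0
    exact h ⟨y, hy', hy, h0⟩
  · rw [← hf']; exact hp.2

/-- Baire's theorem: countably many dense open sets meet the nonempty open region in a common point.
It will supply orbits that avoid the zeros of a denominator altogether. -/
theorem exists_generic {ι : Type*} [Countable ι] {g : ι → Holo n} (hg : ∀ i, g i ≠ 0) {ε : ℝ}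
    (hε : 0 < ε) : ∃ p ∈ region n ε, ∀ i, (g i).1 p ≠ 0 := by
  choose U hU hU' hg' using fun i => dense_ne_zero (hg i)
  obtain ⟨G, hG, hG'⟩ := exists_varVal_analytic (n := n)
  have hO : IsOpen (torusSet n ∩ G ⁻¹' {x | ∀ v, ‖x v‖ < ε}) := by
    refine hG.continuousOn.isOpen_inter_preimage (isOpen_torusSet n) ?_
    rw [Set.ofPred_forall]
    exact isOpen_iInter_of_finite fun v =>
      isOpen_lt (continuous_norm.comp (continuous_apply v)) continuous_const
  obtain ⟨p, hp⟩ := exists_varVal_eq (n := n)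
    (Units.mk0 ((ε / 2 : ℝ) : ℂ) (Complex.ofReal_ne_zero.mpr (half_pos hε).ne'))
  obtain ⟨z, hz, hz'⟩ := (dense_iInter_of_isOpen hU hU').inter_open_nonempty _ hO
    ⟨coords p, coords_mem p, fun v => by
      rw [hG', hp, Units.val_mk0, Complex.norm_real, Real.norm_of_nonneg (half_pos hε).le]
      exact half_lt_self hε⟩
  obtain ⟨r, rfl⟩ := exists_coords hz.1
  refine ⟨r, mem_region_iff.mpr fun v => ?_, fun i => hg' i r (Set.mem_iInter.mp hz' i)⟩
  rw [← hG']; exact hz.2 v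

end

end BqKZ
end
noncomputable section
namespace BqKZ

/-! ### Limits along orbits -/

section
variable {n : ℕ} (q : QParam)

/-- The translation by `m` times the sum of the fundamental weights. -/
def orb (n : ℕ) (q : QParam) (m : ℕ) : Torus n × Torus n :=
  (qpow q (-(m • rho)), qpow q (m • rho))

theorem varVal_mul (l m : Lat n) (p : Torus n × Torus n) (v : Var n) :
    varVal ((qpow q (-l), qpow q m) * p) v = scaleFactor q l m v * varVal p v := by
  have h := congrArg (fun f : Holo n => f.1 p) (dilate_varHolo q l m v)
  exact h

theorem orb_zero : orb n q 0 = 1 := by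
  simp only [orb, zero_smul, neg_zero]
  exact Prod.ext (funext fun _ => zpow_zero _) (funext fun _ => zpow_zero _)

theorem orb_succ (m : ℕ) : orb n q (m + 1) = (qpow q (-rho), qpow q rho) * orb n q m := by
  rw [orb, orb, Prod.mk_mul_mk, ← qpow_add, ← qpow_add, add_smul, one_smul, neg_add,
    add_comm (m • (rho : Lat n)), add_comm (-(m • (rho : Lat n)))]

theorem varVal_orb (m : ℕ) (p : Torus n × Torus n) (v : Var n) :
    varVal (orb n q m * p) v = (q.unit : ℂ) ^ m * varVal p v := by
  induction m with
  | zero => rw [orb_zero, one_mul, pow_zero, one_mul]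
  | succ m ih => rw [orb_succ, mul_assoc, varVal_mul, scaleFactor_rho, ih, pow_succ', mul_assoc]

variable {q}

theorem orb_mul_mem {ε : ℝ} {p : Torus n × Torus n} (hp : p ∈ region n ε) (m : ℕ) :
    orb n q m * p ∈ region n ε := by
  rw [mem_region_iff] at hp ⊢
  intro v
  rw [varVal_orb, norm_mul, norm_pow]
  exact (mul_le_of_le_one_left (norm_nonneg _)
    (pow_le_one₀ (norm_nonneg _) (norm_unit_lt_one q).le)).trans_lt (hp v)

theorem region_mono {ε ε' : ℝ} (h : ε ≤ ε') : region n ε ⊆ region n ε' := fun _ hp =>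
  mem_region_iff.mpr fun v => (mem_region_iff.mp hp v).trans_le h

variable (q)

/-- The meromorphic function `x` is regular near the origin, with the limit `c` along all orbits. -/
def OrbitLim (x : Mero n) (c : ℂ) : Prop := ∃ ε : ℝ, 0 < ε ∧ ∃ f g : Holo n, g ≠ 0 ∧
  x * algebraMap (Holo n) (Mero n) g = algebraMap (Holo n) (Mero n) f ∧
  ∃ s : Torus n × Torus n → ℂ, (∀ p ∈ region n ε, g.1 p * s p = f.1 p) ∧
    ∀ p ∈ region n ε, Filter.Tendsto (fun m => s (orb n q m * p)) Filter.atTop (nhds c)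

variable {q}

theorem field_add_identity {F : Type*} [CommRing F] {x y g g' f f' : F} (h : x * g = f)
    (h' : y * g' = f') : (x + y) * (g * g') = f * g' + f' * g := by
  rw [← h, ← h']; ring

theorem OrbitLim.add {x y : Mero n} {c d : ℂ} (hx : OrbitLim q x c) (hy : OrbitLim q y d) :
    OrbitLim q (x + y) (c + d) := by
  obtain ⟨ε, hε, f, g, hg, h, s, hs, hs'⟩ := hx
  obtain ⟨ε', hε', f', g', hg', h', s', hs1, hs1'⟩ := hy
  refine ⟨min ε ε', lt_min hε hε', f * g' + f' * g, g * g', mul_ne_zero hg hg', ?_,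
    fun p => s p + s' p, fun p hp => ?_, fun p hp => ?_⟩
  · rw [map_mul, map_add, map_mul, map_mul]
    exact field_add_identity h h'
  · change g.1 p * g'.1 p * (s p + s' p) = f.1 p * g'.1 p + f'.1 p * g.1 p
    rw [← hs p (region_mono (min_le_left _ _) hp), ← hs1 p (region_mono (min_le_right _ _) hp)]
    ring
  · exact (hs' p (region_mono (min_le_left _ _) hp)).add (hs1' p (region_mono (min_le_right _ _) hp))

theorem OrbitLim.mul {x y : Mero n} {c d : ℂ} (hx : OrbitLim q x c) (hy : OrbitLim q y d) :
    OrbitLim q (x * y) (c * d) := by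
  obtain ⟨ε, hε, f, g, hg, h, s, hs, hs'⟩ := hx
  obtain ⟨ε', hε', f', g', hg', h', s', hs1, hs1'⟩ := hy
  refine ⟨min ε ε', lt_min hε hε', f * f', g * g', mul_ne_zero hg hg', ?_,
    fun p => s p * s' p, fun p hp => ?_, fun p hp => ?_⟩
  · rw [map_mul, map_mul, ← h, ← h']
    exact mul_mul_mul_comm x y _ _
  · change g.1 p * g'.1 p * (s p * s' p) = f.1 p * f'.1 p
    rw [← hs p (region_mono (min_le_left _ _) hp), ← hs1 p (region_mono (min_le_right _ _) hp)]
    ring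
  · exact (hs' p (region_mono (min_le_left _ _) hp)).mul (hs1' p (region_mono (min_le_right _ _) hp))

theorem exists_eval_ne_zero {e : Pol n} (he : MvPolynomial.constantCoeff e = 1) :
    ∃ ε : ℝ, 0 < ε ∧ ∀ p ∈ region n ε, 1 / 2 ≤ ‖MvPolynomial.eval (varVal p) e‖ := by
  have h1 : Filter.Tendsto (fun x => ‖MvPolynomial.eval x e‖) (nhds (0 : Var n → ℂ)) (nhds 1) := by
    have := ((MvPolynomial.continuous_eval e).norm.tendsto 0)
    rwa [show MvPolynomial.eval (0 : Var n → ℂ) e = 1 by rw [← he, ← MvPolynomial.eval_zero],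
      norm_one] at this
  obtain ⟨ε, hε, h2⟩ := Metric.eventually_nhds_iff.mp (h1.eventually (lt_mem_nhds (by norm_num : (1 / 2 : ℝ) < 1)))
  refine ⟨ε, hε, fun p hp => (h2 ?_).le⟩
  rw [dist_zero_right, pi_norm_lt_iff hε]
  exact mem_region_iff.mp hp

theorem tendsto_eval_orb (f : Pol n) (p : Torus n × Torus n) :
    Filter.Tendsto (fun m => MvPolynomial.eval (varVal (orb n q m * p)) f) Filter.atTop
      (nhds (MvPolynomial.constantCoeff f)) := by
  have h : Filter.Tendsto (fun m => varVal (orb n q m * p)) Filter.atTop (nhds 0) := by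
    rw [tendsto_pi_nhds]
    intro v
    simp only [varVal_orb]
    have := (tendsto_pow_atTop_nhds_zero_of_norm_lt_one (norm_unit_lt_one q)).mul_const (varVal p v)
    rwa [zero_mul] at this
  have := ((MvPolynomial.continuous_eval f).tendsto 0).comp h
  rwa [show MvPolynomial.eval (0 : Var n → ℂ) f = MvPolynomial.constantCoeff f by
    rw [← MvPolynomial.eval_zero]] at this

theorem Val.orbitLim {x : Mero n} {c : ℂ} (hx : Val x c) : OrbitLim q x c := by
  obtain ⟨f, e, he, rfl, h⟩ := hx
  obtain ⟨ε, hε, h1⟩ := exists_eval_ne_zero he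
  refine ⟨ε, hε, evPol f, evPol e, evPol_ne_zero (by rw [he]; exact one_ne_zero), h,
    fun p => MvPolynomial.eval (varVal p) f / MvPolynomial.eval (varVal p) e, fun p hp => ?_,
    fun p hp => ?_⟩
  · rw [evPol_val, evPol_val]
    refine mul_div_cancel₀ _ fun h0 => ?_
    have := h1 p hp
    rw [h0, norm_zero] at this
    norm_num at this
  · have := (tendsto_eval_orb (q := q) f p).div (tendsto_eval_orb (q := q) e p) (by rw [he]; exact one_ne_zero)
    rwa [he, div_one] at this

theorem OrbitLim.sum {ι : Type*} {s : Finset ι} {x : ι → Mero n} {c : ι → ℂ}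
    (h : ∀ i ∈ s, OrbitLim q (x i) (c i)) : OrbitLim q (∑ i ∈ s, x i) (∑ i ∈ s, c i) := by
  induction s using Finset.cons_induction with
  | empty => exact val_zero.orbitLim
  | cons i s hi ih =>
    rw [Finset.sum_cons, Finset.sum_cons]
    exact (h i (Finset.mem_cons_self _ _)).add (ih fun j hj => h j (Finset.mem_cons_of_mem hj))

theorem dilate_ne_zero (c : Torus n × Torus n) {g : Holo n} (hg : g ≠ 0) : dilate c g ≠ 0 :=
  fun h => hg ((dilate c).injective (h.trans (map_zero _).symm))

/-- Shifts that enlarge none of the variables keep the region stable, and they commute with the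
motion along orbits. -/
theorem OrbitLim.shift {l m : Lat n} (hlm : ∀ v : Var n, ‖(scaleFactor q l m v : ℂ)‖ ≤ 1)
    {x : Mero n} {c : ℂ} (hx : OrbitLim q x c) : OrbitLim q (shift q l m x) c := by
  obtain ⟨ε, hε, f, g, hg, h, s, hs, hs'⟩ := hx
  have hmem : ∀ {p : Torus n × Torus n}, p ∈ region n ε → (qpow q (-l), qpow q m) * p ∈ region n ε :=
    fun hp => mem_region_iff.mpr fun v => by
      rw [varVal_mul, norm_mul]
      exact (mul_le_of_le_one_left (norm_nonneg _) (hlm v)).trans_lt (mem_region_iff.mp hp v)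
  refine ⟨ε, hε, dilate (qpow q (-l), qpow q m) f, dilate (qpow q (-l), qpow q m) g,
    dilate_ne_zero _ hg, ?_, fun p => s ((qpow q (-l), qpow q m) * p), fun p hp => hs _ (hmem hp),
    fun p hp => ?_⟩
  · rw [← shift_algebraMap, ← shift_algebraMap, ← h, shift_mul]
  · simp only [mul_left_comm _ (orb n q _)]
    exact hs' _ (hmem hp)

/-! ### Expansions and limits -/

theorem seriesTerm_orb (K : (Fin (n + 1) → ℕ) × (Fin (n + 1) → ℕ) → Perm n → ℂ)
    (ab : (Fin (n + 1) → ℕ) × (Fin (n + 1) → ℕ)) (p : Torus n × Torus n) (m : ℕ) :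
    seriesTerm K ab (orb n q m * p) =
      ((q.unit : ℂ) ^ m) ^ (∑ i, ab.1 i + ∑ i, ab.2 i) • seriesTerm K ab p := by
  have h : ∀ p : Torus n × Torus n, ((tpow p.1 (-posRoot ab.1) * tpow p.2 (posRoot ab.2) : ℂˣ) : ℂ) =
      (∏ i, varVal p (Sum.inl i) ^ ab.1 i) * ∏ i, varVal p (Sum.inr i) ^ ab.2 i := fun p => by
    change (monoHolo (-posRoot ab.1) (posRoot ab.2)).1 p = _
    rw [monoHolo_posRoot, evPol_val]
    simp
  rw [seriesTerm, seriesTerm, smul_smul, h, h]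
  congr 1
  simp only [varVal_orb, mul_pow, Finset.prod_mul_distrib, Finset.prod_pow_eq_pow_sum, pow_add]
  ring

/-- At the `m`-th point of an orbit a term of degree `d` is multiplied by `q^{m d}`. By dominated
convergence, with normal convergence at the starting point as the majorant, only the term of degree
zero survives. -/
theorem HasExpansion.orbitLim {Ψ : HeckeMero n} {ε : ℝ} (hε : 0 < ε)
    {K : (Fin (n + 1) → ℕ) × (Fin (n + 1) → ℕ) → Perm n → ℂ} (h : HasExpansion Ψ ε K) (v : Perm n) :
    OrbitLim q (Ψ v) (K (0, 0) v) := by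
  obtain ⟨f, g, hg, hΨ, hs⟩ := h.eq_sum v
  refine ⟨ε, hε, f, g, hg, by rw [hΨ]; exact div_mul_cancel₀ _ (holo_ne_zero hg),
    fun p => ∑' ab, seriesTerm K ab p v, hs, fun p hp => ?_⟩
  obtain ⟨M, hM, hM'⟩ := h.normal {p} (Set.singleton_subset_iff.mpr hp) isCompact_singleton
  have h0 : K (0, 0) v = ∑' ab : (Fin (n + 1) → ℕ) × (Fin (n + 1) → ℕ),
      if ab = (0, 0) then K (0, 0) v else 0 := by rw [tsum_ite_eq]
  rw [h0]
  have hq := norm_unit_lt_one q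
  refine tendsto_tsum_of_dominated_convergence (G := ℂ) hM (fun ab => ?_) (Filter.Eventually.of_forall
    fun m ab => ?_)
  · split_ifs with hab
    · subst hab
      refine tendsto_const_nhds.congr fun m => ?_
      rw [seriesTerm, posRoot_zero, neg_zero, tpow_zero, tpow_zero, one_mul, Units.val_one, one_smul]
    · have hd : ∑ i, ab.1 i + ∑ i, ab.2 i ≠ 0 := fun hd => hab (by
        obtain ⟨h1, h2⟩ := add_eq_zero.mp hd
        exact Prod.ext (funext fun i => Finset.sum_eq_zero_iff.mp h1 i (Finset.mem_univ i))
          (funext fun i => Finset.sum_eq_zero_iff.mp h2 i (Finset.mem_univ i)))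
      simp only [seriesTerm_orb, Pi.smul_apply, smul_eq_mul]
      have := ((tendsto_pow_atTop_nhds_zero_of_norm_lt_one hq).pow
        (∑ i, ab.1 i + ∑ i, ab.2 i)).mul_const (seriesTerm K ab p v)
      rwa [zero_pow hd, zero_mul] at this
  · rw [seriesTerm_orb, Pi.smul_apply, smul_eq_mul, norm_mul, norm_pow, norm_pow]
    refine (mul_le_of_le_one_left (norm_nonneg _) (pow_le_one₀ (pow_nonneg (norm_nonneg _) _)
      (pow_le_one₀ (norm_nonneg _) hq.le))).trans ?_
    exact (norm_le_pi_norm _ v).trans (hM' p rfl ab)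

end

end BqKZ
end
noncomputable section
namespace BqKZ

/-! ### Uniqueness -/

section
variable {ι : Type*} [Fintype ι] [DecidableEq ι]

/-- The product `(M + E_0) ⋯ (M + E_{m-1})`. -/
def matProd (M : Matrix ι ι ℂ) (E : ℕ → Matrix ι ι ℂ) : ℕ → Matrix ι ι ℂ
  | 0 => 1
  | m + 1 => matProd M E m * (M + E m)

theorem exists_matProd_le {M : Matrix ι ι ℂ} (hM : M * M = M) {E : ℕ → Matrix ι ι ℂ} {c θ : ℝ}
    (hc : 0 ≤ c) (hθ : 0 ≤ θ) (hθ' : θ < 1) (hE : ∀ i, entryNorm norm (E i) ≤ c * θ ^ i) :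
    ∃ B, ∀ m, entryNorm norm (matProd M E m) ≤ B := by
  obtain ⟨t, ht1, ht2, ht3⟩ : ∃ t : ℝ, 1 ≤ t ∧ entryNorm norm (1 : Matrix ι ι ℂ) ≤ t ∧
      entryNorm norm M ≤ t :=
    ⟨max 1 (max (entryNorm norm (1 : Matrix ι ι ℂ)) (entryNorm norm M)), le_max_left _ _,
      (le_max_left _ _).trans (le_max_right _ _), (le_max_right _ _).trans (le_max_right _ _)⟩
  exact ⟨t * Real.exp (c * t / (1 - θ)), fun m =>
    entryNorm_prod_bound (S := ℂ) (N := norm) (Q := matProd M E) (E := E) (M := M)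
      (fun _ => norm_nonneg _) norm_zero norm_add_le (fun _ _ => norm_mul_le _ _)
      hM hc hE hθ hθ' ht1 ht2 ht3 rfl (fun _ => rfl) m⟩

theorem eq_matProd_mulVec {M : Matrix ι ι ℂ} {E : ℕ → Matrix ι ι ℂ} {y : ℕ → ι → ℂ}
    (hy : ∀ m, y m = (M + E m).mulVec (y (m + 1))) (m : ℕ) :
    y 0 = (matProd M E m).mulVec (y m) := by
  induction m with
  | zero => exact (Matrix.one_mulVec _).symm
  | succ m ih => rw [matProd, ← Matrix.mulVec_mulVec, ← hy, ← ih]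

omit [DecidableEq ι] in
theorem norm_mulVec_le (A : Matrix ι ι ℂ) (y : ι → ℂ) (v : ι) :
    ‖A.mulVec y v‖ ≤ entryNorm norm A * ‖y‖ :=
  mulVec_norm_le (S := ℂ) (N := norm) (fun _ => norm_nonneg _) norm_zero norm_add_le
    (fun _ _ => norm_mul_le _ _) A y (fun u => norm_le_pi_norm y u) v

/-- Iterating, `y 0` is a product of `m` matrices applied to `y m`. The products are bounded because
`M` is idempotent, and `y m` tends to `0`. -/
theorem eq_zero_of_recursion {M : Matrix ι ι ℂ} (hM : M * M = M) {E : ℕ → Matrix ι ι ℂ}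
    {y : ℕ → ι → ℂ} {c θ : ℝ} (hc : 0 ≤ c) (hθ : 0 ≤ θ) (hθ' : θ < 1)
    (hE : ∀ i, entryNorm norm (E i) ≤ c * θ ^ i) (hy : ∀ m, y m = (M + E m).mulVec (y (m + 1)))
    (hlim : Filter.Tendsto y Filter.atTop (nhds 0)) : y 0 = 0 := by
  obtain ⟨B, hB⟩ := exists_matProd_le hM hc hθ hθ' hE
  funext v
  have h1 : ∀ m, ‖y 0 v‖ ≤ B * ‖y m‖ := fun m => by
    rw [eq_matProd_mulVec hy m]
    exact (norm_mulVec_le _ _ v).trans (mul_le_mul_of_nonneg_right (hB m) (norm_nonneg _))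
  have h2 := ge_of_tendsto' ((hlim.norm).const_mul B) h1
  rw [norm_zero, mul_zero] at h2
  exact norm_le_zero_iff.mp h2

end

/-! ### Solutions are determined by their limits along orbits. -/

section
variable {n : ℕ} {q : QParam} {k : ℂˣ}

theorem exists_common_val {ι : Type*} [Finite ι] {x : ι → Mero n} {c : ι → ℂ}
    (h : ∀ i, Val (x i) (c i)) : ∃ (p : ι → Pol n) (e : Pol n), MvPolynomial.constantCoeff e = 1 ∧
      (∀ i, MvPolynomial.constantCoeff (p i) = c i) ∧ ∀ i, x i * merPol e = merPol (p i) := by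
  classical
  have := Fintype.ofFinite ι
  choose p e he hp hx using h
  refine ⟨fun i => p i * ∏ j ∈ Finset.univ.erase i, e j, ∏ j, e j, ?_, fun i => ?_, fun i => ?_⟩
  · rw [map_prod]; exact Finset.prod_eq_one fun i _ => he i
  · rw [map_mul, map_prod, Finset.prod_eq_one fun i _ => he i, mul_one, hp]
  · rw [← Finset.mul_prod_erase _ _ (Finset.mem_univ i), merPol_mul, merPol_mul, ← hx]
    exact (mul_assoc _ _ _).symm

theorem exists_common_orbitLim {ι : Type*} [Finite ι] [Nonempty ι] {x : ι → Mero n} {c : ι → ℂ}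
    (h : ∀ i, OrbitLim q (x i) (c i)) : ∃ ε : ℝ, 0 < ε ∧ ∃ (f : ι → Holo n) (g : Holo n), g ≠ 0 ∧
      (∀ i, x i * algebraMap (Holo n) (Mero n) g = algebraMap (Holo n) (Mero n) (f i)) ∧
      ∃ s : ι → Torus n × Torus n → ℂ, ∀ i, (∀ p ∈ region n ε, g.1 p * s i p = (f i).1 p) ∧
        ∀ p ∈ region n ε, Filter.Tendsto (fun m => s i (orb n q m * p)) Filter.atTop (nhds (c i)) := by
  classical
  have := Fintype.ofFinite ι
  choose ε hε f g hg hx s hs hs' using h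
  obtain ⟨i₀, hi₀⟩ := Finite.exists_min ε
  refine ⟨ε i₀, hε i₀, fun i => f i * ∏ j ∈ Finset.univ.erase i, g j, ∏ j, g j,
    Finset.prod_ne_zero_iff.mpr fun i _ => hg i, fun i => ?_, s, fun i => ⟨fun p hp => ?_, fun p hp =>
      hs' i p (region_mono (hi₀ i) hp)⟩⟩
  · rw [← Finset.mul_prod_erase _ _ (Finset.mem_univ i), map_mul, map_mul, ← hx]
    exact (mul_assoc _ _ _).symm
  · rw [← Finset.mul_prod_erase _ _ (Finset.mem_univ i)]
    change (g i).1 p * _ * s i p = (f i).1 p * _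
    rw [← hs i p (region_mono (hi₀ i) hp), mul_right_comm]

theorem identity_of_sum {R F ι : Type*} [CommRing R] [IsDomain R] [Field F] [Algebra R F]
    [IsFractionRing R F] (s : Finset ι) {d : F} {f g e g' : R} {a x : ι → F} {b y : ι → R}
    (h : d = ∑ u ∈ s, a u * x u) (hd : d * algebraMap R F g = algebraMap R F f)
    (ha : ∀ u, a u * algebraMap R F e = algebraMap R F (b u))
    (hx : ∀ u, x u * algebraMap R F g' = algebraMap R F (y u)) :
    f * e * g' = g * ∑ u ∈ s, b u * y u := by
  apply IsFractionRing.injective R F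
  rw [map_mul, map_mul, map_mul, ← hd, map_sum, h, Finset.mul_sum, Finset.sum_mul, Finset.sum_mul,
    Finset.sum_mul]
  refine Finset.sum_congr rfl fun u _ => ?_
  rw [map_mul, ← ha, ← hx]
  ring

theorem shift_mul_algebraMap_dilate {l m : Lat n} {x : Mero n} {f g : Holo n}
    (h : x * algebraMap (Holo n) (Mero n) g = algebraMap (Holo n) (Mero n) f) :
    shift q l m x * algebraMap (Holo n) (Mero n) (dilate (qpow q (-l), qpow q m) g) =
      algebraMap (Holo n) (Mero n) (dilate (qpow q (-l), qpow q m) f) := by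
  rw [← shift_algebraMap, ← shift_algebraMap, ← h, shift_mul]

theorem holo_sum_val {ι : Type*} (s : Finset ι) (a : ι → Holo n) (p : Torus n × Torus n) :
    (∑ u ∈ s, a u).1 p = ∑ u ∈ s, (a u).1 p := by
  induction s using Finset.cons_induction with
  | empty => rfl
  | cons u s hu ih => rw [Finset.sum_cons, Finset.sum_cons, ← ih]; rfl

/-- A meromorphic function need not have a value at every point, so the equation is cleared of
denominators before it is evaluated along an orbit. -/
theorem holo_identity_of_fixed {D : HeckeMero n} (hD : gaugedTransl q k rho rho D = D)
    {P : Perm n → Perm n → Pol n} {e : Pol n} (hP : ∀ v u,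
      gaugedTransl q k rho rho (Pi.single u 1) v * merPol e = merPol (P v u))
    {f : Perm n → Holo n} {g : Holo n}
    (hf : ∀ v, D v * algebraMap (Holo n) (Mero n) g = algebraMap (Holo n) (Mero n) (f v)) (v : Perm n) :
    f v * evPol e * dilate (qpow q (-rho), qpow q rho) g =
      g * ∑ u, evPol (P v u) * dilate (qpow q (-rho), qpow q rho) (f u) := by
  have h1 : D v = ∑ u, gaugedTransl q k rho rho (Pi.single u 1) v * shift q rho rho (D u) := by
    rw [← gaugedTransl_apply, hD]
  exact identity_of_sum (R := Holo n) (F := Mero n) _ h1 (hf v) (hP v)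
    fun u => shift_mul_algebraMap_dilate (hf u)

theorem entryNorm_le {ι : Type*} [Fintype ι] {A : Matrix ι ι ℂ} {C : ι → ι → ℝ} {t : ℝ}
    (h : ∀ u v, ‖A u v‖ ≤ C u v * t) : entryNorm norm A ≤ (∑ u, ∑ v, C u v) * t := by
  rw [entryNorm, Finset.sum_mul]
  refine Finset.sum_le_sum fun u _ => ?_
  rw [Finset.sum_mul]
  exact Finset.sum_le_sum fun v _ => h u v

/-- If `D` were nonzero, there would be an orbit along which the denominators do not vanish but `D`
does not vanish at its starting point. On this orbit the equation of `(ρ, ρ)` becomes the recursion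
of `eq_zero_of_recursion`, with errors of order `q^m`, which forces the starting value to be zero.
-/
theorem eq_zero_of_orbitLim {D : HeckeMero n} (hD : gaugedTransl q k rho rho D = D)
    (h0 : ∀ v, OrbitLim q (D v) 0) : D = 0 := by
  obtain ⟨M, hM, hM2, -⟩ := hasIdem_rho (n := n) q k
  obtain ⟨P, e, he, hPM, hP⟩ := exists_common_val fun i : Perm n × Perm n => hM i.1 i.2
  obtain ⟨ε, hε, f, g, hg, hf, s, hs⟩ := exists_common_orbitLim h0
  obtain ⟨ε', hε', h1⟩ := exists_eval_ne_zero he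
  have hid := holo_identity_of_fixed hD (P := fun v u => P (v, u)) (fun v u => hP (v, u)) hf
  have hf0 : ∀ v, f v = 0 := fun v => by
    by_contra hv
    -- The index `none` keeps `f v` nonzero at `p`, and `some m` keeps the common denominator
    -- nonzero at the `m`-th point of the orbit.
    obtain ⟨p, hp, hgen⟩ := exists_generic (g := fun o : Option ℕ =>
      o.elim (f v) fun m => dilate (orb n q m) g) (fun o => by
        cases o with
        | none => exact hv
        | some m => exact dilate_ne_zero _ hg) (lt_min hε hε')
    have hgm : ∀ m, g.1 (orb n q m * p) ≠ 0 := fun m => hgen (some m)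
    have hpm := fun m => orb_mul_mem (q := q) hp m
    have hen : ∀ m, 1 / 2 ≤ ‖MvPolynomial.eval (varVal (orb n q m * p)) e‖ := fun m =>
      h1 _ (region_mono (min_le_right _ _) (hpm m))
    have hsm : ∀ m u, g.1 (orb n q m * p) * s u (orb n q m * p) = (f u).1 (orb n q m * p) := fun m u =>
      (hs u).1 _ (region_mono (min_le_left _ _) (hpm m))
    set z : ℕ → Var n → ℂ := fun m => varVal (orb n q m * p) with hz
    have he0 : ∀ m, MvPolynomial.eval (z m) e ≠ 0 := fun m h => by
      have := hen m
      rw [show varVal (orb n q m * p) = z m from rfl, h, norm_zero] at this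
      norm_num at this
    let E : ℕ → Matrix (Perm n) (Perm n) ℂ := fun m => Matrix.of fun v u =>
      MvPolynomial.eval (z m) (P (v, u)) / MvPolynomial.eval (z m) e - M v u
    have hrec : ∀ m, (fun u => s u (orb n q m * p)) =
        (M + E m).mulVec fun u => s u (orb n q (m + 1) * p) := fun m => funext fun v => by
      have h2 := congrArg (fun f : Holo n => f.1 (orb n q m * p)) (hid v)
      change (f v).1 (orb n q m * p) * (evPol e).1 (orb n q m * p) *
        g.1 ((qpow q (-rho), qpow q rho) * (orb n q m * p)) =
          g.1 (orb n q m * p) * (∑ u, evPol (P (v, u)) * dilate (qpow q (-rho), qpow q rho) (f u)).1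
            (orb n q m * p) at h2
      rw [holo_sum_val, ← mul_assoc, ← orb_succ] at h2
      have h3 : ∀ u, (evPol (P (v, u)) * dilate (qpow q (-rho), qpow q rho) (f u)).1 (orb n q m * p) =
          MvPolynomial.eval (z m) (P (v, u)) *
            (g.1 (orb n q (m + 1) * p) * s u (orb n q (m + 1) * p)) := fun u => by
        change (evPol (P (v, u))).1 (orb n q m * p) *
          (f u).1 ((qpow q (-rho), qpow q rho) * (orb n q m * p)) = _
        rw [evPol_val, ← mul_assoc (_, _), ← orb_succ, hsm]
      simp only [h3] at h2
      rw [← hsm, evPol_val] at h2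
      have h4 : s v (orb n q m * p) * MvPolynomial.eval (z m) e =
          ∑ u, MvPolynomial.eval (z m) (P (v, u)) * s u (orb n q (m + 1) * p) := by
        apply mul_left_cancel₀ (hgm (m + 1))
        apply mul_left_cancel₀ (hgm m)
        rw [Finset.mul_sum]
        simp only [mul_left_comm (g.1 (orb n q (m + 1) * p))]
        rw [← h2]
        ring
      rw [Matrix.mulVec, dotProduct]
      rw [eq_div_of_mul_eq (he0 m) h4, Finset.sum_div]
      refine Finset.sum_congr rfl fun u _ => ?_
      have hEv : E m v u =
        MvPolynomial.eval (z m) (P (v, u)) / MvPolynomial.eval (z m) e - M v u := rfl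
      rw [Matrix.add_apply, hEv, add_sub_cancel, div_mul_eq_mul_div]
    -- The numerator of `E m v u` is a polynomial without constant term evaluated at `q^m z`, hence
    -- of order `q^m`; the denominator is at least `1/2` in absolute value, which accounts for the
    -- factor 2 below.
    have hC : ∀ v u, MvPolynomial.constantCoeff (P (v, u) - MvPolynomial.C (M v u) * e) = 0 :=
      fun v u => by
        rw [map_sub, map_mul, hPM, MvPolynomial.constantCoeff_C, he, mul_one, sub_self]
    choose C hC0 hC' using fun v u => exists_eval_le (hC v u) (varVal p)
    have hE : ∀ m v u, ‖E m v u‖ ≤ 2 * C v u * (q : ℝ) ^ m := fun m v u => by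
      have h2 : E m v u = MvPolynomial.eval (z m) (P (v, u) - MvPolynomial.C (M v u) * e) /
          MvPolynomial.eval (z m) e := by
        rw [map_sub, map_mul, MvPolynomial.eval_C, sub_div, mul_div_cancel_right₀ _ (he0 m)]
        rfl
      have h3 : z m = fun v => (q.unit : ℂ) ^ m * varVal p v := funext fun v => varVal_orb q m p v
      have h4 := hC' v u ((q.unit : ℂ) ^ m) (by
        rw [norm_pow]; exact pow_le_one₀ (norm_nonneg _) (norm_unit_lt_one q).le)
      rw [← h3, norm_pow, norm_unit] at h4
      rw [h2, norm_div, div_le_iff₀ (norm_pos_iff.mpr (he0 m))]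
      refine h4.trans ?_
      have h5 : 0 ≤ C v u * (q : ℝ) ^ m := mul_nonneg (hC0 v u) (pow_nonneg q.2.1.le m)
      have := mul_le_mul_of_nonneg_left (hen m) h5
      calc C v u * (q : ℝ) ^ m = 2 * (C v u * (q : ℝ) ^ m * (1 / 2)) := by ring
        _ ≤ 2 * (C v u * (q : ℝ) ^ m * ‖MvPolynomial.eval (z m) e‖) :=
            mul_le_mul_of_nonneg_left this zero_le_two
        _ = _ := by ring
    have hlim : Filter.Tendsto (fun m => fun u => s u (orb n q m * p)) Filter.atTop (nhds 0) :=
      tendsto_pi_nhds.mpr fun u => (hs u).2 p (region_mono (min_le_left _ _) hp)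
    have h2 := eq_zero_of_recursion hM2 (Finset.sum_nonneg fun v _ => Finset.sum_nonneg fun u _ =>
      mul_nonneg zero_le_two (hC0 v u)) q.2.1.le q.2.2 (fun m => entryNorm_le (hE m)) hrec hlim
    have h3 : s v (orb n q 0 * p) = 0 := congrFun h2 v
    have h4 := hsm 0 v
    rw [h3, mul_zero, orb_zero, one_mul] at h4
    exact hgen none h4.symm
  funext v
  have h2 := hf v
  rw [hf0, map_zero] at h2
  exact (mul_eq_zero.mp h2).resolve_right (holo_ne_zero hg)

theorem OrbitLim.sub {x y : Mero n} {c d : ℂ} (hx : OrbitLim q x c) (hy : OrbitLim q y d) :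
    OrbitLim q (x - y) (c - d) := by
  have := hx.add ((val_one (n := n)).neg.orbitLim.mul hy)
  rwa [neg_one_mul, neg_one_mul, ← sub_eq_add_neg, ← sub_eq_add_neg] at this

theorem map_sub_eq_of_fixed {A : Type*} [AddCommGroup A] {T : A → A}
    (hT : ∀ x y, T (x + y) = T x + T y) {x y : A} (hx : T x = x) (hy : T y = y) :
    T (x - y) = x - y := by
  have h := hT (x - y) y
  rw [sub_add_cancel, hx, hy] at h
  exact eq_sub_of_add_eq h.symm

theorem eq_of_orbitLim {Ψ Ψ' : HeckeMero n} (h : gaugedTransl q k rho rho Ψ = Ψ)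
    (h' : gaugedTransl q k rho rho Ψ' = Ψ') {c : Perm n → ℂ} (hc : ∀ v, OrbitLim q (Ψ v) (c v))
    (hc' : ∀ v, OrbitLim q (Ψ' v) (c v)) : Ψ = Ψ' :=
  sub_eq_zero.mp (eq_zero_of_orbitLim (q := q) (k := k)
    (map_sub_eq_of_fixed (gaugedTransl_add q k rho rho) h h') fun v => by
      have := (hc v).sub (hc' v)
      rwa [sub_self] at this)

/-- By commutativity the transform of `Ψ` again satisfies the equation of `(ρ, ρ)`, and its limit is
`A T_{w_0} = T_{w_0}`. Uniqueness identifies it with `Ψ`. -/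
theorem gaugedTransl_eq_of_hasIdem {Ψ : HeckeMero n} (hΨ : gaugedTransl q k rho rho Ψ = Ψ)
    (hlim : ∀ v, OrbitLim q (Ψ v) ((Pi.single Fin.revPerm 1 : Perm n → ℂ) v)) {l m : Lat n}
    (h : HasIdem q k l m) (hlm : ∀ v : Var n, ‖(scaleFactor q l m v : ℂ)‖ ≤ 1) :
    gaugedTransl q k l m Ψ = Ψ := by
  obtain ⟨A, hA, -, hA'⟩ := h
  exact eq_of_orbitLim (by rw [gaugedTransl_comm, hΨ]) hΨ (c := Pi.single Fin.revPerm 1) (fun v => by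
    rw [gaugedTransl_apply, ← hA', Matrix.mulVec, dotProduct]
    exact OrbitLim.sum fun u _ => (hA v u).orbitLim.mul ((hlim u).shift hlm)) hlim

end

end BqKZ
end
noncomputable section
namespace BqKZ

/-! ### Existence -/

section
variable {n : ℕ} {q : QParam} {k : ℂˣ}

theorem Absol.scale {V : Type*} [Fintype V] {R : ℝ} (hR : 0 ≤ R) {K : MvPowerSeries V ℂ}
    (hK : Absol R K) {s : ℂ} (hs : ‖s‖ ≤ 1) : Absol R (scale s K) := by
  refine Summable.of_nonneg_of_le (fun a => mul_nonneg (norm_nonneg _) (pow_nonneg hR _)) (fun a => ?_) hK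
  rw [coeff_scale, norm_mul, norm_pow]
  exact mul_le_mul_of_nonneg_right (mul_le_of_le_one_left (norm_nonneg _)
    (pow_le_one₀ (norm_nonneg _) hs)) (pow_nonneg hR _)

theorem varVal_rho (p : Torus n × Torus n) :
    varVal ((qpow q (-rho), qpow q rho) * p) = fun v => (q.unit : ℂ) * varVal p v :=
  funext fun v => by rw [varVal_mul, scaleFactor_rho]

theorem entHolo_eq_sum {ι : Type*} [Fintype ι] {F : ι → MvPowerSeries (Var n) ℂ}
    (hF : ∀ u (R : ℝ), 0 ≤ R → Absol R (F u)) {G : MvPowerSeries (Var n) ℂ}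
    (hG : ∀ R : ℝ, 0 ≤ R → Absol R G) {P : ι → Pol n}
    (h : G = ∑ u, (P u : MvPowerSeries (Var n) ℂ) * scale q.unit (F u)) :
    entHolo G hG = ∑ u, evPol (P u) * dilate (qpow q (-rho), qpow q rho) (entHolo (F u) (hF u)) := by
  refine Subtype.ext (funext fun p => ?_)
  rw [holo_sum_val]
  change evS G (varVal p) = _
  have h0 : ∀ v, ‖varVal p v‖ ≤ ‖varVal p‖ := fun v => norm_le_pi_norm _ v
  have hq := (norm_unit_lt_one q).le
  have h1 : ∀ u, Absol ‖varVal p‖ (scale q.unit (F u)) := fun u =>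
    (hF u _ (norm_nonneg _)).scale (norm_nonneg _) hq
  rw [h, evS_sum _ (fun u _ => (absol_coe _ (P u)).mul (norm_nonneg _) (h1 u)) h0]
  refine Finset.sum_congr rfl fun u _ => ?_
  rw [evS_mul (absol_coe _ (P u)) (h1 u) h0, evS_coe, evS_scale]
  change _ = (evPol (P u)).1 p * evS (F u) (varVal ((qpow q (-rho), qpow q rho) * p))
  rw [evPol_val, varVal_rho]

/-- The exponent of a monomial in `t^{-α_i}` and `γ^{α_i}`. -/
def expEquiv (n : ℕ) : (Fin (n + 1) → ℕ) × (Fin (n + 1) → ℕ) ≃ (Var n →₀ ℕ) :=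
  (Equiv.sumArrowEquivProdArrow _ _ ℕ).symm.trans Finsupp.equivFunOnFinite.symm

theorem tpow_posRoot (ab : (Fin (n + 1) → ℕ) × (Fin (n + 1) → ℕ)) (p : Torus n × Torus n) :
    ((tpow p.1 (-posRoot ab.1) * tpow p.2 (posRoot ab.2) : ℂˣ) : ℂ) =
      ∏ v, varVal p v ^ expEquiv n ab v := by
  change (monoHolo (-posRoot ab.1) (posRoot ab.2)).1 p = _
  rw [monoHolo_posRoot, evPol_val, Fintype.prod_sum_type]
  simp [expEquiv, Equiv.sumArrowEquivProdArrow]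

/-- The coefficients of a vector of power series in `t^{-α_i}` and `γ^{α_i}`. -/
def vecCoeff (G : Perm n → MvPowerSeries (Var n) ℂ)
    (ab : (Fin (n + 1) → ℕ) × (Fin (n + 1) → ℕ)) (v : Perm n) : ℂ :=
  MvPowerSeries.coeff (expEquiv n ab) (G v)

theorem seriesTerm_vecCoeff (G : Perm n → MvPowerSeries (Var n) ℂ)
    (ab : (Fin (n + 1) → ℕ) × (Fin (n + 1) → ℕ)) (p : Torus n × Torus n) (v : Perm n) :
    seriesTerm (vecCoeff G) ab p v =
      MvPowerSeries.coeff (expEquiv n ab) (G v) * ∏ u, varVal p u ^ expEquiv n ab u := by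
  rw [seriesTerm, tpow_posRoot, Pi.smul_apply, smul_eq_mul, mul_comm]; rfl

theorem tsum_seriesTerm_vecCoeff (G : Perm n → MvPowerSeries (Var n) ℂ) (p : Torus n × Torus n)
    (v : Perm n) : ∑' ab, seriesTerm (vecCoeff G) ab p v = evS (G v) (varVal p) := by
  simp only [seriesTerm_vecCoeff]
  exact (expEquiv n).tsum_eq fun a => MvPowerSeries.coeff a (G v) * ∏ u, varVal p u ^ a u

theorem exists_bound_seriesTerm {G : Perm n → MvPowerSeries (Var n) ℂ} {R : ℝ} (hR : 0 ≤ R)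
    (hG : ∀ v, Absol R (G v)) : ∃ M : (Fin (n + 1) → ℕ) × (Fin (n + 1) → ℕ) → ℝ, Summable M ∧
      ∀ p ∈ region n R, ∀ ab, ‖seriesTerm (vecCoeff G) ab p‖ ≤ M ab := by
  let N : (Var n →₀ ℕ) → Perm n → ℝ := fun a v => ‖MvPowerSeries.coeff a (G v)‖ * R ^ a.degree
  have h0 : ∀ a v, 0 ≤ N a v := fun a v => mul_nonneg (norm_nonneg _) (pow_nonneg hR _)
  have hN : Summable fun a => ∑ v, N a v := summable_sum fun v _ => hG v
  refine ⟨fun ab => ∑ v, N (expEquiv n ab) v, hN.comp_injective (expEquiv n).injective,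
    fun p hp ab => (pi_norm_le_iff_of_nonneg (Finset.sum_nonneg fun v _ => h0 _ v)).mpr fun v => ?_⟩
  rw [seriesTerm_vecCoeff]
  exact (norm_term_le (fun v => (mem_region_iff.mp hp v).le) _ _).trans
    (Finset.single_le_sum (f := N (expEquiv n ab)) (fun v _ => h0 _ v) (Finset.mem_univ v))

/-- The entire series `F` and `S` give the quotient of analytic functions on all of `T × T`, while
the series `G`, which is `F / S`, is only needed to converge near the origin. -/
theorem hasExpansion_div {F G : Perm n → MvPowerSeries (Var n) ℂ} {S : MvPowerSeries (Var n) ℂ}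
    (hF : ∀ v (R : ℝ), 0 ≤ R → Absol R (F v)) (hS : ∀ R : ℝ, 0 ≤ R → Absol R S)
    (hS0 : entHolo S hS ≠ 0) {R : ℝ} (hR : 0 < R) (hG : ∀ v, Absol R (G v))
    (hSG : ∀ v, S * G v = F v) :
    HasExpansion (fun v => algebraMap (Holo n) (Mero n) (entHolo (F v) (hF v)) /
      algebraMap (Holo n) (Mero n) (entHolo S hS)) R (vecCoeff G) where
  normal C hC _ := by
    obtain ⟨M, hM, h⟩ := exists_bound_seriesTerm hR.le hG
    exact ⟨M, hM, fun p hp => h p (hC hp)⟩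
  eq_sum v := by
    refine ⟨_, _, hS0, rfl, fun p hp => ?_⟩
    rw [tsum_seriesTerm_vecCoeff]
    change evS S (varVal p) * evS (G v) (varVal p) = evS (F v) (varVal p)
    rw [← evS_mul (hS R hR.le) (hG v) fun v => (mem_region_iff.mp hp v).le, hSG]

theorem constantCoeff_coe (f : Pol n) :
    MvPowerSeries.constantCoeff (f : MvPowerSeries (Var n) ℂ) = MvPolynomial.constantCoeff f := by
  rw [← MvPowerSeries.coeff_zero_eq_constantCoeff_apply, MvPolynomial.coeff_coe]; rfl

/-- The scalar case of `exists_entire_solution`: the series is the infinite product of the `e(q^m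
z)`. -/
theorem exists_entire_denominator {e : Pol n} (he : MvPolynomial.constantCoeff e = 1) (q : QParam) :
    ∃ S : MvPowerSeries (Var n) ℂ, MvPowerSeries.constantCoeff S = 1 ∧
      (∀ R : ℝ, 0 ≤ R → Absol R S) ∧ S = (e : MvPowerSeries (Var n) ℂ) * scale q.unit S := by
  obtain ⟨F, hF1, hF2, hF3⟩ := exists_entire_solution (ι := Unit) (V := Var n) (norm_unit_lt_one q)
    (P := fun _ _ => (e : MvPowerSeries (Var n) ℂ)) (fun R _ _ _ => absol_coe R e) (M := 1)
    (fun u v => by rw [constantCoeff_coe, he]; simp) (mul_one _) (x := fun _ => 1)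
    (Matrix.one_mulVec _)
  refine ⟨F (), hF1 (), fun R hR => hF2 R hR (), ?_⟩
  conv_lhs => rw [hF3]
  simp

theorem fixed_identity {R F ι : Type*} [CommRing R] [Field F] [Algebra R F]
    (s : Finset ι) {f e S S' : R} {a x : ι → F} {b y : ι → R}
    (hS : algebraMap R F S ≠ 0) (hSe : S = e * S') (hf : f = ∑ u ∈ s, b u * y u)
    (ha : ∀ u, a u * algebraMap R F e = algebraMap R F (b u))
    (hx : ∀ u, x u * algebraMap R F S' = algebraMap R F (y u)) :
    ∑ u ∈ s, a u * x u = algebraMap R F f / algebraMap R F S := by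
  rw [eq_div_iff hS, hSe, hf, map_mul, map_sum, Finset.sum_mul]
  refine Finset.sum_congr rfl fun u _ => ?_
  rw [map_mul, ← ha, ← hx]
  ring

theorem div_mul_algebraMap {R F : Type*} [CommRing R] [Field F] [Algebra R F] {f S : R}
    (hS : algebraMap R F S ≠ 0) :
    algebraMap R F f / algebraMap R F S * algebraMap R F S = algebraMap R F f :=
  div_mul_cancel₀ _ hS

/-- With `A = P / e`, the relations `F(z) = P(z) F(qz)` and `S(z) = e(z) S(qz)` give `Ψ(z) = A(z)
Ψ(qz)` for `Ψ = F / S`. The leading coefficient is `F(0) / S(0) = T_{w_0}`. -/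
theorem exists_fixed_rho : ∃ Ψ : HeckeMero n, gaugedTransl q k rho rho Ψ = Ψ ∧
    IsAsymptoticallyFree Ψ := by
  obtain ⟨M, hM, hM2, hM1⟩ := hasIdem_rho (n := n) q k
  obtain ⟨P, e, he, hPM, hP⟩ := exists_common_val fun i : Perm n × Perm n => hM i.1 i.2
  obtain ⟨S, hS1, hS2, hS3⟩ := exists_entire_denominator he q
  obtain ⟨F, hF1, hF2, hF3⟩ := exists_entire_solution (norm_unit_lt_one q)
    (P := fun v u => (P (v, u) : MvPowerSeries (Var n) ℂ)) (fun R _ v u => absol_coe R _)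
    (fun v u => by rw [constantCoeff_coe, hPM]) hM2 hM1
  have hF2' : ∀ v (R : ℝ), 0 ≤ R → Absol R (F v) := fun v R hR => hF2 R hR v
  have hS0 : entHolo S hS2 ≠ 0 := entHolo_ne_zero hS2 (by rw [hS1]; exact one_ne_zero)
  obtain ⟨R, hR, hR'⟩ := exists_absol_inv (hS2 1 zero_le_one) hS1
  have hSe : entHolo S hS2 = evPol e * dilate (qpow q (-rho), qpow q rho) (entHolo S hS2) := by
    have := entHolo_eq_sum (ι := Unit) (q := q) (fun _ => hS2) hS2 (P := fun _ => e)
      (F := fun _ => S) (by simpa using hS3)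
    simpa using this
  have hF := fun v => entHolo_eq_sum hF2' (hF2' v) (hF3 v)
  refine ⟨fun v => algebraMap (Holo n) (Mero n) (entHolo (F v) (hF2' v)) /
      algebraMap (Holo n) (Mero n) (entHolo S hS2), funext fun v => ?_, R, hR, _,
    hasExpansion_div hF2' hS2 hS0 hR (G := fun v => F v * S⁻¹)
      (fun v => (hF2' v R hR.le).mul hR.le hR') (fun v => ?_), funext fun v => ?_⟩
  · rw [gaugedTransl_apply]
    exact fixed_identity (R := Holo n) (F := Mero n) _ (holo_ne_zero hS0) hSe (hF v)
      (fun u => hP (v, u))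
      fun u => shift_mul_algebraMap_dilate (div_mul_algebraMap (holo_ne_zero hS0))
  · rw [mul_left_comm, MvPowerSeries.mul_inv_cancel S (by rw [hS1]; exact one_ne_zero), mul_one]
  · have h0 : expEquiv n (0, 0) = 0 := by
      ext v; cases v <;> simp [expEquiv, Equiv.sumArrowEquivProdArrow]
    rw [vecCoeff, h0, MvPowerSeries.coeff_zero_eq_constantCoeff_apply, map_mul, hF1,
      MvPowerSeries.constantCoeff_inv, hS1, inv_one, mul_one]

/-! ### The basic asymptotically free solution -/

theorem norm_unit_zpow_le {m : ℤ} (hm : 0 ≤ m) : ‖((q.unit ^ m : ℂˣ) : ℂ)‖ ≤ 1 := by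
  lift m to ℕ using hm
  rw [zpow_natCast, Units.val_pow_eq_pow_val, norm_pow]
  exact pow_le_one₀ (norm_nonneg _) (norm_unit_lt_one q).le

theorem fund_sub_nonneg (r : ℕ) (i : Fin (n + 1)) :
    0 ≤ (fund r : Lat n) i.castSucc - (fund r : Lat n) i.succ := by
  simp only [fund, ind, Fin.val_castSucc, Fin.val_succ]
  split_ifs <;> omega

theorem norm_scaleFactor_fund_left (r : ℕ) (v : Var n) :
    ‖(scaleFactor q (fund r : Lat n) 0 v : ℂ)‖ ≤ 1 := by
  cases v with
  | inl i => exact norm_unit_zpow_le (fund_sub_nonneg r i)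
  | inr i => exact norm_unit_zpow_le (sub_self (0 : ℤ)).ge

theorem norm_scaleFactor_fund_right (r : ℕ) (v : Var n) :
    ‖(scaleFactor q (0 : Lat n) (fund r) v : ℂ)‖ ≤ 1 := by
  cases v with
  | inl i => exact norm_unit_zpow_le (sub_self (0 : ℤ)).ge
  | inr i => exact norm_unit_zpow_le (fund_sub_nonneg r i)

/-- Each `ε_i` is a difference of consecutive fundamental weights. The weight with `r = N`, all of
whose coordinates are 1, is needed for the last one. -/
theorem fixed_of_fund {A : Type*} {T : Lat n → A → A} (hT : ∀ l m x, T l (T m x) = T (l + m) x)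
    {x : A} (h0 : T 0 x = x) (h : ∀ r ≤ n + 2, T (fund r) x = x) (l : Lat n) : T l x = x := by
  have he : ∀ i, T (eps i) x = x := fun i => by
    conv_lhs => rw [← h i i.isLt.le]
    rw [hT, eps_eq_fund, sub_add_cancel]
    exact h _ i.isLt
  induction l using lat_induction with
  | zero => exact h0
  | add l i ih => rw [← hT, he, ih]
  | sub l i ih =>
    conv_lhs => rw [← he i]
    rw [hT, sub_add_cancel, ih]

theorem IsAsymptoticallyFree.orbitLim {Ψ : HeckeMero n} (h : IsAsymptoticallyFree Ψ) (v : Perm n) :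
    OrbitLim q (Ψ v) ((Pi.single Fin.revPerm 1 : Perm n → ℂ) v) := by
  obtain ⟨ε, hε, K, hK, hK0⟩ := h
  rw [← hK0]
  exact hK.orbitLim hε v

/-- The limit argument is confined to fundamental weights, whose shifts do not enlarge the
variables. The group law then covers all `l` and `m`, including shifts that leave the region of
convergence. -/
theorem gaugedTransl_eq_of_isAsymptoticallyFree {Ψ : HeckeMero n}
    (hΨ : gaugedTransl q k rho rho Ψ = Ψ) (h : IsAsymptoticallyFree Ψ) (l m : Lat n) :
    gaugedTransl q k l m Ψ = Ψ := by
  have hl : gaugedTransl q k l 0 Ψ = Ψ :=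
    fixed_of_fund (T := fun l => gaugedTransl q k l 0)
      (fun l m x => by rw [gaugedTransl_gaugedTransl, add_zero]) (gaugedTransl_zero q k Ψ)
      (fun r hr => gaugedTransl_eq_of_hasIdem hΨ h.orbitLim (hasIdem_fund_left q k hr)
        (norm_scaleFactor_fund_left r)) l
  have hm : gaugedTransl q k 0 m Ψ = Ψ :=
    fixed_of_fund (T := fun m => gaugedTransl q k 0 m)
      (fun l m x => by rw [gaugedTransl_gaugedTransl, add_zero]) (gaugedTransl_zero q k Ψ)
      (fun r hr => gaugedTransl_eq_of_hasIdem hΨ h.orbitLim (hasIdem_fund_right q k hr)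
        (norm_scaleFactor_fund_right r)) m
  rw [← add_zero l, ← zero_add m, ← gaugedTransl_gaugedTransl, hm, hl]

end

end BqKZ
end
-- The basic asymptotically free solution.
theorem mainTheorem2 (n : ℕ) (q : BqKZ.QParam) (k : ℂˣ) :
    ∃ Ψ : BqKZ.HeckeMero n,
      (∀ κ : ℂˣ, BqKZ.IsGaugedSolution q k κ Ψ) ∧
      BqKZ.IsAsymptoticallyFree Ψ ∧
      (∀ Ψ' : BqKZ.HeckeMero n, (∃ κ : ℂˣ, BqKZ.IsGaugedSolution q k κ Ψ') →
        BqKZ.IsAsymptoticallyFree Ψ' → Ψ' = Ψ) ∧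
      ∀ κ : ℂˣ, (fun w => BqKZ.gauge q k κ * Ψ w) ∈ BqKZ.SOL q k := by
  obtain ⟨Ψ, hΨ, hfree⟩ := BqKZ.exists_fixed_rho (n := n) (q := q) (k := k)
  have hfix := BqKZ.gaugedTransl_eq_of_isAsymptoticallyFree hΨ hfree
  refine ⟨Ψ, fun κ => (BqKZ.isGaugedSolution_iff q k κ Ψ).mpr hfix, hfree, fun Ψ' h' hfree' => ?_,
    fun κ => BqKZ.gauge_mul_mem_SOL q k κ hfix⟩
  obtain ⟨κ, h'⟩ := h'
  -- Uniqueness requires only the equation of `(ρ, ρ)` and the common limit `T_{w_0}`, so the value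
  -- of `κ` and the radius belonging to `Ψ'` play no role.
  exact BqKZ.eq_of_orbitLim ((BqKZ.isGaugedSolution_iff q k κ Ψ').mp h' BqKZ.rho BqKZ.rho) hΨ
    hfree'.orbitLim hfree.orbitLim
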